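/- Let $k$ be a commutative unital ring, $\mathcal H$ a Hopf algebra over $k$ with antipode $S$, coproduct written $h\mapsto h^{(0)}\otimes h^{(1)}$ (and $h^{(0)}\otimes\cdots\otimes h^{(n)}$ for the iterated coproduct), and let $A$ be a unital left $\mathcal H$-module algebra, i.e. $h(ab)=(h^{(0)}a)(h^{(1)}b)$ and $h1=\epsilon(h)1$. The crossed product $A\rtimes\mathcal H$ is $A\otimes\mathcal H$ with $(a\otimes g)(b\otimes h)=a(g^{(0)}b)\otimes g^{(1)}h$; $\mathcal H^{cop}$ is $\mathcal H$ with the opposite coproduct, and $A^{op}$ is an $\mathcal H^{cop}$-module algebra with the same action. Paracyclic modules and mixed complexes. A paracyclic $k$-module has faces $\partial_i$, degeneracies $\sigma_i$ and invertible operators $\tau_n$ with the simplicial identities and $\partial_i\tau_n=\tau_{n-1}\partial_{i-1}$ $(1\le i\le n)$, $\partial_0\tau_n=\partial_n$, $\sigma_i\tau_n=\tau_{n+1}\sigma_{i-1}$ $(1\le i\le n)$, $\sigma_0\tau_n=\tau_{n+1}^2\sigma_n$; it is cyclic if $\tau_n^{n+1}=1$. Put $b=\sum_{i=0}^n(-1)^i\partial_i$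 and $B=(1-(-1)^{n+1}\tau_{n+1})\,\sigma N$ with $\sigma=\tau_{n+1}\sigma_n$, $N=\sum_{i=0}^n(-1)^{in}\tau_n^i$. A cylindrical module $X=\{X(p,q)\}$ carries a paracyclic structure $(\partial,\sigma,\tau)$ in the $q$-direction and another one $(\bar\partial,\bar\sigma,\bar\tau)$ in the $p$-direction that commute with each other and satisfy $\bar\tau^{p+1}\tau^{q+1}=1$ on $X(p,q)$. Its diagonal $\Delta X$ (with $X(n,n)$ in degree $n$ and operators $\bar\partial_i\partial_i,\bar\sigma_i\sigma_i,\bar\tau\tau$) is a cyclic module. $\mathrm{Tot}(X)$ denotes the mixed complex $\bigoplus_{p+q=n}N(X)(p,q)$, where $N(X)(p,q)$ is the quotient of $X(p,q)$ by the images of all $\sigma_i,\bar\sigma_i$, with operators $b+\bar b$ and $B+T\bar B$, $T=1-(bB+Bb)$ (the operators $b,B$ of the $q$-direction being multiplied by $(-1)^p$ on $X(p,q)$). Coefficients. Let $\mathsf W$ be a $\mathbb Z$-graded $k[\mathbf u]$-module, $\deg\mathbf u=-2$, of finite homological dimension (finite projective dimension over $k[\mathbf u]$). For a mixed complex $(V,b,B)$,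 $HC_n(V;\mathsf W)$, $n\in\mathbb Z$, is the degree-$n$ homology of $(V[[\mathbf u]]\otimes_{k[\mathbf u]}\mathsf W,\ b+\mathbf uB)$, where $V[[\mathbf u]]$ has degree-$m$ part $\prod_{i\ge0}V_{m+2i}\mathbf u^i$. For a cyclic module take $V=(X_\bullet,b,B)$; for an algebra $R$ take its standard cyclic module $\{R^{\otimes(n+1)}\}_{n\ge0}$. The module $A\natural\mathcal H$. Let $(A\natural\mathcal H)(p,q)=\mathcal H^{\otimes(p+1)}\otimes A^{\otimes(q+1)}$, with elements written $(g_0,\dots,g_p\mid a_q,\dots,a_0)$, and $$\tau(g_0,\dots,g_p\mid a_q,\dots,a_0)=(g_0^{(0)},\dots,g_p^{(0)}\mid a_{q-1},\dots,a_0,S(g_0^{(1)}\cdots g_p^{(1)})a_q),$$ $$\partial_i(g_0,\dots,g_p\mid a_q,\dots,a_0)=(g_0,\dots,g_p\mid a_q,\dots,a_{i+1}a_i,\dots,a_0)\ (0\le i<q),$$ $$\partial_q(g_0,\dots,g_p\mid a_q,\dots,a_0)=(g_0^{(0)},\dots,g_p^{(0)}\mid a_{q-1},\dots,a_1,a_0\,(S(g_0^{(1)}\cdots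 g_p^{(1)})a_q)),$$ $$\sigma_i(g_0,\dots,g_p\mid a_q,\dots,a_0)=(g_0,\dots,g_p\mid a_q,\dots,a_{i+1},1,a_i,\dots,a_0)\ (0\le i\le q),$$ $$\bar\tau(g_0,\dots,g_p\mid a_q,\dots,a_0)=(g_p^{(0)},g_0,\dots,g_{p-1}\mid g_p^{(1)}a_q,\dots,g_p^{(q+1)}a_0),$$ $$\bar\partial_i(g_0,\dots,g_p\mid a_q,\dots,a_0)=(g_0,\dots,g_ig_{i+1},\dots,g_p\mid a_q,\dots,a_0)\ (0\le i<p),$$ $$\bar\partial_p(g_0,\dots,g_p\mid a_q,\dots,a_0)=(g_p^{(0)}g_0,g_1,\dots,g_{p-1}\mid g_p^{(1)}a_q,\dots,g_p^{(q+1)}a_0),$$ $$\bar\sigma_i(g_0,\dots,g_p\mid a_q,\dots,a_0)=(g_0,\dots,g_i,1,g_{i+1},\dots,g_p\mid a_q,\dots,a_0)\ (0\le i\le p).$$ Theorem. $A\natural\mathcal H$ is a cylindrical module, and for every $n\in\mathbb Z$ there are isomorphisms of $k$-modules $$HC_n(\mathrm{Tot}(A\natural\mathcal H);\mathsf W)\cong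 HC_n(\Delta(A\natural\mathcal H);\mathsf W)\cong HC_n(A^{op}\rtimes\mathcal H^{cop};\mathsf W).$$ If $S$ is invertible (so that $\mathcal H^{cop}$ is a Hopf algebra with antipode $S^{-1}$), then $A^{op}\natural\mathcal H^{cop}$ is a cylindrical module, and for every $n\in\mathbb Z$ $$HC_n(\mathrm{Tot}(A^{op}\natural\mathcal H^{cop});\mathsf W)\cong HC_n(\Delta(A^{op}\natural\mathcal H^{cop});\mathsf W)\cong HC_n(A\rtimes\mathcal H;\mathsf W).$$ -/

import Mathlib

open scoped TensorProduct Polynomial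

universe u v w x

namespace HopfCyclic

/-- The operators of a paracyclic `k`-module: faces `d n i : X (n+1) → X n` for `i ≤ n + 1`,
degeneracies `s n i : X n → X (n+1)` for `i ≤ n`, and cyclic operators `t n : X n → X n`.
(The values at larger `i` are never used.) -/
structure ParacyclicOps (k : Type u) [CommRing k] (X : ℕ → Type v)
    [∀ n, AddCommGroup (X n)] [∀ n, Module k (X n)] where
  d : ∀ n : ℕ, ℕ → X (n + 1) →ₗ[k] X n
  s : ∀ n : ℕ, ℕ → X n →ₗ[k] X (n + 1)
  t : ∀ n : ℕ, X n →ₗ[k] X n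

namespace ParacyclicOps

variable {k : Type u} [CommRing k] {X : ℕ → Type v}
  [∀ n, AddCommGroup (X n)] [∀ n, Module k (X n)] (P : ParacyclicOps k X)

/-- The identities of a paracyclic module. -/
structure IsParacyclic : Prop where
  d_d : ∀ n i j, i ≤ j → j ≤ n + 1 → ∀ x, P.d n i (P.d (n + 1) (j + 1) x) = P.d n j (P.d (n + 1) i x)
  s_s : ∀ n i j, i ≤ j → j ≤ n → ∀ x, P.s (n + 1) i (P.s n j x) = P.s (n + 1) (j + 1) (P.s n i x)
  d_s_lt : ∀ n i j, i ≤ j → j ≤ n →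
    ∀ x, P.d (n + 1) i (P.s (n + 1) (j + 1) x) = P.s n j (P.d n i x)
  d_s_self : ∀ n i, i ≤ n → ∀ x, P.d n i (P.s n i x) = x
  d_s_succ : ∀ n i, i ≤ n → ∀ x, P.d n (i + 1) (P.s n i x) = x
  d_s_gt : ∀ n i j, j < i → i ≤ n + 1 →
    ∀ x, P.d (n + 1) (i + 1) (P.s (n + 1) j x) = P.s n j (P.d n i x)
  d_t_zero : ∀ n x, P.d n 0 (P.t (n + 1) x) = P.d n (n + 1) x
  d_t_succ : ∀ n i, i ≤ n → ∀ x, P.d n (i + 1) (P.t (n + 1) x) = P.t n (P.d n i x)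
  s_t_zero : ∀ n x, P.s n 0 (P.t n x) = P.t (n + 1) (P.t (n + 1) (P.s n n x))
  s_t_succ : ∀ n i, i + 1 ≤ n → ∀ x, P.s n (i + 1) (P.t n x) = P.t (n + 1) (P.s n i x)
  t_bijective : ∀ n, Function.Bijective (P.t n)

/-- A cyclic module is a paracyclic module with `t ^ (n + 1) = 1` in degree `n`. -/
structure IsCyclic : Prop extends P.IsParacyclic where
  t_pow : ∀ n x, (P.t n ^ (n + 1)) x = x

/-- The Hochschild boundary `b = ∑ (-1)^i d_i`. -/
def b (n : ℕ) : X (n + 1) →ₗ[k] X n :=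
  ∑ i ∈ Finset.range (n + 2), (-1 : k) ^ i • P.d n i

/-- The norm operator `N = ∑ (-1)^(i n) t^i` in degree `n`. -/
def norm (n : ℕ) : X n →ₗ[k] X n :=
  ∑ i ∈ Finset.range (n + 1), (-1 : k) ^ (i * n) • P.t n ^ i

/-- The extra degeneracy `t s_n`. -/
def extra (n : ℕ) : X n →ₗ[k] X (n + 1) := P.t (n + 1) ∘ₗ P.s n n

/-- Connes' operator `B = (1 - (-1)^(n+1) t) σ N`, with `σ` the extra degeneracy. -/
def B (n : ℕ) : X n →ₗ[k] X (n + 1) :=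
  (LinearMap.id - (-1 : k) ^ (n + 1) • P.t (n + 1)) ∘ₗ P.extra n ∘ₗ P.norm n

/-- The submodule of degenerate chains. -/
def degen : ∀ n : ℕ, Submodule k (X n)
  | 0 => ⊥
  | n + 1 => ⨆ i : Fin (n + 1), LinearMap.range (P.s n i)

variable {P}

theorem s_mem_degen {n i : ℕ} (hi : i ≤ n) (x : X n) : P.s n i x ∈ P.degen (n + 1) :=
  Submodule.mem_iSup_of_mem (⟨i, Nat.lt_succ_of_le hi⟩ : Fin (n + 1)) ⟨x, rfl⟩

theorem degen_induction {n : ℕ} {p : X (n + 1) → Prop} (hs : ∀ i ≤ n, ∀ x, p (P.s n i x))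
    (h0 : p 0) (ha : ∀ x y, p x → p y → p (x + y)) {x : X (n + 1)} (hx : x ∈ P.degen (n + 1)) :
    p x := by
  refine Submodule.iSup_induction _ (motive := p) hx ?_ h0 ha
  rintro i _ ⟨y, rfl⟩
  exact hs i (Nat.lt_succ_iff.mp i.2) y

/-- The signed face and cyclic operators. -/
def sd (P : ParacyclicOps k X) (n i : ℕ) : X (n + 1) →ₗ[k] X n := (-1 : k) ^ i • P.d n i

def st (P : ParacyclicOps k X) (n : ℕ) : X n →ₗ[k] X n := (-1 : k) ^ n • P.t n

theorem st_pow (n i : ℕ) : P.st n ^ i = (-1 : k) ^ (i * n) • P.t n ^ i := by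
  rw [st, smul_pow, ← pow_mul, mul_comm]

theorem norm_eq (n : ℕ) : P.norm n = ∑ i ∈ Finset.range (n + 1), P.st n ^ i := by
  simp only [norm, st_pow]

theorem B_apply (n : ℕ) (x : X n) :
    P.B n x = P.extra n (P.norm n x) - P.st (n + 1) (P.extra n (P.norm n x)) := by
  simp [B, st]

namespace IsParacyclic

theorem sd_st_zero (h : P.IsParacyclic) (n : ℕ) (x) : P.sd n 0 (P.st (n + 1) x) = P.sd n (n + 1) x := by
  simp [sd, st, h.d_t_zero]

theorem sd_st_succ (h : P.IsParacyclic) (n i : ℕ) (hi : i ≤ n) (x) :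
    P.sd n (i + 1) (P.st (n + 1) x) = P.st n (P.sd n i x) := by
  simp only [sd, st, LinearMap.smul_apply, map_smul, h.d_t_succ n i hi, smul_smul]
  congr 1; ring

theorem sd_st_pow_le (h : P.IsParacyclic) (n : ℕ) (j : ℕ) : ∀ i, j ≤ i → i ≤ n + 1 → ∀ x,
    P.sd n i ((P.st (n + 1) ^ j) x) = (P.st n ^ j) (P.sd n (i - j) x) := by
  induction j with
  | zero => intro i _ _ x; simp
  | succ j ih =>
    intro i hij hi x
    obtain ⟨i, rfl⟩ : ∃ i', i = i' + 1 := ⟨i - 1, by omega⟩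
    rw [pow_succ', pow_succ', Module.End.mul_apply, Module.End.mul_apply, h.sd_st_succ n i (by omega),
      ih i (by omega) (by omega), Nat.add_sub_add_right]

theorem sd_st_pow_gt (h : P.IsParacyclic) (n i j : ℕ) (hij : i ≤ j) (hj : j ≤ n) (hi : i ≤ n) (x) :
    P.sd n i ((P.st (n + 1) ^ (j + 1)) x) = (P.st n ^ j) (P.sd n (n + 1 + i - j) x) := by
  obtain ⟨l, rfl⟩ := Nat.exists_eq_add_of_le hij
  rw [show i + l + 1 = i + (1 + l) by ring, pow_add, Module.End.mul_apply,
    h.sd_st_pow_le n i i le_rfl (by omega), Nat.sub_self, pow_add, Module.End.mul_apply,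
    pow_one, h.sd_st_zero, h.sd_st_pow_le n l _ (by omega) (by omega), pow_add,
    Module.End.mul_apply]
  congr 4; omega

theorem sum_sd_norm (h : P.IsParacyclic) (n : ℕ) (x) :
    ∑ i ∈ Finset.range (n + 1), P.sd n i (P.norm (n + 1) x) = P.norm n (P.b n x) := by
  have hb : P.b n x = ∑ l ∈ Finset.range (n + 2), P.sd n l x := by simp [b, sd]
  rw [hb]
  simp only [norm_eq, LinearMap.sum_apply, map_sum]
  rw [← Finset.sum_product', ← Finset.sum_product']
  refine Finset.sum_nbij' (fun ij => if ij.2 ≤ ij.1 then (ij.1 - ij.2, ij.2)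
      else (n + 2 + ij.1 - ij.2, ij.2 - 1))
    (fun lm => if lm.1 + lm.2 ≤ n then (lm.1 + lm.2, lm.2)
      else (lm.1 + lm.2 - (n + 1), lm.2 + 1)) ?_ ?_ ?_ ?_ ?_
  · rintro ⟨i, j⟩ hij; simp only [Finset.mem_product, Finset.mem_range] at hij ⊢
    split_ifs <;> simp <;> omega
  · rintro ⟨i, j⟩ hij; simp only [Finset.mem_product, Finset.mem_range] at hij ⊢
    split_ifs <;> simp <;> omega
  · rintro ⟨i, j⟩ hij; simp only [Finset.mem_product, Finset.mem_range] at hij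
    by_cases hc : j ≤ i
    · simp [hc]; omega
    · simp only [hc, if_false]
      rw [if_neg (by omega)]; ext <;> simp <;> omega
  · rintro ⟨i, j⟩ hij; simp only [Finset.mem_product, Finset.mem_range] at hij
    by_cases hc : i + j ≤ n
    · simp [hc]
    · simp only [hc, if_false]
      rw [if_neg (by omega)]; ext <;> simp <;> omega
  · rintro ⟨i, j⟩ hij; simp only [Finset.mem_product, Finset.mem_range] at hij
    by_cases hc : j ≤ i
    · simp only [hc, if_true]
      exact h.sd_st_pow_le n j i hc (by omega) x
    · simp only [hc, if_false]
      obtain ⟨j, rfl⟩ : ∃ j', j = j' + 1 := ⟨j - 1, by omega⟩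
      rw [h.sd_st_pow_gt n i j (by omega) (by omega) (by omega)]
      rw [Nat.add_sub_cancel, show n + 2 + i - (j + 1) = n + 1 + i - j by omega]

theorem b_sub_st (h : P.IsParacyclic) (n : ℕ) (x) : P.b n (x - P.st (n + 1) x) =
    ∑ i ∈ Finset.range (n + 1), P.sd n i x - P.st n (∑ i ∈ Finset.range (n + 1), P.sd n i x) := by
  have hb : ∀ x, P.b n x = ∑ l ∈ Finset.range (n + 2), P.sd n l x := by simp [b, sd]
  rw [map_sub, hb, hb, Finset.sum_range_succ, Finset.sum_range_succ' _ (n + 1), h.sd_st_zero,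
    map_sum, Finset.sum_congr rfl fun i hi => h.sd_st_succ n i
      (Nat.lt_succ_iff.mp (Finset.mem_range.mp hi)) x]
  abel

theorem st_mul_norm (n : ℕ) (x) : P.norm n (x - P.st n x) = x - (P.t n ^ (n + 1)) x := by
  have h1 : P.norm n * (1 - P.st n) = 1 - P.st n ^ (n + 1) := by
    rw [norm_eq]; exact geom_sum_mul_neg _ _
  have h2 : P.st n ^ (n + 1) = P.t n ^ (n + 1) := by
    rw [st_pow, Even.neg_one_pow (by rw [mul_comm]; exact Nat.even_mul_succ_self n), one_smul]
  rw [h2] at h1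
  exact LinearMap.congr_fun h1 x

theorem norm_sub_st (n : ℕ) (x) : P.norm n x - P.st n (P.norm n x) = x - (P.t n ^ (n + 1)) x := by
  have h1 : (1 - P.st n) * P.norm n = 1 - P.st n ^ (n + 1) := by
    rw [norm_eq]; exact mul_neg_geom_sum _ _
  have h2 : P.st n ^ (n + 1) = P.t n ^ (n + 1) := by
    rw [st_pow, Even.neg_one_pow (by rw [mul_comm]; exact Nat.even_mul_succ_self n), one_smul]
  rw [h2] at h1
  exact LinearMap.congr_fun h1 x

theorem d_extra_zero (h : P.IsParacyclic) (n : ℕ) (x) : P.d n 0 (P.extra n x) = x := by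
  simp [extra, h.d_t_zero, h.d_s_succ]

theorem d_extra_succ (h : P.IsParacyclic) (n i : ℕ) (hi : i ≤ n) (x) :
    P.d (n + 1) (i + 1) (P.extra (n + 1) x) = P.extra n (P.d n i x) := by
  simp only [extra, LinearMap.comp_apply]
  rw [h.d_t_succ (n + 1) i (by omega), h.d_s_lt n i n hi le_rfl]

theorem sd_extra (h : P.IsParacyclic) (n : ℕ) (x : X (n + 1)) :
    ∑ i ∈ Finset.range (n + 2), P.sd (n + 1) i (P.extra (n + 1) x) =
      x - P.extra n (∑ i ∈ Finset.range (n + 1), P.sd n i x) := by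
  rw [Finset.sum_range_succ', map_sum, sub_eq_neg_add, ← Finset.sum_neg_distrib]
  congr 1; swap
  · simp [sd, h.d_extra_zero]
  · refine Finset.sum_congr rfl fun i hi => ?_
    simp only [sd, LinearMap.smul_apply, map_smul]
    rw [h.d_extra_succ n i (Nat.lt_succ_iff.mp (Finset.mem_range.mp hi)), pow_succ]
    simp

theorem b_B_zero (h : P.IsParacyclic) (x : X 0) : P.b 0 (P.B 0 x) = x - P.t 0 x := by
  rw [B_apply, h.b_sub_st]
  simp [sd, norm, st, h.d_extra_zero]

theorem b_B_succ (h : P.IsParacyclic) (n : ℕ) (x : X (n + 1)) :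
    P.b (n + 1) (P.B (n + 1) x) + P.B n (P.b n x) = x - (P.t (n + 1) ^ (n + 2)) x := by
  rw [B_apply, h.b_sub_st, h.sd_extra, h.sum_sd_norm, ← norm_sub_st, B_apply, map_sub]
  abel

theorem b_b (h : P.IsParacyclic) (n : ℕ) (x : X (n + 2)) : P.b n (P.b (n + 1) x) = 0 := by
  have hb : ∀ n x, P.b n x = ∑ l ∈ Finset.range (n + 2), P.sd n l x := by simp [b, sd]
  rw [hb, hb]
  simp only [map_sum]
  rw [← Finset.sum_product']
  refine Finset.sum_involution (fun ij _ => if ij.2 ≤ ij.1 then (ij.2, ij.1 + 1) else (ij.2 - 1, ij.1))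
    ?_ ?_ ?_ ?_
  · rintro ⟨i, j⟩ hij; simp only [Finset.mem_product, Finset.mem_range] at hij
    have key : ∀ i j, i ≤ j → j ≤ n + 1 →
        P.sd n i (P.sd (n + 1) (j + 1) x) + P.sd n j (P.sd (n + 1) i x) = 0 := by
      intro i j hij hj
      simp only [sd, LinearMap.smul_apply, map_smul, h.d_d n i j hij hj, smul_smul, ← add_smul]
      rw [pow_succ]
      convert zero_smul k _ using 2
      ring
    by_cases hc : j ≤ i
    · simp only [hc, if_true]; rw [add_comm]; exact key j i hc (by omega)
    · simp only [hc, if_false]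
      obtain ⟨j, rfl⟩ : ∃ j', j = j' + 1 := ⟨j - 1, by omega⟩
      exact key i j (by omega) (by omega)
  · rintro ⟨i, j⟩ hij _; simp only [Finset.mem_product, Finset.mem_range] at hij
    split_ifs <;> simp <;> omega
  · rintro ⟨i, j⟩ hij; simp only [Finset.mem_product, Finset.mem_range] at hij ⊢
    split_ifs <;> simp <;> omega
  · rintro ⟨i, j⟩ hij; simp only [Finset.mem_product, Finset.mem_range] at hij
    by_cases hc : j ≤ i
    · simp [hc, show ¬ (i + 1 ≤ j) by omega]
    · simp only [hc, if_false]
      rw [if_pos (by omega)]; ext <;> simp; omega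

theorem b_degen (h : P.IsParacyclic) : ∀ (n : ℕ) (x : X (n + 1)), x ∈ P.degen (n + 1) → P.b n x ∈ P.degen n := by
  intro n x hx
  refine degen_induction (p := fun x => P.b n x ∈ P.degen n) ?_ (by simp)
    (fun x y hx hy => by rw [map_add]; exact add_mem hx hy) hx
  intro j hj x
  have hb : ∀ n x, P.b n x = ∑ l ∈ Finset.range (n + 2), P.sd n l x := by simp [b, sd]
  have hj1 : j ∈ Finset.range (n + 2) := by simp; omega
  have hj2 : j + 1 ∈ (Finset.range (n + 2)).erase j := by simp; omega
  rw [hb, ← Finset.add_sum_erase _ _ hj1, ← Finset.add_sum_erase _ _ hj2, ← add_assoc]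
  have : P.sd n j (P.s n j x) + P.sd n (j + 1) (P.s n j x) = 0 := by
    simp [sd, h.d_s_self n j hj, h.d_s_succ n j hj, pow_succ]
  rw [this, zero_add]
  refine Submodule.sum_mem _ fun i hi => ?_
  simp only [Finset.mem_erase, Finset.mem_range] at hi
  refine Submodule.smul_mem _ _ ?_
  obtain _ | n := n
  · omega
  rcases lt_or_gt_of_ne hi.2.1 with hlt | hgt
  · obtain ⟨j, rfl⟩ : ∃ j', j = j' + 1 := ⟨j - 1, by omega⟩
    rw [h.d_s_lt n i j (by omega) (by omega)]
    exact s_mem_degen (by omega) _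
  · obtain ⟨i, rfl⟩ : ∃ i', i = i' + 1 := ⟨i - 1, by omega⟩
    rw [h.d_s_gt n i j (by omega) (by omega)]
    exact s_mem_degen (by omega) _

/-- Degenerate chains together with the image of the extra degeneracy. -/
theorem ext_induction {n : ℕ} {p : X (n + 1) → Prop} (hs : ∀ i ≤ n, ∀ x, p (P.s n i x))
    (he : ∀ x, p (P.extra n x)) (h0 : p 0) (ha : ∀ x y, p x → p y → p (x + y)) {x : X (n + 1)}
    (hx : x ∈ P.degen (n + 1) ⊔ LinearMap.range (P.extra n)) : p x := by
  obtain ⟨y, hy, _, ⟨z, rfl⟩, rfl⟩ := Submodule.mem_sup.mp hx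
  exact ha _ _ (degen_induction hs h0 ha hy) (he z)

theorem t_ext (h : P.IsParacyclic) (n : ℕ) (x : X (n + 1)) (hx : x ∈ P.degen (n + 1) ⊔ LinearMap.range (P.extra n)) :
    P.t (n + 1) x ∈ P.degen (n + 1) ⊔ LinearMap.range (P.extra n) := by
  refine ext_induction (p := fun x => P.t (n + 1) x ∈ P.degen (n + 1) ⊔ LinearMap.range (P.extra n))
    ?_ ?_ (by simp) (fun x y hx hy => by rw [map_add]; exact add_mem hx hy) hx
  · intro i hi x
    rcases eq_or_lt_of_le hi with rfl | hi
    · exact Submodule.mem_sup_right ⟨x, rfl⟩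
    · rw [← h.s_t_succ n i hi]
      exact Submodule.mem_sup_left (s_mem_degen hi _)
  · intro x
    rw [extra, LinearMap.comp_apply, ← h.s_t_zero]
    exact Submodule.mem_sup_left (s_mem_degen (Nat.zero_le _) _)

theorem norm_ext (h : P.IsParacyclic) (n : ℕ) (x : X (n + 1))
    (hx : x ∈ P.degen (n + 1) ⊔ LinearMap.range (P.extra n)) :
    P.norm (n + 1) x ∈ P.degen (n + 1) ⊔ LinearMap.range (P.extra n) := by
  have hp : ∀ i : ℕ, (P.t (n + 1) ^ i) x ∈ P.degen (n + 1) ⊔ LinearMap.range (P.extra n) := by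
    intro i
    induction i with
    | zero => simpa using hx
    | succ i ih => rw [pow_succ', Module.End.mul_apply]; exact h.t_ext n _ ih
  simp only [norm, LinearMap.sum_apply, LinearMap.smul_apply]
  exact Submodule.sum_mem _ fun i _ => Submodule.smul_mem _ _ (hp i)

theorem extra_s (h : P.IsParacyclic) (n j : ℕ) (hj : j ≤ n) (x) :
    P.extra (n + 1) (P.s n j x) = P.s (n + 1) (j + 1) (P.extra n x) := by
  simp only [extra, LinearMap.comp_apply]
  rw [← h.s_s n j n hj le_rfl, h.s_t_succ (n + 1) j (by omega)]

theorem extra_extra (h : P.IsParacyclic) (n : ℕ) (x) :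
    P.extra (n + 1) (P.extra n x) = P.s (n + 1) 0 (P.extra n x) := by
  simp only [extra, LinearMap.comp_apply]
  rw [h.s_t_zero, ← h.s_s n n n le_rfl le_rfl, ← h.s_t_succ (n + 1) n (by omega)]

theorem extra_ext (h : P.IsParacyclic) (n : ℕ) (x : X (n + 1))
    (hx : x ∈ P.degen (n + 1) ⊔ LinearMap.range (P.extra n)) :
    P.extra (n + 1) x ∈ P.degen (n + 2) ∧
      P.t (n + 2) (P.extra (n + 1) x) ∈ P.degen (n + 2) := by
  refine ext_induction (p := fun x => P.extra (n + 1) x ∈ P.degen (n + 2) ∧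
    P.t (n + 2) (P.extra (n + 1) x) ∈ P.degen (n + 2)) ?_ ?_ (by simp)
    (fun x y hx hy => by
      simp only [map_add]; exact ⟨add_mem hx.1 hy.1, add_mem hx.2 hy.2⟩) hx
  · intro j hj x
    rw [h.extra_s n j hj]
    refine ⟨s_mem_degen (by omega) _, ?_⟩
    rcases eq_or_lt_of_le hj with rfl | hj
    · have : P.t (j + 2) (P.s (j + 1) (j + 1) (P.extra j x)) = P.extra (j + 1) (P.extra j x) := rfl
      rw [this, h.extra_extra]
      exact s_mem_degen (by omega) _
    · rw [← h.s_t_succ (n + 1) (j + 1) (by omega)]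
      exact s_mem_degen (by omega) _
  · intro x
    rw [h.extra_extra]
    refine ⟨s_mem_degen (by omega) _, ?_⟩
    rw [← h.s_t_succ (n + 1) 0 (by omega)]
    exact s_mem_degen (by omega) _

theorem B_ext (h : P.IsParacyclic) (n : ℕ) (x : X (n + 1))
    (hx : x ∈ P.degen (n + 1) ⊔ LinearMap.range (P.extra n)) :
    P.B (n + 1) x ∈ P.degen (n + 2) := by
  obtain ⟨h1, h2⟩ := h.extra_ext n _ (h.norm_ext n x hx)
  rw [B_apply, st]
  exact sub_mem h1 (Submodule.smul_mem _ _ h2)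

theorem B_degen (h : P.IsParacyclic) : ∀ (n : ℕ) (x : X n), x ∈ P.degen n → P.B n x ∈ P.degen (n + 1)
  | 0, x, hx => by
    have : x = 0 := by simpa [degen] using hx
    simp [this]
  | n + 1, x, hx => h.B_ext n x (Submodule.mem_sup_left hx)

theorem B_B (h : P.IsParacyclic) (n : ℕ) (x : X n) : P.B (n + 1) (P.B n x) ∈ P.degen (n + 2) := by
  refine h.B_ext n _ ?_
  rw [B_apply, st]
  have h1 : P.extra n (P.norm n x) ∈ P.degen (n + 1) ⊔ LinearMap.range (P.extra n) :=
    Submodule.mem_sup_right ⟨_, rfl⟩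
  exact sub_mem h1 (Submodule.smul_mem _ _ (h.t_ext n _ h1))

end IsParacyclic

/-- In a cyclic module `B ^ 2 = 0` already before normalization. -/
theorem IsCyclic.B_B (h : P.IsCyclic) (n : ℕ) (x : X n) : P.B (n + 1) (P.B n x) = 0 := by
  rw [B_apply, B_apply n, IsParacyclic.st_mul_norm, h.t_pow]
  simp

end ParacyclicOps

/-- A mixed complex of `k`-modules. -/
structure MixedComplex (k : Type u) [CommRing k] (V : ℕ → Type v)
    [∀ n, AddCommGroup (V n)] [∀ n, Module k (V n)] where
  b : ∀ n : ℕ, V (n + 1) →ₗ[k] V n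
  B : ∀ n : ℕ, V n →ₗ[k] V (n + 1)
  b_b : ∀ n x, b n (b (n + 1) x) = 0
  B_B : ∀ n x, B (n + 1) (B n x) = 0
  b_B_zero : ∀ x, b 0 (B 0 x) = 0
  b_B_succ : ∀ n x, b (n + 1) (B (n + 1) x) + B n (b n x) = 0

section Shift

variable {k : Type u} [CommRing k] {V : ℕ → Type v}
  [∀ n, AddCommGroup (V n)] [∀ n, Module k (V n)]

/-- A family of maps lowering the degree by one, as an operator on `∏ n, V n`. -/
def lower (f : ∀ n : ℕ, V (n + 1) →ₗ[k] V n) : (∀ n, V n) →ₗ[k] (∀ n, V n) :=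
  LinearMap.pi fun n => f n ∘ₗ LinearMap.proj (n + 1)

/-- A family of maps raising the degree by one, as an operator on `∏ n, V n`. -/
def raise (f : ∀ n : ℕ, V n →ₗ[k] V (n + 1)) : (∀ n, V n) →ₗ[k] (∀ n, V n) :=
  LinearMap.pi fun n => match n with
    | 0 => 0
    | n + 1 => f n ∘ₗ LinearMap.proj n

@[simp] theorem lower_apply (f : ∀ n : ℕ, V (n + 1) →ₗ[k] V n) (x : ∀ n, V n) (n : ℕ) :
    lower f x n = f n (x (n + 1)) := rfl

@[simp] theorem raise_zero (f : ∀ n : ℕ, V n →ₗ[k] V (n + 1)) (x : ∀ n, V n) :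
    raise f x 0 = 0 := rfl

@[simp] theorem raise_succ (f : ∀ n : ℕ, V n →ₗ[k] V (n + 1)) (x : ∀ n, V n) (n : ℕ) :
    raise f x (n + 1) = f n (x n) := rfl

end Shift

namespace ParacyclicOps

variable {k : Type u} [CommRing k] {X : ℕ → Type v}
  [∀ n, AddCommGroup (X n)] [∀ n, Module k (X n)]

/-- The mixed complex `(C(P), b, B)` of a cyclic module. -/
def mixed (P : ParacyclicOps k X) (h : P.IsCyclic) : MixedComplex k X where
  b := P.b
  B := P.B
  b_b := h.b_b
  B_B := h.B_B
  b_B_zero x := by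
    rw [h.b_B_zero]
    have := h.t_pow 0 x
    simp only [zero_add, pow_one] at this
    rw [this, sub_self]
  b_B_succ n x := by rw [h.b_B_succ, h.t_pow, sub_self]

end ParacyclicOps

/-! ### Cyclic homology of a mixed complex with coefficients -/

namespace MixedComplex

variable {k : Type u} [CommRing k] {V : ℕ → Type v}
  [∀ n, AddCommGroup (V n)] [∀ n, Module k (V n)] (M : MixedComplex k V)

variable (k V) in
/-- The degree `m` part `∏_{i ≥ 0} V_{m + 2 i} u^i` of `V[[u]]`, where `u` has degree `-2`. The
power of `u` is determined by the degrees, so that a series is recorded as the family of its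
coefficients. -/
def series (m : ℤ) : Submodule k (∀ n, V n) where
  carrier := {f | ∀ n : ℕ, (¬ ∃ i : ℕ, (n : ℤ) = m + 2 * i) → f n = 0}
  add_mem' hf hg n hn := by simp [hf n hn, hg n hn]
  zero_mem' _ _ := rfl
  smul_mem' c f hf n hn := by simp [hf n hn]

/-- The differential `b + u B`, on families of coefficients. -/
def total : (∀ n, V n) →ₗ[k] (∀ n, V n) := lower M.b + raise M.B

theorem total_mem (m : ℤ) (f : ∀ n, V n) (hf : f ∈ series k V m) :
    M.total f ∈ series k V (m - 1) := by
  intro n hn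
  have h1 : f (n + 1) = 0 := hf _ fun ⟨i, hi⟩ => hn ⟨i, by push_cast at hi; omega⟩
  rcases n with _ | n
  · simp [total, h1]
  · have h2 : f n = 0 := hf _ fun ⟨i, hi⟩ => hn ⟨i + 1, by push_cast; omega⟩
    simp [total, h1, h2]

theorem total_total (f : ∀ n, V n) : M.total (M.total f) = 0 := by
  funext n
  rcases n with _ | _ | n
  · simp [total, M.b_b, M.b_B_zero]
  · simpa [total, M.b_b] using M.b_B_succ 0 (f 1)
  · have := M.b_B_succ (n + 1) (f (n + 2))
    simp only [total, LinearMap.add_apply, Pi.add_apply, lower_apply, raise_succ, map_add,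
      M.b_b, M.B_B, zero_add, add_zero]
    exact (add_comm _ _).trans this

theorem series_le (m : ℤ) : series k V m ≤ series k V (m - 2) := fun _ hf n hn =>
  hf n fun ⟨i, hi⟩ => hn ⟨i + 1, by push_cast; omega⟩

variable (k V) in
/-- The graded module `V[[u]]`. -/
def Series := DirectSum ℤ fun m => series k V m

noncomputable instance : AddCommGroup (Series k V) :=
  inferInstanceAs (AddCommGroup (DirectSum ℤ fun m => series k V m))

noncomputable instance : Module k (Series k V) :=
  inferInstanceAs (Module k (DirectSum ℤ fun m => series k V m))

variable (k V) in
/-- The homogeneous element of degree `m` given by a series. -/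
noncomputable def hom (m : ℤ) : series k V m →ₗ[k] Series k V :=
  DirectSum.lof k ℤ (fun m => series k V m) m

theorem hom_congr {m m' : ℤ} (hm : m = m') (x : series k V m) (y : series k V m')
    (hxy : x.1 = y.1) : hom k V m x = hom k V m' y := by
  subst hm; congr 1; exact Subtype.ext hxy

theorem series_ext {N : Type*} [AddCommGroup N] [Module k N] {f g : Series k V →ₗ[k] N}
    (h : ∀ m x, f (hom k V m x) = g (hom k V m x)) : f = g :=
  DirectSum.linearMap_ext k fun m => LinearMap.ext fun x => h m x

variable (k V) in
/-- Multiplication by `u` on `V[[u]]`; it moves degree `m` to degree `m - 2` and does not change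
the family of coefficients. -/
noncomputable def mulU : Module.End k (Series k V) :=
  DirectSum.toModule k ℤ (Series k V) fun m =>
    hom k V (m - 2) ∘ₗ Submodule.inclusion (series_le m)

/-- The differential `b + u B` on `V[[u]]`. -/
noncomputable def diff : Module.End k (Series k V) :=
  DirectSum.toModule k ℤ (Series k V) fun m =>
    hom k V (m - 1) ∘ₗ M.total.restrict (M.total_mem m)

theorem mulU_hom (m : ℤ) (x : series k V m) :
    mulU k V (hom k V m x) = hom k V (m - 2) ⟨x, series_le m x.2⟩ :=
  DirectSum.toModule_lof k (φ := fun m => hom k V (m - 2) ∘ₗ Submodule.inclusion (series_le m)) m x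

theorem diff_hom (m : ℤ) (x : series k V m) :
    M.diff (hom k V m x) = hom k V (m - 1) ⟨M.total x, M.total_mem m x x.2⟩ :=
  DirectSum.toModule_lof k
    (φ := fun m => hom k V (m - 1) ∘ₗ M.total.restrict (M.total_mem m)) m x

theorem diff_diff (x : Series k V) : M.diff (M.diff x) = 0 := by
  have : M.diff ∘ₗ M.diff = 0 := by
    refine series_ext fun m x => ?_
    rw [LinearMap.comp_apply, diff_hom, diff_hom, LinearMap.zero_apply,
      ← map_zero (hom k V (m - 1 - 1))]
    exact hom_congr rfl _ _ (M.total_total x)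
  exact LinearMap.congr_fun this x

theorem diff_mulU (x : Series k V) : M.diff (mulU k V x) = mulU k V (M.diff x) := by
  have : M.diff ∘ₗ mulU k V = mulU k V ∘ₗ M.diff := by
    refine series_ext fun m x => ?_
    rw [LinearMap.comp_apply, LinearMap.comp_apply, diff_hom, mulU_hom, mulU_hom, diff_hom]
    exact hom_congr (by ring) _ _ rfl
  exact LinearMap.congr_fun this x

/-- `V[[u]]` is a module over `k[u]`. -/
noncomputable instance : Module k[X] (Series k V) :=
  Module.compHom (Series k V) (Polynomial.aeval (R := k) (mulU k V)).toRingHom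

theorem poly_smul_def (p : k[X]) (x : Series k V) :
    p • x = Polynomial.aeval (R := k) (mulU k V) p x := rfl

instance : IsScalarTower k k[X] (Series k V) where
  smul_assoc c p x := by simp [poly_smul_def]

/-- The differential `b + u B` on `V[[u]]` as a `k[u]`-linear map. -/
noncomputable def diffU : Series k V →ₗ[k[X]] Series k V where
  toFun := M.diff
  map_add' := map_add _
  map_smul' p x := by
    have hc : Commute M.diff (mulU k V) := LinearMap.ext M.diff_mulU
    simp only [poly_smul_def, RingHom.id_apply]
    induction p using Polynomial.induction_on' with
    | add p q hp hq => simp only [map_add, LinearMap.add_apply, hp, hq]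
    | monomial n a =>
      rw [Polynomial.aeval_monomial]
      exact LinearMap.congr_fun
        (((Algebra.commute_algebraMap_right a M.diff).mul_right (hc.pow_right n)).eq) x

section Coefficients

variable (W : Type w) [AddCommGroup W] [Module k W] [Module k[X] W]

variable (k V) in
/-- `V ⊠ W = V[[u]] ⊗_{k[u]} W`. -/
noncomputable abbrev Box := Series k V ⊗[k[X]] W

/-- The differential `b + u B` on `V ⊠ W`. -/
noncomputable def boxDiff : Box k V W →ₗ[k] Box k V W :=
  (M.diffU.rTensor W).restrictScalars k

variable {W} (𝒲 : ℤ → Submodule k W)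

variable (V) in
/-- The degree `n` part of `V ⊠ W`, for a grading `𝒲` of `W`. -/
noncomputable def boxDeg (n : ℤ) : Submodule k (Box k V W) :=
  Submodule.span k {z | ∃ (m : ℤ) (x : series k V m) (w : W), w ∈ 𝒲 (n - m) ∧
    z = hom k V m x ⊗ₜ[k[X]] w}

/-- The cycles of degree `n` in `V ⊠ W`. -/
noncomputable def boxCycles (n : ℤ) : Submodule k (Box k V W) :=
  LinearMap.ker (M.boxDiff W) ⊓ boxDeg V 𝒲 n

/-- The boundaries of degree `n` in `V ⊠ W`. -/
noncomputable def boxBoundaries (n : ℤ) : Submodule k (Box k V W) :=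
  (boxDeg V 𝒲 (n + 1)).map (M.boxDiff W)

/-- The cyclic homology `HC_n(V; W)` of a mixed complex with coefficients in the graded
`k[u]`-module `W`: the degree `n` homology of `(V ⊠ W, b + u B)`. -/
abbrev HC (n : ℤ) : Type _ :=
  M.boxCycles 𝒲 n ⧸ (M.boxBoundaries 𝒲 n).submoduleOf (M.boxCycles 𝒲 n)

theorem boxBoundaries_le (n : ℤ) : M.boxBoundaries 𝒲 n ≤ M.boxCycles 𝒲 n := by
  rw [boxBoundaries, boxDeg, Submodule.map_span_le]
  rintro _ ⟨m, x, w, hw, rfl⟩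
  have hd : ∀ (m : ℤ) (x : series k V m) (w : W), M.boxDiff W
      (hom k V m x ⊗ₜ[k[X]] w) =
      M.diff (hom k V m x) ⊗ₜ[k[X]] w := fun _ _ _ => rfl
  rw [hd, diff_hom]
  refine ⟨?_, Submodule.subset_span ⟨m - 1, _, w, by convert hw using 2; ring, rfl⟩⟩
  rw [SetLike.mem_coe, LinearMap.mem_ker, hd, ← diff_hom]
  rw [diff_diff, TensorProduct.zero_tmul]

end Coefficients

end MixedComplex


/-- The operators of a bi-paracyclic `k`-module `X p q`: for every `p` the operators `h p` in the
`q`-direction and for every `q` the (barred) operators `v q` in the `p`-direction. -/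
structure CylindricalOps (k : Type u) [CommRing k] (X : ℕ → ℕ → Type v)
    [∀ p q, AddCommGroup (X p q)] [∀ p q, Module k (X p q)] where
  h : ∀ p : ℕ, ParacyclicOps k (X p)
  v : ∀ q : ℕ, ParacyclicOps k fun p => X p q

namespace CylindricalOps

open ParacyclicOps

variable {k : Type u} [CommRing k] {X : ℕ → ℕ → Type v}
  [∀ p q, AddCommGroup (X p q)] [∀ p q, Module k (X p q)] (C : CylindricalOps k X)

/-- A cylindrical module: both families are paracyclic, the operators of the two directions
commute, and `t̄ ^ (p + 1) t ^ (q + 1) = 1` on `X p q`. -/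
structure IsCylindrical : Prop where
  h_para : ∀ p, (C.h p).IsParacyclic
  v_para : ∀ q, (C.v q).IsParacyclic
  d_d : ∀ p q i j, i ≤ q + 1 → j ≤ p + 1 → ∀ x,
    (C.h p).d q i ((C.v (q + 1)).d p j x) = (C.v q).d p j ((C.h (p + 1)).d q i x)
  d_s : ∀ p q i j, i ≤ q + 1 → j ≤ p → ∀ x,
    (C.h (p + 1)).d q i ((C.v (q + 1)).s p j x) = (C.v q).s p j ((C.h p).d q i x)
  d_t : ∀ p q i, i ≤ q + 1 → ∀ x,
    (C.h p).d q i ((C.v (q + 1)).t p x) = (C.v q).t p ((C.h p).d q i x)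
  s_d : ∀ p q i j, i ≤ q → j ≤ p + 1 → ∀ x,
    (C.h p).s q i ((C.v q).d p j x) = (C.v (q + 1)).d p j ((C.h (p + 1)).s q i x)
  s_s : ∀ p q i j, i ≤ q → j ≤ p → ∀ x,
    (C.h (p + 1)).s q i ((C.v q).s p j x) = (C.v (q + 1)).s p j ((C.h p).s q i x)
  s_t : ∀ p q i, i ≤ q → ∀ x,
    (C.h p).s q i ((C.v q).t p x) = (C.v (q + 1)).t p ((C.h p).s q i x)
  t_d : ∀ p q j, j ≤ p + 1 → ∀ x,
    (C.h p).t q ((C.v q).d p j x) = (C.v q).d p j ((C.h (p + 1)).t q x)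
  t_s : ∀ p q j, j ≤ p → ∀ x,
    (C.h (p + 1)).t q ((C.v q).s p j x) = (C.v q).s p j ((C.h p).t q x)
  t_t : ∀ p q x, (C.h p).t q ((C.v q).t p x) = (C.v q).t p ((C.h p).t q x)
  t_pow : ∀ p q x, ((C.v q).t p ^ (p + 1)) (((C.h p).t q ^ (q + 1)) x) = x

/-- The diagonal `Δ C`. -/
def diag : ParacyclicOps k fun n => X n n where
  d n i := (C.v n).d n i ∘ₗ (C.h (n + 1)).d n i
  s n i := (C.v (n + 1)).s n i ∘ₗ (C.h n).s n i
  t n := (C.v n).t n ∘ₗ (C.h n).t n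

variable {C}

theorem IsCylindrical.diag (H : C.IsCylindrical) : C.diag.IsCyclic where
  d_d n i j hij hj x := by
    simp only [CylindricalOps.diag, LinearMap.comp_apply]
    rw [H.d_d (n + 1) n i (j + 1) (by omega) (by omega), (H.h_para _).d_d n i j hij hj,
      (H.v_para _).d_d n i j hij hj, ← H.d_d (n + 1) n j i (by omega) (by omega)]
  s_s n i j hij hj x := by
    simp only [CylindricalOps.diag, LinearMap.comp_apply]
    rw [H.s_s n (n + 1) i j (by omega) (by omega), (H.h_para _).s_s n i j hij hj,
      (H.v_para _).s_s n i j hij hj, ← H.s_s n (n + 1) (j + 1) i (by omega) (by omega)]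
  d_s_lt n i j hij hj x := by
    simp only [CylindricalOps.diag, LinearMap.comp_apply]
    rw [H.d_s (n + 1) (n + 1) i (j + 1) (by omega) (by omega), (H.h_para _).d_s_lt n i j hij hj,
      (H.v_para _).d_s_lt n i j hij hj, ← H.s_d n n j i (by omega) (by omega)]
  d_s_self n i hi x := by
    simp only [CylindricalOps.diag, LinearMap.comp_apply]
    rw [H.d_s n n i i (by omega) (by omega), (H.h_para _).d_s_self n i hi,
      (H.v_para _).d_s_self n i hi]
  d_s_succ n i hi x := by
    simp only [CylindricalOps.diag, LinearMap.comp_apply]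
    rw [H.d_s n n (i + 1) i (by omega) (by omega), (H.h_para _).d_s_succ n i hi,
      (H.v_para _).d_s_succ n i hi]
  d_s_gt n i j hij hi x := by
    simp only [CylindricalOps.diag, LinearMap.comp_apply]
    rw [H.d_s (n + 1) (n + 1) (i + 1) j (by omega) (by omega), (H.h_para _).d_s_gt n i j hij hi,
      (H.v_para _).d_s_gt n i j hij hi, ← H.s_d n n j i (by omega) (by omega)]
  d_t_zero n x := by
    simp only [CylindricalOps.diag, LinearMap.comp_apply]
    rw [H.d_t (n + 1) n 0 (by omega), (H.h_para _).d_t_zero, (H.v_para _).d_t_zero]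
  d_t_succ n i hi x := by
    simp only [CylindricalOps.diag, LinearMap.comp_apply]
    rw [H.d_t (n + 1) n (i + 1) (by omega), (H.h_para _).d_t_succ n i hi,
      (H.v_para _).d_t_succ n i hi, ← H.t_d n n i (by omega)]
  s_t_zero n x := by
    simp only [CylindricalOps.diag, LinearMap.comp_apply]
    rw [H.s_t n n 0 (by omega), (H.h_para _).s_t_zero, (H.v_para _).s_t_zero,
      H.t_s n (n + 1) n le_rfl, H.t_t (n + 1) (n + 1), H.t_s n (n + 1) n le_rfl]
  s_t_succ n i hi x := by
    simp only [CylindricalOps.diag, LinearMap.comp_apply]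
    rw [H.s_t n n (i + 1) (by omega), (H.h_para _).s_t_succ n i hi,
      (H.v_para _).s_t_succ n i hi, H.t_s n (n + 1) i (by omega)]
  t_bijective n := ((H.v_para n).t_bijective n).comp ((H.h_para n).t_bijective n)
  t_pow n x := by
    have hc : Commute ((C.v n).t n) ((C.h n).t n) :=
      LinearMap.ext fun x => (H.t_t n n x).symm
    have : C.diag.t n = (C.v n).t n * (C.h n).t n := rfl
    rw [this, hc.mul_pow]
    exact H.t_pow n n x

variable (C)

/-- The chains of `X p q` that are degenerate in one of the two directions. -/
def degen (p q : ℕ) : Submodule k (X p q) := (C.h p).degen q ⊔ (C.v q).degen p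

/-- The normalized module `N(C) p q`. -/
abbrev Norm (p q : ℕ) : Type v := X p q ⧸ C.degen p q

variable {C}

theorem map_degen {Y Z : ℕ → Type v} [∀ n, AddCommGroup (Y n)] [∀ n, Module k (Y n)]
    [∀ n, AddCommGroup (Z n)] [∀ n, Module k (Z n)] (P : ParacyclicOps k Y)
    (Q : ParacyclicOps k Z) (f : ∀ n, Y n →ₗ[k] Z n)
    (hf : ∀ n i, i ≤ n → ∀ x, f (n + 1) (P.s n i x) = Q.s n i (f n x)) :
    ∀ (n : ℕ) (x : Y n), x ∈ P.degen n → f n x ∈ Q.degen n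
  | 0, x, hx => by
    have : x = 0 := by simpa [ParacyclicOps.degen] using hx
    simp [this]
  | n + 1, x, hx => degen_induction (p := fun x => f (n + 1) x ∈ Q.degen (n + 1))
      (fun i hi x => by rw [hf n i hi]; exact s_mem_degen hi _) (by simp)
      (fun x y hx hy => by rw [map_add]; exact add_mem hx hy) hx

theorem pow_comm {M N : Type v} [AddCommGroup M] [Module k M] [AddCommGroup N] [Module k N]
    {f : M →ₗ[k] N} {s : M →ₗ[k] M} {t : N →ₗ[k] N} (h : ∀ x, t (f x) = f (s x)) (n : ℕ) (x : M) :
    (t ^ n) (f x) = f ((s ^ n) x) := by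
  induction n generalizing x with
  | zero => rfl
  | succ n ih => rw [pow_succ, pow_succ, Module.End.mul_apply, Module.End.mul_apply, h, ih]

/-- An operator commuting with `t` and the last degeneracy commutes with `B`. -/
theorem B_comm {Y Z : ℕ → Type v} [∀ n, AddCommGroup (Y n)] [∀ n, Module k (Y n)]
    [∀ n, AddCommGroup (Z n)] [∀ n, Module k (Z n)] (P : ParacyclicOps k Y)
    (Q : ParacyclicOps k Z) (f : ∀ n, Y n →ₗ[k] Z n)
    (ht : ∀ n x, Q.t n (f n x) = f n (P.t n x))
    (hs : ∀ n x, Q.s n n (f n x) = f (n + 1) (P.s n n x)) (n : ℕ) (x : Y n) :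
    Q.B n (f n x) = f (n + 1) (P.B n x) := by
  have hN : Q.norm n (f n x) = f n (P.norm n x) := by
    simp only [ParacyclicOps.norm, LinearMap.sum_apply, LinearMap.smul_apply, map_sum, map_smul,
      pow_comm (ht n)]
  rw [B_apply, B_apply, hN]
  simp only [ParacyclicOps.extra, LinearMap.comp_apply, st, LinearMap.smul_apply, map_sub,
    map_smul, hs, ht]

theorem b_comm {Y Z : ℕ → Type v} [∀ n, AddCommGroup (Y n)] [∀ n, Module k (Y n)]
    [∀ n, AddCommGroup (Z n)] [∀ n, Module k (Z n)] (P : ParacyclicOps k Y)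
    (Q : ParacyclicOps k Z) (f : ∀ n, Y n →ₗ[k] Z n)
    (hd : ∀ n i, i ≤ n + 1 → ∀ x, Q.d n i (f (n + 1) x) = f n (P.d n i x)) (n : ℕ) (x : Y (n + 1)) :
    Q.b n (f (n + 1) x) = f n (P.b n x) := by
  simp only [ParacyclicOps.b, LinearMap.sum_apply, LinearMap.smul_apply, map_sum, map_smul]
  exact Finset.sum_congr rfl fun i hi => by
    rw [hd n i (Nat.lt_succ_iff.mp (Finset.mem_range.mp hi))]

namespace IsCylindrical

variable (H : C.IsCylindrical)

/-- `b` on normalized chains. -/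
def hb (p q : ℕ) : C.Norm p (q + 1) →ₗ[k] C.Norm p q :=
  Submodule.mapQ _ _ ((C.h p).b q) <| sup_le
    (fun x hx => Submodule.mem_sup_left ((H.h_para p).b_degen q x hx))
    (fun x hx => Submodule.mem_sup_right (map_degen (C.v (q + 1)) (C.v q) (fun p => (C.h p).b q)
      (fun p i hi x => (b_comm (C.h p) (C.h (p + 1)) (fun q => (C.v q).s p i)
        (fun q j hj x => H.d_s p q j i hj hi x) q x)) p x hx))

/-- `B` on normalized chains. -/
def hB (p q : ℕ) : C.Norm p q →ₗ[k] C.Norm p (q + 1) :=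
  Submodule.mapQ _ _ ((C.h p).B q) <| sup_le
    (fun x hx => Submodule.mem_sup_left ((H.h_para p).B_degen q x hx))
    (fun x hx => Submodule.mem_sup_right (map_degen (C.v q) (C.v (q + 1)) (fun p => (C.h p).B q)
      (fun p i hi x => (B_comm (C.h p) (C.h (p + 1)) (fun q => (C.v q).s p i)
        (fun q x => H.t_s p q i hi x) (fun q x => H.s_s p q q i le_rfl hi x) q x)) p x hx))

/-- `b̄` on normalized chains. -/
def vb (p q : ℕ) : C.Norm (p + 1) q →ₗ[k] C.Norm p q :=
  Submodule.mapQ _ _ ((C.v q).b p) <| sup_le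
    (fun x hx => Submodule.mem_sup_left (map_degen (C.h (p + 1)) (C.h p) (fun q => (C.v q).b p)
      (fun q i hi x => (b_comm (C.v q) (C.v (q + 1)) (fun p => (C.h p).s q i)
        (fun p j hj x => (H.s_d p q i j hi hj x).symm) p x)) q x hx))
    (fun x hx => Submodule.mem_sup_right ((H.v_para q).b_degen p x hx))

/-- `B̄` on normalized chains. -/
def vB (p q : ℕ) : C.Norm p q →ₗ[k] C.Norm (p + 1) q :=
  Submodule.mapQ _ _ ((C.v q).B p) <| sup_le
    (fun x hx => Submodule.mem_sup_left (map_degen (C.h p) (C.h (p + 1)) (fun q => (C.v q).B p)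
      (fun q i hi x => (B_comm (C.v q) (C.v (q + 1)) (fun p => (C.h p).s q i)
        (fun p x => (H.s_t p q i hi x).symm) (fun p x => (H.s_s p q i p hi le_rfl x).symm) p x))
      q x hx))
    (fun x hx => Submodule.mem_sup_right ((H.v_para q).B_degen p x hx))

/-- `(-1)^p b` on `∏ p q, N(C) p q`. The sign, here and in `TB`, makes the operators of the two
directions anticommute. -/
def Tb : Module.End k (∀ p q, C.Norm p q) :=
  LinearMap.pi fun p => (-1 : k) ^ p • (lower (H.hb p) ∘ₗ LinearMap.proj p)

/-- `(-1)^p B`. -/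
def TB : Module.End k (∀ p q, C.Norm p q) :=
  LinearMap.pi fun p => (-1 : k) ^ p • (raise (H.hB p) ∘ₗ LinearMap.proj p)

/-- `b̄`. -/
def Tb' : Module.End k (∀ p q, C.Norm p q) :=
  lower fun p => LinearMap.pi fun q => H.vb p q ∘ₗ LinearMap.proj q

/-- `B̄`. -/
def TB' : Module.End k (∀ p q, C.Norm p q) :=
  raise fun p => LinearMap.pi fun q => H.vB p q ∘ₗ LinearMap.proj q

/-- `T = 1 - (b B + B b)`. -/
def T : Module.End k (∀ p q, C.Norm p q) := 1 - (H.Tb * H.TB + H.TB * H.Tb)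

/-- `Tot(b) = b + b̄`. -/
def totb : Module.End k (∀ p q, C.Norm p q) := H.Tb + H.Tb'

/-- `Tot(B) = B + T B̄`. -/
def totB : Module.End k (∀ p q, C.Norm p q) := H.TB + H.T * H.TB'

theorem hb_mk (p q : ℕ) (x : X p (q + 1)) : H.hb p q (Submodule.Quotient.mk x) =
    Submodule.Quotient.mk ((C.h p).b q x) := rfl

theorem hB_mk (p q : ℕ) (x : X p q) : H.hB p q (Submodule.Quotient.mk x) =
    Submodule.Quotient.mk ((C.h p).B q x) := rfl

theorem vb_mk (p q : ℕ) (x : X (p + 1) q) : H.vb p q (Submodule.Quotient.mk x) =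
    Submodule.Quotient.mk ((C.v q).b p x) := rfl

theorem vB_mk (p q : ℕ) (x : X p q) : H.vB p q (Submodule.Quotient.mk x) =
    Submodule.Quotient.mk ((C.v q).B p x) := rfl

theorem hb_hb (p q : ℕ) (x) : H.hb p q (H.hb p (q + 1) x) = 0 := by
  obtain ⟨x, rfl⟩ := Submodule.Quotient.mk_surjective _ x
  rw [hb_mk, hb_mk, (H.h_para p).b_b]; rfl

theorem vb_vb (p q : ℕ) (x) : H.vb p q (H.vb (p + 1) q x) = 0 := by
  obtain ⟨x, rfl⟩ := Submodule.Quotient.mk_surjective _ x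
  rw [vb_mk, vb_mk, (H.v_para q).b_b]; rfl

theorem hB_hB (p q : ℕ) (x) : H.hB p (q + 1) (H.hB p q x) = 0 := by
  obtain ⟨x, rfl⟩ := Submodule.Quotient.mk_surjective _ x
  rw [hB_mk, hB_mk]
  exact (Submodule.Quotient.mk_eq_zero _).mpr (Submodule.mem_sup_left ((H.h_para p).B_B q x))

theorem vB_vB (p q : ℕ) (x) : H.vB (p + 1) q (H.vB p q x) = 0 := by
  obtain ⟨x, rfl⟩ := Submodule.Quotient.mk_surjective _ x
  rw [vB_mk, vB_mk]
  exact (Submodule.Quotient.mk_eq_zero _).mpr (Submodule.mem_sup_right ((H.v_para q).B_B p x))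

theorem hb_vb (p q : ℕ) (x) : H.hb p q (H.vb p (q + 1) x) = H.vb p q (H.hb (p + 1) q x) := by
  obtain ⟨x, rfl⟩ := Submodule.Quotient.mk_surjective _ x
  rw [vb_mk, hb_mk, hb_mk, vb_mk]
  refine congrArg Submodule.Quotient.mk ?_
  exact (b_comm (C.v (q + 1)) (C.v q) (fun p => (C.h p).b q)
    (fun p j hj x => (b_comm (C.h (p + 1)) (C.h p) (fun q => (C.v q).d p j)
      (fun q i hi x => H.d_d p q i j hi hj x) q x).symm) p x).symm

theorem hb_vB (p q : ℕ) (x) : H.hb (p + 1) q (H.vB p (q + 1) x) = H.vB p q (H.hb p q x) := by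
  obtain ⟨x, rfl⟩ := Submodule.Quotient.mk_surjective _ x
  rw [vB_mk, hb_mk, hb_mk, vB_mk]
  refine congrArg Submodule.Quotient.mk ?_
  exact (B_comm (C.v (q + 1)) (C.v q) (fun p => (C.h p).b q)
    (fun p x => (b_comm (C.h p) (C.h p) (fun q => (C.v q).t p)
      (fun q i hi x => H.d_t p q i hi x) q x).symm)
    (fun p x => (b_comm (C.h p) (C.h (p + 1)) (fun q => (C.v q).s p p)
      (fun q i hi x => H.d_s p q i p hi le_rfl x) q x).symm) p x).symm

theorem hB_vb (p q : ℕ) (x) : H.hB p q (H.vb p q x) = H.vb p (q + 1) (H.hB (p + 1) q x) := by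
  obtain ⟨x, rfl⟩ := Submodule.Quotient.mk_surjective _ x
  rw [vb_mk, hB_mk, hB_mk, vb_mk]
  refine congrArg Submodule.Quotient.mk ?_
  exact B_comm (C.h (p + 1)) (C.h p) (fun q => (C.v q).b p)
    (fun q x => (b_comm (C.v q) (C.v q) (fun p => (C.h p).t q)
      (fun p j hj x => (H.t_d p q j hj x).symm) p x).symm)
    (fun q x => (b_comm (C.v q) (C.v (q + 1)) (fun p => (C.h p).s q q)
      (fun p j hj x => (H.s_d p q q j le_rfl hj x).symm) p x).symm) q x

theorem hB_vB (p q : ℕ) (x) : H.hB (p + 1) q (H.vB p q x) = H.vB p (q + 1) (H.hB p q x) := by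
  obtain ⟨x, rfl⟩ := Submodule.Quotient.mk_surjective _ x
  rw [vB_mk, hB_mk, hB_mk, vB_mk]
  refine congrArg Submodule.Quotient.mk ?_
  exact B_comm (C.h p) (C.h (p + 1)) (fun q => (C.v q).B p)
    (fun q x => (B_comm (C.v q) (C.v q) (fun p => (C.h p).t q)
      (fun p x => (H.t_t p q x).symm) (fun p x => (H.t_s p q p le_rfl x).symm) p x).symm)
    (fun q x => (B_comm (C.v q) (C.v (q + 1)) (fun p => (C.h p).s q q)
      (fun p x => (H.s_t p q q le_rfl x).symm)
      (fun p x => (H.s_s p q q p le_rfl le_rfl x).symm) p x).symm) q x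

theorem neg_one_mul_self (p : ℕ) : (-1 : k) ^ p * (-1) ^ p = 1 := by
  rw [← mul_pow]; simp

theorem T_apply (f : ∀ p q, C.Norm p q) (p q : ℕ) (x : X p q)
    (hx : f p q = Submodule.Quotient.mk x) :
    H.T f p q = Submodule.Quotient.mk (((C.h p).t q ^ (q + 1)) x) := by
  rcases q with _ | q
  · have := (H.h_para p).b_B_zero x
    simp [T, Tb, TB, hx, hb_mk, hB_mk, smul_smul, neg_one_mul_self, this, ← Submodule.Quotient.mk_sub]
  · have := (H.h_para p).b_B_succ q x
    have h2 : ((C.h p).t (q + 1) ^ (q + 2)) x =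
        x - ((C.h p).b (q + 1) ((C.h p).B (q + 1) x) + (C.h p).B q ((C.h p).b q x)) := by
      rw [this]; abel
    rw [show q + 1 + 1 = q + 2 from rfl, h2]
    simp [T, Tb, TB, hx, hb_mk, hB_mk, smul_smul, neg_one_mul_self]

theorem T'_apply (f : ∀ p q, C.Norm p q) (p q : ℕ) (x : X p q)
    (hx : f p q = Submodule.Quotient.mk x) :
    ((1 - (H.Tb' * H.TB' + H.TB' * H.Tb')) f : ∀ p q, C.Norm p q) p q =
      Submodule.Quotient.mk (((C.v q).t p ^ (p + 1)) x) := by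
  rcases p with _ | p
  · have := (H.v_para q).b_B_zero x
    simp [Tb', TB', hx, vb_mk, vB_mk, this]
  · have := (H.v_para q).b_B_succ p x
    have h2 : ((C.v q).t (p + 1) ^ (p + 2)) x =
        x - ((C.v q).b (p + 1) ((C.v q).B (p + 1) x) + (C.v q).B p ((C.v q).b p x)) := by
      rw [this]; abel
    rw [show p + 1 + 1 = p + 2 from rfl, h2]
    simp [Tb', TB', hx, vb_mk, vB_mk]

theorem T_T' : H.T * (1 - (H.Tb' * H.TB' + H.TB' * H.Tb')) = 1 := by
  refine LinearMap.ext fun f => funext fun p => funext fun q => ?_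
  obtain ⟨x, hx⟩ := Submodule.Quotient.mk_surjective _ (f p q)
  rw [Module.End.mul_apply, H.T_apply _ p q _ (H.T'_apply f p q x hx.symm)]
  have hc : Commute ((C.v q).t p) ((C.h p).t q) := LinearMap.ext fun x => (H.t_t p q x).symm
  have h2 := LinearMap.congr_fun (hc.pow_pow (p + 1) (q + 1)).eq x
  simp only [Module.End.mul_apply, H.t_pow] at h2
  rw [← h2, hx, Module.End.one_apply]

theorem ring_aux {R : Type*} [Ring R] {b B c D T : R} (hT : T = 1 - (b * B + B * b))
    (hbb : b * b = 0) (hBB : B * B = 0) (hcc : c * c = 0) (hDD : D * D = 0)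
    (hbc : b * c = -(c * b)) (hbD : b * D = -(D * b)) (hBc : B * c = -(c * B))
    (hBD : B * D = -(D * B)) (hTT : T * (1 - (c * D + D * c)) = 1) :
    (b + c) * (b + c) = 0 ∧ (B + T * D) * (B + T * D) = 0 ∧
      (b + c) * (B + T * D) + (B + T * D) * (b + c) = 0 := by
  have e1 : Commute T b := by
    rw [hT, Commute, SemiconjBy]
    have h1 : ∀ x, b * (b * x) = 0 := fun x => by rw [← mul_assoc, hbb, zero_mul]
    simp only [sub_mul, mul_sub, add_mul, mul_add, one_mul, mul_one, mul_assoc, hbb, h1, mul_zero,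
      add_zero, zero_add]
  have e2 : Commute T B := by
    rw [hT, Commute, SemiconjBy]
    have h1 : ∀ x, B * (B * x) = 0 := fun x => by rw [← mul_assoc, hBB, zero_mul]
    simp only [sub_mul, mul_sub, add_mul, mul_add, one_mul, mul_one, mul_assoc, hBB, h1, mul_zero,
      add_zero, zero_add]
  have e3 : Commute T c := by
    rw [hT, Commute, SemiconjBy]
    have h1 : b * B * c = c * b * B := by
      rw [mul_assoc, hBc, mul_neg, ← mul_assoc, hbc]; noncomm_ring
    have h2 : B * b * c = c * B * b := by
      rw [mul_assoc, hbc, mul_neg, ← mul_assoc, hBc]; noncomm_ring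
    rw [sub_mul, mul_sub, add_mul, mul_add, h1, h2, one_mul, mul_one, mul_assoc, mul_assoc]
  have e4 : Commute T D := by
    rw [hT, Commute, SemiconjBy]
    have h1 : b * B * D = D * b * B := by
      rw [mul_assoc, hBD, mul_neg, ← mul_assoc, hbD]; noncomm_ring
    have h2 : B * b * D = D * B * b := by
      rw [mul_assoc, hbD, mul_neg, ← mul_assoc, hBD]; noncomm_ring
    rw [sub_mul, mul_sub, add_mul, mul_add, h1, h2, one_mul, mul_one, mul_assoc, mul_assoc]
  refine ⟨?_, ?_, ?_⟩
  · rw [mul_add, add_mul, add_mul, hbb, hcc, hbc]; simp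
  · have : (B + T * D) * (B + T * D) = B * B + T * (B * D + D * B) + T * (T * (D * D)) := by
      have f1 : B * (T * D) = T * (B * D) := by rw [← mul_assoc, ← e2.eq, mul_assoc]
      have f2 : T * D * (T * D) = T * (T * (D * D)) := by
        rw [mul_assoc, ← mul_assoc D, ← e4.eq, mul_assoc]
      rw [mul_add, add_mul, add_mul, f1, f2]; noncomm_ring
    rw [this, hBB, hBD, hDD]; simp
  · have f1 : b * (T * D) = T * (b * D) := by rw [← mul_assoc, ← e1.eq, mul_assoc]
    have f2 : c * (T * D) = T * (c * D) := by rw [← mul_assoc, ← e3.eq, mul_assoc]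
    have f3 : b * B + B * b = 1 - T := by rw [hT]; abel
    have : (b + c) * (B + T * D) + (B + T * D) * (b + c) =
        (b * B + B * b) + (B * c + c * B) + T * (b * D + D * b) + T * (c * D + D * c) := by
      rw [mul_add, add_mul, add_mul, f1, f2]; noncomm_ring
    rw [this, hBc, hbD, f3]
    rw [mul_sub, mul_one] at hTT
    rw [neg_add_cancel, neg_add_cancel, mul_zero, add_zero, add_zero, ← hTT]
    abel

theorem tot_laws : H.totb * H.totb = 0 ∧ H.totB * H.totB = 0 ∧
    H.totb * H.totB + H.totB * H.totb = 0 := by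
  refine ring_aux (R := Module.End k (∀ p q, C.Norm p q)) rfl ?_ ?_ ?_ ?_ ?_ ?_ ?_ ?_ H.T_T'
  · refine LinearMap.ext fun f => funext fun p => funext fun q => ?_
    simp [Tb, H.hb_hb]
  · refine LinearMap.ext fun f => funext fun p => funext fun q => ?_
    rcases q with _ | _ | q <;> simp [TB, H.hB_hB]
  · refine LinearMap.ext fun f => funext fun p => funext fun q => ?_
    simp [Tb', H.vb_vb]
  · refine LinearMap.ext fun f => funext fun p => funext fun q => ?_
    rcases p with _ | _ | p <;> simp [TB', H.vB_vB]
  · refine LinearMap.ext fun f => funext fun p => funext fun q => ?_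
    simp [Tb, Tb', H.hb_vb, pow_succ]
  · refine LinearMap.ext fun f => funext fun p => funext fun q => ?_
    rcases p with _ | p <;> simp [Tb, TB', H.hb_vB, pow_succ]
  · refine LinearMap.ext fun f => funext fun p => funext fun q => ?_
    rcases q with _ | q <;> simp [TB, Tb', H.hB_vb, pow_succ]
  · refine LinearMap.ext fun f => funext fun p => funext fun q => ?_
    rcases p with _ | p <;> rcases q with _ | q <;> simp [TB, TB', H.hB_vB, pow_succ]

end IsCylindrical

variable (C) in
/-- `Tot_n(N(C)) = ⨁_{p + q = n} N(C) p q`, as the families supported on `p + q = n`. -/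
def Tot (n : ℤ) : Submodule k (∀ p q, C.Norm p q) where
  carrier := {f | ∀ p q : ℕ, (p + q : ℤ) ≠ n → f p q = 0}
  add_mem' hf hg p q h := by simp [hf p q h, hg p q h]
  zero_mem' _ _ _ := rfl
  smul_mem' c f hf p q h := by simp [hf p q h]

namespace IsCylindrical

variable (H : C.IsCylindrical)

theorem Tb_mem {n : ℤ} {f : ∀ p q, C.Norm p q} (hf : f ∈ C.Tot n) : H.Tb f ∈ C.Tot (n - 1) := by
  intro p q h
  have := hf p (q + 1) (by push_cast; omega)
  simp [Tb, this]

theorem TB_mem {n : ℤ} {f : ∀ p q, C.Norm p q} (hf : f ∈ C.Tot n) : H.TB f ∈ C.Tot (n + 1) := by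
  intro p q h
  rcases q with _ | q
  · simp [TB]
  · have := hf p q (by push_cast at h; omega)
    simp [TB, this]

theorem Tb'_mem {n : ℤ} {f : ∀ p q, C.Norm p q} (hf : f ∈ C.Tot n) :
    H.Tb' f ∈ C.Tot (n - 1) := by
  intro p q h
  have := hf (p + 1) q (by push_cast; omega)
  simp [Tb', this]

theorem TB'_mem {n : ℤ} {f : ∀ p q, C.Norm p q} (hf : f ∈ C.Tot n) :
    H.TB' f ∈ C.Tot (n + 1) := by
  intro p q h
  rcases p with _ | p
  · simp [TB']
  · have := hf p q (by push_cast at h; omega)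
    simp [TB', this]

theorem T_mem {n : ℤ} {f : ∀ p q, C.Norm p q} (hf : f ∈ C.Tot n) : H.T f ∈ C.Tot n := by
  have h1 := H.Tb_mem (H.TB_mem hf)
  have h2 := H.TB_mem (H.Tb_mem hf)
  rw [add_sub_cancel_right] at h1
  rw [sub_add_cancel] at h2
  exact sub_mem hf (add_mem h1 h2)

theorem totb_mem (n : ℤ) (f : ∀ p q, C.Norm p q) (hf : f ∈ C.Tot n) :
    H.totb f ∈ C.Tot (n - 1) :=
  add_mem (H.Tb_mem hf) (H.Tb'_mem hf)

theorem totB_mem (n : ℤ) (f : ∀ p q, C.Norm p q) (hf : f ∈ C.Tot n) :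
    H.totB f ∈ C.Tot (n + 1) :=
  add_mem (H.TB_mem hf) (H.T_mem (H.TB'_mem hf))

theorem tot_neg (f : ∀ p q, C.Norm p q) (hf : f ∈ C.Tot 0) : H.totb f = 0 :=
  funext fun p => funext fun q => H.totb_mem 0 f hf p q (by omega)

/-- The mixed complex `(Tot(N(C)), b + b̄, B + T B̄)` of a cylindrical module. -/
def tot : MixedComplex k fun n : ℕ => C.Tot n where
  b n := H.totb.restrict fun f hf => by
    simpa using H.totb_mem _ f hf
  B n := H.totB.restrict fun f hf => by
    simpa using H.totB_mem _ f hf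
  b_b n f := Subtype.ext (LinearMap.congr_fun H.tot_laws.1 f.1)
  B_B n f := Subtype.ext (LinearMap.congr_fun H.tot_laws.2.1 f.1)
  b_B_zero f := Subtype.ext <| by
    have := LinearMap.congr_fun H.tot_laws.2.2 f.1
    rw [LinearMap.add_apply, Module.End.mul_apply, Module.End.mul_apply,
      H.tot_neg f.1 (by simpa using f.2), map_zero, add_zero] at this
    exact this
  b_B_succ n f := Subtype.ext (LinearMap.congr_fun H.tot_laws.2.2 f.1)

end IsCylindrical

end CylindricalOps


/-! ### Tensor powers and the cyclic module of an algebra -/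

section Tensor

variable (k : Type u) [CommRing k] (M : Type v) [AddCommGroup M] [Module k M]

/-- The tensor power `M^{⊗ n}`, with tensor factors numbered from `0` to `n - 1`. -/
abbrev TPow (n : ℕ) := ⨂[k] _ : Fin n, M

variable {k M}

/-- `(a_0, …, a_{n+1}) ↦ (a_0, …, μ(a_i, a_{i+1}), …, a_{n+1})` for `i ≤ n`. -/
def contractFun (μ : M →ₗ[k] M →ₗ[k] M) {n : ℕ} (i : ℕ) (a : Fin (n + 2) → M) : Fin (n + 1) → M :=
  fun j => if j.val < i then a j.castSucc
    else if j.val = i then μ (a j.castSucc) (a j.succ) else a j.succ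

theorem contractFun_update (μ : M →ₗ[k] M →ₗ[k] M) {n : ℕ} (i : ℕ) (hi : i ≤ n)
    [DecidableEq (Fin (n + 2))] (m : Fin (n + 2)) (a : Fin (n + 2) → M) :
    ∃ (j : Fin (n + 1)) (f : M →ₗ[k] M),
      ∀ x, contractFun μ i (Function.update a m x) = Function.update (contractFun μ i a) j (f x) := by
  have hm := m.2
  by_cases h1 : m.val < i
  · refine ⟨⟨m.val, by omega⟩, LinearMap.id, fun x => ?_⟩
    funext l
    simp only [contractFun, Function.update_apply, Fin.ext_iff, Fin.val_castSucc, Fin.val_succ,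
      LinearMap.id_apply]
    split_ifs <;> first | rfl | omega
  · by_cases h2 : m.val = i
    · refine ⟨⟨m.val, by omega⟩, μ.flip (a ⟨m.val + 1, by omega⟩), fun x => ?_⟩
      funext l
      simp only [contractFun, Function.update_apply, Fin.ext_iff, Fin.val_castSucc, Fin.val_succ,
        LinearMap.flip_apply]
      split_ifs with h3 <;> first | rfl | omega | skip
      rw [show l.succ = ⟨m.val + 1, by omega⟩ from Fin.ext (by simp; omega)]
    · by_cases h3 : m.val = i + 1
      · refine ⟨⟨i, by omega⟩, μ (a ⟨i, by omega⟩), fun x => ?_⟩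
        funext l
        simp only [contractFun, Function.update_apply, Fin.ext_iff, Fin.val_castSucc, Fin.val_succ]
        split_ifs <;> first | rfl | omega | skip
        rw [show l.castSucc = ⟨i, by omega⟩ from Fin.ext (by simp; omega)]
      · refine ⟨⟨m.val - 1, by omega⟩, LinearMap.id, fun x => ?_⟩
        funext l
        simp only [contractFun, Function.update_apply, Fin.ext_iff, Fin.val_castSucc,
          Fin.val_succ, LinearMap.id_apply]
        split_ifs <;> first | rfl | omega

/-- The map `(a_0, …, a_{n+1}) ↦ (a_0, …, μ(a_i, a_{i+1}), …, a_{n+1})` on tensor powers. -/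
noncomputable def contract (μ : M →ₗ[k] M →ₗ[k] M) (n i : ℕ) (hi : i ≤ n) :
    TPow k M (n + 2) →ₗ[k] TPow k M (n + 1) :=
  PiTensorProduct.lift
    { toFun := fun a => PiTensorProduct.tprod k (contractFun μ i a)
      map_update_add' := fun a m x y => by
        obtain ⟨j, f, hf⟩ := contractFun_update μ i hi m a
        simp only [hf, map_add, MultilinearMap.map_update_add]
      map_update_smul' := fun a m c x => by
        obtain ⟨j, f, hf⟩ := contractFun_update μ i hi m a
        simp only [hf, map_smul, MultilinearMap.map_update_smul] }

variable (k) in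
/-- The map `(a_0, …, a_n) ↦ (a_0, …, a_i, e, a_{i+1}, …, a_n)` for `i ≤ n`. -/
noncomputable def insert (e : M) (n i : ℕ) : TPow k M (n + 1) →ₗ[k] TPow k M (n + 2) :=
  PiTensorProduct.lift
    ((PiTensorProduct.tprod k : MultilinearMap k (fun _ : Fin (n + 2) => M) _).curryMid
      (Fin.ofNat (n + 2) (i + 1)) e)

variable (k M) in
/-- The map `(a_0, …, a_n) ↦ (a_n, a_0, …, a_{n-1})`. -/
noncomputable def rotate (n : ℕ) : TPow k M (n + 1) →ₗ[k] TPow k M (n + 1) :=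
  (PiTensorProduct.reindex k (fun _ => M) (finRotate (n + 1))).toLinearMap

/-- The pure tensor with entries `α 0, …, α (n - 1)`. -/
noncomputable def pure (n : ℕ) (α : ℕ → M) : TPow k M n :=
  PiTensorProduct.tprod k fun j : Fin n => α j

theorem pure_congr {n : ℕ} {α β : ℕ → M} (h : ∀ m < n, α m = β m) :
    pure (k := k) n α = pure n β :=
  congrArg (PiTensorProduct.tprod k) (funext fun j : Fin n => h j.val j.2)

theorem tpow_ext {N : Type*} [AddCommGroup N] [Module k N] {n : ℕ} {f g : TPow k M n →ₗ[k] N}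
    (h : ∀ α : ℕ → M, f (pure n α) = g (pure n α)) : f = g := by
  refine PiTensorProduct.ext (MultilinearMap.ext fun a => ?_)
  have : PiTensorProduct.tprod k a =
      pure (k := k) n (fun m => if hm : m < n then a ⟨m, hm⟩ else 0) :=
    congrArg _ (funext fun j => by simp)
  simp only [LinearMap.compMultilinearMap_apply, this, h]

theorem contract_pure (μ : M →ₗ[k] M →ₗ[k] M) (n i : ℕ) (hi : i ≤ n) (α : ℕ → M) :
    contract μ n i hi (pure (n + 2) α) = pure (n + 1) fun m =>
      if m < i then α m else if m = i then μ (α m) (α (m + 1)) else α (m + 1) := by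
  simp only [contract, pure, PiTensorProduct.lift.tprod]; rfl

theorem insert_pure (e : M) (n i : ℕ) (hi : i ≤ n) (α : ℕ → M) :
    insert k e n i (pure (n + 1) α) = pure (n + 2) fun m =>
      if m ≤ i then α m else if m = i + 1 then e else α (m - 1) := by
  simp only [insert, pure, PiTensorProduct.lift.tprod, MultilinearMap.curryMid_apply_apply]
  congr 1
  have hi' : (Fin.ofNat (n + 2) (i + 1)).val = i + 1 := by
    simp [Nat.mod_eq_of_lt (show i + 1 < n + 2 by omega)]
  funext j
  refine Fin.succAboveCases (Fin.ofNat (n + 2) (i + 1)) ?_ (fun l => ?_) j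
  · rw [Fin.insertNth_apply_same, hi']; simp
  · rw [Fin.insertNth_apply_succAbove]
    simp only [Fin.succAbove, Fin.lt_def, Fin.val_castSucc, hi']
    split_ifs with h1 h2 h3 h4 h5 <;> simp at * <;> first | rfl | omega

theorem rotate_pure (n : ℕ) (α : ℕ → M) :
    rotate k M n (pure (n + 1) α) = pure (n + 1) fun m => if m = 0 then α n else α (m - 1) := by
  simp only [rotate, pure, LinearEquiv.coe_toLinearMap]
  refine (PiTensorProduct.reindex_tprod (R := k) (s := fun _ => M) (finRotate (n + 1)) _).trans ?_
  congr 1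
  funext j
  obtain ⟨l, rfl⟩ := (finRotate (n + 1)).surjective j
  rw [Equiv.symm_apply_apply]
  rcases eq_or_ne l (Fin.last n) with rfl | hl
  · simp
  · have : (finRotate (n + 1) l).val = l + 1 := coe_finRotate_of_ne_last hl
    rw [this]; simp

end Tensor

section Algebra

variable (k : Type u) [CommRing k] (R : Type v) [Ring R] [Algebra k R]

/-- The operators of the cyclic module of a `k`-algebra `R`, with `X n = R^{⊗ (n+1)}`. -/
noncomputable def algOps : ParacyclicOps k fun n => TPow k R (n + 1) where
  d n i := if hi : i ≤ n then contract (LinearMap.mul k R) n i hi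
    else contract (LinearMap.mul k R) n 0 (Nat.zero_le n) ∘ₗ rotate k R (n + 1)
  s n i := insert k 1 n i
  t n := rotate k R n

theorem alg_d_pure (n i : ℕ) (hi : i ≤ n + 1) (α : ℕ → R) :
    (algOps k R).d n i (pure (n + 2) α) = pure (n + 1) fun m =>
      if i = n + 1 then (if m = 0 then α (n + 1) * α 0 else α m)
      else if m < i then α m else if m = i then α m * α (m + 1) else α (m + 1) := by
  rcases eq_or_lt_of_le hi with rfl | hi
  · simp only [algOps, show ¬ (n + 1 ≤ n) by omega, dite_false, LinearMap.comp_apply, rotate_pure,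
      contract_pure]
    refine pure_congr fun m _ => ?_
    by_cases hm : m = 0 <;> simp [hm]
  · simp only [algOps, Nat.lt_succ_iff.mp hi, dite_true, contract_pure]
    refine pure_congr fun m _ => ?_
    simp [hi.ne]

theorem alg_s_pure (n i : ℕ) (hi : i ≤ n) (α : ℕ → R) :
    (algOps k R).s n i (pure (n + 1) α) = pure (n + 2) fun m =>
      if m ≤ i then α m else if m = i + 1 then 1 else α (m - 1) :=
  insert_pure 1 n i hi α

theorem alg_t_pure (n : ℕ) (α : ℕ → R) :
    (algOps k R).t n (pure (n + 1) α) = pure (n + 1) fun m => if m = 0 then α n else α (m - 1) :=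
  rotate_pure n α

theorem alg_t_pow_pure (n : ℕ) (α : ℕ → R) (j : ℕ) (hj : j ≤ n + 1) :
    ((algOps k R).t n ^ j) (pure (n + 1) α) =
      pure (n + 1) fun m => if m < j then α (m + (n + 1) - j) else α (m - j) := by
  induction j with
  | zero => exact pure_congr fun m _ => by simp
  | succ j ih =>
    rw [pow_succ', Module.End.mul_apply, ih (by omega), alg_t_pure]
    refine pure_congr fun m hm => ?_
    split_ifs <;> first | omega | (congr 1; omega)

/-- The cyclic module of an algebra is a cyclic module. -/
theorem algOps_isCyclic : (algOps k R).IsCyclic := by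
  have key : ∀ {Y : Type (max u v)} [AddCommGroup Y] [Module k Y] {n : ℕ}
      (f g : TPow k R n →ₗ[k] Y),
      (∀ α : ℕ → R, f (pure n α) = g (pure n α)) → ∀ x, f x = g x :=
    fun f g h x => LinearMap.congr_fun (tpow_ext h) x
  have tp : ∀ n x, ((algOps k R).t n ^ (n + 1)) x = x := fun n =>
    key ((algOps k R).t n ^ (n + 1)) LinearMap.id fun α => by
      rw [alg_t_pow_pure k R n α (n + 1) le_rfl]
      exact pure_congr fun m hm => by simp [hm]
  exact {
    d_d := fun n i j hij hj => key ((algOps k R).d n i ∘ₗ (algOps k R).d (n + 1) (j + 1))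
        ((algOps k R).d n j ∘ₗ (algOps k R).d (n + 1) i) fun α => by
      simp only [LinearMap.comp_apply]
      rw [alg_d_pure k R (n + 1) _ (by omega), alg_d_pure k R (n + 1) _ (by omega),
        alg_d_pure k R n _ (by omega), alg_d_pure k R n _ (by omega)]
      refine pure_congr fun m hm => ?_
      grind
    s_s := fun n i j hij hj => key ((algOps k R).s (n + 1) i ∘ₗ (algOps k R).s n j)
        ((algOps k R).s (n + 1) (j + 1) ∘ₗ (algOps k R).s n i) fun α => by
      simp only [LinearMap.comp_apply]
      rw [alg_s_pure k R n _ (by omega), alg_s_pure k R n _ (by omega),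
        alg_s_pure k R (n + 1) _ (by omega), alg_s_pure k R (n + 1) _ (by omega)]
      refine pure_congr fun m hm => ?_
      grind
    d_s_lt := fun n i j hij hj => key ((algOps k R).d (n + 1) i ∘ₗ (algOps k R).s (n + 1) (j + 1))
        ((algOps k R).s n j ∘ₗ (algOps k R).d n i) fun α => by
      simp only [LinearMap.comp_apply]
      rw [alg_s_pure k R (n + 1) _ (by omega), alg_d_pure k R n _ (by omega),
        alg_d_pure k R (n + 1) _ (by omega), alg_s_pure k R n _ (by omega)]
      refine pure_congr fun m hm => ?_
      grind
    d_s_self := fun n i hi => key ((algOps k R).d n i ∘ₗ (algOps k R).s n i) LinearMap.id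
        fun α => by
      simp only [LinearMap.comp_apply, LinearMap.id_apply]
      rw [alg_s_pure k R n _ (by omega), alg_d_pure k R n _ (by omega)]
      refine pure_congr fun m hm => ?_
      grind
    d_s_succ := fun n i hi => key ((algOps k R).d n (i + 1) ∘ₗ (algOps k R).s n i) LinearMap.id
        fun α => by
      simp only [LinearMap.comp_apply, LinearMap.id_apply]
      rw [alg_s_pure k R n _ (by omega), alg_d_pure k R n _ (by omega)]
      refine pure_congr fun m hm => ?_
      grind
    d_s_gt := fun n i j hij hi => key ((algOps k R).d (n + 1) (i + 1) ∘ₗ (algOps k R).s (n + 1) j)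
        ((algOps k R).s n j ∘ₗ (algOps k R).d n i) fun α => by
      simp only [LinearMap.comp_apply]
      rw [alg_s_pure k R (n + 1) _ (by omega), alg_d_pure k R n _ (by omega),
        alg_d_pure k R (n + 1) _ (by omega), alg_s_pure k R n _ (by omega)]
      refine pure_congr fun m hm => ?_
      grind
    d_t_zero := fun n => key ((algOps k R).d n 0 ∘ₗ (algOps k R).t (n + 1))
        ((algOps k R).d n (n + 1)) fun α => by
      simp only [LinearMap.comp_apply]
      rw [alg_t_pure, alg_d_pure k R n _ (by omega), alg_d_pure k R n _ (by omega)]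
      refine pure_congr fun m hm => ?_
      grind
    d_t_succ := fun n i hi => key ((algOps k R).d n (i + 1) ∘ₗ (algOps k R).t (n + 1))
        ((algOps k R).t n ∘ₗ (algOps k R).d n i) fun α => by
      simp only [LinearMap.comp_apply]
      rw [alg_t_pure, alg_d_pure k R n _ (by omega), alg_d_pure k R n _ (by omega), alg_t_pure]
      refine pure_congr fun m hm => ?_
      grind
    s_t_zero := fun n => key ((algOps k R).s n 0 ∘ₗ (algOps k R).t n)
        ((algOps k R).t (n + 1) ∘ₗ (algOps k R).t (n + 1) ∘ₗ (algOps k R).s n n) fun α => by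
      simp only [LinearMap.comp_apply]
      rw [alg_t_pure, alg_s_pure k R n _ (by omega), alg_s_pure k R n _ (by omega), alg_t_pure,
        alg_t_pure]
      refine pure_congr fun m hm => ?_
      grind
    s_t_succ := fun n i hi => key ((algOps k R).s n (i + 1) ∘ₗ (algOps k R).t n)
        ((algOps k R).t (n + 1) ∘ₗ (algOps k R).s n i) fun α => by
      simp only [LinearMap.comp_apply]
      rw [alg_t_pure, alg_s_pure k R n _ (by omega), alg_s_pure k R n _ (by omega), alg_t_pure]
      refine pure_congr fun m hm => ?_
      grind
    t_bijective := fun n => (PiTensorProduct.reindex k (fun _ => R) (finRotate (n + 1))).bijective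
    t_pow := tp }

end Algebra


/-! ### Module algebras, crossed products and co-opposites -/

section Action

variable (k : Type u) (H : Type v) (A : Type w) [CommRing k] [Ring H]
  [Ring A] [Algebra k A] [Module H A]

/-- The action of `H` on `A`, as an algebra map. -/
noncomputable def act [Algebra k H] [IsScalarTower k H A] : H →ₐ[k] Module.End k A :=
  Algebra.lsmul k k A

@[simp] theorem act_apply [Algebra k H] [IsScalarTower k H A] (h : H) (a : A) :
    act k H A h a = h • a := rfl

/-- `A` is a left `H`-module algebra: `h (a b) = (h⁰ a) (h¹ b)` and `h 1 = ε(h) 1`. -/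
class ModuleAlgebra [Bialgebra k H] [IsScalarTower k H A] : Prop where
  smul_mul : ∀ (h : H) (a b : A), h • (a * b) =
    LinearMap.mul' k A (TensorProduct.map ((act k H A).toLinearMap.flip a)
      ((act k H A).toLinearMap.flip b) (Coalgebra.comul (R := k) h))
  smul_one : ∀ h : H, h • (1 : A) = algebraMap k A (Coalgebra.counit (R := k) h)

variable [Bialgebra k H] [IsScalarTower k H A]

variable {k H A} in
theorem ModuleAlgebra.smul_mul_repr [ModuleAlgebra k H A] {h : H} (a b : A) {ι : Type*}
    (r : Coalgebra.Repr k h ι) : h • (a * b) =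
      ∑ i ∈ r.index, (r.left i • a) * (r.right i • b) := by
  rw [ModuleAlgebra.smul_mul (k := k), ← r.eq]
  simp

/-- The crossed product `A ⋊ H`: the module `A ⊗ H` with the product
`(a ⊗ g) (b ⊗ h) = a (g⁰ b) ⊗ g¹ h`. -/
def Crossed := A ⊗[k] H

namespace Crossed

noncomputable instance : AddCommGroup (Crossed k H A) := inferInstanceAs (AddCommGroup (A ⊗[k] H))
noncomputable instance : Module k (Crossed k H A) := inferInstanceAs (Module k (A ⊗[k] H))

/-- The diagonal action `g (b ⊗ h) = g⁰ b ⊗ g¹ h` of `H` on `A ⊗ H`. -/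
noncomputable def diagonal : H →ₐ[k] Module.End k (A ⊗[k] H) :=
  (Module.endTensorEndAlgHom (R := k) (S := k) (A := k) (M := A) (N := H)).comp
    ((Algebra.TensorProduct.map (act k H A) (Algebra.lmul k H)).comp (Bialgebra.comulAlgHom k H))

/-- Multiplication by elements of `A` on the left of `A ⊗ H`. -/
noncomputable def leftMul : A →ₐ[k] Module.End k (A ⊗[k] H) :=
  (Module.endTensorEndAlgHom (R := k) (S := k) (A := k) (M := A) (N := H)).comp
    ((Algebra.TensorProduct.includeLeft).comp (Algebra.lmul k A))

/-- Left multiplication in the crossed product: `a ⊗ g` acts on `b ⊗ h` by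
`a (g⁰ b) ⊗ g¹ h`. -/
noncomputable def mulHom : A ⊗[k] H →ₗ[k] Module.End k (A ⊗[k] H) :=
  TensorProduct.lift ((LinearMap.mul k (Module.End k (A ⊗[k] H))).compl₁₂
    (leftMul k H A).toLinearMap (diagonal k H A).toLinearMap)

variable {k H A}

theorem leftMul_tmul (a b : A) (h : H) : leftMul k H A a (b ⊗ₜ h) = (a * b) ⊗ₜ h := by
  simp [leftMul, Module.endTensorEndAlgHom_apply]

theorem diagonal_tmul (g : H) (b : A) (h : H) {ι : Type*} (r : Coalgebra.Repr k g ι) :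
    diagonal k H A g (b ⊗ₜ h) = ∑ i ∈ r.index, (r.left i • b) ⊗ₜ (r.right i * h) := by
  simp only [diagonal, AlgHom.comp_apply, Bialgebra.comulAlgHom_apply]
  rw [← r.eq]
  simp [Module.endTensorEndAlgHom_apply]

theorem mulHom_tmul (a : A) (g : H) :
    mulHom k H A (a ⊗ₜ g) = leftMul k H A a * diagonal k H A g := rfl

theorem mulHom_tmul_tmul (a b : A) (g h : H) {ι : Type*} (r : Coalgebra.Repr k g ι) :
    mulHom k H A (a ⊗ₜ g) (b ⊗ₜ h) =
      ∑ i ∈ r.index, (a * (r.left i • b)) ⊗ₜ (r.right i * h) := by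
  rw [mulHom_tmul, Module.End.mul_apply, diagonal_tmul g b h r, map_sum]
  simp [leftMul_tmul]

variable [ModuleAlgebra k H A]

theorem diagonal_leftMul (g : H) (b : A) :
    diagonal k H A g * leftMul k H A b = mulHom k H A (diagonal k H A g (b ⊗ₜ 1)) := by
  refine TensorProduct.ext' fun c l => ?_
  let r := Coalgebra.Repr.arbitrary k g
  let r₁ := fun i => Coalgebra.Repr.arbitrary k (r.left i)
  let r₂ := fun i => Coalgebra.Repr.arbitrary k (r.right i)
  let F : H ⊗[k] (H ⊗[k] H) →ₗ[k] A ⊗[k] H :=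
    TensorProduct.map (LinearMap.mul' k A) LinearMap.id ∘ₗ
      (TensorProduct.assoc k A A H).symm.toLinearMap ∘ₗ
      TensorProduct.map ((act k H A).toLinearMap.flip b)
        (TensorProduct.map ((act k H A).toLinearMap.flip c) (LinearMap.mulRight k l))
  have hF : ∀ x y z, F (x ⊗ₜ (y ⊗ₜ z)) = ((x • b) * (y • c)) ⊗ₜ (z * l) := fun x y z => by
    simp [F]
  have := congrArg F (Coalgebra.sum_tmul_tmul_eq r r₁ r₂)
  simp only [map_sum, hF] at this
  rw [Module.End.mul_apply, leftMul_tmul, diagonal_tmul g _ l r, diagonal_tmul g b 1 r, map_sum,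
    LinearMap.sum_apply]
  simp only [mul_one]
  rw [Finset.sum_congr rfl fun i _ => mulHom_tmul_tmul (r.left i • b) c (r.right i) l (r₂ i), ← this]
  refine Finset.sum_congr rfl fun i _ => ?_
  rw [ModuleAlgebra.smul_mul_repr b c (r₁ i), TensorProduct.sum_tmul]

theorem mulHom_mulHom (x y : A ⊗[k] H) :
    mulHom k H A (mulHom k H A x y) = mulHom k H A x * mulHom k H A y := by
  have h1 : ∀ (a : A) (z : A ⊗[k] H),
      mulHom k H A (leftMul k H A a z) = leftMul k H A a * mulHom k H A z := by
    intro a z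
    induction z with
    | zero => simp
    | add z w hz hw => simp only [map_add, hz, hw, mul_add]
    | tmul b h => rw [leftMul_tmul, mulHom_tmul, mulHom_tmul, map_mul, mul_assoc]
  have h2 : ∀ (g h : H) (b : A), mulHom k H A (diagonal k H A g (b ⊗ₜ h)) =
      mulHom k H A (diagonal k H A g (b ⊗ₜ 1)) * diagonal k H A h := by
    intro g h b
    rw [diagonal_tmul g b h (Coalgebra.Repr.arbitrary k g),
      diagonal_tmul g b 1 (Coalgebra.Repr.arbitrary k g)]
    simp only [map_sum, mulHom_tmul, map_mul, mul_one, Finset.sum_mul, mul_assoc]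
  induction x with
  | zero => simp
  | add x x' hx hx' => simp only [map_add, LinearMap.add_apply, hx, hx', add_mul]
  | tmul a g =>
    induction y with
    | zero => simp
    | add y y' hy hy' => simp only [map_add, hy, hy', mul_add]
    | tmul b h =>
      rw [mulHom_tmul, mulHom_tmul, Module.End.mul_apply, h1, h2, ← diagonal_leftMul]
      simp only [mul_assoc]

theorem mulHom_one (x : A ⊗[k] H) : mulHom k H A x (1 ⊗ₜ 1) = x := by
  induction x with
  | zero => simp
  | add x y hx hy => simp only [map_add, LinearMap.add_apply, hx, hy]
  | tmul a g =>
    let r := Coalgebra.Repr.arbitrary k g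
    rw [mulHom_tmul_tmul a 1 g 1 r]
    have : ∀ i, (a * (r.left i • (1 : A))) ⊗ₜ[k] (r.right i * 1) =
        a ⊗ₜ[k] (Coalgebra.counit (R := k) (r.left i) • r.right i) := fun i => by
      rw [ModuleAlgebra.smul_one (k := k), mul_one, ← Algebra.commutes, ← Algebra.smul_def,
        TensorProduct.smul_tmul]
    rw [Finset.sum_congr rfl fun i _ => this i, ← TensorProduct.tmul_sum,
      Coalgebra.sum_counit_smul r]

theorem mulHom_one_left : mulHom k H A (1 ⊗ₜ 1) = 1 := by
  rw [mulHom_tmul, map_one, map_one, mul_one]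

noncomputable instance : Ring (Crossed k H A) where
  __ := (inferInstance : AddCommGroup (Crossed k H A))
  mul x y := mulHom k H A x y
  one := (1 : A) ⊗ₜ[k] (1 : H)
  mul_assoc x y z := LinearMap.congr_fun (mulHom_mulHom x y) z
  one_mul x := LinearMap.congr_fun mulHom_one_left x
  mul_one x := mulHom_one x
  left_distrib x y z := map_add (mulHom k H A x) y z
  right_distrib x y z := by
    exact LinearMap.congr_fun (map_add (mulHom k H A) x y) z
  zero_mul x := by
    exact LinearMap.congr_fun (map_zero (mulHom k H A)) x
  mul_zero x := map_zero (mulHom k H A x)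

noncomputable instance : Algebra k (Crossed k H A) :=
  Algebra.ofModule
    (fun c x y => LinearMap.congr_fun (map_smul (mulHom k H A) c x) y)
    (fun c x y => map_smul (mulHom k H A x) c y)

end Crossed

end Action

/-! The co-opposite of a bialgebra. -/

/-- `H^cop`: the same algebra with the opposite comultiplication. -/
def Cop (H : Type v) : Type v := H

namespace Cop

variable (k : Type u) (H : Type v) [CommRing k] [Ring H]

instance : Ring (Cop H) := inferInstanceAs (Ring H)

instance [Algebra k H] : Algebra k (Cop H) := inferInstanceAs (Algebra k H)

instance {M : Type w} [AddCommMonoid M] [Module H M] : Module (Cop H) M :=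
  inferInstanceAs (Module H M)

instance {M : Type w} [AddCommMonoid M] [Module k M] [Algebra k H] [Module H M]
    [IsScalarTower k H M] : IsScalarTower k (Cop H) M :=
  inferInstanceAs (IsScalarTower k H M)

section

variable {H} in
/-- The identity map `H → H^cop`. -/
def of [Algebra k H] : H ≃ₐ[k] Cop H := AlgEquiv.refl

variable {k H} in
theorem of_smul [Algebra k H] {M : Type w} [AddCommMonoid M] [Module H M] (h : H) (m : M) :
    of k h • m = h • m := rfl

variable [Bialgebra k H]

noncomputable instance : CoalgebraStruct k (Cop H) where
  comul := TensorProduct.map (of k (H := H)).toLinearMap (of k (H := H)).toLinearMap ∘ₗ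
    (TensorProduct.comm k H H).toLinearMap ∘ₗ Coalgebra.comul (R := k) (A := H) ∘ₗ
    (of k (H := H)).symm.toLinearMap
  counit := Coalgebra.counit (R := k) (A := H) ∘ₗ (of k (H := H)).symm.toLinearMap

variable {k H}

theorem comul_of (h : H) : Coalgebra.comul (R := k) (of k h) =
    Algebra.TensorProduct.map (of k (H := H)).toAlgHom (of k (H := H)).toAlgHom
      (Algebra.TensorProduct.comm k H H (Coalgebra.comul (R := k) h)) := rfl

theorem counit_of (h : H) : Coalgebra.counit (R := k) (of k h) = Coalgebra.counit (R := k) h := rfl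

theorem comul_repr {h : H} {ι : Type*} (r : Coalgebra.Repr k h ι) :
    Coalgebra.comul (R := k) (of k h) = ∑ i ∈ r.index, of k (r.right i) ⊗ₜ[k] of k (r.left i) := by
  rw [comul_of, ← r.eq]
  simp

noncomputable instance : Coalgebra k (Cop H) where
  coassoc := by
    refine LinearMap.ext fun x => ?_
    obtain ⟨h, rfl⟩ := (of k (H := H)).surjective x
    let r := Coalgebra.Repr.arbitrary k h
    let r₁ := fun i => Coalgebra.Repr.arbitrary k (r.left i)
    let r₂ := fun i => Coalgebra.Repr.arbitrary k (r.right i)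
    let e : H →ₗ[k] Cop H := (of k (H := H)).toLinearMap
    let F : H ⊗[k] (H ⊗[k] H) →ₗ[k] Cop H ⊗[k] (Cop H ⊗[k] Cop H) :=
      TensorProduct.map e (TensorProduct.map e e) ∘ₗ
      (TensorProduct.assoc k H H H).toLinearMap ∘ₗ (TensorProduct.comm k H (H ⊗[k] H)).toLinearMap ∘ₗ
        LinearMap.lTensor H (TensorProduct.comm k H H).toLinearMap
    have hF : ∀ x y z : H, F (x ⊗ₜ (y ⊗ₜ z)) = of k z ⊗ₜ (of k y ⊗ₜ of k x) :=
      fun x y z => by simp [F, e]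
    have := congrArg F (Coalgebra.sum_tmul_tmul_eq r r₁ r₂)
    simp only [map_sum, hF] at this
    simp only [LinearMap.comp_apply]
    rw [comul_repr r]
    simp only [map_sum, LinearMap.rTensor_tmul, LinearMap.lTensor_tmul]
    simp only [fun i => comul_repr (r₁ i), fun i => comul_repr (r₂ i)]
    simp only [TensorProduct.sum_tmul, TensorProduct.tmul_sum, map_sum, LinearEquiv.coe_coe,
      TensorProduct.assoc_tmul]
    exact this.symm
  rTensor_counit_comp_comul := by
    refine LinearMap.ext fun x => ?_
    obtain ⟨h, rfl⟩ := (of k (H := H)).surjective x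
    let r := Coalgebra.Repr.arbitrary k h
    have := congrArg (TensorProduct.map LinearMap.id (of k (H := H)).toLinearMap ∘
      TensorProduct.comm k H k) (Coalgebra.sum_tmul_counit_eq r)
    simp only [map_sum, Function.comp_apply, TensorProduct.comm_tmul, TensorProduct.map_tmul] at this
    rw [LinearMap.comp_apply, comul_repr r, map_sum]
    exact this
  lTensor_counit_comp_comul := by
    refine LinearMap.ext fun x => ?_
    obtain ⟨h, rfl⟩ := (of k (H := H)).surjective x
    let r := Coalgebra.Repr.arbitrary k h
    have := congrArg (TensorProduct.map (of k (H := H)).toLinearMap LinearMap.id ∘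
      TensorProduct.comm k k H) (Coalgebra.sum_counit_tmul_eq r)
    simp only [map_sum, Function.comp_apply, TensorProduct.comm_tmul, TensorProduct.map_tmul] at this
    rw [LinearMap.comp_apply, comul_repr r, map_sum]
    exact this

noncomputable instance : Bialgebra k (Cop H) :=
  Bialgebra.mk' k (Cop H) (Bialgebra.counit_one (R := k) (A := H))
    (fun {a b} => Bialgebra.counit_mul (R := k) (A := H) a b)
    (by
      rw [← map_one (of k (H := H)), comul_of, Bialgebra.comul_one, map_one, map_one])
    (fun {a b} => by
      obtain ⟨a, rfl⟩ := (of k (H := H)).surjective a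
      obtain ⟨b, rfl⟩ := (of k (H := H)).surjective b
      rw [← map_mul, comul_of, comul_of, comul_of, Bialgebra.comul_mul, map_mul, map_mul])

/-- If `A` is an `H`-module algebra then `A^op` is an `H^cop`-module algebra. -/
instance (A : Type w) [Ring A] [Algebra k A] [Module H A] [IsScalarTower k H A]
    [ModuleAlgebra k H A] : ModuleAlgebra k (Cop H) Aᵐᵒᵖ where
  smul_mul x a b := by
    obtain ⟨h, rfl⟩ := (of k (H := H)).surjective x
    let r := Coalgebra.Repr.arbitrary k h
    rw [comul_repr r]
    simp only [map_sum, TensorProduct.map_tmul, LinearMap.mul'_apply, LinearMap.flip_apply,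
      AlgHom.toLinearMap_apply, act_apply, of_smul]
    refine MulOpposite.unop_injective ?_
    have := ModuleAlgebra.smul_mul_repr (MulOpposite.unop b) (MulOpposite.unop a) r
    simpa using this
  smul_one x := MulOpposite.unop_injective
    (ModuleAlgebra.smul_one (k := k) (A := A) ((of k (H := H)).symm x))

end

variable {k H} in
/-- If the antipode `S` of `H` is bijective then `H^cop` is a Hopf algebra with antipode `S⁻¹`. -/
@[reducible]
noncomputable def hopfAlgebra [HopfAlgebra k H]
    (hS : Function.Bijective (HopfAlgebra.antipode k : H → H)) : HopfAlgebra k (Cop H) where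
  antipode := (of k (H := H)).toLinearMap ∘ₗ
    (LinearEquiv.ofBijective (HopfAlgebra.antipode k (A := H)) hS).symm.toLinearMap ∘ₗ
    (of k (H := H)).symm.toLinearMap
  mul_antipode_rTensor_comul := by
    refine LinearMap.ext fun x => ?_
    obtain ⟨h, rfl⟩ := (of k (H := H)).surjective x
    let r := Coalgebra.Repr.arbitrary k h
    have hT : ∀ x, HopfAlgebra.antipode k
        ((LinearEquiv.ofBijective (HopfAlgebra.antipode k (A := H)) hS).symm x) = x :=
      fun x => (LinearEquiv.ofBijective (HopfAlgebra.antipode k (A := H)) hS).apply_symm_apply x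
    simp only [LinearMap.comp_apply]
    rw [comul_repr r]
    simp only [map_sum, LinearMap.rTensor_tmul, LinearMap.mul'_apply, LinearMap.comp_apply,
      AlgEquiv.toLinearMap_apply, LinearEquiv.coe_coe, AlgEquiv.symm_apply_apply, ← map_mul,
      counit_of, Algebra.linearMap_apply]
    rw [← map_sum, ← AlgEquiv.commutes (of k (H := H))]
    refine congrArg _ (hS.1 ?_)
    simp only [map_sum, HopfAlgebra.antipode_mul_antidistrib, hT]
    rw [HopfAlgebra.sum_antipode_mul_eq_algebraMap_counit r, Algebra.algebraMap_eq_smul_one,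
      map_smul, HopfAlgebra.antipode_one]
  mul_antipode_lTensor_comul := by
    refine LinearMap.ext fun x => ?_
    obtain ⟨h, rfl⟩ := (of k (H := H)).surjective x
    let r := Coalgebra.Repr.arbitrary k h
    have hT : ∀ x, HopfAlgebra.antipode k
        ((LinearEquiv.ofBijective (HopfAlgebra.antipode k (A := H)) hS).symm x) = x :=
      fun x => (LinearEquiv.ofBijective (HopfAlgebra.antipode k (A := H)) hS).apply_symm_apply x
    simp only [LinearMap.comp_apply]
    rw [comul_repr r]
    simp only [map_sum, LinearMap.lTensor_tmul, LinearMap.mul'_apply, LinearMap.comp_apply,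
      AlgEquiv.toLinearMap_apply, LinearEquiv.coe_coe, AlgEquiv.symm_apply_apply, ← map_mul,
      counit_of, Algebra.linearMap_apply]
    rw [← map_sum, ← AlgEquiv.commutes (of k (H := H))]
    refine congrArg _ (hS.1 ?_)
    simp only [map_sum, HopfAlgebra.antipode_mul_antidistrib, hT]
    rw [HopfAlgebra.sum_mul_antipode_eq_algebraMap_counit r, Algebra.algebraMap_eq_smul_one,
      map_smul, HopfAlgebra.antipode_one]

end Cop


/-! ### The cylindrical module `A ♮ H` -/

section Legs

variable {k : Type u} [CommRing k] {H : Type v} [Ring H] [Algebra k H]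

/-- The tensor with entry `h` in slot `i` and entries `1` elsewhere. -/
noncomputable def single {R : Type v} [Ring R] [Algebra k R] {n : ℕ} (i : Fin n) :
    R →ₐ[k] TPow k R n :=
  PiTensorProduct.singleAlgHom (A := fun _ => R) i

/-- For `c i (g i) = x i ⊗ y i` this is `(g_0, …, g_{n-1}) ↦ (x_0, …, x_{n-1}) ⊗ y_0 ⋯ y_{n-1}`. -/
noncomputable def legs {n : ℕ} (c : Fin n → H →ₗ[k] H ⊗[k] H) :
    TPow k H n →ₗ[k] TPow k H n ⊗[k] H :=
  PiTensorProduct.lift ((MultilinearMap.mkPiAlgebraFin k n (TPow k H n ⊗[k] H)).compLinearMap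
    fun i => TensorProduct.map (single i).toLinearMap LinearMap.id ∘ₗ c i)

theorem list_prod_tmul {R S : Type*} [Ring R] [Ring S] [Algebra k R] [Algebra k S] :
    ∀ (n : ℕ) (x : Fin n → R) (y : Fin n → S),
      (List.ofFn fun i => x i ⊗ₜ[k] y i).prod = (List.ofFn x).prod ⊗ₜ[k] (List.ofFn y).prod
  | 0, x, y => by simp [Algebra.TensorProduct.one_def]
  | n + 1, x, y => by
    rw [List.ofFn_succ, List.ofFn_succ, List.ofFn_succ, List.prod_cons, List.prod_cons,
      List.prod_cons, list_prod_tmul n, Algebra.TensorProduct.tmul_mul_tmul]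

theorem list_prod_mulSingle : ∀ (n : ℕ) (x : Fin n → H) (j : Fin n),
    (List.ofFn fun i => (Pi.mulSingle i (x i) : Fin n → H) j).prod = x j
  | n + 1, x, j => by
    rw [List.ofFn_succ, List.prod_cons]
    refine Fin.cases ?_ (fun l => ?_) j
    · rw [Pi.mulSingle_eq_same, List.prod_eq_one, mul_one]
      intro y hy
      obtain ⟨i, rfl⟩ := (List.mem_ofFn' _ _).mp hy
      exact Pi.mulSingle_eq_of_ne (Fin.succ_ne_zero i).symm _
    · rw [Pi.mulSingle_eq_of_ne (Fin.succ_ne_zero l), one_mul]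
      refine Eq.trans ?_ (list_prod_mulSingle n (fun i => x i.succ) l)
      congr 2
      funext i
      simp [Pi.mulSingle_apply, Fin.succ_inj]

theorem list_prod_single (n : ℕ) (x : Fin n → H) :
    (List.ofFn fun i => single (k := k) i (x i)).prod = PiTensorProduct.tprod k x := by
  have h1 : (fun i => single (k := k) i (x i)) =
      (PiTensorProduct.tprodMonoidHom k (A := fun _ : Fin n => H)) ∘
        fun i => Pi.mulSingle i (x i) := rfl
  have h2 : (List.ofFn fun i => (Pi.mulSingle i (x i) : Fin n → H)).prod = x := by
    funext j
    refine (map_list_prod (Pi.evalMonoidHom (fun _ : Fin n => H) j) _).trans ?_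
    rw [List.map_ofFn]
    exact list_prod_mulSingle n x j
  rw [h1, ← List.map_ofFn, ← map_list_prod, h2]
  rfl

theorem legs_tprod {n : ℕ} (c : Fin n → H →ₗ[k] H ⊗[k] H) (g x y : Fin n → H)
    (h : ∀ i, c i (g i) = x i ⊗ₜ y i) :
    legs c (PiTensorProduct.tprod k g) = PiTensorProduct.tprod k x ⊗ₜ (List.ofFn y).prod := by
  rw [legs, PiTensorProduct.lift.tprod, MultilinearMap.compLinearMap_apply,
    MultilinearMap.mkPiAlgebraFin_apply, ← list_prod_single, ← list_prod_tmul]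
  simp [h]

end Legs

namespace Natural

variable (k : Type u) (H : Type v) (A : Type w) [CommRing k] [Ring H] [Ring A] [Algebra k A]
  [Module H A]

section Bialgebra

variable [Bialgebra k H]

/-- `(g_0, …, g_p) ↦ (g_0⁰, …, g_p⁰) ⊗ g_0¹ ⋯ g_p¹`. -/
noncomputable def coact (p : ℕ) : TPow k H (p + 1) →ₗ[k] TPow k H (p + 1) ⊗[k] H :=
  legs fun _ => Coalgebra.comul

/-- `(g_0, …, g_p) ↦ (g_0⁰, g_1, …, g_p) ⊗ g_0¹`. -/
noncomputable def splitZero (p : ℕ) : TPow k H (p + 1) →ₗ[k] TPow k H (p + 1) ⊗[k] H :=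
  legs fun i => if i = 0 then Coalgebra.comul else (TensorProduct.mk k H H).flip 1

variable {k} in
/-- `m ⊗ (a_0, …, a_{n-1}) ↦ (m, a_0, …, a_{n-1})`. -/
noncomputable def tcons {M : Type v} [AddCommGroup M] [Module k M] (n : ℕ) :
    M ⊗[k] TPow k M n →ₗ[k] TPow k M (n + 1) :=
  TensorProduct.lift (PiTensorProduct.lift.toLinearMap ∘ₗ
    (PiTensorProduct.tprod k : MultilinearMap k (fun _ : Fin (n + 1) => M) _).curryLeft)

/-- The iterated coproduct with reversed legs, `h ↦ (hⁿ, …, h¹, h⁰)`. -/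
noncomputable def revComul : ∀ n : ℕ, H →ₗ[k] TPow k H (n + 1)
  | 0 => (single 0).toLinearMap
  | n + 1 => tcons (n + 1) ∘ₗ LinearMap.lTensor H (revComul n) ∘ₗ
      (TensorProduct.comm k H H).toLinearMap ∘ₗ Coalgebra.comul

variable [IsScalarTower k H A]

/-- `h ⊗ (a_0, …, a_q) ↦ (h a_0, a_1, …, a_q)`. -/
noncomputable def actZero (q : ℕ) : H →ₗ[k] TPow k A (q + 1) →ₗ[k] TPow k A (q + 1) :=
  PiTensorProduct.map₂ (fun _ => (act k H A).toLinearMap) ∘ₗ (single 0).toLinearMap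

/-- `h ⊗ (a_0, …, a_q) ↦ (h^q a_0, …, h¹ a_{q-1}, h⁰ a_q)`. -/
noncomputable def actAll (q : ℕ) : H →ₗ[k] TPow k A (q + 1) →ₗ[k] TPow k A (q + 1) :=
  PiTensorProduct.map₂ (fun _ => (act k H A).toLinearMap) ∘ₗ revComul k H q

/-- `τ̄ (g_0, …, g_p | a_q, …, a_0) = (g_p⁰, g_0, …, g_{p-1} | g_p¹ a_q, …, g_p^{q+1} a_0)`. -/
noncomputable def tauBar (p q : ℕ) : TPow k H (p + 1) ⊗[k] TPow k A (q + 1) →ₗ[k]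
    TPow k H (p + 1) ⊗[k] TPow k A (q + 1) :=
  LinearMap.lTensor _ (TensorProduct.lift (actAll k H A q)) ∘ₗ
    (TensorProduct.assoc k _ _ _).toLinearMap ∘ₗ
    TensorProduct.map (splitZero k H p ∘ₗ rotate k H p) LinearMap.id

end Bialgebra

variable [HopfAlgebra k H] [IsScalarTower k H A]

/-- `τ (g_0, …, g_p | a_q, …, a_0) = (g_0⁰, …, g_p⁰ | a_{q-1}, …, a_0, S(g_0¹ ⋯ g_p¹) a_q)`. -/
noncomputable def tau (p q : ℕ) : TPow k H (p + 1) ⊗[k] TPow k A (q + 1) →ₗ[k]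
    TPow k H (p + 1) ⊗[k] TPow k A (q + 1) :=
  LinearMap.lTensor _ (TensorProduct.lift (actZero k H A q ∘ₗ HopfAlgebra.antipode k)) ∘ₗ
    (TensorProduct.assoc k _ _ _).toLinearMap ∘ₗ
    TensorProduct.map (coact k H p) (rotate k A q)

end Natural

open Natural in
/-- The operators of the cylindrical module `A ♮ H`, with `X p q = H^{⊗ (p+1)} ⊗ A^{⊗ (q+1)}`.
An element is written `(g_0, …, g_p | a_q, …, a_0)`, and `a_i` is kept in slot `i` of the tensor
power of `A`, so that the `i`-th face in the `q`-direction multiplies `a_{i+1} a_i`; the last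
one is `(g_0⁰, …, g_p⁰ | a_{q-1}, …, a_0 (S(g_0¹ ⋯ g_p¹) a_q))`. -/
noncomputable def natural (k : Type u) (H : Type v) (A : Type w) [CommRing k] [Ring H] [Ring A]
    [Algebra k A] [Module H A] [HopfAlgebra k H] [IsScalarTower k H A] :
    CylindricalOps k fun p q => TPow k H (p + 1) ⊗[k] TPow k A (q + 1) where
  h p :=
    { d := fun q i => if hi : i ≤ q
        then LinearMap.lTensor _ (contract (LinearMap.mul k A).flip q i hi)
        else LinearMap.lTensor _ (contract (LinearMap.mul k A).flip q 0 (Nat.zero_le q)) ∘ₗ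
          tau k H A p (q + 1)
      s := fun q i => LinearMap.lTensor _ (insert k 1 q i)
      t := fun q => tau k H A p q }
  v q :=
    { d := fun p i => if hi : i ≤ p
        then LinearMap.rTensor _ (contract (LinearMap.mul k H) p i hi)
        else LinearMap.rTensor _ (contract (LinearMap.mul k H) p 0 (Nat.zero_le p)) ∘ₗ
          tauBar k H A (p + 1) q
      s := fun p i => LinearMap.rTensor _ (insert k 1 p i)
      t := fun p => tauBar k H A p q }

end HopfCyclic

/-!
The cyclic homology of a mixed complex with coefficients in a graded `k[u]`-module is computed from
the operator `b + u B` on formal power series in `u`. A map `F₀ + u F₁` commuting with this operator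
induces isomorphisms on `HC`, whatever the coefficients, as soon as `F₀` is a homotopy equivalence
for `b` alone: a quasi-inverse and homotopies for `F₀` contract the mapping cone up to an operator
that raises the power of `u`, and adding the geometric series of such an operator gives an exact
contraction (`MixedComplex.nonempty_HC_equiv`). Its entries are homogeneous maps and homotopies of
power series and hence pass to the tensor product with the coefficients.

The comparison of the total complex of a cylindrical module with its diagonal is the cyclic
Eilenberg–Zilber theorem. Here `F₀` is the shuffle map `∇` and `F₁` is the cyclic shuffle: for a chain
`y` in bidegree `(p, q)` one applies to every rotation of `y` by `a` and `c` the two extra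
degeneracies, and then those shuffles for which the `p`-step at `a` comes before the `q`-step at
`c` (`CylindricalOps.cyc`). In the boundary of such a restricted shuffle (`CylindricalOps.shuf_b`) the
faces of the rotated chain telescope over the rotations, and the faces which merge the two marked
steps leave the shuffles through a corner, which add up to the norm operator of the diagonal
(`sum_corner`). This is `IsCylindrical.b_cyc`, and it says that `∇ + u cyc` commutes with `b + u B`
up to degenerate chains. The Alexander–Whitney map is a left inverse of `∇` on normalized chains;
on the other side the homotopy is the one that décalage attaches to any natural endomorphism of the
diagonal which is zero in degree `0` (`CylindricalOps.htpy_spec`). The same homotopy compares the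
diagonal with its normalization. Together this gives `IsCylindrical.nonempty_tot_equiv_diag`.

The cylindrical structure of `A ♮ H` is explained by the operators
`E_{j,i} : (g_0, …, g_p | a_q, …, a_0) ↦ (g_0, …, g_j⁰, …, g_p | a_q, …, g_j¹ a_i, …, a_0)`, which are
invertible by the antipode. On the spaces of `A ♮ H` there is also the untwisted structure, given by
the cyclic module of `H` and that of the algebra `A` with the opposite product. The cyclic operators
of `A ♮ H` are the untwisted ones composed with the product of the operators `E_{0,i}` in a row,
for `τ̄`, and with the inverse of the product of the operators `E_{j,0}` in a column, for `τ`
(`natural_isGridTwist`). The operators `E_{j,i}` and `E_{j',i'}` commute if `j ≠ j'` and `i ≠ i'`, and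
they are permuted by the rotations. From this the identities of a cylindrical module follow
formally (`IsGridTwist.isCylindrical`); in particular `τ̄^{p+1}` is the product of all rows,
`τ^{q+1}` the inverse of the product of all columns, and the two products over the grid agree.

Finally the product of the operators `E_{j,i}` with `j < i` (`CylindricalOps.reorder`) moves all
elements of `H` past the elements of `A`. It carries the cyclic module of `A ⊗ H` with the product
`(a ⊗ g) (b ⊗ h) = (g¹ b) a ⊗ g⁰ h` to the diagonal of `A ♮ H`; since all the operators of a cyclic
module are generated by `τ`, `∂_0` and `σ_0`, only these are compared (`nonempty_HC_diag_equiv`). This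
algebra is the crossed product of `A^op` and `H^cop`. If the antipode is invertible, everything
applies to `H^cop` and `A^op`, and the algebra is then the crossed product of `A` and `H`.
-/

namespace HopfCyclic

/-! ### Homotopy invariance of cyclic homology with coefficients -/

namespace MixedComplex

section BoxMap

variable {k : Type u} [CommRing k] {V V' V'' : ℕ → Type*}
  [∀ n, AddCommGroup (V n)] [∀ n, Module k (V n)] [∀ n, AddCommGroup (V' n)]
  [∀ n, Module k (V' n)] [∀ n, AddCommGroup (V'' n)] [∀ n, Module k (V'' n)]

/-- A map of families of coefficients is homogeneous of degree `d` if it takes series of degree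
`m` to series of degree `m + d`. -/
abbrev IsHomog (d : ℤ) (φ : (∀ n, V n) →ₗ[k] ∀ n, V' n) : Prop :=
  ∀ m, ∀ f ∈ series k V m, φ f ∈ series k V' (m + d)

/-- The `k[u]`-linear map of power series given by a homogeneous map of families. It is
`k[u]`-linear because multiplication by `u` does not change the family of coefficients. -/
noncomputable def seriesMap {d : ℤ} (φ : (∀ n, V n) →ₗ[k] ∀ n, V' n) (hφ : IsHomog d φ) :
    Series k V →ₗ[k[X]] Series k V' :=
  let ψ : Series k V →ₗ[k] Series k V' := DirectSum.toModule k ℤ (Series k V') fun m =>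
    hom k V' (m + d) ∘ₗ φ.restrict (hφ m)
  have hψ : ∀ m x, ψ (hom k V m x) = hom k V' (m + d) ⟨φ x, hφ m x x.2⟩ := fun m x =>
    DirectSum.toModule_lof k (φ := fun m => hom k V' (m + d) ∘ₗ φ.restrict (hφ m)) m x
  have hu : ψ ∘ₗ mulU k V = mulU k V' ∘ₗ ψ := series_ext fun m x => by
    rw [LinearMap.comp_apply, LinearMap.comp_apply, hψ, mulU_hom, mulU_hom, hψ]
    exact hom_congr (by ring) _ _ rfl
  { toFun := ψ
    map_add' := map_add _
    map_smul' := fun p x => by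
      simp only [poly_smul_def, RingHom.id_apply]
      induction p using Polynomial.induction_on' with
      | add p q hp hq => simp only [map_add, LinearMap.add_apply, hp, hq]
      | monomial n a =>
        simp only [Polynomial.aeval_monomial, Module.End.mul_apply, Module.algebraMap_end_apply,
          map_smul]
        congr 1
        induction n generalizing x with
        | zero => simp
        | succ n ih =>
          rw [pow_succ, Module.End.mul_apply, ih, pow_succ, Module.End.mul_apply]
          exact congrArg _ (LinearMap.congr_fun hu x) }

theorem seriesMap_hom {d : ℤ} (φ : (∀ n, V n) →ₗ[k] ∀ n, V' n) (hφ : IsHomog d φ) (m : ℤ)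
    (x : series k V m) :
    seriesMap φ hφ (hom k V m x) = hom k V' (m + d) ⟨φ x, hφ m x x.2⟩ :=
  DirectSum.toModule_lof k (φ := fun m => hom k V' (m + d) ∘ₗ φ.restrict (hφ m)) m x

variable (W : Type w) [AddCommGroup W] [Module k W] [Module k[X] W]

/-- The map on `V ⊠ W` given by a homogeneous map of families. -/
noncomputable def boxMap {d : ℤ} (φ : (∀ n, V n) →ₗ[k] ∀ n, V' n) (hφ : IsHomog d φ) :
    Box k V W →ₗ[k] Box k V' W :=
  ((seriesMap φ hφ).rTensor W).restrictScalars k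

variable {W}

theorem boxMap_tmul {d : ℤ} (φ : (∀ n, V n) →ₗ[k] ∀ n, V' n) (hφ : IsHomog d φ) (m : ℤ)
    (x : series k V m) (w : W) : boxMap W φ hφ (hom k V m x ⊗ₜ[k[X]] w) =
      hom k V' (m + d) ⟨φ x, hφ m x x.2⟩ ⊗ₜ[k[X]] w := by
  rw [← seriesMap_hom]; rfl

theorem boxDiff_tmul (M : MixedComplex k V) (m : ℤ) (x : series k V m) (w : W) :
    M.boxDiff W (hom k V m x ⊗ₜ[k[X]] w) =
      hom k V (m - 1) ⟨M.total x, M.total_mem m x x.2⟩ ⊗ₜ[k[X]] w := by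
  rw [← diff_hom]; rfl

theorem box_ext {N : Type*} [AddCommGroup N] [Module k N] {f g : Box k V W →ₗ[k] N}
    (h : ∀ m x w, f (hom k V m x ⊗ₜ[k[X]] w) = g (hom k V m x ⊗ₜ[k[X]] w)) : f = g := by
  refine LinearMap.ext fun z => ?_
  induction z using TensorProduct.induction_on with
  | zero => simp
  | add y z hy hz => simp only [map_add, hy, hz]
  | tmul s w =>
    let F : Series k V →ₗ[k] Box k V W :=
      { toFun := fun s => s ⊗ₜ w
        map_add' := fun a b => TensorProduct.add_tmul a b w
        map_smul' := fun c a => (TensorProduct.smul_tmul' c a w).symm }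
    exact LinearMap.congr_fun (series_ext (f := f ∘ₗ F) (g := g ∘ₗ F) fun m x => h m x w) s

theorem boxMap_mem_boxDeg {d : ℤ} (φ : (∀ n, V n) →ₗ[k] ∀ n, V' n) (hφ : IsHomog d φ)
    (𝒲 : ℤ → Submodule k W) (n : ℤ) {z : Box k V W} (hz : z ∈ boxDeg V 𝒲 n) :
    boxMap W φ hφ z ∈ boxDeg V' 𝒲 (n + d) := by
  have : (boxDeg V 𝒲 n).map (boxMap W φ hφ) ≤ boxDeg V' 𝒲 (n + d) := by
    rw [boxDeg, Submodule.map_span_le]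
    rintro _ ⟨m, x, w, hw, rfl⟩
    rw [boxMap_tmul]
    exact Submodule.subset_span ⟨m + d, _, w, by convert hw using 2; ring, rfl⟩
  exact this ⟨z, hz, rfl⟩

theorem boxMap_boxDiff (M : MixedComplex k V) (M' : MixedComplex k V')
    (F : (∀ n, V n) →ₗ[k] ∀ n, V' n) (hF : IsHomog 0 F)
    (h : ∀ x, F (M.total x) = M'.total (F x)) (z : Box k V W) :
    boxMap W F hF (M.boxDiff W z) = M'.boxDiff W (boxMap W F hF z) := by
  refine LinearMap.congr_fun (f := boxMap W F hF ∘ₗ M.boxDiff W)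
    (g := M'.boxDiff W ∘ₗ boxMap W F hF) (box_ext fun m x w => ?_) z
  rw [LinearMap.comp_apply, LinearMap.comp_apply, boxDiff_tmul, boxMap_tmul, boxMap_tmul,
    boxDiff_tmul]
  congr 1
  exact hom_congr (by ring) _ _ (h x)

theorem boxMap_homotopy (M : MixedComplex k V) (F : (∀ n, V n) →ₗ[k] ∀ n, V' n)
    (G : (∀ n, V' n) →ₗ[k] ∀ n, V n) (K : (∀ n, V n) →ₗ[k] ∀ n, V n)
    (hF : IsHomog 0 F) (hG : IsHomog 0 G) (hK : IsHomog 1 K)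
    (h : ∀ x, G (F x) = x + (M.total (K x) + K (M.total x))) (z : Box k V W) :
    boxMap W G hG (boxMap W F hF z) =
      z + (M.boxDiff W (boxMap W K hK z) + boxMap W K hK (M.boxDiff W z)) := by
  refine LinearMap.congr_fun (f := boxMap W G hG ∘ₗ boxMap W F hF)
    (g := LinearMap.id + (M.boxDiff W ∘ₗ boxMap W K hK + boxMap W K hK ∘ₗ M.boxDiff W))
    (box_ext fun m x w => ?_) z
  simp only [LinearMap.comp_apply, LinearMap.add_apply, LinearMap.id_apply, boxDiff_tmul,
    boxMap_tmul]
  have hx := h x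
  have e1 : (⟨M.total (K x), M.total_mem _ _ (hK m x x.2)⟩ : series k V (m + 1 - 1)).1 ∈
      series k V m := by
    convert M.total_mem _ _ (hK m x x.2) using 1; simp
  have e2 : K (M.total x) ∈ series k V m := by
    convert hK _ _ (M.total_mem _ _ x.2) using 1; simp
  have a1 : hom k V (m + 1 - 1) ⟨M.total (K x), M.total_mem _ _ (hK m x x.2)⟩ =
      hom k V m ⟨_, e1⟩ := hom_congr (by ring) _ _ rfl
  have a2 : hom k V (m - 1 + 1) ⟨K (M.total x), hK _ _ (M.total_mem _ _ x.2)⟩ =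
      hom k V m ⟨_, e2⟩ := hom_congr (by ring) _ _ rfl
  have a3 : hom k V (m + 0 + 0) ⟨G (F x), hG _ _ (hF m x x.2)⟩ =
      hom k V m x + (hom k V m ⟨_, e1⟩ + hom k V m ⟨_, e2⟩) := by
    rw [← map_add, ← map_add]
    exact hom_congr (by ring) _ _ hx
  rw [a1, a2, a3, TensorProduct.add_tmul, TensorProduct.add_tmul]

theorem boxMap_mem_boxCycles (M : MixedComplex k V) (M' : MixedComplex k V')
    (F : (∀ n, V n) →ₗ[k] ∀ n, V' n) (hF : IsHomog 0 F)
    (h : ∀ x, F (M.total x) = M'.total (F x)) (𝒲 : ℤ → Submodule k W) (n : ℤ)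
    (z : Box k V W) (hz : z ∈ M.boxCycles 𝒲 n) : boxMap W F hF z ∈ M'.boxCycles 𝒲 n := by
  refine ⟨?_, by simpa using boxMap_mem_boxDeg F hF 𝒲 n hz.2⟩
  have h1 : M.boxDiff W z = 0 := hz.1
  rw [SetLike.mem_coe, LinearMap.mem_ker, ← boxMap_boxDiff M M' F hF h, h1, map_zero]

/-- The map on cyclic homology given by a degree `0` map of families commuting with `b + u B`. -/
noncomputable def mapHC (M : MixedComplex k V) (M' : MixedComplex k V')
    (F : (∀ n, V n) →ₗ[k] ∀ n, V' n) (hF : IsHomog 0 F)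
    (h : ∀ x, F (M.total x) = M'.total (F x)) (𝒲 : ℤ → Submodule k W) (n : ℤ) :
    M.HC 𝒲 n →ₗ[k] M'.HC 𝒲 n :=
  Submodule.mapQ _ _ ((boxMap W F hF).restrict (boxMap_mem_boxCycles M M' F hF h 𝒲 n)) <| by
    rintro ⟨z, hz⟩ ⟨y, hy, hyz⟩
    refine ⟨boxMap W F hF y, by simpa using boxMap_mem_boxDeg F hF 𝒲 (n + 1) hy, ?_⟩
    rw [← boxMap_boxDiff M M' F hF h, hyz]
    rfl

theorem mapHC_mapHC (M : MixedComplex k V) (M' : MixedComplex k V')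
    (F : (∀ n, V n) →ₗ[k] ∀ n, V' n) (G : (∀ n, V' n) →ₗ[k] ∀ n, V n)
    (K : (∀ n, V n) →ₗ[k] ∀ n, V n) (hF : IsHomog 0 F) (hG : IsHomog 0 G) (hK : IsHomog 1 K)
    (hFD : ∀ x, F (M.total x) = M'.total (F x)) (hGD : ∀ x, G (M'.total x) = M.total (G x))
    (h : ∀ x, G (F x) = x + (M.total (K x) + K (M.total x))) (𝒲 : ℤ → Submodule k W) (n : ℤ)
    (z : M.HC 𝒲 n) : mapHC M' M G hG hGD 𝒲 n (mapHC M M' F hF hFD 𝒲 n z) = z := by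
  obtain ⟨⟨z, hz⟩, rfl⟩ := Submodule.Quotient.mk_surjective _ z
  refine (Submodule.Quotient.eq _).mpr ⟨boxMap W K hK z, boxMap_mem_boxDeg K hK 𝒲 n hz.2, ?_⟩
  have h1 : M.boxDiff W z = 0 := hz.1
  have := boxMap_homotopy M F G K hF hG hK h z
  rw [h1, map_zero, add_zero] at this
  exact (sub_eq_of_eq_add' this).symm

/-- A homotopy equivalence of the complexes of power series gives an isomorphism on cyclic
homology, whatever the coefficients. -/
theorem nonempty_HC_equiv_of_homotopy (M : MixedComplex k V) (M' : MixedComplex k V')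
    (F : (∀ n, V n) →ₗ[k] ∀ n, V' n) (G : (∀ n, V' n) →ₗ[k] ∀ n, V n)
    (K : (∀ n, V n) →ₗ[k] ∀ n, V n) (K' : (∀ n, V' n) →ₗ[k] ∀ n, V' n)
    (hF : IsHomog 0 F) (hG : IsHomog 0 G) (hK : IsHomog 1 K) (hK' : IsHomog 1 K')
    (hFD : ∀ x, F (M.total x) = M'.total (F x)) (hGD : ∀ x, G (M'.total x) = M.total (G x))
    (h : ∀ x, G (F x) = x + (M.total (K x) + K (M.total x)))
    (h' : ∀ x, F (G x) = x + (M'.total (K' x) + K' (M'.total x)))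
    (𝒲 : ℤ → Submodule k W) (n : ℤ) : Nonempty (M.HC 𝒲 n ≃ₗ[k] M'.HC 𝒲 n) :=
  ⟨LinearEquiv.ofLinearMap (mapHC M M' F hF hFD 𝒲 n) (mapHC M' M G hG hGD 𝒲 n)
    (LinearMap.ext (mapHC_mapHC M' M G F K' hG hF hK' hGD hFD h' 𝒲 n))
    (LinearMap.ext (mapHC_mapHC M M' F G K hF hG hK hFD hGD h 𝒲 n))⟩

end BoxMap

end MixedComplex

/-! ### Contraction of mapping cones -/

namespace MixedComplex

section Raising

variable {k : Type u} [CommRing k] {Q : ℕ → Type*}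
  [∀ n, AddCommGroup (Q n)] [∀ n, Module k (Q n)]

/-- An operator on families is raising if the component `n` of a value depends only on the
components `m < n` of the argument. -/
def IsRaising (R : Module.End k (∀ n, Q n)) : Prop :=
  ∀ x n, (∀ m < n, x m = 0) → R x n = 0

/-- The inverse `∑ (-R)^i` of `1 + R` for a raising operator `R`; the sum is finite in each
component. -/
def geomInv (R : Module.End k (∀ n, Q n)) : Module.End k (∀ n, Q n) :=
  LinearMap.pi fun n => ∑ i ∈ Finset.range (n + 1), LinearMap.proj n ∘ₗ (-R) ^ i

theorem geomInv_apply (R : Module.End k (∀ n, Q n)) (x : ∀ n, Q n) (n : ℕ) :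
    geomInv R x n = ∑ i ∈ Finset.range (n + 1), ((-R) ^ i) x n := by
  simp [geomInv]

variable {R : Module.End k (∀ n, Q n)}

theorem IsRaising.pow_apply_eq_zero (hR : IsRaising R) (x : ∀ n, Q n) :
    ∀ i n, n < i → ((-R) ^ i) x n = 0 := by
  intro i
  induction i with
  | zero => intro n hn; omega
  | succ i ih =>
    intro n hn
    rw [pow_succ', Module.End.mul_apply, LinearMap.neg_apply, Pi.neg_apply, neg_eq_zero]
    exact hR _ _ fun m hm => ih m (by omega)

theorem IsRaising.geomInv_apply_eq (hR : IsRaising R) (x : ∀ n, Q n) {n N : ℕ} (h : n < N) :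
    geomInv R x n = (∑ i ∈ Finset.range N, (-R) ^ i) x n := by
  rw [geomInv_apply, LinearMap.sum_apply, Finset.sum_apply]
  refine Finset.sum_subset (Finset.range_mono (by omega)) fun i _ hi => ?_
  exact hR.pow_apply_eq_zero x i n (by simpa using hi)

theorem IsRaising.one_add_mul_geomInv (hR : IsRaising R) : (1 + R) * geomInv R = 1 := by
  refine LinearMap.ext fun x => funext fun n => ?_
  have h1 : R (geomInv R x) n = R ((∑ i ∈ Finset.range (n + 1), (-R) ^ i) x) n := by
    rw [← sub_eq_zero, ← Pi.sub_apply, ← map_sub]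
    refine hR _ _ fun m hm => ?_
    rw [Pi.sub_apply, hR.geomInv_apply_eq x (N := n + 1) (by omega), sub_self]
  have h2 : (1 + R) * ∑ i ∈ Finset.range (n + 1), (-R) ^ i = 1 - (-R) ^ (n + 1) := by
    rw [← mul_neg_geom_sum, sub_neg_eq_add]
  have h3 := congrFun (LinearMap.congr_fun h2 x) n
  rw [LinearMap.sub_apply, Pi.sub_apply, hR.pow_apply_eq_zero x _ _ (Nat.lt_succ_self n),
    sub_zero] at h3
  rw [← h3, Module.End.mul_apply, Module.End.mul_apply, LinearMap.add_apply, LinearMap.add_apply,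
    Pi.add_apply, Pi.add_apply, h1, Module.End.one_apply, Module.End.one_apply,
    hR.geomInv_apply_eq x (Nat.lt_succ_self n)]

theorem IsRaising.geomInv_mul_one_add (hR : IsRaising R) : geomInv R * (1 + R) = 1 := by
  refine LinearMap.ext fun x => funext fun n => ?_
  have h2 : (∑ i ∈ Finset.range (n + 1), (-R) ^ i) * (1 + R) = 1 - (-R) ^ (n + 1) := by
    rw [← geom_sum_mul_neg, sub_neg_eq_add]
  have h3 := congrFun (LinearMap.congr_fun h2 x) n
  rw [LinearMap.sub_apply, Pi.sub_apply, hR.pow_apply_eq_zero x _ _ (Nat.lt_succ_self n),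
    sub_zero] at h3
  rw [← h3, Module.End.mul_apply, Module.End.mul_apply,
    hR.geomInv_apply_eq _ (Nat.lt_succ_self n)]

/-- If `D S + S D = 1 + R` with `R` raising, then `S (1 + R)⁻¹` is a contraction. -/
theorem IsRaising.contraction (hR : IsRaising R) {D S : Module.End k (∀ n, Q n)}
    (hD : D * D = 0) (h : D * S + S * D = 1 + R) :
    D * (S * geomInv R) + S * geomInv R * D = 1 := by
  have h1 : (1 + R) * D = D * (1 + R) := by
    rw [← h, add_mul, mul_add, mul_assoc S, hD, ← mul_assoc D D, hD]
    simp [mul_assoc]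
  have h2 : geomInv R * D = D * geomInv R := by
    calc geomInv R * D = geomInv R * (D * (1 + R)) * geomInv R := by
          rw [mul_assoc, mul_assoc, hR.one_add_mul_geomInv, mul_one]
      _ = D * geomInv R := by rw [← h1, ← mul_assoc, hR.geomInv_mul_one_add, one_mul]
  rw [mul_assoc S, h2, ← mul_assoc, ← mul_assoc, ← add_mul, h, hR.one_add_mul_geomInv]

end Raising

section Cone

variable {k : Type u} [CommRing k] {V V' : ℕ → Type*}
  [∀ n, AddCommGroup (V n)] [∀ n, Module k (V n)] [∀ n, AddCommGroup (V' n)]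
  [∀ n, Module k (V' n)]

/-- A family of maps raising the degree by two, as an operator on families. -/
def raise₂ (f : ∀ n : ℕ, V n →ₗ[k] V' (n + 2)) : (∀ n, V n) →ₗ[k] (∀ n, V' n) :=
  LinearMap.pi fun n => match n with
    | 0 => 0
    | 1 => 0
    | n + 2 => f n ∘ₗ LinearMap.proj n

@[simp] theorem raise₂_zero (f : ∀ n : ℕ, V n →ₗ[k] V' (n + 2)) (x : ∀ n, V n) :
    raise₂ f x 0 = 0 := rfl

@[simp] theorem raise₂_one (f : ∀ n : ℕ, V n →ₗ[k] V' (n + 2)) (x : ∀ n, V n) :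
    raise₂ f x 1 = 0 := rfl

@[simp] theorem raise₂_add_two (f : ∀ n : ℕ, V n →ₗ[k] V' (n + 2)) (x : ∀ n, V n) (n : ℕ) :
    raise₂ f x (n + 2) = f n (x n) := rfl

/-- A family of maps preserving the degree, as an operator on families. -/
def level (f : ∀ n : ℕ, V n →ₗ[k] V' n) : (∀ n, V n) →ₗ[k] (∀ n, V' n) :=
  LinearMap.pi fun n => f n ∘ₗ LinearMap.proj n

@[simp] theorem level_apply (f : ∀ n : ℕ, V n →ₗ[k] V' n) (x : ∀ n, V n) (n : ℕ) :
    level f x n = f n (x n) := rfl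

theorem mem_series_congr {m m' : ℤ} (h : m = m') {x : ∀ n, V n} (hx : x ∈ series k V m) :
    x ∈ series k V m' := h ▸ hx

theorem total_zero (M : MixedComplex k V) (x : ∀ n, V n) : M.total x 0 = M.b 0 (x 1) := by
  simp [total]

theorem total_succ (M : MixedComplex k V) (x : ∀ n, V n) (n : ℕ) :
    M.total x (n + 1) = M.b (n + 1) (x (n + 2)) + M.B n (x n) := rfl

theorem isHomog_level (f : ∀ n : ℕ, V n →ₗ[k] V' n) : IsHomog 0 (level f) := by
  intro m x hx n hn
  rw [level_apply, hx n (by simpa using hn), map_zero]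

theorem isHomog_raise₂ (f : ∀ n : ℕ, V n →ₗ[k] V' (n + 2)) : IsHomog 0 (raise₂ f) := by
  intro m x hx n hn
  rcases n with _ | _ | n
  · rfl
  · rfl
  · rw [raise₂_add_two, hx n fun ⟨i, hi⟩ => hn ⟨i + 1, by push_cast; omega⟩, map_zero]

theorem isHomog_raise (f : ∀ n : ℕ, V n →ₗ[k] V (n + 1)) : IsHomog 1 (raise f) := by
  intro m x hx n hn
  rcases n with _ | n
  · rfl
  · rw [raise_succ, hx n fun ⟨i, hi⟩ => hn ⟨i, by push_cast; omega⟩, map_zero]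

/-- Pairs of families, as families of pairs. -/
def pair : ((∀ n, V n) × ∀ n, V' n) ≃ₗ[k] ∀ n, V n × V' n where
  toFun x n := (x.1 n, x.2 n)
  map_add' _ _ := rfl
  map_smul' _ _ := rfl
  invFun a := (fun n => (a n).1, fun n => (a n).2)
  left_inv _ := rfl
  right_inv _ := rfl

/-- The differential `(x, y) ↦ (-D x, F x + D y)` of the mapping cone of `F`. -/
def coneDiff (M : MixedComplex k V) (M' : MixedComplex k V') (F : (∀ n, V n) →ₗ[k] ∀ n, V' n) :
    Module.End k (∀ n, V n × V' n) :=
  pair.toLinearMap ∘ₗ LinearMap.prod (-(M.total ∘ₗ LinearMap.fst _ _ _))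
    (F ∘ₗ LinearMap.fst _ _ _ + M'.total ∘ₗ LinearMap.snd _ _ _) ∘ₗ pair.symm.toLinearMap

/-- The operator `(x, y) ↦ (h x + g y, -h' y)` on the mapping cone of a homotopy equivalence with
quasi-inverse `g` and homotopies `h` and `h'`. -/
def coneHtpy (g : (∀ n, V' n) →ₗ[k] ∀ n, V n) (h : Module.End k (∀ n, V n))
    (h' : Module.End k (∀ n, V' n)) : Module.End k (∀ n, V n × V' n) :=
  pair.toLinearMap ∘ₗ LinearMap.prod (h ∘ₗ LinearMap.fst _ _ _ + g ∘ₗ LinearMap.snd _ _ _)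
    (-(h' ∘ₗ LinearMap.snd _ _ _)) ∘ₗ pair.symm.toLinearMap

/-- A morphism `F₀ + u F₁` of mixed complexes whose leading term is a homotopy equivalence for the
differentials `b` induces isomorphisms on cyclic homology, whatever the coefficients: the operator
`coneHtpy` contracts the mapping cone up to terms which raise the index of the families. -/
theorem nonempty_HC_equiv (M : MixedComplex k V) (M' : MixedComplex k V')
    (F₀ : ∀ n, V n →ₗ[k] V' n) (F₁ : ∀ n, V n →ₗ[k] V' (n + 2))
    (hF : ∀ x, (level F₀ + raise₂ F₁) (M.total x) = M'.total ((level F₀ + raise₂ F₁) x))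
    (g : ∀ n, V' n →ₗ[k] V n) (hg : ∀ n x, g n (M'.b n x) = M.b n (g (n + 1) x))
    (h : ∀ n, V n →ₗ[k] V (n + 1)) (h' : ∀ n, V' n →ₗ[k] V' (n + 1))
    (h_zero : ∀ x, g 0 (F₀ 0 x) = x + M.b 0 (h 0 x))
    (h_succ : ∀ n x, g (n + 1) (F₀ (n + 1) x) =
      x + (M.b (n + 1) (h (n + 1) x) + h n (M.b n x)))
    (h'_zero : ∀ x, F₀ 0 (g 0 x) = x + M'.b 0 (h' 0 x))
    (h'_succ : ∀ n x, F₀ (n + 1) (g (n + 1) x) =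
      x + (M'.b (n + 1) (h' (n + 1) x) + h' n (M'.b n x)))
    {W : Type w} [AddCommGroup W] [Module k W] [Module k[X] W]
    (𝒲 : ℤ → Submodule k W) (n : ℤ) : Nonempty (M.HC 𝒲 n ≃ₗ[k] M'.HC 𝒲 n) := by
  set F := level F₀ + raise₂ F₁ with hFdef
  set D := coneDiff M M' F with hDdef
  set S := coneHtpy (level g) (raise h) (raise h') with hSdef
  set R := D * S + S * D - 1 with hRdef
  have hDS : ∀ x y, D (pair (k := k) (x, y)) = pair (k := k) (-M.total x, F x + M'.total y) :=
    fun _ _ => rfl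
  have hSS : ∀ x y, S (pair (k := k) (x, y)) =
      pair (k := k) (raise h x + level g y, -raise h' y) := fun _ _ => rfl
  have hD : D * D = 0 := by
    refine LinearMap.ext fun a => ?_
    obtain ⟨⟨x, y⟩, rfl⟩ := (pair (k := k)).surjective a
    rw [Module.End.mul_apply, hDS, hDS, LinearMap.zero_apply, ← map_zero (pair (k := k))]
    congr 1
    refine Prod.ext ?_ ?_
    · simp [M.total_total]
    · simp only [map_neg, map_add, M'.total_total, add_zero, hF, Prod.snd_zero]
      exact neg_add_cancel _
  -- The homotopy identities for `F₀` cancel the terms of `D S + S D - 1` that keep the index.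
  have hR : IsRaising R := by
    intro a n ha
    obtain ⟨⟨x, y⟩, rfl⟩ := (pair (k := k)).surjective a
    have hx : ∀ m < n, x m = 0 := fun m hm => congrArg Prod.fst (ha m hm)
    have hy : ∀ m < n, y m = 0 := fun m hm => congrArg Prod.snd (ha m hm)
    have hRa : R (pair (k := k) (x, y)) = pair (k := k)
        (-M.total (raise h x + level g y) + (raise h (-M.total x) + level g (F x + M'.total y)) - x,
          F (raise h x + level g y) + M'.total (-raise h' y) - raise h' (F x + M'.total y) - y) := by
      rw [hRdef, LinearMap.sub_apply, LinearMap.add_apply, Module.End.mul_apply,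
        Module.End.mul_apply, hDS, hSS, hSS, hDS, Module.End.one_apply, ← map_add, ← map_sub]
      congr 1
      refine Prod.ext rfl ?_
      simp only [Prod.snd_add, Prod.snd_sub]
      abel
    rw [hRa]
    refine Prod.ext ?_ ?_
    · change (-M.total (raise h x + level g y) + (raise h (-M.total x) +
        level g (F x + M'.total y)) - x) n = 0
      rcases n with _ | _ | _ | n
      · simp [total_zero, F, h_zero, hg]
        abel
      · have h1 := hy 0 (by omega)
        simp [total_zero, total_succ, F, h_succ, hg, h1]
        abel
      · have h0 := hx 0 (by omega)
        have h1 := hy 1 (by omega)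
        simp [total_succ, F, h_succ, hg, h0, h1]
        abel
      · have h0 := hx (n + 1) (by omega)
        have h1 := hy (n + 2) (by omega)
        simp [total_succ, F, h_succ, hg, h0, h1]
        abel
    · change (F (raise h x + level g y) + M'.total (-raise h' y) - raise h' (F x + M'.total y)
        - y) n = 0
      rcases n with _ | _ | _ | n
      · simp [total_zero, F, h'_zero]
      · have h0 := hx 0 (by omega)
        simp [total_zero, total_succ, F, h'_succ, h0]
        abel
      · have h1 := hy 0 (by omega)
        have h2 := hx 1 (by omega)
        simp [total_succ, F, h'_succ, h1, h2]
        abel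
      · have h0 := hx n (by omega)
        have h1 := hy (n + 1) (by omega)
        have h3 := hx (n + 2) (by omega)
        simp [total_succ, F, h'_succ, h0, h1, h3]
        abel
  have hDSR : D * S + S * D = 1 + R := by rw [hRdef]; abel
  have key := hR.contraction hD hDSR
  obtain ⟨S', hS'⟩ : ∃ S', S' = S * geomInv R := ⟨_, rfl⟩
  rw [← hS'] at key
  -- The entries of the matrix of the exact contraction: `G` is a quasi-inverse of `F`, with `K` and
  -- `-K'` as homotopies.
  let G : (∀ n, V' n) →ₗ[k] ∀ n, V n := LinearMap.fst _ _ _ ∘ₗ pair.symm.toLinearMap ∘ₗ S' ∘ₗ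
    pair.toLinearMap ∘ₗ LinearMap.inr _ _ _
  let K : (∀ n, V n) →ₗ[k] ∀ n, V n := LinearMap.fst _ _ _ ∘ₗ pair.symm.toLinearMap ∘ₗ S' ∘ₗ
    pair.toLinearMap ∘ₗ LinearMap.inl _ _ _
  let L : (∀ n, V n) →ₗ[k] ∀ n, V' n := LinearMap.snd _ _ _ ∘ₗ pair.symm.toLinearMap ∘ₗ S' ∘ₗ
    pair.toLinearMap ∘ₗ LinearMap.inl _ _ _
  let K' : (∀ n, V' n) →ₗ[k] ∀ n, V' n := LinearMap.snd _ _ _ ∘ₗ pair.symm.toLinearMap ∘ₗ S' ∘ₗ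
    pair.toLinearMap ∘ₗ LinearMap.inr _ _ _
  have hS'p : ∀ x y, S' (pair (k := k) (x, y)) = pair (k := k) (K x + G y, L x + K' y) := by
    intro x y
    have : (x, y) = LinearMap.inl k _ _ x + LinearMap.inr k _ _ y := by simp
    rw [this, map_add, map_add]
    rfl
  have hkey : ∀ x y, (-M.total (K x + G y) + (K (-M.total x) + G (F x + M'.total y)) = x) ∧
      (F (K x + G y) + M'.total (L x + K' y) + (L (-M.total x) + K' (F x + M'.total y)) = y) := by
    intro x y
    have := LinearMap.congr_fun key (pair (k := k) (x, y))
    rw [LinearMap.add_apply, Module.End.mul_apply, Module.End.mul_apply, hDS, hS'p, hS'p, hDS,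
      Module.End.one_apply, ← map_add] at this
    exact Prod.ext_iff.mp ((pair (k := k)).injective this)
  have hFh : IsHomog 0 F := fun m x hx => add_mem (isHomog_level F₀ m x hx)
    (isHomog_raise₂ F₁ m x hx)
  -- The chains of degree `m` in the mapping cone. The contraction is homogeneous because `D`, `S` and
  -- hence `R` are.
  let P : ℤ → Submodule k (∀ n, V n × V' n) := fun m =>
    ((series k V (m - 1)).prod (series k V' m)).map pair.toLinearMap
  have hPm : ∀ m x y, pair (k := k) (x, y) ∈ P m ↔ x ∈ series k V (m - 1) ∧ y ∈ series k V' m := by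
    intro m x y
    refine ⟨?_, fun h => ⟨(x, y), h, rfl⟩⟩
    rintro ⟨z, hz, hzy⟩
    obtain rfl := (pair (k := k)).injective hzy
    exact hz
  have hDP : ∀ m, ∀ a ∈ P m, D a ∈ P (m - 1) := by
    intro m a ha
    obtain ⟨⟨x, y⟩, rfl⟩ := (pair (k := k)).surjective a
    obtain ⟨h1, h2⟩ := (hPm _ _ _).mp ha
    rw [hDS, hPm]
    exact ⟨neg_mem (M.total_mem _ _ h1), add_mem (mem_series_congr (by ring) (hFh _ _ h1))
      (M'.total_mem _ _ h2)⟩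
  have hSP : ∀ m, ∀ a ∈ P m, S a ∈ P (m + 1) := by
    intro m a ha
    obtain ⟨⟨x, y⟩, rfl⟩ := (pair (k := k)).surjective a
    obtain ⟨h1, h2⟩ := (hPm _ _ _).mp ha
    rw [hSS, hPm]
    exact ⟨add_mem (mem_series_congr (by ring) (isHomog_raise h _ _ h1))
      (mem_series_congr (by ring) (isHomog_level g _ _ h2)), neg_mem (isHomog_raise h' _ _ h2)⟩
  have hRP : ∀ m, ∀ a ∈ P m, R a ∈ P m := by
    intro m a ha
    have h1 := hDP _ _ (hSP _ _ ha)
    have h2 := hSP _ _ (hDP _ _ ha)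
    rw [add_sub_cancel_right] at h1
    rw [sub_add_cancel] at h2
    exact sub_mem (add_mem h1 h2) ha
  have hIP : ∀ m, ∀ a ∈ P m, geomInv R a ∈ P m := by
    intro m a ha
    have hpow : ∀ i : ℕ, ((-R) ^ i) a ∈ P m := by
      intro i
      induction i with
      | zero => exact ha
      | succ i ih =>
        rw [pow_succ', Module.End.mul_apply, LinearMap.neg_apply]
        exact neg_mem (hRP _ _ ih)
    have hn : ∀ b ∈ P m, ∀ n : ℕ, (¬(∃ i : ℕ, (n : ℤ) = m - 1 + 2 * i) → (b n).1 = 0) ∧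
        (¬(∃ i : ℕ, (n : ℤ) = m + 2 * i) → (b n).2 = 0) := by
      rintro _ ⟨⟨x, y⟩, hxy, rfl⟩ n
      exact ⟨hxy.1 n, hxy.2 n⟩
    refine (hPm m (fun n => (geomInv R a n).1) fun n => (geomInv R a n).2).mpr
      ⟨fun n h => ?_, fun n h => ?_⟩
    · change (geomInv R a n).1 = 0
      rw [geomInv_apply, Prod.fst_sum]
      exact Finset.sum_eq_zero fun i _ => (hn _ (hpow i) n).1 h
    · change (geomInv R a n).2 = 0
      rw [geomInv_apply, Prod.snd_sum]
      exact Finset.sum_eq_zero fun i _ => (hn _ (hpow i) n).2 h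
  have hS'P : ∀ m x y, x ∈ series k V (m - 1) → y ∈ series k V' m →
      K x + G y ∈ series k V m ∧ L x + K' y ∈ series k V' (m + 1) := by
    intro m x y hx hy
    have := hSP _ _ (hIP _ _ ((hPm m x y).mpr ⟨hx, hy⟩))
    rw [← Module.End.mul_apply, ← hS', hS'p, hPm, add_sub_cancel_right] at this
    exact this
  have hG : IsHomog 0 G := fun m y hy =>
    mem_series_congr (add_zero m).symm (by simpa using (hS'P m 0 y (zero_mem _) hy).1)
  have hK : IsHomog 1 K := fun m x hx => by
    simpa using (hS'P (m + 1) x 0 (mem_series_congr (by ring) hx) (zero_mem _)).1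
  have hK' : IsHomog 1 (-K') := fun m y hy => by
    simpa using (hS'P m 0 y (zero_mem _) hy).2
  refine nonempty_HC_equiv_of_homotopy M M' F G K (-K') hFh hG hK hK' hF (fun y => ?_)
    (fun x => ?_) (fun y => ?_) 𝒲 n
  · have := (hkey 0 y).1
    simp only [map_zero, zero_add, neg_zero] at this
    exact (neg_add_eq_zero.mp this).symm
  · have := (hkey x 0).1
    simp only [map_zero, map_neg, add_zero] at this
    refine Eq.trans ?_ (congrArg (· + (M.total (K x) + K (M.total x))) this)
    abel
  · have := (hkey 0 y).2
    simp only [map_zero, zero_add, neg_zero] at this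
    simp only [LinearMap.neg_apply, map_neg]
    refine Eq.trans ?_ (congrArg (· + (-M'.total (K' y) + -K' (M'.total y))) this)
    abel

end Cone

end MixedComplex

/-! ### Simplicial modules and décalage -/

namespace ParacyclicOps

variable {k : Type u} [CommRing k] {X : ℕ → Type v}
  [∀ n, AddCommGroup (X n)] [∀ n, Module k (X n)] (P : ParacyclicOps k X)

/-- The identities of a simplicial module; the cyclic operators play no role. -/
structure IsSimplicial : Prop where
  d_d : ∀ n i j, i ≤ j → j ≤ n + 1 → ∀ x, P.d n i (P.d (n + 1) (j + 1) x) = P.d n j (P.d (n + 1) i x)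
  s_s : ∀ n i j, i ≤ j → j ≤ n → ∀ x, P.s (n + 1) i (P.s n j x) = P.s (n + 1) (j + 1) (P.s n i x)
  d_s_lt : ∀ n i j, i ≤ j → j ≤ n →
    ∀ x, P.d (n + 1) i (P.s (n + 1) (j + 1) x) = P.s n j (P.d n i x)
  d_s_self : ∀ n i, i ≤ n → ∀ x, P.d n i (P.s n i x) = x
  d_s_succ : ∀ n i, i ≤ n → ∀ x, P.d n (i + 1) (P.s n i x) = x
  d_s_gt : ∀ n i j, j < i → i ≤ n + 1 →
    ∀ x, P.d (n + 1) (i + 1) (P.s (n + 1) j x) = P.s n j (P.d n i x)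

variable {P} in
theorem IsParacyclic.isSimplicial (h : P.IsParacyclic) : P.IsSimplicial :=
  ⟨h.d_d, h.s_s, h.d_s_lt, h.d_s_self, h.d_s_succ, h.d_s_gt⟩

/-- The décalage: `X (n + 1)` in degree `n`, without the operators of index `0`. -/
abbrev dec : ParacyclicOps k fun n => X (n + 1) where
  d n i := P.d (n + 1) (i + 1)
  s n i := P.s (n + 1) (i + 1)
  t _ := 0

/-- The other décalage: `X (n + 1)` in degree `n`, without the operators of the last index. -/
abbrev decLast : ParacyclicOps k fun n => X (n + 1) where
  d n i := P.d (n + 1) i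
  s n i := P.s (n + 1) i
  t _ := 0

variable {P}

theorem IsSimplicial.dec (h : P.IsSimplicial) : P.dec.IsSimplicial where
  d_d n i j hij hj := h.d_d _ _ _ (by omega) (by omega)
  s_s n i j hij hj := h.s_s _ _ _ (by omega) (by omega)
  d_s_lt n i j hij hj := h.d_s_lt _ _ _ (by omega) (by omega)
  d_s_self n i hi := h.d_s_self _ _ (by omega)
  d_s_succ n i hi := h.d_s_succ _ _ (by omega)
  d_s_gt n i j hij hi := h.d_s_gt _ _ _ (by omega) (by omega)

theorem b_apply (n : ℕ) (x : X (n + 1)) :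
    P.b n x = ∑ i ∈ Finset.range (n + 2), (-1 : k) ^ i • P.d n i x := by simp [b]

theorem b_zero_apply (x : X 1) : P.b 0 x = P.d 0 0 x - P.d 0 1 x := by
  simp [b_apply, Finset.sum_range_succ, sub_eq_add_neg]

theorem b_succ_apply (n : ℕ) (x : X (n + 2)) :
    P.b (n + 1) x = P.d (n + 1) 0 x - P.dec.b n x := by
  rw [b_apply, b_apply, Finset.sum_range_succ', sub_eq_neg_add, ← Finset.sum_neg_distrib]
  simp [pow_succ]

/-- The homotopy `s_0` contracts the décalage. -/
theorem IsSimplicial.dec_b_s_zero (h : P.IsSimplicial) (n : ℕ) (x : X (n + 1)) :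
    P.dec.b n (P.s (n + 1) 0 x) = x - P.s n 0 (P.d n 0 x - P.b n x) := by
  rw [b_apply, b_apply, Finset.sum_range_succ', Finset.sum_range_succ' _ (n + 1), pow_zero,
    one_smul, one_smul, h.d_s_succ (n + 1) 0 (by omega), sub_add_cancel_right, map_neg,
    sub_neg_eq_add, map_sum]
  refine (add_comm _ _).trans (congrArg _ (Finset.sum_congr rfl fun i hi => ?_))
  rw [map_smul, h.d_s_gt n (i + 1) 0 (by omega) (by simp at hi; omega)]

end ParacyclicOps

namespace CylindricalOps

open ParacyclicOps

section Basic

variable {k : Type u} [CommRing k] {X : ℕ → ℕ → Type v}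
  [∀ p q, AddCommGroup (X p q)] [∀ p q, Module k (X p q)] (C : CylindricalOps k X)

/-- The identities of a bisimplicial module; the cyclic operators play no role. -/
structure IsBisimplicial : Prop where
  h_simp : ∀ p, (C.h p).IsSimplicial
  v_simp : ∀ q, (C.v q).IsSimplicial
  d_d : ∀ p q i j, i ≤ q + 1 → j ≤ p + 1 → ∀ x,
    (C.h p).d q i ((C.v (q + 1)).d p j x) = (C.v q).d p j ((C.h (p + 1)).d q i x)
  d_s : ∀ p q i j, i ≤ q + 1 → j ≤ p → ∀ x,
    (C.h (p + 1)).d q i ((C.v (q + 1)).s p j x) = (C.v q).s p j ((C.h p).d q i x)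
  s_d : ∀ p q i j, i ≤ q → j ≤ p + 1 → ∀ x,
    (C.h p).s q i ((C.v q).d p j x) = (C.v (q + 1)).d p j ((C.h (p + 1)).s q i x)
  s_s : ∀ p q i j, i ≤ q → j ≤ p → ∀ x,
    (C.h (p + 1)).s q i ((C.v q).s p j x) = (C.v (q + 1)).s p j ((C.h p).s q i x)

/-- The décalage in both directions. -/
abbrev dec : CylindricalOps k fun p q => X (p + 1) (q + 1) where
  h p := (C.h (p + 1)).dec
  v q := (C.v (q + 1)).dec

/-- The décalage in the `p`-direction only. -/
abbrev decP : CylindricalOps k fun p q => X (p + 1) q where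
  h p := C.h (p + 1)
  v q := (C.v q).dec

/-- The décalage in both directions that forgets the last operators. -/
abbrev decLast : CylindricalOps k fun p q => X (p + 1) (q + 1) where
  h p := (C.h (p + 1)).decLast
  v q := (C.v (q + 1)).decLast

variable {C}

theorem IsCylindrical.isBisimplicial (H : C.IsCylindrical) : C.IsBisimplicial :=
  ⟨fun p => (H.h_para p).isSimplicial, fun q => (H.v_para q).isSimplicial, H.d_d, H.d_s, H.s_d,
    H.s_s⟩

theorem IsBisimplicial.dec (H : C.IsBisimplicial) : C.dec.IsBisimplicial where
  h_simp p := (H.h_simp (p + 1)).dec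
  v_simp q := (H.v_simp (q + 1)).dec
  d_d p q i j hi hj := H.d_d _ _ _ _ (by omega) (by omega)
  d_s p q i j hi hj := H.d_s _ _ _ _ (by omega) (by omega)
  s_d p q i j hi hj := H.s_d _ _ _ _ (by omega) (by omega)
  s_s p q i j hi hj := H.s_s _ _ _ _ (by omega) (by omega)

theorem IsBisimplicial.decP (H : C.IsBisimplicial) : C.decP.IsBisimplicial where
  h_simp p := H.h_simp (p + 1)
  v_simp q := (H.v_simp q).dec
  d_d p q i j hi hj := H.d_d _ _ _ _ (by omega) (by omega)
  d_s p q i j hi hj := H.d_s _ _ _ _ (by omega) (by omega)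
  s_d p q i j hi hj := H.s_d _ _ _ _ (by omega) (by omega)
  s_s p q i j hi hj := H.s_s _ _ _ _ (by omega) (by omega)

/-- The diagonal of a bisimplicial module is simplicial. -/
theorem IsBisimplicial.diag (H : C.IsBisimplicial) : C.diag.IsSimplicial where
  d_d n i j hij hj x := by
    simp only [CylindricalOps.diag, LinearMap.comp_apply]
    rw [H.d_d (n + 1) n i (j + 1) (by omega) (by omega), (H.h_simp _).d_d n i j hij hj,
      (H.v_simp _).d_d n i j hij hj, ← H.d_d (n + 1) n j i (by omega) (by omega)]
  s_s n i j hij hj x := by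
    simp only [CylindricalOps.diag, LinearMap.comp_apply]
    rw [H.s_s n (n + 1) i j (by omega) (by omega), (H.h_simp _).s_s n i j hij hj,
      (H.v_simp _).s_s n i j hij hj, ← H.s_s n (n + 1) (j + 1) i (by omega) (by omega)]
  d_s_lt n i j hij hj x := by
    simp only [CylindricalOps.diag, LinearMap.comp_apply]
    rw [H.d_s (n + 1) (n + 1) i (j + 1) (by omega) (by omega), (H.h_simp _).d_s_lt n i j hij hj,
      (H.v_simp _).d_s_lt n i j hij hj, ← H.s_d n n j i (by omega) (by omega)]
  d_s_self n i hi x := by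
    simp only [CylindricalOps.diag, LinearMap.comp_apply]
    rw [H.d_s n n i i (by omega) (by omega), (H.h_simp _).d_s_self n i hi,
      (H.v_simp _).d_s_self n i hi]
  d_s_succ n i hi x := by
    simp only [CylindricalOps.diag, LinearMap.comp_apply]
    rw [H.d_s n n (i + 1) i (by omega) (by omega), (H.h_simp _).d_s_succ n i hi,
      (H.v_simp _).d_s_succ n i hi]
  d_s_gt n i j hij hi x := by
    simp only [CylindricalOps.diag, LinearMap.comp_apply]
    rw [H.d_s (n + 1) (n + 1) (i + 1) j (by omega) (by omega), (H.h_simp _).d_s_gt n i j hij hi,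
      (H.v_simp _).d_s_gt n i j hij hi, ← H.s_d n n j i (by omega) (by omega)]

theorem diag_d_apply (n i : ℕ) (x : X (n + 1) (n + 1)) :
    C.diag.d n i x = (C.v n).d n i ((C.h (n + 1)).d n i x) := rfl

theorem diag_s_apply (n i : ℕ) (x : X n n) :
    C.diag.s n i x = (C.v (n + 1)).s n i ((C.h n).s n i x) := rfl

theorem diag_b_succ (n : ℕ) (x : X (n + 2) (n + 2)) :
    C.diag.b (n + 1) x = C.diag.d (n + 1) 0 x - C.dec.diag.b n x := C.diag.b_succ_apply n x

end Basic

section Maps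

variable {k : Type u} [CommRing k] {X Y : ℕ → ℕ → Type v}
  [∀ p q, AddCommGroup (X p q)] [∀ p q, Module k (X p q)]
  [∀ p q, AddCommGroup (Y p q)] [∀ p q, Module k (Y p q)]
  (C : CylindricalOps k X) (D : CylindricalOps k Y)

/-- Families of maps commuting with the degeneracies of both directions. -/
structure IsDegMap (φ : ∀ p q, X p q →ₗ[k] Y p q) : Prop where
  h_s : ∀ p q i, i ≤ q → ∀ x, φ p (q + 1) ((C.h p).s q i x) = (D.h p).s q i (φ p q x)
  v_s : ∀ p q i, i ≤ p → ∀ x, φ (p + 1) q ((C.v q).s p i x) = (D.v q).s p i (φ p q x)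

/-- Maps of bisimplicial modules. -/
structure IsBiMap (φ : ∀ p q, X p q →ₗ[k] Y p q) : Prop extends IsDegMap C D φ where
  h_d : ∀ p q i, i ≤ q + 1 → ∀ x, φ p q ((C.h p).d q i x) = (D.h p).d q i (φ p (q + 1) x)
  v_d : ∀ p q i, i ≤ p + 1 → ∀ x, φ p q ((C.v q).d p i x) = (D.v q).d p i (φ (p + 1) q x)

variable {C D} {φ : ∀ p q, X p q →ₗ[k] Y p q}

theorem IsDegMap.dec (h : IsDegMap C D φ) : IsDegMap C.dec D.dec fun p q => φ (p + 1) (q + 1) where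
  h_s _ _ _ hi := h.h_s _ _ _ (by omega)
  v_s _ _ _ hi := h.v_s _ _ _ (by omega)

theorem IsBiMap.dec (h : IsBiMap C D φ) : IsBiMap C.dec D.dec fun p q => φ (p + 1) (q + 1) where
  toIsDegMap := h.toIsDegMap.dec
  h_d _ _ _ hi := h.h_d _ _ _ (by omega)
  v_d _ _ _ hi := h.v_d _ _ _ (by omega)

/-- The faces of index `0` form a map from the décalage. -/
theorem IsBisimplicial.isBiMap_d_zero (H : C.IsBisimplicial) :
    IsBiMap C.dec C fun p q => (C.v q).d p 0 ∘ₗ (C.h (p + 1)).d q 0 where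
  h_s p q i hi x := by
    simp only [LinearMap.comp_apply]
    rw [(H.h_simp _).d_s_lt q 0 i (by omega) hi, ← H.s_d _ _ _ _ (by omega) (by omega)]
  v_s p q i hi x := by
    simp only [LinearMap.comp_apply]
    rw [H.d_s _ _ _ _ (by omega) (by omega), (H.v_simp _).d_s_lt p 0 i (by omega) hi]
  h_d p q i hi x := by
    simp only [LinearMap.comp_apply]
    rw [(H.h_simp _).d_d q 0 i (by omega) hi, ← H.d_d _ _ _ _ (by omega) (by omega)]
  v_d p q i hi x := by
    simp only [LinearMap.comp_apply]
    rw [H.d_d _ _ _ _ (by omega) (by omega), (H.v_simp _).d_d p 0 i (by omega) hi]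

/-- The degeneracies of index `0` commute with the degeneracies when their values are taken in the
décalage. -/
theorem IsBisimplicial.isDegMap_s_zero (H : C.IsBisimplicial) :
    IsDegMap C C.dec fun p q => (C.v (q + 1)).s p 0 ∘ₗ (C.h p).s q 0 where
  h_s p q i hi x := by
    simp only [LinearMap.comp_apply]
    rw [(H.h_simp _).s_s q 0 i (by omega) hi, ← H.s_s _ _ _ _ (by omega) (by omega)]
  v_s p q i hi x := by
    simp only [LinearMap.comp_apply]
    rw [H.s_s _ _ _ _ (by omega) (by omega), (H.v_simp _).s_s p 0 i (by omega) hi]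

/-- The degeneracies of index `0` form a map from the décalage to the double décalage. -/
theorem IsBisimplicial.isBiMap_s_zero (H : C.IsBisimplicial) :
    IsBiMap C.dec C.dec.dec fun p q => (C.v (q + 2)).s (p + 1) 0 ∘ₗ (C.h (p + 1)).s (q + 1) 0 where
  h_s p q i hi x := by
    simp only [LinearMap.comp_apply]
    rw [(H.h_simp _).s_s (q + 1) 0 (i + 1) (by omega) (by omega),
      ← H.s_s _ _ _ _ (by omega) (by omega)]
  v_s p q i hi x := by
    simp only [LinearMap.comp_apply]
    rw [H.s_s _ _ _ _ (by omega) (by omega),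
      (H.v_simp _).s_s (p + 1) 0 (i + 1) (by omega) (by omega)]
  h_d p q i hi x := by
    simp only [LinearMap.comp_apply]
    rw [H.d_s _ _ _ _ (by omega) (by omega), (H.h_simp _).d_s_gt (q + 1) (i + 1) 0 (by omega)
      (by omega)]
  v_d p q i hi x := by
    simp only [LinearMap.comp_apply]
    rw [H.s_d _ _ _ _ (by omega) (by omega), (H.v_simp _).d_s_gt (p + 1) (i + 1) 0 (by omega)
      (by omega)]

theorem IsBiMap.diag_b (h : IsBiMap C D φ) (n : ℕ) (x : X (n + 1) (n + 1)) :
    φ n n (C.diag.b n x) = D.diag.b n (φ (n + 1) (n + 1) x) := by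
  refine (CylindricalOps.b_comm C.diag D.diag (fun n => φ n n) (fun n i hi x => ?_) n x).symm
  rw [diag_d_apply, diag_d_apply, ← h.h_d _ _ _ hi, ← h.v_d _ _ _ hi]

end Maps

/-! ### Natural endomorphisms of the diagonal -/

section Natural

variable {k : Type u} [CommRing k]

variable (k) in
/-- An endomorphism of the diagonal of degree `0`, defined for all bisimplicial modules. -/
abbrev DiagEnd := ∀ (n : ℕ) {X : ℕ → ℕ → Type v} [∀ p q, AddCommGroup (X p q)]
  [∀ p q, Module k (X p q)], CylindricalOps k X → (X n n →ₗ[k] X n n)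

/-- Naturality with respect to maps of bisimplicial modules. -/
def DiagEnd.IsNatural (G : DiagEnd.{u, v} k) : Prop :=
  ∀ (n : ℕ) {X Y : ℕ → ℕ → Type v} [∀ p q, AddCommGroup (X p q)] [∀ p q, Module k (X p q)]
    [∀ p q, AddCommGroup (Y p q)] [∀ p q, Module k (Y p q)] {C : CylindricalOps k X}
    {D : CylindricalOps k Y}, C.IsBisimplicial → D.IsBisimplicial →
    ∀ {φ : ∀ p q, X p q →ₗ[k] Y p q}, IsBiMap C D φ → ∀ x, φ n n (G n C x) = G n D (φ n n x)

/-- Compatibility with the differential `b` of the diagonal. -/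
def DiagEnd.IsChainMap (G : DiagEnd.{u, v} k) : Prop :=
  ∀ (n : ℕ) {X : ℕ → ℕ → Type v} [∀ p q, AddCommGroup (X p q)] [∀ p q, Module k (X p q)]
    {C : CylindricalOps k X}, C.IsBisimplicial →
    ∀ x, G n C (C.diag.b n x) = C.diag.b n (G (n + 1) C x)

/-- Preservation of the degenerate chains. -/
def DiagEnd.PreservesDegen (G : DiagEnd.{u, v} k) : Prop :=
  ∀ (n : ℕ) {X : ℕ → ℕ → Type v} [∀ p q, AddCommGroup (X p q)] [∀ p q, Module k (X p q)]
    {C : CylindricalOps k X}, C.IsBisimplicial → ∀ x ∈ C.diag.degen n, G n C x ∈ C.diag.degen n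

/-- The homotopy `Φ_{n+1} = G' s_0 - Φ'_n`, where a prime denotes an operator of the décalage. -/
def htpy (G : DiagEnd.{u, v} k) : ∀ (n : ℕ) {X : ℕ → ℕ → Type v} [∀ p q, AddCommGroup (X p q)]
    [∀ p q, Module k (X p q)], CylindricalOps k X → (X n n →ₗ[k] X (n + 1) (n + 1))
  | 0, _, _, _, _ => 0
  | n + 1, _, _, _, C => G (n + 1) C.dec ∘ₗ C.diag.s (n + 1) 0 - htpy G n C.dec

section

variable {G : DiagEnd.{u, v} k} {X : ℕ → ℕ → Type v} [∀ p q, AddCommGroup (X p q)]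
  [∀ p q, Module k (X p q)] {C : CylindricalOps k X}

theorem htpy_zero (x : X 0 0) : htpy G 0 C x = 0 := rfl

theorem htpy_succ (n : ℕ) (x : X (n + 1) (n + 1)) :
    htpy G (n + 1) C x = G (n + 1) C.dec (C.diag.s (n + 1) 0 x) - htpy G n C.dec x := rfl

theorem htpy_natural (hG : G.IsNatural) : ∀ (n : ℕ) {X Y : ℕ → ℕ → Type v}
    [∀ p q, AddCommGroup (X p q)] [∀ p q, Module k (X p q)]
    [∀ p q, AddCommGroup (Y p q)] [∀ p q, Module k (Y p q)] {C : CylindricalOps k X}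
    {D : CylindricalOps k Y}, C.IsBisimplicial → D.IsBisimplicial →
    ∀ {φ : ∀ p q, X p q →ₗ[k] Y p q}, IsBiMap C D φ →
    ∀ x, φ (n + 1) (n + 1) (htpy G n C x) = htpy G n D (φ n n x) := by
  intro n
  induction n with
  | zero => intros; simp [htpy_zero]
  | succ n ih =>
    intro X Y _ _ _ _ C D hC hD φ hφ x
    rw [htpy_succ, htpy_succ, map_sub, ih hC.dec hD.dec hφ.dec,
      hG (n + 1) hC.dec hD.dec hφ.dec, diag_s_apply, diag_s_apply, hφ.v_s _ _ _ (by omega),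
      hφ.h_s _ _ _ (by omega)]

/-- A natural chain endomorphism of the diagonal that is zero in degree `0` is null-homotopic. The
extra degeneracy `s_0` contracts the décalage, and `d_0` maps the décalage back by naturality. -/
theorem htpy_spec (hG : G.IsNatural) (hb : G.IsChainMap)
    (h0 : ∀ {X : ℕ → ℕ → Type v} [∀ p q, AddCommGroup (X p q)] [∀ p q, Module k (X p q)]
      (C : CylindricalOps k X) (x : X 0 0), G 0 C x = 0) : ∀ (n : ℕ) {X : ℕ → ℕ → Type v}
    [∀ p q, AddCommGroup (X p q)] [∀ p q, Module k (X p q)] {C : CylindricalOps k X},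
    C.IsBisimplicial → ∀ x : X (n + 1) (n + 1),
    G (n + 1) C x = C.diag.b (n + 1) (htpy G (n + 1) C x) + htpy G n C (C.diag.b n x) := by
  have hd : ∀ (n : ℕ) {X : ℕ → ℕ → Type v} [∀ p q, AddCommGroup (X p q)]
      [∀ p q, Module k (X p q)] {C : CylindricalOps k X}, C.IsBisimplicial →
      ∀ x : X (n + 1) (n + 1), C.diag.d n 0 (G n C.dec x) = G n C (C.diag.d n 0 x) :=
    fun n X _ _ C hC x => hG n hC.dec hC hC.isBiMap_d_zero x
  intro n
  induction n with
  | zero =>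
    intro X _ _ C hC x
    rw [htpy_zero, add_zero, htpy_succ, htpy_zero, sub_zero, diag_b_succ, hd 1 hC,
      hC.diag.d_s_self _ _ (by omega), ← hb 0 hC.dec, h0, sub_zero]
  | succ n ih =>
    intro X _ _ C hC x
    have h1 : C.dec.diag.b (n + 1) (C.diag.s (n + 2) 0 x) =
        x - C.diag.s (n + 1) 0 (C.diag.d (n + 1) 0 x - C.diag.b (n + 1) x) :=
      hC.diag.dec_b_s_zero (n + 1) x
    have h2 : C.diag.d (n + 2) 0 (htpy G (n + 1) C.dec x) =
        htpy G (n + 1) C (C.diag.d (n + 1) 0 x) :=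
      htpy_natural hG (n + 1) hC.dec hC hC.isBiMap_d_zero x
    have h3 := ih hC.dec x
    have h4 : C.dec.diag.b n x = C.diag.d (n + 1) 0 x - C.diag.b (n + 1) x := by
      rw [diag_b_succ]; abel
    have h5 : C.dec.diag.b (n + 1) (htpy G (n + 1) C.dec x) = G (n + 1) C.dec x -
        htpy G n C.dec (C.diag.d (n + 1) 0 x - C.diag.b (n + 1) x) := by
      rw [h3, h4, add_sub_cancel_right]
    rw [htpy_succ (n + 1), diag_b_succ, map_sub, map_sub, hd _ hC, h2,
      hC.diag.d_s_self _ _ (by omega), ← hb _ hC.dec, h1, h5,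
      htpy_succ n (C.diag.d (n + 1) 0 x), htpy_succ n (C.diag.b (n + 1) x)]
    simp only [map_sub]
    abel

/-- The homotopy descends to normalized chains if the endomorphism does. -/
theorem htpy_mem_degen (hG : G.IsNatural) (hdeg : G.PreservesDegen) : ∀ (n : ℕ)
    {X : ℕ → ℕ → Type v} [∀ p q, AddCommGroup (X p q)] [∀ p q, Module k (X p q)]
    {C : CylindricalOps k X}, C.IsBisimplicial →
    ∀ x ∈ C.diag.degen n, htpy G n C x ∈ C.diag.degen (n + 1) := by
  have hdec : ∀ {X : ℕ → ℕ → Type v} [∀ p q, AddCommGroup (X p q)] [∀ p q, Module k (X p q)]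
      {C : CylindricalOps k X} (n : ℕ) (x : X (n + 2) (n + 2)), x ∈ C.dec.diag.degen (n + 1) →
      x ∈ C.diag.degen (n + 2) := fun {X _ _ C} n x hx =>
    degen_induction (P := C.dec.diag) (p := fun x => x ∈ C.diag.degen (n + 2)) (fun i hi x => s_mem_degen (by omega) _) (zero_mem _)
      (fun _ _ => add_mem) hx
  intro n
  induction n with
  | zero => intros; exact zero_mem _
  | succ n ih =>
    intro X _ _ C hC x hx
    refine degen_induction (P := C.diag) (p := fun x => htpy G (n + 1) C x ∈ C.diag.degen (n + 2))
      ?_ (by rw [map_zero]; exact zero_mem _)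
      (fun x y hx hy => by rw [map_add]; exact add_mem hx hy) hx
    intro i hi x
    rw [htpy_succ]
    have h0 : C.diag.s (n + 1) 0 (C.diag.s n i x) ∈ C.dec.diag.degen (n + 1) := by
      rw [hC.diag.s_s n 0 i (by omega) hi]
      exact s_mem_degen (P := C.dec.diag) hi (C.diag.s n 0 x)
    have h1 : G (n + 1) C.dec (C.diag.s (n + 1) 0 (C.diag.s n i x)) ∈
        C.dec.diag.degen (n + 1) := hdeg (n + 1) (C := C.dec) hC.dec _ h0
    refine sub_mem (hdec (C := C) n _ h1) ?_
    · rcases i with _ | i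
      · rcases n with _ | n
        · exact zero_mem _
        have h1 : htpy G (n + 1) C.dec (C.diag.s (n + 1) 0 x) =
            G (n + 1) C.dec.dec (C.diag.s (n + 2) 0 (C.diag.s (n + 1) 0 x)) -
              htpy G n C.dec.dec (C.diag.s (n + 1) 0 x) := by
          rw [htpy_succ, hC.diag.s_s (n + 1) 0 0 le_rfl (by omega)]; rfl
        have h2 : G (n + 1) C.dec.dec (C.diag.s (n + 2) 0 (C.diag.s (n + 1) 0 x)) =
            C.diag.s (n + 2) 0 (G (n + 1) C.dec (C.diag.s (n + 1) 0 x)) :=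
          (hG (n + 1) hC.dec hC.dec.dec hC.isBiMap_s_zero _).symm
        have h3 : htpy G n C.dec.dec (C.diag.s (n + 1) 0 x) =
            C.diag.s (n + 2) 0 (htpy G n C.dec x) :=
          (htpy_natural hG n hC.dec hC.dec.dec hC.isBiMap_s_zero _).symm
        rw [h1, h2, h3]
        exact sub_mem (s_mem_degen (by omega) _) (s_mem_degen (by omega) _)
      · rcases n with _ | n
        · omega
        exact hdec (n + 1) _ (ih hC.dec _ (s_mem_degen (P := C.dec.diag) (by omega) x))

end

end Natural

end CylindricalOps

namespace CylindricalOps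

open ParacyclicOps

/-! ### The normalization of the diagonal -/

section Normalization

variable {k : Type u} [CommRing k]

/-- The normalization projector `e_{n+1} = e'_n (1 - S_0 D_0)`, where the prime denotes an operator
of the décalage and `S_0`, `D_0` belong to the diagonal. -/
def normProj : ∀ (n : ℕ) {X : ℕ → ℕ → Type v} [∀ p q, AddCommGroup (X p q)]
    [∀ p q, Module k (X p q)], CylindricalOps k X → (X n n →ₗ[k] X n n)
  | 0, _, _, _, _ => LinearMap.id
  | n + 1, _, _, _, C => normProj n C.dec ∘ₗ (LinearMap.id - C.diag.s n 0 ∘ₗ C.diag.d n 0)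

section

variable {X : ℕ → ℕ → Type v} [∀ p q, AddCommGroup (X p q)] [∀ p q, Module k (X p q)]
  {C : CylindricalOps k X}

theorem normProj_zero (x : X 0 0) : normProj 0 C x = x := rfl

theorem normProj_succ (n : ℕ) (x : X (n + 1) (n + 1)) :
    normProj (n + 1) C x = normProj n C.dec (x - C.diag.s n 0 (C.diag.d n 0 x)) := rfl

theorem mem_degen_of_mem_dec (n : ℕ) (x : X (n + 1) (n + 1)) (hx : x ∈ C.dec.diag.degen n) :
    x ∈ C.diag.degen (n + 1) := by
  rcases n with _ | n
  · have : x = 0 := by simpa [ParacyclicOps.degen] using hx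
    rw [this]; exact zero_mem _
  · exact degen_induction (P := C.dec.diag) (p := fun x => x ∈ C.diag.degen (n + 2))
      (fun i hi x => s_mem_degen (by omega) _) (zero_mem _) (fun _ _ => add_mem) hx

theorem normProj_sub_mem : ∀ (n : ℕ) {X : ℕ → ℕ → Type v} [∀ p q, AddCommGroup (X p q)]
    [∀ p q, Module k (X p q)] (C : CylindricalOps k X) (x : X n n),
    normProj n C x - x ∈ C.diag.degen n := by
  intro n
  induction n with
  | zero => intro X _ _ C x; rw [normProj_zero, sub_self]; exact zero_mem _
  | succ n ih =>
    intro X _ _ C x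
    have h := mem_degen_of_mem_dec n _ (ih C.dec (x - C.diag.s n 0 (C.diag.d n 0 x)))
    have h2 : C.diag.s n 0 (C.diag.d n 0 x) ∈ C.diag.degen (n + 1) := s_mem_degen (by omega) _
    rw [normProj_succ]
    convert sub_mem h h2 using 1
    abel

theorem normProj_of_mem : ∀ (n : ℕ) {X : ℕ → ℕ → Type v} [∀ p q, AddCommGroup (X p q)]
    [∀ p q, Module k (X p q)] {C : CylindricalOps k X}, C.IsBisimplicial →
    ∀ x ∈ C.diag.degen n, normProj n C x = 0 := by
  intro n
  induction n with
  | zero =>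
    intro X _ _ C hC x hx
    rw [normProj_zero]; simpa [ParacyclicOps.degen] using hx
  | succ n ih =>
    intro X _ _ C hC x hx
    refine degen_induction (P := C.diag) (p := fun x => normProj (n + 1) C x = 0) ?_
      (map_zero _) (fun x y hx hy => by rw [map_add, hx, hy, add_zero]) hx
    intro i hi x
    rw [normProj_succ]
    rcases i with _ | i
    · rw [hC.diag.d_s_self n 0 hi, sub_self, map_zero]
    · obtain ⟨n, rfl⟩ : ∃ m, n = m + 1 := ⟨n - 1, by omega⟩
      rw [hC.diag.d_s_lt n 0 i (by omega) (by omega), hC.diag.s_s n 0 i (by omega) (by omega),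
        ← map_sub]
      exact ih hC.dec _ (s_mem_degen (P := C.dec.diag) (by omega) _)

end

theorem normProj_natural : DiagEnd.IsNatural.{u, v} (k := k) normProj := by
  intro n
  induction n with
  | zero => intros; rfl
  | succ n ih =>
    intro X Y _ _ _ _ C D hC hD φ hφ x
    rw [normProj_succ, normProj_succ, ih hC.dec hD.dec hφ.dec, map_sub, diag_s_apply,
      diag_s_apply, hφ.v_s _ _ _ (by omega), hφ.h_s _ _ _ (by omega), diag_d_apply, diag_d_apply,
      hφ.v_d _ _ _ (by omega), hφ.h_d _ _ _ (by omega)]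

theorem normProj_isChainMap : DiagEnd.IsChainMap.{u, v} (k := k) normProj := by
  intro n
  induction n with
  | zero =>
    intro X _ _ C hC x
    rw [normProj_zero, normProj_succ, normProj_zero, b_zero_apply, b_zero_apply, map_sub, map_sub,
      hC.diag.d_s_self 0 0 le_rfl, hC.diag.d_s_succ 0 0 le_rfl]
    abel
  | succ n ih =>
    intro X _ _ C hC x
    have h1 : C.diag.d (n + 1) 0 (normProj (n + 1) C.dec
        (x - C.diag.s (n + 1) 0 (C.diag.d (n + 1) 0 x))) = 0 := by
      have : C.diag.d (n + 1) 0 (normProj (n + 1) C.dec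
          (x - C.diag.s (n + 1) 0 (C.diag.d (n + 1) 0 x))) = normProj (n + 1) C
          (C.diag.d (n + 1) 0 (x - C.diag.s (n + 1) 0 (C.diag.d (n + 1) 0 x))) :=
        normProj_natural (n + 1) hC.dec hC hC.isBiMap_d_zero _
      rw [this, map_sub, hC.diag.d_s_self _ _ (by omega), sub_self, map_zero]
    have h2 : C.dec.diag.b n x = C.diag.d (n + 1) 0 x - C.diag.b (n + 1) x := by
      rw [diag_b_succ]; abel
    have h3 : C.dec.diag.b n (C.diag.s (n + 1) 0 (C.diag.d (n + 1) 0 x)) = C.diag.d (n + 1) 0 x -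
        C.diag.s n 0 (C.diag.d n 0 (C.diag.d (n + 1) 0 x) - C.diag.b n (C.diag.d (n + 1) 0 x)) :=
      hC.diag.dec_b_s_zero n _
    have h4 : C.diag.d n 0 (C.dec.diag.b n x) = C.diag.b n (C.diag.d (n + 1) 0 x) :=
      hC.isBiMap_d_zero.diag_b n x
    rw [h2, map_sub] at h4
    rw [normProj_succ (n + 1), diag_b_succ n (normProj (n + 1) C.dec _), h1, ← ih hC.dec, map_sub, h2, h3, ← h4,
      normProj_succ n, zero_sub, ← map_neg]
    congr 1
    simp only [map_sub]
    abel

end Normalization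

/-! ### The shuffle map -/

section Families

variable {k : Type u} [CommRing k] {X : ℕ → ℕ → Type v}
  [∀ p q, AddCommGroup (X p q)] [∀ p q, Module k (X p q)] (C : CylindricalOps k X)

/-- The first step of a shuffle that degenerates the `q`-direction. -/
def stepH : (∀ p q, X p q) →ₗ[k] (∀ p q, X (p + 1) (q + 1)) :=
  LinearMap.pi fun p => LinearMap.pi fun q =>
    (C.h (p + 1)).s q 0 ∘ₗ LinearMap.proj q ∘ₗ LinearMap.proj (p + 1)

/-- The first step of a shuffle that degenerates the `p`-direction, with its sign. -/
def stepV : (∀ p q, X p q) →ₗ[k] (∀ p q, X (p + 1) (q + 1)) :=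
  LinearMap.pi fun p => LinearMap.pi fun q =>
    (-1 : k) ^ p • ((C.v (q + 1)).s p 0 ∘ₗ LinearMap.proj (q + 1) ∘ₗ LinearMap.proj p)

/-- The last step of a shuffle that degenerates the `q`-direction, with its sign. -/
def lastH : (∀ p q, X p q) →ₗ[k] (∀ p q, X (p + 1) (q + 1)) :=
  LinearMap.pi fun p => LinearMap.pi fun q =>
    (-1 : k) ^ q • ((C.h (p + 1)).s q q ∘ₗ LinearMap.proj q ∘ₗ LinearMap.proj (p + 1))

/-- The last step of a shuffle that degenerates the `p`-direction. -/
def lastV : (∀ p q, X p q) →ₗ[k] (∀ p q, X (p + 1) (q + 1)) :=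
  LinearMap.pi fun p => LinearMap.pi fun q =>
    (C.v (q + 1)).s p p ∘ₗ LinearMap.proj (q + 1) ∘ₗ LinearMap.proj p

theorem stepH_apply (x : ∀ p q, X p q) (p q : ℕ) :
    C.stepH x p q = (C.h (p + 1)).s q 0 (x (p + 1) q) := rfl

theorem stepV_apply (x : ∀ p q, X p q) (p q : ℕ) :
    C.stepV x p q = (-1 : k) ^ p • (C.v (q + 1)).s p 0 (x p (q + 1)) := rfl

theorem lastH_apply (x : ∀ p q, X p q) (p q : ℕ) :
    C.lastH x p q = (-1 : k) ^ q • (C.h (p + 1)).s q q (x (p + 1) q) := rfl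

theorem lastV_apply (x : ∀ p q, X p q) (p q : ℕ) :
    C.lastV x p q = (C.v (q + 1)).s p p (x p (q + 1)) := rfl

/-- The differential `b̄ + (-1)^p b` on families. -/
def famDiff : (∀ p q, X p q) →ₗ[k] (∀ p q, X p q) :=
  LinearMap.pi fun p => LinearMap.pi fun q =>
    (C.v q).b p ∘ₗ LinearMap.proj q ∘ₗ LinearMap.proj (p + 1) +
      (-1 : k) ^ p • ((C.h p).b q ∘ₗ LinearMap.proj (q + 1) ∘ₗ LinearMap.proj p)

theorem famDiff_apply (x : ∀ p q, X p q) (p q : ℕ) :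
    C.famDiff x p q = (C.v q).b p (x (p + 1) q) + (-1 : k) ^ p • (C.h p).b q (x p (q + 1)) := rfl

end Families

section Shuffle

variable {k : Type u} [CommRing k]

/-- The shuffle map from families to the diagonal, by recursion on the first step. -/
def nabla : ∀ (n : ℕ) {X : ℕ → ℕ → Type v} [∀ p q, AddCommGroup (X p q)]
    [∀ p q, Module k (X p q)], CylindricalOps k X → ((∀ p q, X p q) →ₗ[k] X n n)
  | 0, _, _, _, _ => LinearMap.proj 0 ∘ₗ LinearMap.proj 0
  | n + 1, _, _, _, C => nabla n C.dec ∘ₗ (C.stepH + C.stepV)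

section

variable {X Y : ℕ → ℕ → Type v} [∀ p q, AddCommGroup (X p q)] [∀ p q, Module k (X p q)]
  [∀ p q, AddCommGroup (Y p q)] [∀ p q, Module k (Y p q)]
  {C : CylindricalOps k X} {D : CylindricalOps k Y}

theorem nabla_zero (x : ∀ p q, X p q) : nabla 0 C x = x 0 0 := rfl

theorem nabla_succ (n : ℕ) (x : ∀ p q, X p q) :
    nabla (n + 1) C x = nabla n C.dec (C.stepH x + C.stepV x) := rfl

theorem stepH_map {φ : ∀ p q, X p q →ₗ[k] Y p q} (hφ : IsDegMap C D φ) (x : ∀ p q, X p q) :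
    D.stepH (fun p q => φ p q (x p q)) = fun p q => φ (p + 1) (q + 1) (C.stepH x p q) := by
  funext p q
  rw [stepH_apply, stepH_apply, hφ.h_s _ _ _ (by omega)]

theorem stepV_map {φ : ∀ p q, X p q →ₗ[k] Y p q} (hφ : IsDegMap C D φ) (x : ∀ p q, X p q) :
    D.stepV (fun p q => φ p q (x p q)) = fun p q => φ (p + 1) (q + 1) (C.stepV x p q) := by
  funext p q
  rw [stepV_apply, stepV_apply, map_smul, hφ.v_s _ _ _ (by omega)]

end

theorem nabla_natural : ∀ (n : ℕ) {X Y : ℕ → ℕ → Type v} [∀ p q, AddCommGroup (X p q)]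
    [∀ p q, Module k (X p q)] [∀ p q, AddCommGroup (Y p q)] [∀ p q, Module k (Y p q)]
    {C : CylindricalOps k X} {D : CylindricalOps k Y} {φ : ∀ p q, X p q →ₗ[k] Y p q},
    IsDegMap C D φ → ∀ x : ∀ p q, X p q,
    φ n n (nabla n C x) = nabla n D fun p q => φ p q (x p q) := by
  intro n
  induction n with
  | zero => intros; rfl
  | succ n ih =>
    intro X Y _ _ _ _ C D φ hφ x
    rw [nabla_succ, nabla_succ, ih hφ.dec, stepH_map hφ, stepV_map hφ]
    congr 1
    funext p q
    exact map_add _ _ _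

variable {X : ℕ → ℕ → Type v} [∀ p q, AddCommGroup (X p q)] [∀ p q, Module k (X p q)]
  {C : CylindricalOps k X}

theorem IsBisimplicial.famDiff_step (H : C.IsBisimplicial) (x : ∀ p q, X p q) :
    C.dec.famDiff (C.stepH x + C.stepV x) = (C.stepH + C.stepV) (fun p q =>
      ((C.v q).d p 0 (x (p + 1) q) - (C.v q).b p (x (p + 1) q)) + (-1 : k) ^ p •
        ((C.h p).d q 0 (x p (q + 1)) - (C.h p).b q (x p (q + 1)))) := by
  funext p q
  simp only [famDiff_apply, Pi.add_apply, LinearMap.add_apply, stepH_apply, stepV_apply, map_add,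
    map_smul]
  have h1 := (H.h_simp (p + 1)).dec_b_s_zero q (x (p + 1) (q + 1))
  have h2 := (H.v_simp (q + 1)).dec_b_s_zero p (x (p + 1) (q + 1))
  have h3 : (C.v (q + 1)).dec.b p ((C.h (p + 2)).s q 0 (x (p + 2) q)) =
      (C.h (p + 1)).s q 0 ((C.v q).dec.b p (x (p + 2) q)) :=
    b_comm (C.v q).dec (C.v (q + 1)).dec (fun p => (C.h (p + 1)).s q 0)
      (fun p j hj x => (H.s_d _ _ _ _ (by omega) (by omega) x).symm) p _
  have h4 : (C.h (p + 1)).dec.b q ((C.v (q + 2)).s p 0 (x p (q + 2))) =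
      (C.v (q + 1)).s p 0 ((C.h p).dec.b q (x p (q + 2))) :=
    b_comm (C.h p).dec (C.h (p + 1)).dec (fun q => (C.v (q + 1)).s p 0)
      (fun q j hj x => H.d_s _ _ _ _ (by omega) (by omega) x) q _
  rw [h1, h2, h3, h4, b_succ_apply (n := p), b_succ_apply (n := q) (P := C.h p)]
  simp only [sub_sub_cancel, map_sub]
  module

/-- The shuffle map is a chain map. -/
theorem nabla_b : ∀ (n : ℕ) {X : ℕ → ℕ → Type v} [∀ p q, AddCommGroup (X p q)]
    [∀ p q, Module k (X p q)] {C : CylindricalOps k X}, C.IsBisimplicial →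
    ∀ x : ∀ p q, X p q, C.diag.b n (nabla (n + 1) C x) = nabla n C (C.famDiff x) := by
  intro n
  induction n with
  | zero =>
    intro X _ _ C H x
    simp only [nabla_succ, nabla_zero, famDiff_apply, b_zero_apply, stepH_apply,
      stepV_apply, diag_d_apply, map_add, pow_zero, one_smul]
    simp only [(H.h_simp _).d_s_self 0 0 le_rfl, (H.h_simp _).d_s_succ 0 0 le_rfl,
      H.d_s 0 0 0 0 (by omega) le_rfl, H.d_s 0 0 1 0 (by omega) le_rfl,
      (H.v_simp _).d_s_self 0 0 le_rfl, (H.v_simp _).d_s_succ 0 0 le_rfl]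
  | succ n ih =>
    intro X _ _ C H x
    have h1 : C.diag.d (n + 1) 0 (nabla (n + 1) C.dec (C.stepH x + C.stepV x)) =
        nabla (n + 1) C (fun p q => (C.v q).d p 0 (x (p + 1) q) +
          (-1 : k) ^ p • (C.h p).d q 0 (x p (q + 1))) := by
      refine (nabla_natural (n + 1) H.isBiMap_d_zero.toIsDegMap _).trans ?_
      congr 1
      funext p q
      simp only [Pi.add_apply, map_add, LinearMap.comp_apply, stepH_apply, stepV_apply, map_smul]
      rw [(H.h_simp _).d_s_self q 0 (by omega), H.d_s _ _ _ _ (by omega) (by omega),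
        (H.v_simp _).d_s_self p 0 (by omega)]
    rw [nabla_succ, diag_b_succ, h1, ih H.dec, H.famDiff_step, LinearMap.add_apply, ← nabla_succ,
      ← map_sub]
    congr 1
    funext p q
    simp only [famDiff_apply, Pi.sub_apply, smul_sub]
    abel

/-- The shuffle map by recursion on the last step. -/
theorem nabla_last : ∀ (n : ℕ) {X : ℕ → ℕ → Type v} [∀ p q, AddCommGroup (X p q)]
    [∀ p q, Module k (X p q)] {C : CylindricalOps k X}, C.IsBisimplicial →
    ∀ x : ∀ p q, X p q, nabla (n + 1) C x = nabla n C.decLast (C.lastH x + C.lastV x) := by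
  intro n
  induction n with
  | zero =>
    intro X _ _ C H x
    simp [nabla_succ, nabla_zero, stepH_apply, stepV_apply, lastH_apply, lastV_apply]
  | succ n ih =>
    intro X _ _ C H x
    rw [nabla_succ, ih H.dec, nabla_succ]
    change nabla n C.dec.decLast _ = nabla n C.dec.decLast _
    congr 1
    funext p q
    simp only [Pi.add_apply, stepH_apply, stepV_apply, lastH_apply, lastV_apply, map_add, map_smul]
    rw [(H.h_simp _).s_s q 0 q (by omega) (by omega), (H.v_simp _).s_s p 0 p (by omega) (by omega),
      H.s_s (p + 1) (q + 1) (q + 1) 0 (by omega) (by omega),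
      H.s_s (p + 1) (q + 1) 0 (p + 1) (by omega) (by omega)]
    module

/-- A degeneracy of index `0` of a degenerate chain is degenerate in the décalage, up to a chain
that is the simultaneous degeneracy of index `0` in both directions. -/
theorem IsBisimplicial.s_zero_mem (H : C.IsBisimplicial) (p q : ℕ) :
    (∀ x ∈ C.degen (p + 1) q, (C.h (p + 1)).s q 0 x ∈
      C.dec.degen p q ⊔ LinearMap.range ((C.v (q + 1)).s p 0 ∘ₗ (C.h p).s q 0)) ∧
    (∀ x ∈ C.degen p (q + 1), (C.v (q + 1)).s p 0 x ∈
      C.dec.degen p q ⊔ LinearMap.range ((C.v (q + 1)).s p 0 ∘ₗ (C.h p).s q 0)) := by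
  constructor
  · suffices h : C.degen (p + 1) q ≤ Submodule.comap ((C.h (p + 1)).s q 0) (C.dec.degen p q ⊔
        LinearMap.range ((C.v (q + 1)).s p 0 ∘ₗ (C.h p).s q 0)) from fun x hx => h hx
    refine sup_le ?_ (iSup_le fun ⟨i, hi⟩ => ?_)
    · rcases q with _ | m
      · exact bot_le
      refine iSup_le fun ⟨i, hi⟩ => ?_
      rintro _ ⟨x, rfl⟩
      refine Submodule.mem_sup_left (Submodule.mem_sup_left ?_)
      rw [(H.h_simp _).s_s m 0 i (by omega) (by omega)]
      exact s_mem_degen (P := (C.h (p + 1)).dec) (Nat.lt_succ_iff.mp hi) _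
    · rintro _ ⟨x, rfl⟩
      rw [Submodule.mem_comap, H.s_s _ _ _ _ (by omega) (Nat.lt_succ_iff.mp hi)]
      rcases i with _ | i
      · exact Submodule.mem_sup_right ⟨x, rfl⟩
      · obtain ⟨m, rfl⟩ : ∃ m, p = m + 1 := ⟨p - 1, by omega⟩
        exact Submodule.mem_sup_left (Submodule.mem_sup_right
          (s_mem_degen (P := (C.v (q + 1)).dec) (by omega) _))
  · suffices h : C.degen p (q + 1) ≤ Submodule.comap ((C.v (q + 1)).s p 0) (C.dec.degen p q ⊔
        LinearMap.range ((C.v (q + 1)).s p 0 ∘ₗ (C.h p).s q 0)) from fun x hx => h hx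
    refine sup_le (iSup_le fun ⟨i, hi⟩ => ?_) ?_
    · rintro _ ⟨x, rfl⟩
      rw [Submodule.mem_comap]
      rcases i with _ | i
      · exact Submodule.mem_sup_right ⟨x, rfl⟩
      · rw [← H.s_s _ _ _ _ (by omega) (by omega)]
        obtain ⟨m, rfl⟩ : ∃ m, q = m + 1 := ⟨q - 1, by omega⟩
        exact Submodule.mem_sup_left (Submodule.mem_sup_left
          (s_mem_degen (P := (C.h (p + 1)).dec) (by omega) _))
    · rcases p with _ | m
      · exact bot_le
      refine iSup_le fun ⟨i, hi⟩ => ?_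
      rintro _ ⟨x, rfl⟩
      refine Submodule.mem_sup_left (Submodule.mem_sup_right ?_)
      rw [(H.v_simp _).s_s m 0 i (by omega) (by omega)]
      exact s_mem_degen (P := (C.v (q + 1)).dec) (Nat.lt_succ_iff.mp hi) _

/-- A family with values in `C.dec.degen ⊔ range S_0` splits into a degenerate family of the
décalage and the image of a family under `S_0`. -/
theorem exists_split {y : ∀ p q, X (p + 1) (q + 1)} (hy : ∀ p q, y p q ∈
      C.dec.degen p q ⊔ LinearMap.range ((C.v (q + 1)).s p 0 ∘ₗ (C.h p).s q 0)) :
    ∃ (u : ∀ p q, X (p + 1) (q + 1)) (z : ∀ p q, X p q), (∀ p q, u p q ∈ C.dec.degen p q) ∧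
      y = u + fun p q => ((C.v (q + 1)).s p 0 ∘ₗ (C.h p).s q 0) (z p q) := by
  have : ∀ p q, ∃ u z, u ∈ C.dec.degen p q ∧
      y p q = u + ((C.v (q + 1)).s p 0 ∘ₗ (C.h p).s q 0) z := by
    intro p q
    obtain ⟨u, hu, _, ⟨z, rfl⟩, h⟩ := Submodule.mem_sup.mp (hy p q)
    exact ⟨u, z, hu, h.symm⟩
  choose u z hu h using this
  exact ⟨u, z, hu, funext fun p => funext fun q => h p q⟩

/-- Shuffles of degenerate families are degenerate. -/
theorem nabla_mem_degen : ∀ (n : ℕ) {X : ℕ → ℕ → Type v} [∀ p q, AddCommGroup (X p q)]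
    [∀ p q, Module k (X p q)] {C : CylindricalOps k X}, C.IsBisimplicial →
    ∀ x : ∀ p q, X p q, (∀ p q, x p q ∈ C.degen p q) → nabla n C x ∈ C.diag.degen n := by
  intro n
  induction n with
  | zero =>
    intro X _ _ C H x hx
    have : x 0 0 = 0 := by simpa [degen, ParacyclicOps.degen] using hx 0 0
    rw [nabla_zero, this]; exact zero_mem _
  | succ n ih =>
    intro X _ _ C H x hx
    obtain ⟨u, z, hu, h⟩ := exists_split (C := C) (y := C.stepH x + C.stepV x) fun p q =>
      add_mem ((H.s_zero_mem p q).1 _ (hx _ _))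
        (Submodule.smul_mem _ _ ((H.s_zero_mem p q).2 _ (hx _ _)))
    rw [nabla_succ, h, map_add, ← nabla_natural n H.isDegMap_s_zero]
    exact add_mem (mem_degen_of_mem_dec n _ (ih H.dec u hu)) (s_mem_degen (by omega) _)

end Shuffle

/-! ### The Alexander–Whitney map -/

section AlexanderWhitney

variable {k : Type u} [CommRing k]

/-- The iterated last face `X p q → X 0 q` of the `p`-direction. -/
def vert {X : ℕ → ℕ → Type v} [∀ p q, AddCommGroup (X p q)] [∀ p q, Module k (X p q)]
    (C : CylindricalOps k X) (q : ℕ) : ∀ p, X p q →ₗ[k] X 0 q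
  | 0 => LinearMap.id
  | p + 1 => vert C q p ∘ₗ (C.v q).d p (p + 1)

/-- The Alexander–Whitney map, by recursion on the number of faces `d_0` of the `q`-direction. -/
def aw : ∀ (n : ℕ) {X : ℕ → ℕ → Type v} [∀ p q, AddCommGroup (X p q)]
    [∀ p q, Module k (X p q)], CylindricalOps k X → (X n n →ₗ[k] ∀ p q, X p q)
  | 0, _, _, _, _ => LinearMap.pi fun p => match p with
    | 0 => LinearMap.single k _ 0
    | _ + 1 => 0
  | n + 1, _, _, _, C => LinearMap.pi fun p => match p with
    | 0 => LinearMap.single k _ (n + 1) ∘ₗ vert C (n + 1) (n + 1)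
    | p + 1 => LinearMap.proj p ∘ₗ aw n C.decP ∘ₗ (C.h (n + 1)).d n 0

variable {X : ℕ → ℕ → Type v} [∀ p q, AddCommGroup (X p q)] [∀ p q, Module k (X p q)]
  {C : CylindricalOps k X}

theorem vert_zero (q : ℕ) (x : X 0 q) : vert C q 0 x = x := rfl

theorem vert_succ (p q : ℕ) (x : X (p + 1) q) :
    vert C q (p + 1) x = vert C q p ((C.v q).d p (p + 1) x) := rfl

theorem aw_zero_zero (n : ℕ) (x : X n n) : aw n C x 0 = Pi.single n (vert C n n x) := by
  rcases n with _ | n <;> rfl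

theorem aw_succ_succ (n p : ℕ) (x : X (n + 1) (n + 1)) :
    aw (n + 1) C x (p + 1) = aw n C.decP ((C.h (n + 1)).d n 0 x) p := rfl

theorem aw_eq_zero : ∀ (n : ℕ) {X : ℕ → ℕ → Type v} [∀ p q, AddCommGroup (X p q)]
    [∀ p q, Module k (X p q)] (C : CylindricalOps k X) (x : X n n) (p q : ℕ), p + q ≠ n →
    aw n C x p q = 0 := by
  intro n
  induction n with
  | zero =>
    intro X _ _ C x p q h
    rcases p with _ | p
    · rw [aw_zero_zero, Pi.single_eq_of_ne (by omega)]
    · rfl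
  | succ n ih =>
    intro X _ _ C x p q h
    rcases p with _ | p
    · rw [aw_zero_zero, Pi.single_eq_of_ne (by omega)]
    · rw [aw_succ_succ]; exact ih C.decP _ p q (by omega)

section

variable {Y : ℕ → ℕ → Type v} [∀ p q, AddCommGroup (Y p q)] [∀ p q, Module k (Y p q)]

/-- Families of maps commuting with the faces that occur in the Alexander–Whitney map. -/
structure IsAWMap (C : CylindricalOps k X) (D : CylindricalOps k Y)
    (φ : ∀ p q, X p q →ₗ[k] Y p q) : Prop where
  h_d : ∀ p q x, φ p q ((C.h p).d q 0 x) = (D.h p).d q 0 (φ p (q + 1) x)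
  v_d : ∀ p q x, φ p q ((C.v q).d p (p + 1) x) = (D.v q).d p (p + 1) (φ (p + 1) q x)

variable {D : CylindricalOps k Y} {φ : ∀ p q, X p q →ₗ[k] Y p q}

theorem IsAWMap.decP (h : IsAWMap C D φ) : IsAWMap C.decP D.decP fun p q => φ (p + 1) q :=
  ⟨fun _ _ => h.h_d _ _, fun _ _ => h.v_d _ _⟩

theorem IsAWMap.vert (h : IsAWMap C D φ) (q : ℕ) : ∀ (p : ℕ) (x : X p q),
    φ 0 q (vert C q p x) = CylindricalOps.vert D q p (φ p q x)
  | 0, x => rfl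
  | p + 1, x => by rw [vert_succ, vert_succ, h.vert q p, h.v_d]

end

theorem aw_natural : ∀ (n : ℕ) {X Y : ℕ → ℕ → Type v} [∀ p q, AddCommGroup (X p q)]
    [∀ p q, Module k (X p q)] [∀ p q, AddCommGroup (Y p q)] [∀ p q, Module k (Y p q)]
    {C : CylindricalOps k X} {D : CylindricalOps k Y} {φ : ∀ p q, X p q →ₗ[k] Y p q},
    IsAWMap C D φ → ∀ (x : X n n) (p q : ℕ),
    φ p q (aw n C x p q) = aw n D (φ n n x) p q := by
  intro n
  induction n with
  | zero =>
    intro X Y _ _ _ _ C D φ h x p q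
    rcases p with _ | p
    · rw [aw_zero_zero, aw_zero_zero]
      rcases q with _ | q
      · rfl
      · rw [Pi.single_eq_of_ne (by omega), Pi.single_eq_of_ne (by omega), map_zero]
    · exact map_zero _
  | succ n ih =>
    intro X Y _ _ _ _ C D φ h x p q
    rcases p with _ | p
    · rw [aw_zero_zero, aw_zero_zero]
      rcases eq_or_ne q (n + 1) with rfl | hq
      · rw [Pi.single_eq_same, Pi.single_eq_same, h.vert]
      · rw [Pi.single_eq_of_ne hq, Pi.single_eq_of_ne hq, map_zero]
    · rw [aw_succ_succ, aw_succ_succ, ← h.h_d]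
      exact ih h.decP _ p q

theorem IsBiMap.isAWMap {Y : ℕ → ℕ → Type v} [∀ p q, AddCommGroup (Y p q)]
    [∀ p q, Module k (Y p q)] {D : CylindricalOps k Y} {φ : ∀ p q, X p q →ₗ[k] Y p q}
    (h : IsBiMap C D φ) : IsAWMap C D φ :=
  ⟨fun _ _ => h.h_d _ _ _ (by omega), fun _ _ => h.v_d _ _ _ (by omega)⟩

theorem IsBisimplicial.vert_h_d (H : C.IsBisimplicial) (q i : ℕ) (hi : i ≤ q + 1) :
    ∀ (p : ℕ) (x : X p (q + 1)), vert C q p ((C.h p).d q i x) = (C.h 0).d q i (vert C (q + 1) p x)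
  | 0, x => rfl
  | p + 1, x => by
    rw [vert_succ, vert_succ, ← H.d_d _ _ _ _ hi (by omega), H.vert_h_d q i hi p]

theorem IsBisimplicial.vert_h_s (H : C.IsBisimplicial) (q i : ℕ) (hi : i ≤ q) :
    ∀ (p : ℕ) (x : X p q), vert C (q + 1) p ((C.h p).s q i x) = (C.h 0).s q i (vert C q p x)
  | 0, x => rfl
  | p + 1, x => by
    rw [vert_succ, vert_succ, ← H.s_d _ _ _ _ hi (by omega), H.vert_h_s q i hi p]

theorem IsBisimplicial.vert_v_d (H : C.IsBisimplicial) (q : ℕ) :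
    ∀ (p i : ℕ), i ≤ p → ∀ (x : X (p + 1) q),
      vert C q p ((C.v q).d p (i + 1) x) = vert C q (p + 1) x
  | 0, i, hi, x => by rw [Nat.le_zero.mp hi]; rfl
  | p + 1, i, hi, x => by
    rw [vert_succ (p + 1)]
    rcases eq_or_lt_of_le hi with rfl | h
    · rfl
    · rw [vert_succ p, ← (H.v_simp _).d_d p (i + 1) (p + 1) (by omega) (by omega),
        H.vert_v_d q p i (by omega), vert_succ]

theorem IsBisimplicial.vert_v_s (H : C.IsBisimplicial) (q : ℕ) :
    ∀ (p i : ℕ), i ≤ p → ∀ (x : X p q), vert C q (p + 1) ((C.v q).s p i x) = vert C q p x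
  | p, i, hi, x => by
    rw [← H.vert_v_d q p i hi, (H.v_simp _).d_s_succ p i hi]

theorem IsBisimplicial.d_one_vert_decP (H : C.IsBisimplicial) (q : ℕ) :
    ∀ (p : ℕ) (x : X (p + 1) q), (C.v q).d 0 1 (vert C.decP q p x) = vert C q (p + 1) x
  | 0, x => rfl
  | p + 1, x => by
    rw [vert_succ, H.d_one_vert_decP q p, ← H.vert_v_d q (p + 1) (p + 1) le_rfl]

theorem IsBisimplicial.d_zero_vert_decP (H : C.IsBisimplicial) (q : ℕ) :
    ∀ (p : ℕ) (x : X (p + 1) q), (C.v q).d 0 0 (vert C.decP q p x) = vert C q p ((C.v q).d p 0 x)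
  | 0, x => rfl
  | p + 1, x => by
    rw [vert_succ, H.d_zero_vert_decP q p, vert_succ, (H.v_simp _).d_d p 0 (p + 1) (by omega) le_rfl]

theorem IsBisimplicial.isAWMap_s_zero (H : C.IsBisimplicial) :
    IsAWMap C C.decP fun p q => (C.v q).s p 0 where
  h_d p q x := (H.d_s _ _ _ _ (by omega) (by omega) x).symm
  v_d p q x := ((H.v_simp q).d_s_gt p (p + 1) 0 (by omega) le_rfl x).symm

end AlexanderWhitney

end CylindricalOps

/-! ### Shuffles and the Alexander–Whitney map on normalized chains -/

namespace CylindricalOps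

open ParacyclicOps

section AlexanderWhitney

variable {k : Type u} [CommRing k]

theorem IsBisimplicial.vert_diag_b {X : ℕ → ℕ → Type v} [∀ p q, AddCommGroup (X p q)]
    [∀ p q, Module k (X p q)] {C : CylindricalOps k X} (H : C.IsBisimplicial) (n : ℕ)
    (x : X (n + 1) (n + 1)) : vert C n n (C.diag.b n x) =
      (C.v n).b 0 (vert C.decP n n ((C.h (n + 1)).d n 0 x)) +
        (C.h 0).b n (vert C (n + 1) (n + 1) x) := by
  rw [b_zero_apply, H.d_one_vert_decP, H.d_zero_vert_decP, H.vert_h_d _ _ (by omega), b_apply,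
    b_apply, Finset.sum_range_succ', Finset.sum_range_succ' _ (n + 1), map_add, map_sum]
  have : ∀ i ∈ Finset.range (n + 1), vert C n n ((-1 : k) ^ (i + 1) • C.diag.d n (i + 1) x) =
      (-1 : k) ^ (i + 1) • (C.h 0).d n (i + 1) (vert C (n + 1) (n + 1) x) := by
    intro i hi
    rw [Finset.mem_range] at hi
    rw [map_smul, diag_d_apply, H.vert_v_d n n i (by omega), H.vert_h_d n (i + 1) (by omega)]
  rw [Finset.sum_congr rfl this, pow_zero, one_smul, one_smul, diag_d_apply]
  abel

theorem IsBisimplicial.aw_b_zero {X : ℕ → ℕ → Type v} [∀ p q, AddCommGroup (X p q)]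
    [∀ p q, Module k (X p q)] {C : CylindricalOps k X} (H : C.IsBisimplicial) (n : ℕ)
    (x : X (n + 1) (n + 1)) :
    aw n C (C.diag.b n x) 0 n = C.famDiff (aw (n + 1) C x) 0 n := by
  rw [aw_zero_zero, Pi.single_eq_same, famDiff_apply, aw_succ_succ, aw_zero_zero, aw_zero_zero,
    Pi.single_eq_same, Pi.single_eq_same, H.vert_diag_b, pow_zero, one_smul]

theorem IsBisimplicial.d_zero_diag_b {X : ℕ → ℕ → Type v} [∀ p q, AddCommGroup (X p q)]
    [∀ p q, Module k (X p q)] {C : CylindricalOps k X} (H : C.IsBisimplicial) (n : ℕ)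
    (x : X (n + 2) (n + 2)) : (C.h (n + 1)).d n 0 (C.diag.b (n + 1) x) =
      (C.v n).d (n + 1) 0 ((C.h (n + 2)).d n 0 ((C.h (n + 2)).d (n + 1) 0 x)) -
        C.decP.diag.b n ((C.h (n + 2)).d (n + 1) 0 x) := by
  rw [b_apply, Finset.sum_range_succ', map_add, map_sum, pow_zero, one_smul, diag_d_apply,
    H.d_d _ _ _ _ (by omega) (by omega), b_apply]
  refine (add_comm _ _).trans ?_
  rw [sub_eq_add_neg, ← Finset.sum_neg_distrib]
  congr 1
  refine Finset.sum_congr rfl fun i hi => ?_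
  rw [Finset.mem_range] at hi
  rw [map_smul, diag_d_apply, diag_d_apply, H.d_d _ _ _ _ (by omega) (by omega),
    (H.h_simp _).d_d n 0 i (by omega) (by omega), pow_succ, mul_neg_one, neg_smul]

/-- The Alexander–Whitney map is a chain map. -/
theorem aw_b : ∀ (n : ℕ) {X : ℕ → ℕ → Type v} [∀ p q, AddCommGroup (X p q)]
    [∀ p q, Module k (X p q)] {C : CylindricalOps k X}, C.IsBisimplicial →
    ∀ (x : X (n + 1) (n + 1)) (p q : ℕ),
      aw n C (C.diag.b n x) p q = C.famDiff (aw (n + 1) C x) p q := by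
  intro n
  induction n with
  | zero =>
    intro X _ _ C H x p q
    by_cases h : p + q = 0
    · obtain ⟨rfl, rfl⟩ : p = 0 ∧ q = 0 := by omega
      exact H.aw_b_zero 0 x
    · rw [aw_eq_zero _ _ _ _ _ h, famDiff_apply, aw_eq_zero _ _ _ _ _ (by omega),
        aw_eq_zero _ _ _ _ _ (by omega), map_zero, map_zero, smul_zero, add_zero]
  | succ n ih =>
    intro X _ _ C H x p q
    by_cases h : p + q = n + 1
    · rcases p with _ | p
      · obtain rfl : q = n + 1 := by omega
        exact H.aw_b_zero (n + 1) x
      · have h1 := ih H.decP ((C.h (n + 2)).d (n + 1) 0 x) p q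
        have h2 : (C.v q).d (p + 1) 0 (aw n C.decP.decP ((C.h (n + 2)).d n 0
            ((C.h (n + 2)).d (n + 1) 0 x)) p q) = aw n C.decP ((C.v n).d (n + 1) 0
            ((C.h (n + 2)).d n 0 ((C.h (n + 2)).d (n + 1) 0 x))) p q :=
          aw_natural n (C := C.decP.decP) (D := C.decP) (φ := fun p q => (C.v q).d (p + 1) 0)
            ⟨fun p q x => (H.d_d _ _ _ _ (by omega) (by omega) x).symm, fun p q x =>
              (H.v_simp q).d_d (p + 1) 0 (p + 2) (by omega) le_rfl x⟩ _ p q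
        rw [famDiff_apply] at h1
        rw [aw_succ_succ, H.d_zero_diag_b, map_sub, Pi.sub_apply, Pi.sub_apply, h1, famDiff_apply,
          aw_succ_succ, aw_succ_succ, aw_succ_succ, b_succ_apply, ← h2, aw_succ_succ]
        module
    · rw [aw_eq_zero _ _ _ _ _ h, famDiff_apply, aw_eq_zero _ _ _ _ _ (by omega),
        aw_eq_zero _ _ _ _ _ (by omega), map_zero, map_zero, smul_zero, add_zero]

theorem mem_degen_of_decP {X : ℕ → ℕ → Type v} [∀ p q, AddCommGroup (X p q)]
    [∀ p q, Module k (X p q)] {C : CylindricalOps k X} (p q : ℕ) (x : X (p + 1) q)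
    (hx : x ∈ C.decP.degen p q) : x ∈ C.degen (p + 1) q := by
  have h : C.decP.degen p q ≤ C.degen (p + 1) q := by
    refine sup_le_sup le_rfl ?_
    rcases p with _ | p
    · exact bot_le
    · exact fun x hx => degen_induction (P := (C.v q).dec)
        (p := fun x => x ∈ (C.v q).degen (p + 2)) (fun i hi x => s_mem_degen (by omega) _)
        (zero_mem _) (fun _ _ => add_mem) hx
  exact h hx

/-- The Alexander–Whitney map sends degenerate chains to degenerate families. -/
theorem aw_mem_degen : ∀ (n : ℕ) {X : ℕ → ℕ → Type v} [∀ p q, AddCommGroup (X p q)]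
    [∀ p q, Module k (X p q)] {C : CylindricalOps k X}, C.IsBisimplicial →
    ∀ x ∈ C.diag.degen n, ∀ p q, aw n C x p q ∈ C.degen p q := by
  intro n
  induction n with
  | zero =>
    intro X _ _ C H x hx p q
    have : x = 0 := by simpa [ParacyclicOps.degen] using hx
    rw [this, map_zero]; exact zero_mem _
  | succ n ih =>
    intro X _ _ C H x hx p q
    refine degen_induction (P := C.diag) (p := fun x => aw (n + 1) C x p q ∈ C.degen p q) ?_
      (by rw [map_zero]; exact zero_mem _)
      (fun x y hx hy => by rw [map_add]; exact add_mem hx hy) hx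
    intro i hi x
    rcases p with _ | p
    · rw [aw_zero_zero]
      rcases eq_or_ne q (n + 1) with rfl | hq
      · rw [Pi.single_eq_same, diag_s_apply, H.vert_v_s (n + 1) n i hi, H.vert_h_s n i hi]
        exact Submodule.mem_sup_left (s_mem_degen hi _)
      · rw [Pi.single_eq_of_ne hq]; exact zero_mem _
    · rw [aw_succ_succ, diag_s_apply, H.d_s _ _ _ _ (by omega) hi]
      rcases i with _ | i
      · rw [(H.h_simp _).d_s_self n 0 hi]
        have h := aw_natural n H.isAWMap_s_zero x p q
        rw [← h]
        exact Submodule.mem_sup_right (s_mem_degen (by omega) _)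
      · obtain ⟨n, rfl⟩ : ∃ m, n = m + 1 := ⟨n - 1, by omega⟩
        rw [(H.h_simp _).d_s_lt n 0 i (by omega) (by omega)]
        exact mem_degen_of_decP p q _ (ih H.decP _
          (s_mem_degen (P := C.decP.diag) (i := i) (by omega) _) p q)

/-- A simplicial module as a bisimplicial module that is constant in the `p`-direction. -/
abbrev const {Y : ℕ → Type v} [∀ n, AddCommGroup (Y n)] [∀ n, Module k (Y n)]
    (P : ParacyclicOps k Y) : CylindricalOps k fun _ q => Y q where
  h _ := P
  v _ := ⟨fun _ _ => LinearMap.id, fun _ _ => LinearMap.id, fun _ => 0⟩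

/-- For a constant `p`-direction only the shuffle without `p`-steps is nondegenerate. -/
theorem nabla_const_sub_mem : ∀ (n : ℕ) {Y : ℕ → Type v} [∀ n, AddCommGroup (Y n)]
    [∀ n, Module k (Y n)] (P : ParacyclicOps k Y) (x : ℕ → ∀ q, Y q),
    nabla n (const P) x - x 0 n ∈ P.degen n := by
  intro n
  induction n with
  | zero => intro Y _ _ P x; rw [nabla_zero, sub_self]; exact zero_mem _
  | succ n ih =>
    intro Y _ _ P x
    have h := ih P.dec ((const P).stepH x + (const P).stepV x)
    have h1 : nabla n (const P).dec ((const P).stepH x + (const P).stepV x) -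
        ((const P).stepH x + (const P).stepV x) 0 n ∈ P.degen (n + 1) := by
      rcases n with _ | n
      · have h' := h
        rw [show P.dec.degen 0 = ⊥ from rfl, Submodule.mem_bot] at h'
        exact h' ▸ zero_mem _
      · exact degen_induction (P := P.dec) (p := fun x => x ∈ P.degen (n + 2))
          (fun i hi x => s_mem_degen (by omega) _) (zero_mem _) (fun _ _ => add_mem) h
    have h2 : P.s n 0 (x 1 n) ∈ P.degen (n + 1) := s_mem_degen (by omega) _
    have h3 := add_mem h1 h2
    rw [nabla_succ]
    convert h3 using 1
    have h4 : ((const P).stepH x + (const P).stepV x) 0 n = P.s n 0 (x 1 n) + x 0 (n + 1) := by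
      simp [stepH_apply, stepV_apply]
    rw [h4]
    abel

/-- The Alexander–Whitney map is a left inverse of the shuffle map up to degenerate chains. -/
theorem aw_nabla_sub_mem : ∀ (n : ℕ) {X : ℕ → ℕ → Type v} [∀ p q, AddCommGroup (X p q)]
    [∀ p q, Module k (X p q)] {C : CylindricalOps k X}, C.IsBisimplicial →
    ∀ (x : ∀ p q, X p q) (p q : ℕ), p + q = n →
      aw n C (nabla n C x) p q - x p q ∈ C.degen p q := by
  intro n
  induction n with
  | zero =>
    intro X _ _ C H x p q h
    obtain ⟨rfl, rfl⟩ : p = 0 ∧ q = 0 := by omega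
    rw [aw_zero_zero, Pi.single_eq_same, nabla_zero, vert_zero, sub_self]
    exact zero_mem _
  | succ n ih =>
    intro X _ _ C H x p q h
    rcases p with _ | p
    · obtain rfl : q = n + 1 := by omega
      rw [aw_zero_zero, Pi.single_eq_same]
      have h1 : vert C (n + 1) (n + 1) (nabla (n + 1) C x) =
          nabla (n + 1) (const (C.h 0)) fun p q => vert C q p (x p q) :=
        nabla_natural (n + 1) (D := const (C.h 0)) (φ := fun p q => vert C q p)
          ⟨fun p q i hi x => H.vert_h_s q i hi p x, fun p q i hi x => H.vert_v_s q p i hi x⟩ x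
      rw [h1]
      exact Submodule.mem_sup_left
        (nabla_const_sub_mem (n + 1) (C.h 0) fun p q => vert C q p (x p q))
    · have h1 : (C.h (n + 1)).d n 0 (nabla (n + 1) C x) = nabla n C.decP (fun p q => x (p + 1) q +
          (-1 : k) ^ p • (C.v q).s p 0 ((C.h p).d q 0 (x p (q + 1)))) := by
        rw [nabla_succ]
        refine (nabla_natural n (C := C.dec) (D := C.decP) (φ := fun p q => (C.h (p + 1)).d q 0)
          ⟨fun p q i hi x => (H.h_simp _).d_s_lt q 0 i (by omega) hi x,
            fun p q i hi x => H.d_s _ _ _ _ (by omega) (by omega) x⟩ _).trans ?_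
        congr 1
        funext p q
        rw [Pi.add_apply, Pi.add_apply, map_add, stepH_apply, stepV_apply, map_smul,
          (H.h_simp _).d_s_self q 0 (by omega), H.d_s _ _ _ _ (by omega) (by omega)]
      rw [aw_succ_succ, h1]
      have h2 := mem_degen_of_decP p q _ (ih H.decP (fun p q => x (p + 1) q +
          (-1 : k) ^ p • (C.v q).s p 0 ((C.h p).d q 0 (x p (q + 1)))) p q (by omega))
      have h3 : (-1 : k) ^ p • (C.v q).s p 0 ((C.h p).d q 0 (x p (q + 1))) ∈ C.degen (p + 1) q :=
        Submodule.smul_mem _ _ (Submodule.mem_sup_right (s_mem_degen (by omega) _))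
      convert add_mem h2 h3 using 1
      abel

/-- The composite of the shuffle map and the Alexander–Whitney map, minus the identity. -/
def shuffleSub : DiagEnd.{u, v} k := fun n _ _ _ C => nabla n C ∘ₗ aw n C - LinearMap.id

theorem shuffleSub_apply (n : ℕ) {X : ℕ → ℕ → Type v} [∀ p q, AddCommGroup (X p q)]
    [∀ p q, Module k (X p q)] (C : CylindricalOps k X) (x : X n n) :
    shuffleSub n C x = nabla n C (aw n C x) - x := rfl

theorem shuffleSub_natural : DiagEnd.IsNatural.{u, v} (k := k) shuffleSub := by
  intro n X Y _ _ _ _ C D hC hD φ hφ x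
  rw [shuffleSub_apply, shuffleSub_apply, map_sub, nabla_natural n hφ.toIsDegMap]
  congr 2
  funext p q
  exact aw_natural n hφ.isAWMap x p q

theorem shuffleSub_isChainMap : DiagEnd.IsChainMap.{u, v} (k := k) shuffleSub := by
  intro n X _ _ C hC x
  rw [shuffleSub_apply, shuffleSub_apply, map_sub, nabla_b n hC]
  congr 2
  funext p q
  exact aw_b n hC x p q

theorem shuffleSub_preservesDegen : DiagEnd.PreservesDegen.{u, v} (k := k) shuffleSub :=
  fun n _ _ _ _ hC x hx =>
    sub_mem (nabla_mem_degen n hC _ (aw_mem_degen n hC x hx)) hx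

theorem shuffleSub_zero {X : ℕ → ℕ → Type v} [∀ p q, AddCommGroup (X p q)]
    [∀ p q, Module k (X p q)] (C : CylindricalOps k X) (x : X 0 0) : shuffleSub 0 C x = 0 := by
  rw [shuffleSub_apply, nabla_zero, aw_zero_zero, Pi.single_eq_same, vert_zero, sub_self]

/-- The normalization projector minus the identity. -/
def normSub : DiagEnd.{u, v} k := fun n _ _ _ C => normProj n C - LinearMap.id

theorem normSub_apply (n : ℕ) {X : ℕ → ℕ → Type v} [∀ p q, AddCommGroup (X p q)]
    [∀ p q, Module k (X p q)] (C : CylindricalOps k X) (x : X n n) :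
    normSub n C x = normProj n C x - x := rfl

theorem normSub_natural : DiagEnd.IsNatural.{u, v} (k := k) normSub := by
  intro n X Y _ _ _ _ C D hC hD φ hφ x
  rw [normSub_apply, normSub_apply, map_sub, normProj_natural n hC hD hφ]

theorem normSub_isChainMap : DiagEnd.IsChainMap.{u, v} (k := k) normSub := by
  intro n X _ _ C hC x
  rw [normSub_apply, normSub_apply, map_sub, normProj_isChainMap n hC]

end AlexanderWhitney

end CylindricalOps

/-! ### Partial boundaries of cyclic rotations -/

namespace ParacyclicOps

variable {k : Type u} [CommRing k] {X : ℕ → Type v}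
  [∀ n, AddCommGroup (X n)] [∀ n, Module k (X n)] (P : ParacyclicOps k X)

/-- The part `∑_{i ≤ a} (-1)^i d_i` of the boundary `b`. -/
def bLe (a n : ℕ) : X (n + 1) →ₗ[k] X n := ∑ i ∈ Finset.range (a + 1), P.sd n i

theorem bLe_apply (a n : ℕ) (x : X (n + 1)) :
    P.bLe a n x = ∑ i ∈ Finset.range (a + 1), P.sd n i x := by simp [bLe]

theorem bLe_zero (n : ℕ) (x : X (n + 1)) : P.bLe 0 n x = P.d n 0 x := by simp [bLe, sd]

theorem b_eq_sum_sd (n : ℕ) (x : X (n + 1)) :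
    P.b n x = ∑ i ∈ Finset.range (n + 2), P.sd n i x := by simp [b, sd]

theorem bLe_succ (a n : ℕ) (x : X (n + 2)) :
    P.bLe (a + 1) (n + 1) x = P.d (n + 1) 0 x - P.dec.bLe a n x := by
  rw [bLe_apply, bLe_apply, Finset.sum_range_succ', sub_eq_neg_add, ← Finset.sum_neg_distrib]
  simp [sd, pow_succ]

variable {P}

theorem IsSimplicial.dec_bLe_s_zero (h : P.IsSimplicial) (a n : ℕ) (ha : a ≤ n) (x : X (n + 1)) :
    P.dec.bLe a n (P.s (n + 1) 0 x) = x - P.s n 0 (P.d n 0 x - P.bLe a n x) := by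
  simp only [bLe_apply, sd, LinearMap.smul_apply]
  rw [Finset.sum_range_succ', Finset.sum_range_succ' _ a, pow_zero,
    one_smul, one_smul, h.d_s_succ (n + 1) 0 (by omega), sub_add_cancel_right, map_neg,
    sub_neg_eq_add, map_sum]
  refine (add_comm _ _).trans (congrArg _ (Finset.sum_congr rfl fun i hi => ?_))
  rw [map_smul, h.d_s_gt n (i + 1) 0 (by omega) (by simp at hi; omega)]

theorem IsParacyclic.d_extra_last (h : P.IsParacyclic) (n : ℕ) (x : X n) :
    P.d n (n + 1) (P.extra n x) = P.t n x := by
  rw [← h.d_t_zero, extra, LinearMap.comp_apply, ← h.s_t_zero, h.d_s_self n 0 (by omega)]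

theorem IsParacyclic.sd_extra_last (h : P.IsParacyclic) (n : ℕ) (x : X n) :
    P.sd n (n + 1) (P.extra n x) = - P.st n x := by
  rw [sd, LinearMap.smul_apply, h.d_extra_last, st, LinearMap.smul_apply, pow_succ, mul_neg_one,
    neg_smul]

theorem IsParacyclic.sd_extra_succ (h : P.IsParacyclic) (n i : ℕ) (hi : i ≤ n) (x : X (n + 1)) :
    P.sd (n + 1) (i + 1) (P.extra (n + 1) x) = - P.extra n (P.sd n i x) := by
  rw [sd, LinearMap.smul_apply, h.d_extra_succ n i hi, sd, LinearMap.smul_apply, map_smul,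
    pow_succ, mul_neg_one, neg_smul]

theorem IsParacyclic.bLe_extra (h : P.IsParacyclic) (a n : ℕ) (ha : a ≤ n + 1) (x : X (n + 1)) :
    P.bLe a (n + 1) (P.extra (n + 1) x) =
      x - P.extra n (∑ i ∈ Finset.range a, P.sd n i x) := by
  rw [bLe_apply, Finset.sum_range_succ', map_sum, sub_eq_neg_add, ← Finset.sum_neg_distrib]
  congr 1
  · refine Finset.sum_congr rfl fun i hi => h.sd_extra_succ n i ?_ x
    rw [Finset.mem_range] at hi; omega
  · simp [sd, h.d_extra_zero]

theorem IsParacyclic.b_extra (h : P.IsParacyclic) (n : ℕ) (x : X (n + 1)) :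
    P.b (n + 1) (P.extra (n + 1) x) =
      x - P.extra n (∑ i ∈ Finset.range (n + 1), P.sd n i x) - P.st (n + 1) x := by
  rw [← h.bLe_extra (n + 1) n le_rfl, bLe_apply, b_eq_sum_sd, Finset.sum_range_succ _ (n + 2),
    h.sd_extra_last, sub_eq_add_neg]

theorem IsParacyclic.b_extra_zero (h : P.IsParacyclic) (x : X 0) :
    P.b 0 (P.extra 0 x) = x - P.st 0 x := by
  rw [b_eq_sum_sd, Finset.sum_range_succ, h.sd_extra_last, Finset.sum_range_one, sd,
    LinearMap.smul_apply, h.d_extra_zero, pow_zero, one_smul, sub_eq_add_neg]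

/-- The faces of `t̂^(a+1) x` up to `a` and the faces of `t̂^a x` from `a` on, where `t̂` is the signed
cyclic operator, make up the boundary of `x`. -/
theorem IsParacyclic.sum_sd_st_pow (h : P.IsParacyclic) (n a : ℕ) (ha : a ≤ n) (x : X (n + 1)) :
    ∑ i ∈ Finset.range (a + 1), P.sd n i ((P.st (n + 1) ^ (a + 1)) x) +
      (∑ i ∈ Finset.range (n + 1), P.sd n i ((P.st (n + 1) ^ a) x) -
        ∑ i ∈ Finset.range a, P.sd n i ((P.st (n + 1) ^ a) x)) = (P.st n ^ a) (P.b n x) := by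
  have h1 : ∀ (f : ℕ → X n) (r s t : ℕ), r = s + t →
      ∑ i ∈ Finset.range r, f i = ∑ i ∈ Finset.range s, f i + ∑ i ∈ Finset.range t, f (s + i) := by
    rintro f _ s t rfl; exact Finset.sum_range_add _ _ _
  rw [h1 _ (n + 1) a (n + 1 - a) (by omega), add_sub_cancel_left, b_eq_sum_sd,
    h1 _ (n + 2) (n + 1 - a) (a + 1) (by omega), map_add, map_sum, map_sum]
  refine (add_comm _ _).trans (congrArg₂ _ ?_ ?_)
  · refine Finset.sum_congr rfl fun i hi => ?_
    rw [Finset.mem_range] at hi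
    rw [h.sd_st_pow_le n a (a + i) (by omega) (by omega), Nat.add_sub_cancel_left]
  · refine Finset.sum_congr rfl fun i hi => ?_
    rw [Finset.mem_range] at hi
    rw [h.sd_st_pow_gt n i a (by omega) (by omega) (by omega)]
    congr 3
    omega

/-- The boundaries of the elements `σ t̂^a x`, split into an initial and a final part, telescope. -/
theorem IsParacyclic.sum_bLe_extra (h : P.IsParacyclic) {Z : Type w} [AddCommGroup Z] [Module k Z]
    (n : ℕ) (Φ : ℕ → X (n + 1) →ₗ[k] Z) (x : X (n + 1)) :
    ∑ a ∈ Finset.range (n + 2), (Φ a (P.bLe a (n + 1) (P.extra (n + 1) ((P.st (n + 1) ^ a) x))) +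
      Φ (a + 1) (P.b (n + 1) (P.extra (n + 1) ((P.st (n + 1) ^ a) x)) -
        P.bLe a (n + 1) (P.extra (n + 1) ((P.st (n + 1) ^ a) x)))) =
    Φ 0 x - Φ (n + 2) ((P.st (n + 1) ^ (n + 2)) x) -
      ∑ a ∈ Finset.range (n + 1), Φ (a + 1) (P.extra n ((P.st n ^ a) (P.b n x))) := by
  have h1 : ∀ a ∈ Finset.range (n + 2),
      (Φ a (P.bLe a (n + 1) (P.extra (n + 1) ((P.st (n + 1) ^ a) x))) +
      Φ (a + 1) (P.b (n + 1) (P.extra (n + 1) ((P.st (n + 1) ^ a) x)) -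
        P.bLe a (n + 1) (P.extra (n + 1) ((P.st (n + 1) ^ a) x)))) =
      ((Φ a ((P.st (n + 1) ^ a) x) - Φ (a + 1) ((P.st (n + 1) ^ (a + 1)) x)) -
      Φ a (P.extra n (∑ i ∈ Finset.range a, P.sd n i ((P.st (n + 1) ^ a) x)))) -
      Φ (a + 1) (P.extra n (∑ i ∈ Finset.range (n + 1), P.sd n i ((P.st (n + 1) ^ a) x) -
        ∑ i ∈ Finset.range a, P.sd n i ((P.st (n + 1) ^ a) x))) := by
    intro a ha
    rw [Finset.mem_range] at ha
    rw [h.bLe_extra a n (by omega), h.b_extra, pow_succ', Module.End.mul_apply]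
    simp only [map_sub]
    abel
  rw [Finset.sum_congr rfl h1, Finset.sum_sub_distrib, Finset.sum_sub_distrib,
    Finset.sum_range_sub' (fun a => Φ a ((P.st (n + 1) ^ a) x)), Finset.sum_range_succ' (fun a =>
      Φ a (P.extra n (∑ i ∈ Finset.range a, P.sd n i ((P.st (n + 1) ^ a) x)))),
    Finset.sum_range_succ (fun a => Φ (a + 1) (P.extra n (∑ i ∈ Finset.range (n + 1),
      P.sd n i ((P.st (n + 1) ^ a) x) - ∑ i ∈ Finset.range a, P.sd n i ((P.st (n + 1) ^ a) x)))),
    sub_self, map_zero, map_zero, add_zero, Finset.sum_range_zero, map_zero, map_zero, add_zero,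
    sub_sub, ← Finset.sum_add_distrib]
  congr 1
  refine Finset.sum_congr rfl fun a ha => ?_
  rw [Finset.mem_range] at ha
  rw [← map_add, ← map_add, h.sum_sd_st_pow n a (by omega)]

theorem IsParacyclic.bLe_extra_zero (h : P.IsParacyclic) {Z : Type w} [AddCommGroup Z] [Module k Z]
    (Φ : ℕ → X 0 →ₗ[k] Z) (x : X 0) :
    ∑ a ∈ Finset.range 1, (Φ a (P.bLe a 0 (P.extra 0 ((P.st 0 ^ a) x))) +
      Φ (a + 1) (P.b 0 (P.extra 0 ((P.st 0 ^ a) x)) - P.bLe a 0 (P.extra 0 ((P.st 0 ^ a) x)))) =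
    Φ 0 x - Φ 1 ((P.st 0 ^ 1) x) := by
  rw [Finset.sum_range_one, pow_zero, Module.End.one_apply, bLe_zero, h.d_extra_zero,
    h.b_extra_zero, sub_sub_cancel_left, map_neg, pow_one, sub_eq_add_neg]

end ParacyclicOps

namespace CylindricalOps

open ParacyclicOps

/-! ### Restricted shuffles -/

section Single

variable {k : Type u} [CommRing k] {X : ℕ → ℕ → Type v}
  [∀ p q, AddCommGroup (X p q)] [∀ p q, Module k (X p q)] (C : CylindricalOps k X)

variable (k) in
/-- The family with the single entry `y` at `(p, q)`. -/
def sgl (p q : ℕ) : X p q →ₗ[k] ∀ p q, X p q :=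
  LinearMap.single k (fun p => ∀ q, X p q) p ∘ₗ LinearMap.single k (X p) q

theorem sgl_same (p q : ℕ) (y : X p q) : sgl k p q y p q = y := by simp [sgl]

theorem sgl_ne {p q p' q' : ℕ} (y : X p q) (h : ¬ (p' = p ∧ q' = q)) : sgl k p q y p' q' = 0 := by
  by_cases hp : p' = p
  · subst hp
    have hq : q' ≠ q := fun e => h ⟨rfl, e⟩
    simp [sgl, Pi.single_eq_of_ne hq]
  · simp [sgl, Pi.single_eq_of_ne hp]

theorem eq_sgl {p q : ℕ} {y : X p q} {f : ∀ p q, X p q} (h : f p q = y)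
    (h0 : ∀ p' q', ¬ (p' = p ∧ q' = q) → f p' q' = 0) : f = sgl k p q y := by
  funext p' q'
  by_cases e : p' = p ∧ q' = q
  · obtain ⟨rfl, rfl⟩ := e; rw [sgl_same, h]
  · rw [sgl_ne y e, h0 _ _ e]

theorem stepH_sgl_succ (p q : ℕ) (y : X (p + 1) q) :
    C.stepH (sgl k (p + 1) q y) = sgl k (X := fun p q => X (p + 1) (q + 1)) p q
      ((C.h (p + 1)).s q 0 y) := by
  refine eq_sgl (by rw [stepH_apply, sgl_same]) fun p' q' h => ?_
  rw [stepH_apply, sgl_ne y (by omega), map_zero]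

theorem stepH_sgl_zero (q : ℕ) (y : X 0 q) : C.stepH (sgl k 0 q y) = 0 := by
  funext p' q'
  rw [stepH_apply, sgl_ne y (by omega), map_zero]; rfl

theorem stepV_sgl_succ (p q : ℕ) (y : X p (q + 1)) :
    C.stepV (sgl k p (q + 1) y) = (-1 : k) ^ p • sgl k (X := fun p q => X (p + 1) (q + 1)) p q
      ((C.v (q + 1)).s p 0 y) := by
  rw [← map_smul]
  refine eq_sgl (by rw [stepV_apply, sgl_same]) fun p' q' h => ?_
  rw [stepV_apply, sgl_ne y (by omega), map_zero, smul_zero]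

theorem stepV_sgl_zero (p : ℕ) (y : X p 0) : C.stepV (sgl k p 0 y) = 0 := by
  funext p' q'
  rw [stepV_apply, sgl_ne y (by omega), map_zero, smul_zero]; rfl

theorem famDiff_sgl_succ (p q : ℕ) (y : X (p + 1) (q + 1)) :
    C.famDiff (sgl k (p + 1) (q + 1) y) = sgl k p (q + 1) ((C.v (q + 1)).b p y) +
      (-1 : k) ^ (p + 1) • sgl k (p + 1) q ((C.h (p + 1)).b q y) := by
  funext p' q'
  rw [famDiff_apply, Pi.add_apply, Pi.add_apply, Pi.smul_apply, Pi.smul_apply]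
  congr 1
  · by_cases h : p' = p ∧ q' = q + 1
    · obtain ⟨rfl, rfl⟩ := h
      rw [sgl_same, sgl_same]
    · rw [sgl_ne _ (by omega), sgl_ne _ h, map_zero]
  · by_cases h : p' = p + 1 ∧ q' = q
    · obtain ⟨rfl, rfl⟩ := h
      rw [sgl_same, sgl_same]
    · rw [sgl_ne _ (by omega), sgl_ne _ h, map_zero, smul_zero, smul_zero]

theorem famDiff_sgl_zero (q : ℕ) (y : X 0 (q + 1)) :
    C.famDiff (sgl k 0 (q + 1) y) = sgl k 0 q ((C.h 0).b q y) := by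
  refine eq_sgl ?_ fun p' q' h => ?_
  · rw [famDiff_apply, sgl_ne _ (by omega), map_zero, zero_add, sgl_same, pow_zero, one_smul]
  · rw [famDiff_apply, sgl_ne _ (by omega), sgl_ne _ (by omega), map_zero, map_zero, smul_zero,
      add_zero]

end Single

section Restricted

variable {k : Type u} [CommRing k]

/-- The sum of the shuffles in which the `a`-th step in the `p`-direction comes before the `c`-th step in
the `q`-direction, by recursion on the first step. It is the full shuffle map for `a = 0`, and it
vanishes for `c = 0 < a`. -/
def shuf : ∀ (n a c : ℕ) {X : ℕ → ℕ → Type v} [∀ p q, AddCommGroup (X p q)]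
    [∀ p q, Module k (X p q)], CylindricalOps k X → ((∀ p q, X p q) →ₗ[k] X n n)
  | n, 0, _, _, _, _, C => nabla n C
  | _, _ + 1, 0, _, _, _, _ => 0
  | 0, _ + 1, _ + 1, _, _, _, _ => 0
  | n + 1, a + 1, c + 1, _, _, _, C =>
    shuf n a (c + 1) C.dec ∘ₗ C.stepH + shuf n (a + 1) c C.dec ∘ₗ C.stepV

/-- The sum of the shuffles passing through the diagonal of the square in position `(a, c)`: first
`a` steps in the one direction and `c` steps in the other one, in any order, then the diagonal of
that square, and then an arbitrary shuffle. -/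
def corner : ∀ (n a c : ℕ) {X : ℕ → ℕ → Type v} [∀ p q, AddCommGroup (X p q)]
    [∀ p q, Module k (X p q)], CylindricalOps k X → ((∀ p q, X p q) →ₗ[k] X n n)
  | 0, _, _, _, _, _, _ => 0
  | n + 1, 0, 0, X, _, _, C => nabla n C.dec ∘ₗ LinearMap.pi fun p => LinearMap.pi fun q =>
      (-1 : k) ^ p • (LinearMap.proj (φ := X (p + 1)) (q + 1) ∘ₗ LinearMap.proj (p + 1))
  | n + 1, a + 1, 0, _, _, _, C => corner n a 0 C.dec ∘ₗ C.stepH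
  | n + 1, 0, c + 1, _, _, _, C => corner n 0 c C.dec ∘ₗ C.stepV
  | n + 1, a + 1, c + 1, _, _, _, C =>
    corner n a (c + 1) C.dec ∘ₗ C.stepH + corner n (a + 1) c C.dec ∘ₗ C.stepV

section

variable {X : ℕ → ℕ → Type v} [∀ p q, AddCommGroup (X p q)] [∀ p q, Module k (X p q)]
  {C : CylindricalOps k X} (n a c : ℕ) (x : ∀ p q, X p q)

theorem shuf_zero : shuf n 0 c C x = nabla n C x := by
  rcases n with _ | n <;> rfl

theorem shuf_succ_zero : shuf n (a + 1) 0 C x = 0 := by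
  rcases n with _ | n <;> rfl

theorem shuf_succ : shuf (n + 1) (a + 1) (c + 1) C x =
    shuf n a (c + 1) C.dec (C.stepH x) + shuf n (a + 1) c C.dec (C.stepV x) := rfl

theorem corner_zero : corner (n + 1) 0 0 C x = nabla n C.dec
    fun p q => (-1 : k) ^ p • x (p + 1) (q + 1) := rfl

theorem corner_succ_zero : corner (n + 1) (a + 1) 0 C x = corner n a 0 C.dec (C.stepH x) := rfl

theorem corner_zero_succ : corner (n + 1) 0 (c + 1) C x = corner n 0 c C.dec (C.stepV x) := rfl

theorem corner_succ : corner (n + 1) (a + 1) (c + 1) C x =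
    corner n a (c + 1) C.dec (C.stepH x) + corner n (a + 1) c C.dec (C.stepV x) := rfl

end

theorem shuf_natural : ∀ (n a c : ℕ) {X Y : ℕ → ℕ → Type v} [∀ p q, AddCommGroup (X p q)]
    [∀ p q, Module k (X p q)] [∀ p q, AddCommGroup (Y p q)] [∀ p q, Module k (Y p q)]
    {C : CylindricalOps k X} {D : CylindricalOps k Y} {φ : ∀ p q, X p q →ₗ[k] Y p q},
    IsDegMap C D φ → ∀ x : ∀ p q, X p q,
    φ n n (shuf n a c C x) = shuf n a c D fun p q => φ p q (x p q) := by
  intro n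
  induction n with
  | zero =>
    intro a c X Y _ _ _ _ C D φ hφ x
    rcases a with _ | a
    · rfl
    · rcases c with _ | c <;> exact map_zero _
  | succ n ih =>
    intro a c X Y _ _ _ _ C D φ hφ x
    rcases a with _ | a
    · rw [shuf_zero, shuf_zero]; exact nabla_natural (n + 1) hφ x
    rcases c with _ | c
    · exact map_zero _
    rw [shuf_succ, shuf_succ, map_add, ih _ _ hφ.dec, ih _ _ hφ.dec, stepH_map hφ, stepV_map hφ]

theorem corner_natural : ∀ (n a c : ℕ) {X Y : ℕ → ℕ → Type v} [∀ p q, AddCommGroup (X p q)]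
    [∀ p q, Module k (X p q)] [∀ p q, AddCommGroup (Y p q)] [∀ p q, Module k (Y p q)]
    {C : CylindricalOps k X} {D : CylindricalOps k Y} {φ : ∀ p q, X p q →ₗ[k] Y p q},
    IsDegMap C D φ → ∀ x : ∀ p q, X p q,
    φ n n (corner n a c C x) = corner n a c D fun p q => φ p q (x p q) := by
  intro n
  induction n with
  | zero => intros; exact map_zero _
  | succ n ih =>
    intro a c X Y _ _ _ _ C D φ hφ x
    rcases a with _ | a <;> rcases c with _ | c
    · rw [corner_zero, corner_zero, nabla_natural n hφ.dec]
      congr 1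
      funext p q
      exact map_smul _ _ _
    · rw [corner_zero_succ, corner_zero_succ, ih _ _ hφ.dec, stepV_map hφ]
    · rw [corner_succ_zero, corner_succ_zero, ih _ _ hφ.dec, stepH_map hφ]
    · rw [corner_succ, corner_succ, map_add, ih _ _ hφ.dec, ih _ _ hφ.dec, stepH_map hφ,
        stepV_map hφ]

theorem shuf_mem_degen : ∀ (n a c : ℕ) {X : ℕ → ℕ → Type v} [∀ p q, AddCommGroup (X p q)]
    [∀ p q, Module k (X p q)] {C : CylindricalOps k X}, C.IsBisimplicial →
    ∀ x : ∀ p q, X p q, (∀ p q, x p q ∈ C.degen p q) → shuf n a c C x ∈ C.diag.degen n := by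
  intro n
  induction n with
  | zero =>
    intro a c X _ _ C H x hx
    rcases a with _ | a
    · exact nabla_mem_degen 0 H x hx
    · rcases c with _ | c <;> exact zero_mem _
  | succ n ih =>
    intro a c X _ _ C H x hx
    rcases a with _ | a
    · rw [shuf_zero]; exact nabla_mem_degen (n + 1) H x hx
    rcases c with _ | c
    · rw [shuf_succ_zero]; exact zero_mem _
    obtain ⟨u, z, hu, h⟩ := exists_split (C := C) (y := C.stepH x) fun p q =>
      (H.s_zero_mem p q).1 _ (hx _ _)
    obtain ⟨u', z', hu', h'⟩ := exists_split (C := C) (y := C.stepV x) fun p q =>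
      Submodule.smul_mem _ _ ((H.s_zero_mem p q).2 _ (hx _ _))
    rw [shuf_succ, h, h', map_add, map_add, ← shuf_natural n _ _ H.isDegMap_s_zero,
      ← shuf_natural n _ _ H.isDegMap_s_zero]
    exact add_mem (add_mem (mem_degen_of_mem_dec n _ (ih _ _ H.dec u hu)) (s_mem_degen (by omega) _))
      (add_mem (mem_degen_of_mem_dec n _ (ih _ _ H.dec u' hu')) (s_mem_degen (by omega) _))

/-- A shuffle has no more steps in a direction than the degree allows. -/
theorem shuf_eq_zero : ∀ (n a c : ℕ) {X : ℕ → ℕ → Type v} [∀ p q, AddCommGroup (X p q)]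
    [∀ p q, Module k (X p q)] (C : CylindricalOps k X) (p q : ℕ) (y : X p q), p ≤ a →
    shuf n (a + 1) c C (sgl k p q y) = 0 := by
  intro n
  induction n with
  | zero => intro a c X _ _ C p q y h; rcases c with _ | c <;> rfl
  | succ n ih =>
    intro a c X _ _ C p q y h
    rcases c with _ | c
    · rfl
    have h1 : shuf n (a + 1) c C.dec (C.stepV (sgl k p q y)) = 0 := by
      rcases q with _ | q
      · rw [stepV_sgl_zero, map_zero]
      · rw [stepV_sgl_succ, map_smul, ih a c C.dec p q _ h, smul_zero]
    rw [shuf_succ, h1, add_zero]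
    rcases p with _ | p
    · rw [stepH_sgl_zero, map_zero]
    · obtain ⟨a, rfl⟩ : ∃ b, a = b + 1 := ⟨a - 1, by omega⟩
      rw [stepH_sgl_succ, ih a _ C.dec p q _ (by omega)]

theorem shuf_eq_nabla : ∀ (n a c : ℕ) {X : ℕ → ℕ → Type v} [∀ p q, AddCommGroup (X p q)]
    [∀ p q, Module k (X p q)] (C : CylindricalOps k X) (p q : ℕ) (y : X p q), a ≤ p → q < c →
    p + q = n → shuf n a c C (sgl k p q y) = nabla n C (sgl k p q y) := by
  intro n
  induction n with
  | zero =>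
    intro a c X _ _ C p q y h hq hn
    obtain rfl : a = 0 := by omega
    rfl
  | succ n ih =>
    intro a c X _ _ C p q y h hq hn
    rcases a with _ | a
    · rw [shuf_zero]
    obtain ⟨c, rfl⟩ : ∃ b, c = b + 1 := ⟨c - 1, by omega⟩
    obtain ⟨p, rfl⟩ : ∃ b, p = b + 1 := ⟨p - 1, by omega⟩
    rw [shuf_succ, nabla_succ, map_add, stepH_sgl_succ, ih a (c + 1) C.dec p q _ (by omega) hq
      (by omega)]
    congr 1
    rcases q with _ | q
    · rw [stepV_sgl_zero, map_zero, map_zero]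
    · rw [stepV_sgl_succ, map_smul, map_smul, ih (a + 1) c C.dec (p + 1) q _ (by omega) (by omega)
        (by omega)]

end Restricted

end CylindricalOps

/-! ### The boundary of a restricted shuffle -/

namespace CylindricalOps

open ParacyclicOps

section Restricted

variable {k : Type u} [CommRing k]

section

variable {X : ℕ → ℕ → Type v} [∀ p q, AddCommGroup (X p q)] [∀ p q, Module k (X p q)]
  {C : CylindricalOps k X}

theorem shuf_sgl (n a c p q : ℕ) (y : X (p + 1) (q + 1)) :
    shuf (n + 1) (a + 1) (c + 1) C (sgl k (p + 1) (q + 1) y) =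
      shuf n a (c + 1) C.dec (sgl k (X := fun p q => X (p + 1) (q + 1)) p (q + 1)
        ((C.h (p + 1)).s (q + 1) 0 y)) +
      (-1 : k) ^ (p + 1) • shuf n (a + 1) c C.dec (sgl k (X := fun p q => X (p + 1) (q + 1))
        (p + 1) q ((C.v (q + 1)).s (p + 1) 0 y)) := by
  rw [shuf_succ, stepH_sgl_succ, stepV_sgl_succ, map_smul]

theorem shuf_sgl_zero_left (n a c q : ℕ) (y : X 0 (q + 1)) :
    shuf (n + 1) (a + 1) (c + 1) C (sgl k 0 (q + 1) y) =
      shuf n (a + 1) c C.dec (sgl k (X := fun p q => X (p + 1) (q + 1))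
        0 q ((C.v (q + 1)).s 0 0 y)) := by
  rw [shuf_succ, stepH_sgl_zero, stepV_sgl_succ, map_zero, zero_add, pow_zero, one_smul]

theorem shuf_sgl_zero_right (n a c p : ℕ) (y : X (p + 1) 0) :
    shuf (n + 1) (a + 1) (c + 1) C (sgl k (p + 1) 0 y) =
      shuf n a (c + 1) C.dec (sgl k (X := fun p q => X (p + 1) (q + 1)) p 0
        ((C.h (p + 1)).s 0 0 y)) := by
  rw [shuf_succ, stepH_sgl_succ, stepV_sgl_zero, map_zero, add_zero]

theorem IsDegMap.shuf_sgl {Y : ℕ → ℕ → Type v} [∀ p q, AddCommGroup (Y p q)]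
    [∀ p q, Module k (Y p q)] {D : CylindricalOps k Y} {φ : ∀ p q, X p q →ₗ[k] Y p q}
    (hφ : IsDegMap C D φ) (n a c p q : ℕ) (y : X p q) :
    φ n n (shuf n a c C (sgl k p q y)) = shuf n a c D (sgl k p q (φ p q y)) := by
  rw [shuf_natural n a c hφ]
  congr 1
  refine eq_sgl (by rw [sgl_same]) fun p' q' h => by rw [sgl_ne _ h, map_zero]

theorem corner_zero_sgl (n p q : ℕ) (y : X (p + 1) (q + 1)) :
    corner (n + 1) 0 0 C (sgl k (p + 1) (q + 1) y) = (-1 : k) ^ p • nabla n C.dec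
      (sgl k (X := fun p q => X (p + 1) (q + 1)) p q y) := by
  rw [corner_zero, ← map_smul, ← map_smul]
  congr 1
  refine eq_sgl (by rw [sgl_same]) fun p' q' h => by rw [sgl_ne _ (by omega), smul_zero]

theorem nabla_zero_sgl (p q : ℕ) (h : p + q ≠ 0) (y : X p q) : nabla 0 C (sgl k p q y) = 0 := by
  rw [nabla_zero, sgl_ne _ (by omega)]

theorem shuf_zero_sgl (a c p q : ℕ) (h : p + q ≠ 0) (y : X p q) :
    shuf 0 a c C (sgl k p q y) = 0 := by
  rcases a with _ | a
  · rw [shuf_zero, nabla_zero_sgl p q h]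
  · rcases c with _ | c <;> rfl

end

set_option maxHeartbeats 1000000 in
/-- The boundary of a restricted shuffle. The faces that merge steps across the boundary of the
restriction leave the shuffles through a corner. -/
theorem shuf_b : ∀ (n a c : ℕ) {X : ℕ → ℕ → Type v} [∀ p q, AddCommGroup (X p q)]
    [∀ p q, Module k (X p q)] {C : CylindricalOps k X}, C.IsBisimplicial → ∀ (p q : ℕ), a ≤ p →
    c ≤ q → ∀ y : X (p + 1) (q + 1),
    C.diag.b n (shuf (n + 1) (a + 1) (c + 1) C (sgl k (p + 1) (q + 1) y)) =
      shuf n a (c + 1) C (sgl k p (q + 1) ((C.v (q + 1)).bLe a p y)) +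
      shuf n (a + 1) (c + 1) C (sgl k p (q + 1) ((C.v (q + 1)).b p y - (C.v (q + 1)).bLe a p y)) +
      (-1 : k) ^ (p + 1) • (shuf n (a + 1) c C (sgl k (p + 1) q ((C.h (p + 1)).bLe c q y)) +
        shuf n (a + 1) (c + 1) C (sgl k (p + 1) q
          ((C.h (p + 1)).b q y - (C.h (p + 1)).bLe c q y))) +
      (-1 : k) ^ (a + c + 1) • corner n a c C (sgl k (p + 1) (q + 1) y) := by
  intro n
  induction n with
  | zero =>
    intro a c X _ _ C H p q ha hc y
    rw [shuf_sgl, shuf_zero_sgl _ _ _ _ (by omega), shuf_zero_sgl _ _ _ _ (by omega),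
      shuf_zero_sgl _ _ _ _ (by omega), shuf_zero_sgl _ _ _ _ (by omega),
      shuf_zero_sgl _ _ _ _ (by omega), shuf_zero_sgl _ _ _ _ (by omega)]
    simp [corner]
  | succ n ih =>
    intro a c X _ _ C H p q ha hc y
    have hD : C.diag.d (n + 1) 0 (shuf (n + 2) (a + 1) (c + 1) C (sgl k (p + 1) (q + 1) y)) =
        shuf (n + 1) a (c + 1) C (sgl k p (q + 1) ((C.v (q + 1)).d p 0 y)) +
        (-1 : k) ^ (p + 1) • shuf (n + 1) (a + 1) c C
          (sgl k (p + 1) q ((C.h (p + 1)).d q 0 y)) := by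
      have h1 := H.isBiMap_d_zero.shuf_sgl (n + 1) a (c + 1) p (q + 1)
        ((C.h (p + 1)).s (q + 1) 0 y)
      have h2 := H.isBiMap_d_zero.shuf_sgl (n + 1) (a + 1) c (p + 1) q
        ((C.v (q + 1)).s (p + 1) 0 y)
      rw [LinearMap.comp_apply, LinearMap.comp_apply, (H.h_simp _).d_s_self _ _ (by omega)] at h1
      rw [LinearMap.comp_apply, LinearMap.comp_apply, H.d_s _ _ _ _ (by omega) (by omega),
        (H.v_simp _).d_s_self _ _ (by omega)] at h2
      rw [shuf_sgl, map_add, map_smul, diag_d_apply, h1, diag_d_apply, h2]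
    have e1 : ∀ (p q : ℕ) (y : X (p + 2) q), (C.v (q + 1)).dec.b p ((C.h (p + 2)).s q 0 y) =
        (C.h (p + 1)).s q 0 ((C.v q).dec.b p y) := fun p q y =>
      b_comm (C.v q).dec (C.v (q + 1)).dec (fun p => (C.h (p + 1)).s q 0)
        (fun p j hj x => (H.s_d _ _ _ _ (by omega) (by omega) x).symm) p y
    have e2 : ∀ (p q : ℕ) (y : X p (q + 2)), (C.h (p + 1)).dec.b q ((C.v (q + 2)).s p 0 y) =
        (C.v (q + 1)).s p 0 ((C.h p).dec.b q y) := fun p q y =>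
      b_comm (C.h p).dec (C.h (p + 1)).dec (fun q => (C.v (q + 1)).s p 0)
        (fun q j hj x => H.d_s _ _ _ _ (by omega) (by omega) x) q y
    have e3 : ∀ (a p q : ℕ), a ≤ p → ∀ y : X (p + 2) q,
        (C.v (q + 1)).dec.bLe a p ((C.h (p + 2)).s q 0 y) =
        (C.h (p + 1)).s q 0 ((C.v q).dec.bLe a p y) := by
      intro a p q ha y
      simp only [bLe_apply, sd, LinearMap.smul_apply, map_sum, map_smul]
      refine Finset.sum_congr rfl fun i hi => ?_
      rw [Finset.mem_range] at hi
      rw [H.s_d _ _ _ _ (by omega) (by omega)]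
    have e4 : ∀ (c p q : ℕ), c ≤ q → ∀ y : X p (q + 2),
        (C.h (p + 1)).dec.bLe c q ((C.v (q + 2)).s p 0 y) =
        (C.v (q + 1)).s p 0 ((C.h p).dec.bLe c q y) := by
      intro c p q hc y
      simp only [bLe_apply, sd, LinearMap.smul_apply, map_sum, map_smul]
      refine Finset.sum_congr rfl fun i hi => ?_
      rw [Finset.mem_range] at hi
      rw [H.d_s _ _ _ _ (by omega) (by omega)]
    have e5 := (H.h_simp (p + 1)).dec_b_s_zero q y
    have e6 := (H.v_simp (q + 1)).dec_b_s_zero p y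
    have e7 := (H.h_simp (p + 1)).dec_bLe_s_zero c q hc y
    have e8 := (H.v_simp (q + 1)).dec_bLe_s_zero a p ha y
    rw [diag_b_succ, hD, shuf_sgl]
    rcases a with _ | a <;> rcases c with _ | c
    · have f1 : C.dec.diag.b n (nabla (n + 1) C.dec (sgl k (X := fun p q => X (p + 1) (q + 1))
          p (q + 1) ((C.h (p + 1)).s (q + 1) 0 y))) = _ := nabla_b n H.dec _
      simp only [shuf_zero, shuf_succ_zero, smul_zero, add_zero, f1, bLe_zero, corner_zero_sgl]
      rcases p with _ | p <;> rcases q with _ | q <;>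
      simp only [famDiff_sgl_zero, famDiff_sgl_succ, shuf_sgl, shuf_sgl_zero_left,
        shuf_sgl_zero_right, shuf_succ_zero, shuf_zero, smul_zero, add_zero, map_add, map_sub,
        map_smul, e1, e5, b_succ_apply, sub_sub_cancel_left, map_neg] <;>
      module
    · obtain ⟨q, rfl⟩ : ∃ b, q = b + 1 := ⟨q - 1, by omega⟩
      have f1 : C.dec.diag.b n (nabla (n + 1) C.dec (sgl k (X := fun p q => X (p + 1) (q + 1))
          p (q + 2) ((C.h (p + 1)).s (q + 2) 0 y))) = _ := nabla_b n H.dec _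
      rw [map_add, map_smul, ih _ _ H.dec _ _ (by omega) (by omega), shuf_zero,
        shuf_zero (n + 1) _ (C := C.dec), f1, e2,
        e4 _ _ _ (by omega), e6, e8, (C.h _).b_succ_apply, (C.h _).bLe_succ, corner_zero_succ,
        stepV_sgl_succ, bLe_zero]
      rcases p with _ | p <;>
      simp only [famDiff_sgl_zero, famDiff_sgl_succ, shuf_sgl, shuf_sgl_zero_left,
        shuf_zero, map_add, map_sub,
        map_smul, e1, e5, b_succ_apply, sub_sub_cancel] <;>
      module
    · obtain ⟨p, rfl⟩ : ∃ b, p = b + 1 := ⟨p - 1, by omega⟩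
      rw [map_add, ih _ _ H.dec _ _ (by omega) (by omega), shuf_succ_zero, e1,
        e3 _ _ _ (by omega), e5, e7, (C.v _).b_succ_apply, (C.v _).bLe_succ, corner_succ_zero,
        stepH_sgl_succ, bLe_zero, shuf_succ_zero, shuf_succ_zero]
      rcases q with _ | q <;>
      simp only [shuf_sgl, shuf_sgl_zero_right, shuf_succ_zero,
        smul_zero, add_zero, zero_add, map_sub,
        map_zero, sub_self] <;>
      module
    · obtain ⟨p, rfl⟩ : ∃ b, p = b + 1 := ⟨p - 1, by omega⟩
      obtain ⟨q, rfl⟩ : ∃ b, q = b + 1 := ⟨q - 1, by omega⟩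
      rw [map_add, map_smul, ih _ _ H.dec _ _ (by omega) (by omega),
        ih _ _ H.dec _ _ (by omega) (by omega), e1, e2, e3 _ _ _ (by omega), e4 _ _ _ (by omega),
        e5, e6, e7, e8, (C.v _).b_succ_apply, (C.h _).b_succ_apply, (C.v _).bLe_succ,
        (C.h _).bLe_succ, corner_succ, stepH_sgl_succ, stepV_sgl_succ]
      simp only [map_sub, shuf_sgl, sub_sub_cancel, sub_sub_sub_cancel_left, map_smul]
      module

end Restricted

end CylindricalOps

/-! ### Corners of shuffles -/

namespace CylindricalOps

open ParacyclicOps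

section Corner

variable {k : Type u} [CommRing k]

theorem nabla_congr : ∀ (n : ℕ) {X : ℕ → ℕ → Type v} [∀ p q, AddCommGroup (X p q)]
    [∀ p q, Module k (X p q)] (C : CylindricalOps k X) {x y : ∀ p q, X p q},
    (∀ p q, p + q = n → x p q = y p q) → nabla n C x = nabla n C y := by
  intro n
  induction n with
  | zero => intro X _ _ C x y h; exact h 0 0 rfl
  | succ n ih =>
    intro X _ _ C x y h
    rw [nabla_succ, nabla_succ]
    refine ih C.dec fun p q hpq => ?_
    rw [Pi.add_apply, Pi.add_apply, Pi.add_apply, Pi.add_apply, stepH_apply, stepH_apply,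
      stepV_apply, stepV_apply, h _ _ (by omega), h _ _ (by omega)]

theorem corner_congr : ∀ (n a c : ℕ) {X : ℕ → ℕ → Type v} [∀ p q, AddCommGroup (X p q)]
    [∀ p q, Module k (X p q)] (C : CylindricalOps k X) {x y : ∀ p q, X p q},
    (∀ p q, p + q = n + 1 → x p q = y p q) → corner n a c C x = corner n a c C y := by
  intro n
  induction n with
  | zero => intros; rfl
  | succ n ih =>
    intro a c X _ _ C x y h
    have hH : ∀ p q, p + q = n + 1 → C.stepH x p q = C.stepH y p q := fun p q hpq => by
      rw [stepH_apply, stepH_apply, h _ _ (by omega)]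
    have hV : ∀ p q, p + q = n + 1 → C.stepV x p q = C.stepV y p q := fun p q hpq => by
      rw [stepV_apply, stepV_apply, h _ _ (by omega)]
    rcases a with _ | a <;> rcases c with _ | c
    · rw [corner_zero, corner_zero]
      exact nabla_congr n C.dec fun p q hpq => by rw [h _ _ (by omega)]
    · rw [corner_zero_succ, corner_zero_succ]; exact ih _ _ C.dec hV
    · rw [corner_succ_zero, corner_succ_zero]; exact ih _ _ C.dec hH
    · rw [corner_succ, corner_succ, ih _ _ C.dec hV, ih _ _ C.dec hH]

theorem corner_eq_zero_left : ∀ (n a c : ℕ) {X : ℕ → ℕ → Type v} [∀ p q, AddCommGroup (X p q)]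
    [∀ p q, Module k (X p q)] (C : CylindricalOps k X) (p q : ℕ) (y : X p q), p ≤ a →
    corner n a c C (sgl k p q y) = 0 := by
  intro n
  induction n with
  | zero => intros; rfl
  | succ n ih =>
    intro a c X _ _ C p q y h
    have hV : ∀ c, corner n a c C.dec (C.stepV (sgl k p q y)) = 0 := by
      intro c
      rcases q with _ | q
      · rw [stepV_sgl_zero, map_zero]
      · rw [stepV_sgl_succ, map_smul, ih _ _ _ _ _ _ h, smul_zero]
    have hH : ∀ b c, a = b + 1 → corner n b c C.dec (C.stepH (sgl k p q y)) = 0 := by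
      intro b c hb
      rcases p with _ | p
      · rw [stepH_sgl_zero, map_zero]
      · rw [stepH_sgl_succ, ih _ _ _ _ _ _ (by omega)]
    rcases a with _ | a <;> rcases c with _ | c
    · rw [corner_zero]
      refine (congrArg _ ?_).trans (map_zero _)
      funext p' q'
      rw [sgl_ne _ (by omega), smul_zero]; rfl
    · rw [corner_zero_succ, hV]
    · rw [corner_succ_zero, hH _ _ rfl]
    · rw [corner_succ, hV, hH _ _ rfl, add_zero]

theorem corner_eq_zero_right : ∀ (n a c : ℕ) {X : ℕ → ℕ → Type v} [∀ p q, AddCommGroup (X p q)]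
    [∀ p q, Module k (X p q)] (C : CylindricalOps k X) (p q : ℕ) (y : X p q), q ≤ c →
    corner n a c C (sgl k p q y) = 0 := by
  intro n
  induction n with
  | zero => intros; rfl
  | succ n ih =>
    intro a c X _ _ C p q y h
    have hV : ∀ a b, c = b + 1 → corner n a b C.dec (C.stepV (sgl k p q y)) = 0 := by
      intro a b hb
      rcases q with _ | q
      · rw [stepV_sgl_zero, map_zero]
      · rw [stepV_sgl_succ, map_smul, ih _ _ _ _ _ _ (by omega), smul_zero]
    have hH : ∀ a, corner n a c C.dec (C.stepH (sgl k p q y)) = 0 := by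
      intro a
      rcases p with _ | p
      · rw [stepH_sgl_zero, map_zero]
      · rw [stepH_sgl_succ, ih _ _ _ _ _ _ h]
    rcases a with _ | a <;> rcases c with _ | c
    · rw [corner_zero]
      refine (congrArg _ ?_).trans (map_zero _)
      funext p' q'
      rw [sgl_ne _ (by omega), smul_zero]; rfl
    · rw [corner_zero_succ, hV _ _ rfl]
    · rw [corner_succ_zero, hH]
    · rw [corner_succ, hV _ _ rfl, hH, add_zero]

section

variable {X : ℕ → ℕ → Type v} [∀ p q, AddCommGroup (X p q)] [∀ p q, Module k (X p q)]
  {C : CylindricalOps k X}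

theorem IsBisimplicial.last_stepH (H : C.IsBisimplicial) (x : ∀ p q, X p q) :
    C.dec.lastH (C.stepH x) + C.dec.lastV (C.stepH x) = C.decLast.stepH (C.lastH x + C.lastV x) := by
  funext p q
  rw [stepH_apply, Pi.add_apply, Pi.add_apply, Pi.add_apply, Pi.add_apply, map_add, lastH_apply,
    lastV_apply, lastH_apply, lastV_apply, stepH_apply, stepH_apply, map_smul,
    H.s_s (p + 1) (q + 1) 0 (p + 1) (by omega) (by omega),
    (H.h_simp _).s_s q 0 q (by omega) (by omega)]

theorem IsBisimplicial.last_stepV (H : C.IsBisimplicial) (x : ∀ p q, X p q) :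
    C.dec.lastH (C.stepV x) + C.dec.lastV (C.stepV x) = C.decLast.stepV (C.lastH x + C.lastV x) := by
  funext p q
  rw [stepV_apply, Pi.add_apply, Pi.add_apply, Pi.add_apply, Pi.add_apply, map_add, lastH_apply,
    lastV_apply, lastH_apply, lastV_apply, stepV_apply, stepV_apply, map_smul, map_smul, map_smul,
    H.s_s (p + 1) (q + 1) (q + 1) 0 (by omega) (by omega),
    (H.v_simp _).s_s p 0 p (by omega) (by omega)]
  module

end

/-- Shuffles through a corner by recursion on the last step, if there is a step after the corner. -/
theorem corner_last : ∀ (n a c : ℕ) {X : ℕ → ℕ → Type v} [∀ p q, AddCommGroup (X p q)]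
    [∀ p q, Module k (X p q)] {C : CylindricalOps k X}, C.IsBisimplicial → a + c < n →
    ∀ x : ∀ p q, X p q, corner (n + 1) a c C x = corner n a c C.decLast (C.lastH x + C.lastV x) := by
  intro n
  induction n with
  | zero => intros; omega
  | succ n ih =>
    intro a c X _ _ C H h x
    rcases a with _ | a <;> rcases c with _ | c
    · rw [corner_zero, nabla_last n H.dec, corner_zero]
      change nabla n C.dec.decLast _ = nabla n C.dec.decLast _
      congr 1
      funext p q
      simp only [Pi.add_apply, lastH_apply, lastV_apply, map_smul, smul_add]
      module
    · rw [corner_zero_succ, ih _ _ H.dec (by omega), H.last_stepV]; rfl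
    · rw [corner_succ_zero, ih _ _ H.dec (by omega), H.last_stepH]; rfl
    · rw [corner_succ, ih _ _ H.dec (by omega), ih _ _ H.dec (by omega), H.last_stepH,
        H.last_stepV]; rfl

end Corner

/-! ### Extra degeneracies of a cylindrical module -/

namespace IsCylindrical

variable {k : Type u} [CommRing k] {X : ℕ → ℕ → Type v}
  [∀ p q, AddCommGroup (X p q)] [∀ p q, Module k (X p q)] {C : CylindricalOps k X}
  (H : C.IsCylindrical)

theorem extra_s (H : C.IsCylindrical) (p q j : ℕ) (hj : j ≤ p) (x : X p q) : (C.h (p + 1)).extra q ((C.v q).s p j x) =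
    (C.v (q + 1)).s p j ((C.h p).extra q x) := by
  simp only [extra, LinearMap.comp_apply]
  rw [H.s_s _ _ _ _ le_rfl hj, H.t_s _ _ _ hj]

theorem extra_d (H : C.IsCylindrical) (p q j : ℕ) (hj : j ≤ p + 1) (x : X (p + 1) q) :
    (C.h p).extra q ((C.v q).d p j x) = (C.v (q + 1)).d p j ((C.h (p + 1)).extra q x) := by
  simp only [extra, LinearMap.comp_apply]
  rw [H.s_d _ _ _ _ le_rfl hj, H.t_d _ _ _ hj]

theorem extra_t (H : C.IsCylindrical) (p q : ℕ) (x : X p q) :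
    (C.h p).extra q ((C.v q).t p x) = (C.v (q + 1)).t p ((C.h p).extra q x) := by
  simp only [extra, LinearMap.comp_apply]
  rw [H.s_t _ _ _ le_rfl, H.t_t]

theorem d_extra (H : C.IsCylindrical) (p q i : ℕ) (hi : i ≤ q + 1) (x : X p (q + 1)) :
    (C.h (p + 1)).d q i ((C.v (q + 1)).extra p x) = (C.v q).extra p ((C.h p).d q i x) := by
  simp only [extra, LinearMap.comp_apply]
  rw [H.d_t _ _ _ hi, H.d_s _ _ _ _ hi le_rfl]

theorem s_extra (H : C.IsCylindrical) (p q i : ℕ) (hi : i ≤ q) (x : X p q) :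
    (C.h (p + 1)).s q i ((C.v q).extra p x) = (C.v (q + 1)).extra p ((C.h p).s q i x) := by
  simp only [extra, LinearMap.comp_apply]
  rw [H.s_t _ _ _ hi, H.s_s _ _ _ _ hi le_rfl]

theorem t_extra (H : C.IsCylindrical) (p q : ℕ) (x : X p q) :
    (C.h (p + 1)).t q ((C.v q).extra p x) = (C.v q).extra p ((C.h p).t q x) := by
  simp only [extra, LinearMap.comp_apply]
  rw [H.t_t, H.t_s _ _ _ le_rfl]

theorem extra_extra (H : C.IsCylindrical) (p q : ℕ) (x : X p q) :
    (C.h (p + 1)).extra q ((C.v q).extra p x) = (C.v (q + 1)).extra p ((C.h p).extra q x) := by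
  rw [extra, LinearMap.comp_apply, H.s_extra _ _ _ le_rfl, H.t_extra]
  rfl

theorem diag_extra (H : C.IsCylindrical) (n : ℕ) (x : X n n) :
    C.diag.extra n x = (C.v (n + 1)).extra n ((C.h n).extra n x) := by
  simp only [extra, LinearMap.comp_apply, CylindricalOps.diag]
  rw [H.t_s _ _ _ le_rfl]

theorem isDegMap_extra (H : C.IsCylindrical) :
    IsDegMap C C.dec fun p q => (C.v (q + 1)).extra p ∘ₗ (C.h p).extra q where
  h_s p q i hi x := by
    rw [LinearMap.comp_apply, LinearMap.comp_apply, (H.h_para p).extra_s q i hi,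
      ← H.s_extra _ _ _ (by omega)]
  v_s p q i hi x := by
    rw [LinearMap.comp_apply, LinearMap.comp_apply, H.extra_s _ _ _ hi,
      (H.v_para _).extra_s p i hi]

theorem isDegMap_d_last (H : C.IsCylindrical) :
    IsDegMap C.decLast C fun p q => (C.v q).d p (p + 1) ∘ₗ (C.h (p + 1)).d q (q + 1) where
  h_s p q i hi x := by
    rw [LinearMap.comp_apply, LinearMap.comp_apply, (H.h_para _).d_s_gt q (q + 1) i (by omega) le_rfl,
      ← H.s_d _ _ _ _ hi (by omega)]
  v_s p q i hi x := by
    rw [LinearMap.comp_apply, LinearMap.comp_apply, H.d_s _ _ _ _ (by omega) (by omega),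
      (H.v_para _).d_s_gt p (p + 1) i (by omega) le_rfl]

/-- The families `(-1)^p σ̄ σ t̂̄^a t̂^c x` in the double décalage. -/
def rot (C : CylindricalOps k X) (a c : ℕ) (x : ∀ p q, X p q) : ∀ p q, X p q
  | 0, _ => 0
  | _ + 1, 0 => 0
  | p + 1, q + 1 => (-1 : k) ^ p • (C.v (q + 1)).extra p ((C.h p).extra q
      (((C.v q).st p ^ a) (((C.h p).st q ^ c) (x p q))))

theorem commute_st (H : C.IsCylindrical) (p q a c : ℕ) (x : X p q) : ((C.v q).st p ^ a) (((C.h p).st q ^ c) x) =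
    ((C.h p).st q ^ c) (((C.v q).st p ^ a) x) := by
  have hc : Commute ((C.v q).st p) ((C.h p).st q) := by
    refine LinearMap.ext fun x => ?_
    simp only [st, Module.End.mul_apply, LinearMap.smul_apply, map_smul, H.t_t]
    exact smul_comm _ _ _
  exact LinearMap.congr_fun (hc.pow_pow a c).eq x

theorem extra_st_pow (H : C.IsCylindrical) (p q a : ℕ) (x : X p q) : (C.h p).extra q (((C.v q).st p ^ a) x) =
    ((C.v (q + 1)).st p ^ a) ((C.h p).extra q x) := by
  refine (pow_comm (fun x => ?_) a x).symm
  simp only [st, LinearMap.smul_apply, map_smul, H.extra_t]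

theorem st_pow_extra (H : C.IsCylindrical) (p q c : ℕ) (x : X p q) : ((C.h (p + 1)).st q ^ c) ((C.v q).extra p x) =
    (C.v q).extra p (((C.h p).st q ^ c) x) := by
  refine pow_comm (fun x => ?_) c x
  simp only [st, LinearMap.smul_apply, map_smul, H.t_extra]

theorem lastH_rot (H : C.IsCylindrical) (a c : ℕ) (x : ∀ p q, X p q) (p q : ℕ) :
    (C.v (q + 1)).extra p ((C.h p).extra q ((C.v q).d p (p + 1) ((C.h (p + 1)).d q (q + 1)
      (C.lastH (rot C a c x) p q)))) = (-1 : k) ^ (p + q) • C.stepH (rot C (a + 1) c x) p q := by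
  rw [lastH_apply, stepH_apply, map_smul, (H.h_para _).d_s_succ q q le_rfl]
  rcases q with _ | q
  · simp [rot]
  · simp only [rot, map_smul]
    rw [(H.v_para _).d_extra_last, ← H.extra_t, (H.h_para _).extra_extra,
      H.s_extra _ _ _ (by omega), pow_succ' _ a, Module.End.mul_apply, st,
      LinearMap.smul_apply]
    simp only [map_smul, smul_smul]
    congr 1
    ring_nf
    rw [mul_comm p 3, pow_mul]
    norm_num

theorem lastV_rot (H : C.IsCylindrical) (a c : ℕ) (x : ∀ p q, X p q) (p q : ℕ) :
    (C.v (q + 1)).extra p ((C.h p).extra q ((C.v q).d p (p + 1) ((C.h (p + 1)).d q (q + 1)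
      (C.lastV (rot C a c x) p q)))) = (-1 : k) ^ (p + q) • C.stepV (rot C a (c + 1) x) p q := by
  rw [lastV_apply, stepV_apply, H.d_s _ _ _ _ le_rfl le_rfl, (H.v_para _).d_s_succ p p le_rfl]
  rcases p with _ | p
  · simp [rot]
  · simp only [rot, map_smul]
    rw [H.d_extra _ _ _ le_rfl, (H.h_para _).d_extra_last, H.commute_st, H.commute_st, H.extra_extra,
      (H.v_para _).extra_extra, pow_succ' _ c, Module.End.mul_apply, st, LinearMap.smul_apply]
    simp only [map_smul, smul_smul]
    congr 1
    ring_nf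
    rw [mul_comm p 3, pow_mul]
    norm_num

/-- Rotating a sum of shuffles through a corner moves the corner one step further. -/
theorem extra_d_last_corner (H : C.IsCylindrical) (n a c : ℕ) (h : a + c < n) (x : ∀ p q, X p q) :
    (-1 : k) ^ n • C.diag.extra n (C.diag.d n (n + 1) (corner (n + 1) a c C (rot C a c x))) =
      - (corner n a c C.dec (C.stepH (rot C (a + 1) c x)) +
        corner n a c C.dec (C.stepV (rot C a (c + 1) x))) := by
  have h1 : C.diag.d n (n + 1) (corner n a c C.decLast
      (C.lastH (rot C a c x) + C.lastV (rot C a c x))) = _ :=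
    corner_natural n a c H.isDegMap_d_last _
  have h2 := corner_natural n a c H.isDegMap_extra fun p q =>
    ((C.v q).d p (p + 1) ∘ₗ (C.h (p + 1)).d q (q + 1))
      ((C.lastH (rot C a c x) + C.lastV (rot C a c x)) p q)
  rw [corner_last n a c H.isBisimplicial h, h1, H.diag_extra]
  refine (congrArg _ h2).trans ?_
  rw [← map_add, ← map_neg, ← map_smul]
  refine corner_congr n a c C.dec fun p q hpq => ?_
  have h3 : (-1 : k) ^ n = - (-1 : k) ^ (p + q) := by rw [hpq, pow_succ]; simp
  rw [Pi.smul_apply, Pi.smul_apply, Pi.add_apply, Pi.add_apply, LinearMap.comp_apply,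
    LinearMap.comp_apply, map_add, map_add, map_add, map_add, H.lastH_rot, H.lastV_rot, ← smul_add,
    smul_smul, h3, neg_mul, neg_one_mul_self, neg_smul, one_smul]
  rfl

theorem sum_corner_succ (n r : ℕ) (x : ∀ p q, X p q) :
    ∑ ac ∈ Finset.HasAntidiagonal.antidiagonal (r + 1), corner (n + 1) ac.1 ac.2 C (rot C ac.1 ac.2 x) =
      ∑ ac ∈ Finset.HasAntidiagonal.antidiagonal r, (corner n ac.1 ac.2 C.dec (C.stepH (rot C (ac.1 + 1) ac.2 x)) +
        corner n ac.1 ac.2 C.dec (C.stepV (rot C ac.1 (ac.2 + 1) x))) := by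
  let F : ℕ × ℕ → X (n + 1) (n + 1) := fun ac => match ac with
    | (0, _) => 0
    | (a + 1, c) => corner n a c C.dec (C.stepH (rot C (a + 1) c x))
  let F' : ℕ × ℕ → X (n + 1) (n + 1) := fun ac => match ac with
    | (_, 0) => 0
    | (a, c + 1) => corner n a c C.dec (C.stepV (rot C a (c + 1) x))
  have h1 : ∀ ac ∈ Finset.HasAntidiagonal.antidiagonal (r + 1),
      corner (n + 1) ac.1 ac.2 C (rot C ac.1 ac.2 x) = F ac + F' ac := by
    rintro ⟨a, c⟩ h
    rw [Finset.HasAntidiagonal.mem_antidiagonal] at h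
    rcases a with _ | a <;> rcases c with _ | c
    · simp at h
    · simp [F, F', corner_zero_succ]
    · simp [F, F', corner_succ_zero]
    · simp [F, F', corner_succ]
  rw [Finset.sum_congr rfl h1, Finset.sum_add_distrib, Finset.sum_add_distrib,
    Finset.Nat.sum_antidiagonal_succ, Finset.Nat.sum_antidiagonal_succ']
  simp [F, F']

/-- The shuffles through the corners on an antidiagonal are the rotations of the full shuffle. -/
theorem sum_corner (H : C.IsCylindrical) (n r : ℕ) (hr : r ≤ n) (x : ∀ p q, X p q) :
    (-1 : k) ^ r • ∑ ac ∈ Finset.HasAntidiagonal.antidiagonal r, corner (n + 1) ac.1 ac.2 C (rot C ac.1 ac.2 x) =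
      C.diag.extra n ((C.diag.st n ^ r) (nabla n C x)) := by
  induction r with
  | zero =>
    rw [Finset.Nat.antidiagonal_zero, Finset.sum_singleton, pow_zero, pow_zero, one_smul,
      Module.End.one_apply, corner_zero, H.diag_extra]
    refine Eq.trans ?_ (nabla_natural n H.isDegMap_extra x).symm
    congr 1
    funext p q
    simp [rot, smul_smul, neg_one_mul_self]
  | succ r ih =>
    have h1 := ih (by omega)
    have h2 : C.diag.extra n ((C.diag.st n ^ (r + 1)) (nabla n C x)) = (-1 : k) ^ n •
        C.diag.extra n (C.diag.d n (n + 1) (C.diag.extra n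
          ((C.diag.st n ^ r) (nabla n C x)))) := by
      rw [H.diag.d_extra_last, pow_succ', Module.End.mul_apply, ← map_smul]; rfl
    rw [h2, ← h1, map_smul, map_smul, smul_comm, map_sum, map_sum, sum_corner_succ,
      pow_succ, mul_neg_one, neg_smul, ← smul_neg, ← Finset.sum_neg_distrib]
    congr 1
    rw [Finset.smul_sum]
    refine Finset.sum_congr rfl fun ac hac => ?_
    rw [Finset.HasAntidiagonal.mem_antidiagonal] at hac
    rw [H.extra_d_last_corner n _ _ (by omega)]

end IsCylindrical

end CylindricalOps

/-! ### The cyclic shuffle -/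

namespace CylindricalOps

open ParacyclicOps

namespace IsCylindrical

variable {k : Type u} [CommRing k] {X : ℕ → ℕ → Type v}
  [∀ p q, AddCommGroup (X p q)] [∀ p q, Module k (X p q)] {C : CylindricalOps k X}

/-- The element `(-1)^p σ̄ σ t̂̄^a t̂^c y`. -/
def rotAt (C : CylindricalOps k X) (p q a c : ℕ) : X p q →ₗ[k] X (p + 1) (q + 1) :=
  (-1 : k) ^ p • ((C.v (q + 1)).extra p ∘ₗ (C.h p).extra q ∘ₗ ((C.v q).st p ^ a) ∘ₗ ((C.h p).st q ^ c))

theorem rotAt_apply (p q a c : ℕ) (y : X p q) : rotAt C p q a c y = (-1 : k) ^ p •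
    (C.v (q + 1)).extra p ((C.h p).extra q (((C.v q).st p ^ a) (((C.h p).st q ^ c) y))) := rfl

theorem rot_sgl (p q a c : ℕ) (y : X p q) :
    rot C a c (sgl k p q y) = sgl k (p + 1) (q + 1) (rotAt C p q a c y) := by
  refine eq_sgl ?_ fun p' q' h => ?_
  · simp only [rot, sgl_same]; rfl
  · rcases p' with _ | p' <;> rcases q' with _ | q'
    · rfl
    · rfl
    · rfl
    · simp only [rot]
      rw [sgl_ne _ (by omega)]
      simp only [map_zero, smul_zero]

/-- The cyclic shuffles of a chain of `X p q`; the relevant value of the index is `p + q + 2`. -/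
def cyc (C : CylindricalOps k X) (m p q : ℕ) : X p q →ₗ[k] X m m :=
  ∑ a ∈ Finset.range (p + 1), ∑ c ∈ Finset.range (q + 1),
    shuf m (a + 1) (c + 1) C ∘ₗ sgl k (p + 1) (q + 1) ∘ₗ rotAt C p q a c

theorem cyc_apply (m p q : ℕ) (y : X p q) : cyc C m p q y =
    ∑ a ∈ Finset.range (p + 1), ∑ c ∈ Finset.range (q + 1),
      shuf m (a + 1) (c + 1) C (sgl k (p + 1) (q + 1) (rotAt C p q a c y)) := by
  simp [cyc]

/-- The cyclic shuffles of `b̄ y`. -/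
def cycV (C : CylindricalOps k X) (m : ℕ) : ∀ p q, X p q →ₗ[k] X m m
  | 0, _ => 0
  | p + 1, q => cyc C m p q ∘ₗ (C.v q).b p

/-- The cyclic shuffles of `(-1)^p b y`. -/
def cycH (C : CylindricalOps k X) (m : ℕ) : ∀ p q, X p q →ₗ[k] X m m
  | _, 0 => 0
  | p, q + 1 => (-1 : k) ^ p • (cyc C m p q ∘ₗ (C.h p).b q)

/-- The part of `cycV` with a fixed number of steps in the `q`-direction. -/
def shufV (C : CylindricalOps k X) (m c : ℕ) : ∀ p q, X p q →ₗ[k] X m m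
  | 0, _ => 0
  | p + 1, q => (∑ a ∈ Finset.range (p + 1),
      shuf m (a + 1) (c + 1) C ∘ₗ sgl k (p + 1) (q + 1) ∘ₗ rotAt C p q a c) ∘ₗ (C.v q).b p

/-- The part of `cycH` with a fixed number of steps in the `p`-direction. -/
def shufH (C : CylindricalOps k X) (m a : ℕ) : ∀ p q, X p q →ₗ[k] X m m
  | _, 0 => 0
  | p, q + 1 => (-1 : k) ^ p • ((∑ c ∈ Finset.range (q + 1),
      shuf m (a + 1) (c + 1) C ∘ₗ sgl k (p + 1) (q + 1) ∘ₗ rotAt C p q a c) ∘ₗ (C.h p).b q)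

theorem cycV_eq_sum (m p q : ℕ) (y : X p q) :
    cycV C m p q y = ∑ c ∈ Finset.range (q + 1), shufV C m c p q y := by
  rcases p with _ | p
  · simp [cycV, shufV]
  · simp only [cycV, shufV, LinearMap.comp_apply, cyc_apply, LinearMap.sum_apply]
    exact Finset.sum_comm

theorem cycH_eq_sum (m p q : ℕ) (y : X p q) :
    cycH C m p q y = ∑ a ∈ Finset.range (p + 1), shufH C m a p q y := by
  rcases q with _ | q
  · simp [cycH, shufH]
  · simp only [cycH, shufH, LinearMap.comp_apply, cyc_apply, LinearMap.sum_apply,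
      LinearMap.smul_apply, Finset.smul_sum]

theorem b_extra (H : C.IsCylindrical) (p q : ℕ) (y : X (p + 1) q) :
    (C.v (q + 1)).b p ((C.h (p + 1)).extra q y) = (C.h p).extra q ((C.v q).b p y) :=
  b_comm (C.v q) (C.v (q + 1)) (fun p => (C.h p).extra q)
    (fun p j hj x => (H.extra_d p q j hj x).symm) p y

theorem h_b_extra (H : C.IsCylindrical) (p q : ℕ) (y : X p (q + 1)) :
    (C.h (p + 1)).b q ((C.v (q + 1)).extra p y) = (C.v q).extra p ((C.h p).b q y) :=
  b_comm (C.h p) (C.h (p + 1)) (fun q => (C.v q).extra p)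
    (fun q i hi x => H.d_extra p q i hi x) q y

theorem b_st_pow (H : C.IsCylindrical) (p q c : ℕ) (y : X (p + 1) q) :
    (C.v q).b p (((C.h (p + 1)).st q ^ c) y) = ((C.h p).st q ^ c) ((C.v q).b p y) := by
  refine (pow_comm (fun x => ?_) c y).symm
  have := b_comm (C.v q) (C.v q) (fun p => (C.h p).t q)
    (fun p j hj x => (H.t_d p q j hj x).symm) p x
  simp only [st, LinearMap.smul_apply, map_smul, this]

theorem h_b_st_pow (H : C.IsCylindrical) (p q a : ℕ) (y : X p (q + 1)) :
    (C.h p).b q (((C.v (q + 1)).st p ^ a) y) = ((C.v q).st p ^ a) ((C.h p).b q y) := by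
  refine (pow_comm (fun x => ?_) a y).symm
  have := b_comm (C.h p) (C.h p) (fun q => (C.v q).t p)
    (fun q i hi x => H.d_t p q i hi x) q x
  simp only [st, LinearMap.smul_apply, map_smul, this]

theorem rotAt_eq_v (H : C.IsCylindrical) (p q a c : ℕ) (y : X p q) : rotAt C p q a c y =
    (-1 : k) ^ p • (C.v (q + 1)).extra p (((C.v (q + 1)).st p ^ a)
      ((C.h p).extra q (((C.h p).st q ^ c) y))) := by
  rw [rotAt_apply, H.extra_st_pow]

theorem rotAt_eq_h (H : C.IsCylindrical) (p q a c : ℕ) (y : X p q) : rotAt C p q a c y =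
    (-1 : k) ^ p • (C.h (p + 1)).extra q (((C.h (p + 1)).st q ^ c)
      ((C.v q).extra p (((C.v q).st p ^ a) y))) := by
  rw [rotAt_apply, H.st_pow_extra, H.extra_extra, H.commute_st]

/-- The contribution of the faces in the `p`-direction to the boundary of the cyclic shuffles. -/
theorem sum_shuf_v (H : C.IsCylindrical) (m p q c : ℕ) (y : X p q) :
    ∑ a ∈ Finset.range (p + 1),
      (shuf m a (c + 1) C (sgl k p (q + 1) ((C.v (q + 1)).bLe a p (rotAt C p q a c y))) +
      shuf m (a + 1) (c + 1) C (sgl k p (q + 1) ((C.v (q + 1)).b p (rotAt C p q a c y) -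
        (C.v (q + 1)).bLe a p (rotAt C p q a c y)))) =
    (-1 : k) ^ p • nabla m C (sgl k p (q + 1) ((C.h p).extra q (((C.h p).st q ^ c) y))) +
      shufV C m c p q y := by
  simp only [H.rotAt_eq_v]
  rcases p with _ | p
  · have h1 := (H.v_para (q + 1)).bLe_extra_zero
      (fun a => shuf m a (c + 1) C ∘ₗ sgl k 0 (q + 1)) ((C.h 0).extra q (((C.h 0).st q ^ c) y))
    simp only [LinearMap.comp_apply, shuf_zero, shuf_eq_zero m 0 (c + 1) C 0 (q + 1) _ le_rfl,
      sub_zero] at h1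
    simp only [pow_zero, one_smul, add_zero, zero_add, shufV, LinearMap.zero_apply]
    exact h1
  · have h1 := (H.v_para (q + 1)).sum_bLe_extra p
      (fun a => (-1 : k) ^ (p + 1) • (shuf m a (c + 1) C ∘ₗ sgl k (p + 1) (q + 1)))
      ((C.h (p + 1)).extra q (((C.h (p + 1)).st q ^ c) y))
    simp only [LinearMap.comp_apply, LinearMap.smul_apply, shuf_zero,
      shuf_eq_zero m (p + 1) (c + 1) C (p + 1) (q + 1) _ le_rfl, sub_zero, smul_zero,
      H.b_extra, H.b_st_pow] at h1
    simp only [map_smul, ← smul_sub, ← smul_add]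
    simp only [map_sub, ← smul_add] at h1 ⊢
    simp only [shufV, LinearMap.comp_apply, LinearMap.sum_apply, H.rotAt_eq_v, map_smul]
    rw [h1, sub_eq_add_neg, ← Finset.sum_neg_distrib]
    congr 1
    refine Finset.sum_congr rfl fun a _ => ?_
    rw [pow_succ, mul_neg_one, neg_smul, neg_neg]

/-- The contribution of the faces in the `q`-direction to the boundary of the cyclic shuffles. -/
theorem sum_shuf_h (H : C.IsCylindrical) (m p q a : ℕ) (ha : a ≤ p) (hm : m = p + q + 1)
    (y : X p q) :
    ∑ c ∈ Finset.range (q + 1), (-1 : k) ^ (p + 1) •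
      (shuf m (a + 1) c C (sgl k (p + 1) q ((C.h (p + 1)).bLe c q (rotAt C p q a c y))) +
      shuf m (a + 1) (c + 1) C (sgl k (p + 1) q ((C.h (p + 1)).b q (rotAt C p q a c y) -
        (C.h (p + 1)).bLe c q (rotAt C p q a c y)))) =
    nabla m C (sgl k (p + 1) q (((C.h (p + 1)).t q ^ (q + 1)) ((C.v q).extra p
        (((C.v q).st p ^ a) y)))) + shufH C m a p q y := by
  have ht : ∀ n (P : ParacyclicOps k (X (p + 1))), P.st n ^ (n + 1) = P.t n ^ (n + 1) := fun n P => by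
    rw [st_pow, Even.neg_one_pow (by rw [mul_comm]; exact Nat.even_mul_succ_self n), one_smul]
  have hs : ∀ z : X m m, (-1 : k) ^ (p + 1) • (-1 : k) ^ p • z = -z := fun z => by
    rw [smul_smul, pow_succ, mul_neg_one, neg_mul, neg_one_mul_self, neg_smul, one_smul]
  simp only [H.rotAt_eq_h]
  rcases q with _ | q
  · have h1 := (H.h_para (p + 1)).bLe_extra_zero
      (fun c => shuf m (a + 1) c C ∘ₗ sgl k (p + 1) 0) ((C.v 0).extra p (((C.v 0).st p ^ a) y))
    simp only [LinearMap.comp_apply, shuf_succ_zero, zero_sub] at h1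
    rw [shuf_eq_nabla m (a + 1) 1 C (p + 1) 0 _ (by omega) (by omega) (by omega), ht 0] at h1
    simp only [map_smul, ← smul_sub, ← smul_add, hs, Finset.sum_neg_distrib, add_zero, zero_add,
      shufH, LinearMap.zero_apply]
    rw [neg_eq_iff_eq_neg]
    simpa using h1
  · have h1 := (H.h_para (p + 1)).sum_bLe_extra q
      (fun c => shuf m (a + 1) c C ∘ₗ sgl k (p + 1) (q + 1))
      ((C.v (q + 1)).extra p (((C.v (q + 1)).st p ^ a) y))
    simp only [LinearMap.comp_apply, shuf_succ_zero, zero_sub, H.h_b_extra, H.h_b_st_pow] at h1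
    rw [shuf_eq_nabla m (a + 1) (q + 2) C (p + 1) (q + 1) _ (by omega) (by omega) (by omega),
      ht (q + 1)] at h1
    simp only [map_smul, ← smul_sub, ← smul_add, hs, Finset.sum_neg_distrib, shufH,
      LinearMap.comp_apply, LinearMap.sum_apply, LinearMap.smul_apply, H.rotAt_eq_h, Finset.smul_sum]
    rw [h1, sub_eq_add_neg, neg_add, neg_neg, neg_neg]
    simp only [smul_smul, neg_one_mul_self, one_smul]

theorem sum_range_product {M : Type*} [AddCommMonoid M] (p q : ℕ) (f : ℕ → ℕ → M)
    (hp : ∀ a c, p < a → f a c = 0) (hq : ∀ a c, q < c → f a c = 0) :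
    ∑ a ∈ Finset.range (p + 1), ∑ c ∈ Finset.range (q + 1), f a c =
      ∑ r ∈ Finset.range (p + q + 1), ∑ ac ∈ Finset.HasAntidiagonal.antidiagonal r,
        f ac.1 ac.2 := by
  rw [← Finset.sum_product', ← Finset.sum_fiberwise_of_maps_to (t := Finset.range (p + q + 1))
    (g := fun ac : ℕ × ℕ => ac.1 + ac.2)]
  · refine Finset.sum_congr rfl fun r _ => ?_
    refine Finset.sum_subset (fun ac h => ?_) fun ac h1 h2 => ?_
    · simp only [Finset.mem_filter] at h
      exact Finset.HasAntidiagonal.mem_antidiagonal.mpr h.2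
    · rw [Finset.HasAntidiagonal.mem_antidiagonal] at h1
      simp only [Finset.mem_filter, Finset.mem_product, Finset.mem_range, not_and] at h2
      by_cases ha : p < ac.1
      · exact hp _ _ ha
      · exact hq _ _ (by by_contra hc; exact h2 ⟨by omega, by omega⟩ h1)
  · rintro ⟨a, c⟩ h
    simp only [Finset.mem_product, Finset.mem_range] at h ⊢
    omega

theorem sum_range_add_add {M : Type*} [AddCommMonoid M] (p q : ℕ) (f g h : ℕ → ℕ → M) :
    ∑ a ∈ Finset.range p, ∑ c ∈ Finset.range q, (f a c + g a c + h a c) =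
      ∑ a ∈ Finset.range p, ∑ c ∈ Finset.range q, f a c +
      ∑ a ∈ Finset.range p, ∑ c ∈ Finset.range q, g a c +
      ∑ a ∈ Finset.range p, ∑ c ∈ Finset.range q, h a c := by
  simp only [Finset.sum_add_distrib]

/-- The boundary of the cyclic shuffles. -/
theorem b_cyc (H : C.IsCylindrical) (n p q : ℕ) (hn : p + q = n) (y : X p q) :
    C.diag.b (n + 1) (cyc C (n + 2) p q y) = cycV C (n + 1) p q y + cycH C (n + 1) p q y +
      (-1 : k) ^ p • nabla (n + 1) C (sgl k p (q + 1) ((C.h p).extra q ((C.h p).norm q y))) +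
      nabla (n + 1) C (sgl k (p + 1) q (((C.h (p + 1)).t q ^ (q + 1))
        ((C.v q).extra p ((C.v q).norm p y)))) -
      C.diag.extra n (C.diag.norm n (nabla n C (sgl k p q y))) := by
  have h1 : C.diag.b (n + 1) (cyc C (n + 2) p q y) =
      ∑ a ∈ Finset.range (p + 1), ∑ c ∈ Finset.range (q + 1),
        ((shuf (n + 1) a (c + 1) C (sgl k p (q + 1) ((C.v (q + 1)).bLe a p (rotAt C p q a c y))) +
        shuf (n + 1) (a + 1) (c + 1) C (sgl k p (q + 1) ((C.v (q + 1)).b p (rotAt C p q a c y) -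
          (C.v (q + 1)).bLe a p (rotAt C p q a c y)))) +
        (-1 : k) ^ (p + 1) •
        (shuf (n + 1) (a + 1) c C (sgl k (p + 1) q ((C.h (p + 1)).bLe c q (rotAt C p q a c y))) +
        shuf (n + 1) (a + 1) (c + 1) C (sgl k (p + 1) q ((C.h (p + 1)).b q (rotAt C p q a c y) -
          (C.h (p + 1)).bLe c q (rotAt C p q a c y)))) +
        (-1 : k) ^ (a + c + 1) • corner (n + 1) a c C (rot C a c (sgl k p q y))) := by
    rw [cyc_apply, map_sum]
    refine Finset.sum_congr rfl fun a ha => ?_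
    rw [map_sum]
    refine Finset.sum_congr rfl fun c hc => ?_
    rw [Finset.mem_range] at ha hc
    rw [shuf_b (n + 1) a c H.isBisimplicial p q (by omega) (by omega), rot_sgl]
  -- Corners outside the rectangle vanish, so the sum may be sorted by the total rotation `a + c`.
  have h2 : ∑ a ∈ Finset.range (p + 1), ∑ c ∈ Finset.range (q + 1),
      (-1 : k) ^ (a + c + 1) • corner (n + 1) a c C (rot C a c (sgl k p q y)) =
      - C.diag.extra n (C.diag.norm n (nabla n C (sgl k p q y))) := by
    rw [sum_range_product p q (fun a c => (-1 : k) ^ (a + c + 1) •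
      corner (n + 1) a c C (rot C a c (sgl k p q y)))
      (fun a c h => by rw [rot_sgl, corner_eq_zero_left _ _ _ _ _ _ _ (by omega), smul_zero])
      (fun a c h => by rw [rot_sgl, corner_eq_zero_right _ _ _ _ _ _ _ (by omega), smul_zero]),
      hn, norm_eq, LinearMap.sum_apply, map_sum, ← Finset.sum_neg_distrib]
    refine Finset.sum_congr rfl fun r hr => ?_
    rw [Finset.mem_range] at hr
    rw [← H.sum_corner n r (by omega), Finset.smul_sum, ← Finset.sum_neg_distrib]
    refine Finset.sum_congr rfl fun ac hac => ?_
    rw [Finset.HasAntidiagonal.mem_antidiagonal] at hac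
    rw [hac, pow_succ, mul_neg_one, neg_smul]
  have h3 : ∑ a ∈ Finset.range (p + 1), ∑ c ∈ Finset.range (q + 1), (-1 : k) ^ (p + 1) •
        (shuf (n + 1) (a + 1) c C (sgl k (p + 1) q ((C.h (p + 1)).bLe c q (rotAt C p q a c y))) +
        shuf (n + 1) (a + 1) (c + 1) C (sgl k (p + 1) q ((C.h (p + 1)).b q (rotAt C p q a c y) -
          (C.h (p + 1)).bLe c q (rotAt C p q a c y)))) = cycH C (n + 1) p q y +
      nabla (n + 1) C (sgl k (p + 1) q (((C.h (p + 1)).t q ^ (q + 1))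
        ((C.v q).extra p ((C.v q).norm p y)))) := by
    rw [Finset.sum_congr rfl fun a ha => H.sum_shuf_h (n + 1) p q a
      (Nat.lt_succ_iff.mp (Finset.mem_range.mp ha)) (by omega) y, Finset.sum_add_distrib,
      norm_eq, LinearMap.sum_apply, map_sum, map_sum, map_sum, map_sum, cycH_eq_sum]
    exact add_comm _ _
  have h4 : ∑ a ∈ Finset.range (p + 1), ∑ c ∈ Finset.range (q + 1),
        (shuf (n + 1) a (c + 1) C (sgl k p (q + 1) ((C.v (q + 1)).bLe a p (rotAt C p q a c y))) +
        shuf (n + 1) (a + 1) (c + 1) C (sgl k p (q + 1) ((C.v (q + 1)).b p (rotAt C p q a c y) -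
          (C.v (q + 1)).bLe a p (rotAt C p q a c y)))) = cycV C (n + 1) p q y +
      (-1 : k) ^ p • nabla (n + 1) C (sgl k p (q + 1) ((C.h p).extra q ((C.h p).norm q y))) := by
    rw [Finset.sum_comm, Finset.sum_congr rfl fun c _ => H.sum_shuf_v (n + 1) p q c y,
      Finset.sum_add_distrib, norm_eq, LinearMap.sum_apply, map_sum, map_sum, map_sum,
      Finset.smul_sum, cycV_eq_sum]
    exact add_comm _ _
  rw [h1, sum_range_add_add, h2, h3, h4]
  abel

end IsCylindrical

end CylindricalOps

/-! ### The cyclic shuffle on normalized chains -/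

namespace CylindricalOps

open ParacyclicOps

namespace IsCylindrical

variable {k : Type u} [CommRing k] {X : ℕ → ℕ → Type v}
  [∀ p q, AddCommGroup (X p q)] [∀ p q, Module k (X p q)] {C : CylindricalOps k X}

theorem _root_.HopfCyclic.CylindricalOps.nabla_eq_sum (n : ℕ) (x : ∀ p q, X p q) :
    nabla n C x = ∑ pq ∈ Finset.HasAntidiagonal.antidiagonal n,
      nabla n C (sgl k pq.1 pq.2 (x pq.1 pq.2)) := by
  rw [← map_sum]
  refine nabla_congr n C fun p q hpq => ?_
  rw [Finset.sum_apply, Finset.sum_apply, Finset.sum_eq_single (p, q), sgl_same]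
  · rintro ⟨p', q'⟩ _ hne
    exact sgl_ne _ fun h => hne (by rw [h.1, h.2])
  · intro h
    exact absurd (Finset.HasAntidiagonal.mem_antidiagonal.mpr hpq) h

/-- The sum of all cyclic shuffles of a family of chains, in total degree `n`. -/
def cycFam (C : CylindricalOps k X) (n : ℕ) : (∀ p q, X p q) →ₗ[k] X (n + 2) (n + 2) :=
  ∑ pq ∈ Finset.HasAntidiagonal.antidiagonal n,
    cyc C (n + 2) pq.1 pq.2 ∘ₗ LinearMap.proj pq.2 ∘ₗ LinearMap.proj pq.1

theorem cycFam_apply (n : ℕ) (x : ∀ p q, X p q) : cycFam C n x =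
    ∑ pq ∈ Finset.HasAntidiagonal.antidiagonal n, cyc C (n + 2) pq.1 pq.2 (x pq.1 pq.2) := by
  simp [cycFam]

theorem sum_cycV_cycH (n : ℕ) (x : ∀ p q, X p q) :
    ∑ pq ∈ Finset.HasAntidiagonal.antidiagonal (n + 1),
      (cycV C (n + 2) pq.1 pq.2 (x pq.1 pq.2) + cycH C (n + 2) pq.1 pq.2 (x pq.1 pq.2)) =
    cycFam C n (C.famDiff x) := by
  rw [Finset.sum_add_distrib, Finset.Nat.sum_antidiagonal_succ, Finset.Nat.sum_antidiagonal_succ',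
    cycFam_apply]
  simp only [famDiff_apply, map_add, Finset.sum_add_distrib]
  simp [cycV, cycH]

/-- `(-1)^p f` for operators `f` in the `q`-direction, followed by `t^(q+1) g` for operators `g` in
the `p`-direction; for `f = B` and `g = B̄` this is the operator `B` of the total complex. -/
def famRaise (C : CylindricalOps k X) (f : ∀ p q, X p q →ₗ[k] X p (q + 1))
    (g : ∀ p q, X p q →ₗ[k] X (p + 1) q) : (∀ p q, X p q) →ₗ[k] (∀ p q, X p q) :=
  (LinearMap.pi fun p => (-1 : k) ^ p • (raise (f p) ∘ₗ LinearMap.proj p)) +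
    (raise fun p => LinearMap.pi fun q =>
      ((C.h (p + 1)).t q ^ (q + 1)) ∘ₗ g p q ∘ₗ LinearMap.proj q)

/-- The operator `B + T B̄` on families of chains. -/
def famB (C : CylindricalOps k X) : (∀ p q, X p q) →ₗ[k] (∀ p q, X p q) :=
  famRaise C (fun p q => (C.h p).B q) (fun p q => (C.v q).B p)

/-- The principal part of `famB` modulo degenerate chains. -/
def famE (C : CylindricalOps k X) : (∀ p q, X p q) →ₗ[k] (∀ p q, X p q) :=
  famRaise C (fun p q => (C.h p).extra q ∘ₗ (C.h p).norm q)
    (fun p q => (C.v q).extra p ∘ₗ (C.v q).norm p)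

theorem nabla_famE (n : ℕ) (x : ∀ p q, X p q) : nabla (n + 1) C (famE C x) =
    ∑ pq ∈ Finset.HasAntidiagonal.antidiagonal n,
      ((-1 : k) ^ pq.1 • nabla (n + 1) C (sgl k pq.1 (pq.2 + 1)
        ((C.h pq.1).extra pq.2 ((C.h pq.1).norm pq.2 (x pq.1 pq.2)))) +
      nabla (n + 1) C (sgl k (pq.1 + 1) pq.2 (((C.h (pq.1 + 1)).t pq.2 ^ (pq.2 + 1))
        ((C.v pq.2).extra pq.1 ((C.v pq.2).norm pq.1 (x pq.1 pq.2)))))) := by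
  rw [famE, famRaise, LinearMap.add_apply, map_add, nabla_eq_sum,
    nabla_eq_sum (x := (raise _) x), Finset.Nat.sum_antidiagonal_succ',
    Finset.Nat.sum_antidiagonal_succ, Finset.sum_add_distrib]
  simp

theorem _root_.HopfCyclic.ParacyclicOps.IsParacyclic.t_extra_mem {Y : ℕ → Type v}
    [∀ n, AddCommGroup (Y n)] [∀ n, Module k (Y n)] {P : ParacyclicOps k Y} (h : P.IsParacyclic)
    (n : ℕ) (y : Y n) : P.t (n + 1) (P.extra n y) ∈ P.degen (n + 1) := by
  rw [extra, LinearMap.comp_apply, ← h.s_t_zero]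
  exact s_mem_degen (Nat.zero_le _) _

theorem _root_.HopfCyclic.ParacyclicOps.IsParacyclic.B_sub_mem {Y : ℕ → Type v}
    [∀ n, AddCommGroup (Y n)] [∀ n, Module k (Y n)] {P : ParacyclicOps k Y} (h : P.IsParacyclic)
    (n : ℕ) (y : Y n) : P.B n y - P.extra n (P.norm n y) ∈ P.degen (n + 1) := by
  rw [B_apply, st, LinearMap.smul_apply, sub_sub_cancel_left]
  exact neg_mem (Submodule.smul_mem _ _ (h.t_extra_mem n _))

theorem t_pow_mem_degen (H : C.IsCylindrical) (p q i : ℕ) (y : X p q) (hy : y ∈ (C.v q).degen p) :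
    ((C.h p).t q ^ i) y ∈ (C.v q).degen p :=
  map_degen (C.v q) (C.v q) (fun p => (C.h p).t q ^ i)
    (fun p j hj x => pow_comm (fun z => H.t_s p q j hj z) i x) p y hy

theorem famB_sub_mem (H : C.IsCylindrical) (x : ∀ p q, X p q) (p q : ℕ) :
    (famB C x - famE C x) p q ∈ C.degen p q := by
  have h1 : ∀ p q, (-1 : k) ^ p • raise (fun q => (C.h p).B q) (x p) q -
      (-1 : k) ^ p • raise (fun q => (C.h p).extra q ∘ₗ (C.h p).norm q) (x p) q ∈
        C.degen p q := fun p q => by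
    rcases q with _ | q
    · simp
    · rw [← smul_sub]
      exact Submodule.smul_mem _ _ (Submodule.mem_sup_left ((H.h_para p).B_sub_mem q _))
  have h2 : ∀ p q, ((raise fun p => LinearMap.pi fun q =>
      ((C.h (p + 1)).t q ^ (q + 1)) ∘ₗ (C.v q).B p ∘ₗ LinearMap.proj q) x -
      (raise fun p => LinearMap.pi fun q => ((C.h (p + 1)).t q ^ (q + 1)) ∘ₗ
        ((C.v q).extra p ∘ₗ (C.v q).norm p) ∘ₗ LinearMap.proj q) x : ∀ p q, X p q) p q ∈
        C.degen p q := fun p q => by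
    rcases p with _ | p
    · simp
    · have : ((C.h (p + 1)).t q ^ (q + 1)) ((C.v q).B p (x p q) -
          (C.v q).extra p ((C.v q).norm p (x p q))) ∈ C.degen (p + 1) q :=
        Submodule.mem_sup_right (H.t_pow_mem_degen _ _ _ _ ((H.v_para q).B_sub_mem p _))
      rw [map_sub] at this
      exact this
  have := add_mem (h1 p q) (h2 p q)
  convert this using 1
  simp only [famB, famE, famRaise, LinearMap.add_apply, Pi.sub_apply, Pi.add_apply,
    LinearMap.pi_apply, LinearMap.smul_apply, LinearMap.comp_apply, LinearMap.proj_apply,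
    Pi.smul_apply]
  abel

/-- The cyclic shuffles are a homotopy between the two operators `B`, up to degenerate chains. -/
theorem b_cycFam (H : C.IsCylindrical) (n : ℕ) (x : ∀ p q, X p q) :
    C.diag.b (n + 1) (cycFam C n x) -
      (∑ pq ∈ Finset.HasAntidiagonal.antidiagonal n,
        (cycV C (n + 1) pq.1 pq.2 (x pq.1 pq.2) + cycH C (n + 1) pq.1 pq.2 (x pq.1 pq.2)) +
      nabla (n + 1) C (famB C x) - C.diag.B n (nabla n C x)) ∈ C.diag.degen (n + 1) := by
  have h1 : C.diag.b (n + 1) (cycFam C n x) = ∑ pq ∈ Finset.HasAntidiagonal.antidiagonal n,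
        (cycV C (n + 1) pq.1 pq.2 (x pq.1 pq.2) + cycH C (n + 1) pq.1 pq.2 (x pq.1 pq.2)) +
      nabla (n + 1) C (famE C x) - C.diag.extra n (C.diag.norm n (nabla n C x)) := by
    rw [cycFam_apply, map_sum, nabla_famE, nabla_eq_sum n x, map_sum, map_sum,
      ← Finset.sum_add_distrib, ← Finset.sum_sub_distrib]
    refine Finset.sum_congr rfl fun pq hpq => ?_
    rw [H.b_cyc n pq.1 pq.2 (Finset.HasAntidiagonal.mem_antidiagonal.mp hpq), add_assoc]
  have h2 := nabla_mem_degen (n + 1) H.isBisimplicial _ (H.famB_sub_mem x)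
  have h3 := H.diag.toIsParacyclic.B_sub_mem n (nabla n C x)
  rw [h1]
  rw [map_sub] at h2
  have := sub_mem h3 h2
  convert this using 1
  abel

/-- Chains degenerate in the `q`-direction, together with the image of the extra degeneracy. -/
def hExt (C : CylindricalOps k X) (p : ℕ) : ∀ q, Submodule k (X p q)
  | 0 => ⊥
  | q + 1 => (C.h p).degen (q + 1) ⊔ LinearMap.range ((C.h p).extra q)

/-- Chains degenerate in the `p`-direction, together with the image of the extra degeneracy. -/
def vExt (C : CylindricalOps k X) : ∀ p q, Submodule k (X p q)
  | 0, _ => ⊥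
  | p + 1, q => (C.v q).degen (p + 1) ⊔ LinearMap.range ((C.v q).extra p)

theorem degen_le_ext (p q : ℕ) : C.degen p q ≤ hExt C p q ⊔ vExt C p q := by
  refine sup_le_sup ?_ ?_
  · rcases q with _ | q
    · exact le_rfl
    · exact le_sup_left
  · rcases p with _ | p
    · exact le_rfl
    · exact le_sup_left

theorem st_pow_ext {Y : ℕ → Type v} [∀ n, AddCommGroup (Y n)] [∀ n, Module k (Y n)]
    {P : ParacyclicOps k Y} (h : P.IsParacyclic) (n i : ℕ) (y : Y (n + 1))
    (hy : y ∈ P.degen (n + 1) ⊔ LinearMap.range (P.extra n)) :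
    (P.st (n + 1) ^ i) y ∈ P.degen (n + 1) ⊔ LinearMap.range (P.extra n) := by
  induction i with
  | zero => exact hy
  | succ i ih =>
    rw [pow_succ', Module.End.mul_apply]
    exact Submodule.smul_mem _ _ (h.t_ext n _ ih)

theorem rotAt_mem_degen (H : C.IsCylindrical) (p q a c : ℕ) (y : X p q)
    (hy : y ∈ hExt C p q ⊔ vExt C p q) : rotAt C p q a c y ∈ C.degen (p + 1) (q + 1) := by
  obtain ⟨y, hy1, z, hz, rfl⟩ := Submodule.mem_sup.mp hy
  rw [map_add]
  refine add_mem ?_ ?_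
  · rcases q with _ | q
    · rw [(Submodule.mem_bot k).mp hy1, map_zero]; exact zero_mem _
    · have h1 := ((H.h_para p).extra_ext q _ (st_pow_ext (H.h_para p) q c y hy1)).1
      rw [H.rotAt_eq_v]
      refine Submodule.smul_mem _ _ (Submodule.mem_sup_left ?_)
      refine map_degen (C.h p) (C.h (p + 1))
        (fun q => (C.v q).extra p ∘ₗ ((C.v q).st p ^ a)) (fun q i hi x => ?_) _ _ h1
      rw [LinearMap.comp_apply, LinearMap.comp_apply, H.s_extra p q i hi]
      congr 1
      exact pow_comm (fun z => by
        simp only [st, LinearMap.smul_apply, map_smul, H.s_t p q i hi]) a x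
  · rcases p with _ | p
    · rw [(Submodule.mem_bot k).mp hz, map_zero]; exact zero_mem _
    · have h1 := ((H.v_para q).extra_ext p _ (st_pow_ext (H.v_para q) p a z hz)).1
      rw [H.rotAt_eq_h]
      refine Submodule.smul_mem _ _ (Submodule.mem_sup_right ?_)
      refine map_degen (C.v q) (C.v (q + 1))
        (fun p => (C.h p).extra q ∘ₗ ((C.h p).st q ^ c)) (fun p j hj x => ?_) _ _ h1
      rw [LinearMap.comp_apply, LinearMap.comp_apply, ← H.extra_s p q j hj]
      congr 1
      exact pow_comm (fun z => by
        simp only [st, LinearMap.smul_apply, map_smul, H.t_s p q j hj]) c x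

theorem sgl_mem_degen (p q : ℕ) (y : X p q) (hy : y ∈ C.degen p q) (p' q' : ℕ) :
    sgl k p q y p' q' ∈ C.degen p' q' := by
  by_cases h : p' = p ∧ q' = q
  · obtain ⟨rfl, rfl⟩ := h
    rwa [sgl_same]
  · rw [sgl_ne _ h]; exact zero_mem _

theorem cycFam_mem_degen (H : C.IsCylindrical) (n : ℕ) (x : ∀ p q, X p q)
    (hx : ∀ p q, x p q ∈ hExt C p q ⊔ vExt C p q) : cycFam C n x ∈ C.diag.degen (n + 2) := by
  rw [cycFam_apply]
  refine Submodule.sum_mem _ fun pq _ => ?_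
  rw [cyc_apply]
  refine Submodule.sum_mem _ fun a _ => Submodule.sum_mem _ fun c _ => ?_
  exact shuf_mem_degen _ _ _ H.isBisimplicial _
    (sgl_mem_degen _ _ _ (H.rotAt_mem_degen _ _ a c _ (hx _ _)))

theorem famB_mem_ext (H : C.IsCylindrical) (x : ∀ p q, X p q) (p q : ℕ) :
    famB C x p q ∈ hExt C p q ⊔ vExt C p q := by
  have hB : ∀ {Y : ℕ → Type v} [∀ n, AddCommGroup (Y n)] [∀ n, Module k (Y n)]
      {P : ParacyclicOps k Y}, P.IsParacyclic → ∀ n y,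
        P.B n y ∈ P.degen (n + 1) ⊔ LinearMap.range (P.extra n) := fun {Y _ _ P} h n y => by
    rw [← sub_add_cancel (P.B n y) (P.extra n (P.norm n y))]
    exact add_mem (Submodule.mem_sup_left (h.B_sub_mem n y)) (Submodule.mem_sup_right ⟨_, rfl⟩)
  refine add_mem (Submodule.mem_sup_left ?_) (Submodule.mem_sup_right ?_)
  · rcases q with _ | q
    · change (-1 : k) ^ p • (0 : X p 0) ∈ _
      rw [smul_zero]; exact zero_mem _
    · exact Submodule.smul_mem _ _ (hB (H.h_para p) q _)
  · rcases p with _ | p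
    · exact zero_mem _
    · change ((C.h (p + 1)).t q ^ (q + 1)) ((C.v q).B p (x p q)) ∈ _
      obtain ⟨y, hy, _, ⟨z, rfl⟩, h⟩ := Submodule.mem_sup.mp (hB (H.v_para q) p (x p q))
      rw [← h, map_add]
      refine add_mem (Submodule.mem_sup_left (H.t_pow_mem_degen _ _ _ _ hy))
        (Submodule.mem_sup_right ⟨((C.h p).t q ^ (q + 1)) z, ?_⟩)
      exact (pow_comm (fun z => H.t_extra p q z) (q + 1) z).symm

/-- The cyclic shuffles lie in the image of the extra degeneracy of the diagonal. -/
theorem cyc_mem_range (H : C.IsCylindrical) (m p q : ℕ) (y : X p q) :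
    cyc C (m + 1) p q y ∈ LinearMap.range (C.diag.extra m) := by
  rw [cyc_apply]
  refine Submodule.sum_mem _ fun a _ => Submodule.sum_mem _ fun c _ => ?_
  set w := (((C.v q).st p ^ a) (((C.h p).st q ^ c) y)) with hw
  have key : ∀ m a c p q (y : X p q), shuf m a c C.dec (sgl k (X := fun p q => X (p + 1) (q + 1)) p q
      ((C.v (q + 1)).extra p ((C.h p).extra q y))) ∈ LinearMap.range (C.diag.extra m) :=
    fun m a c p q y => ⟨shuf m a c C (sgl k p q y), by
      rw [H.diag_extra]
      exact H.isDegMap_extra.shuf_sgl m a c p q y⟩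
  have h1 : (C.h (p + 1)).s (q + 1) 0 ((C.v (q + 1)).extra p ((C.h p).extra q w)) =
      (C.v (q + 2)).extra p ((C.h p).extra (q + 1) ((C.h p).extra q w)) := by
    rw [H.s_extra _ _ _ (Nat.zero_le _), (H.h_para p).extra_extra]
  have h2 : (C.v (q + 1)).s (p + 1) 0 ((C.v (q + 1)).extra p ((C.h p).extra q w)) =
      (C.v (q + 1)).extra (p + 1) ((C.h (p + 1)).extra q ((C.v q).extra p w)) := by
    rw [← (H.v_para _).extra_extra, H.extra_extra]
  rw [shuf_succ, stepH_sgl_succ, stepV_sgl_succ, rotAt_apply]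
  simp only [map_smul]
  rw [h1, h2]
  exact add_mem (Submodule.smul_mem _ _ (key _ _ _ _ _ _))
    (Submodule.smul_mem _ _ (Submodule.smul_mem _ _ (key _ _ _ _ _ _)))

theorem B_cycFam (H : C.IsCylindrical) (n : ℕ) (x : ∀ p q, X p q) :
    C.diag.B (n + 2) (cycFam C n x) ∈ C.diag.degen (n + 3) := by
  rw [cycFam_apply, map_sum]
  exact Submodule.sum_mem _ fun pq _ => H.diag.toIsParacyclic.B_ext _ _
    (Submodule.mem_sup_right (H.cyc_mem_range _ _ _ _))

end IsCylindrical

end CylindricalOps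

/-! ### Normalized chains -/

namespace MixedComplex

variable {k : Type u} [CommRing k] {V V' : ℕ → Type*}
  [∀ n, AddCommGroup (V n)] [∀ n, Module k (V n)] [∀ n, AddCommGroup (V' n)] [∀ n, Module k (V' n)]

/-- The compatibility of `F₀ + u F₁` with `b + u B`, sorted by powers of `u`. -/
theorem level_add_raise₂_total (M : MixedComplex k V) (M' : MixedComplex k V')
    (F₀ : ∀ n, V n →ₗ[k] V' n) (F₁ : ∀ n, V n →ₗ[k] V' (n + 2))
    (h0 : ∀ n x, F₀ n (M.b n x) = M'.b n (F₀ (n + 1) x))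
    (h1 : ∀ x, F₀ 1 (M.B 0 x) = M'.B 0 (F₀ 0 x) + M'.b 1 (F₁ 0 x))
    (h1' : ∀ n x, F₀ (n + 2) (M.B (n + 1) x) + F₁ n (M.b n x) =
      M'.B (n + 1) (F₀ (n + 1) x) + M'.b (n + 2) (F₁ (n + 1) x))
    (h2 : ∀ n x, F₁ (n + 1) (M.B n x) = M'.B (n + 2) (F₁ n x)) (x : ∀ n, V n) :
    (level F₀ + raise₂ F₁) (M.total x) = M'.total ((level F₀ + raise₂ F₁) x) := by
  funext n
  rcases n with _ | _ | _ | n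
  · simp [total_zero, h0]
  · simp [total_succ, h0, h1]
    abel
  · have := h1' 0 (x 1)
    simp only [LinearMap.add_apply, Pi.add_apply, level_apply, raise₂_add_two, raise₂_one,
      total_zero, total_succ, map_add, h0, add_zero]
    refine (add_assoc _ _ _).trans ((congrArg (_ + ·) this).trans ?_)
    abel
  · have := h1' (n + 1) (x (n + 2))
    simp only [LinearMap.add_apply, Pi.add_apply, level_apply, raise₂_add_two,
      total_succ, map_add, h0, h2]
    rw [eq_sub_of_add_eq this]
    abel

end MixedComplex

namespace ParacyclicOps

variable {k : Type u} [CommRing k] {X : ℕ → Type v}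
  [∀ n, AddCommGroup (X n)] [∀ n, Module k (X n)]

/-- The normalized mixed complex of a cyclic module. -/
def normMixed (P : ParacyclicOps k X) (h : P.IsCyclic) : MixedComplex k fun n => X n ⧸ P.degen n where
  b n := Submodule.mapQ _ _ (P.b n) (h.b_degen n)
  B n := Submodule.mapQ _ _ (P.B n) (h.B_degen n)
  b_b n x := by
    obtain ⟨x, rfl⟩ := Submodule.Quotient.mk_surjective _ x
    exact (congrArg Submodule.Quotient.mk ((P.mixed h).b_b n x)).trans rfl
  B_B n x := by
    obtain ⟨x, rfl⟩ := Submodule.Quotient.mk_surjective _ x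
    exact (congrArg Submodule.Quotient.mk ((P.mixed h).B_B n x)).trans rfl
  b_B_zero x := by
    obtain ⟨x, rfl⟩ := Submodule.Quotient.mk_surjective _ x
    exact (congrArg Submodule.Quotient.mk ((P.mixed h).b_B_zero x)).trans rfl
  b_B_succ n x := by
    obtain ⟨x, rfl⟩ := Submodule.Quotient.mk_surjective _ x
    exact (congrArg Submodule.Quotient.mk ((P.mixed h).b_B_succ n x)).trans rfl

end ParacyclicOps

namespace CylindricalOps

open ParacyclicOps

namespace IsCylindrical

variable {k : Type u} [CommRing k] {X : ℕ → ℕ → Type v}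
  [∀ p q, AddCommGroup (X p q)] [∀ p q, Module k (X p q)] {C : CylindricalOps k X}

theorem normSub_zero {X : ℕ → ℕ → Type v} [∀ p q, AddCommGroup (X p q)] [∀ p q, Module k (X p q)]
    (C : CylindricalOps k X) (x : X 0 0) : normSub 0 C x = 0 := by
  rw [normSub_apply, normProj_zero, sub_self]

/-- Normalization of the diagonal is a homotopy equivalence. -/
theorem nonempty_diag_equiv_normMixed (H : C.IsCylindrical) {W : Type*} [AddCommGroup W] [Module k W]
    [Module k[X] W] (𝒲 : ℤ → Submodule k W) (n : ℤ) :
    Nonempty ((C.diag.mixed H.diag).HC 𝒲 n ≃ₗ[k] (C.diag.normMixed H.diag).HC 𝒲 n) := by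
  refine MixedComplex.nonempty_HC_equiv _ _ (fun n => (C.diag.degen n).mkQ) (fun n => 0)
    (MixedComplex.level_add_raise₂_total _ _ _ _ (fun n x => rfl) (fun x => ?_) (fun n x => ?_)
      (fun n x => ?_))
    (fun n => (C.diag.degen n).liftQ (normProj n C) fun x hx =>
      normProj_of_mem n H.isBisimplicial x hx) (fun n x => ?_)
    (fun n => htpy normSub n C) (fun n => 0) (fun x => ?_) (fun n x => ?_) (fun x => ?_)
    (fun n x => ?_) 𝒲 n
  · rw [LinearMap.zero_apply, map_zero, add_zero]; rfl
  · rw [LinearMap.zero_apply, LinearMap.zero_apply, map_zero, add_zero, add_zero]; rfl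
  · rw [LinearMap.zero_apply, LinearMap.zero_apply, map_zero]
  · obtain ⟨x, rfl⟩ := Submodule.Quotient.mk_surjective _ x
    exact normProj_isChainMap n H.isBisimplicial x
  · rw [htpy_zero, map_zero, add_zero]; rfl
  · have := htpy_spec normSub_natural normSub_isChainMap normSub_zero n H.isBisimplicial x
    rw [normSub_apply, sub_eq_iff_eq_add'] at this
    exact this
  all_goals
    obtain ⟨x, rfl⟩ := Submodule.Quotient.mk_surjective _ x
    simp only [LinearMap.zero_apply, map_zero, add_zero]
    exact (Submodule.Quotient.eq _).mpr (normProj_sub_mem _ C x)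

/-- The classes of a family of chains modulo degenerate ones. -/
def famMk (C : CylindricalOps k X) : (∀ p q, X p q) →ₗ[k] (∀ p q, C.Norm p q) :=
  LinearMap.pi fun p => LinearMap.pi fun q =>
    (C.degen p q).mkQ ∘ₗ LinearMap.proj q ∘ₗ LinearMap.proj p

theorem famMk_apply (x : ∀ p q, X p q) (p q : ℕ) :
    famMk C x p q = Submodule.Quotient.mk (x p q) := rfl

theorem famMk_surjective : Function.Surjective (famMk C) := fun y => by
  choose f hf using fun p q => Submodule.Quotient.mk_surjective _ (y p q)
  exact ⟨f, funext fun p => funext fun q => hf p q⟩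

theorem mem_ker_famMk {x : ∀ p q, X p q} :
    x ∈ LinearMap.ker (famMk C) ↔ ∀ p q, x p q ∈ C.degen p q := by
  rw [LinearMap.mem_ker]
  constructor
  · intro h p q
    exact (Submodule.Quotient.mk_eq_zero _).mp (congrFun (congrFun h p) q)
  · intro h
    funext p q
    exact (Submodule.Quotient.mk_eq_zero _).mpr (h p q)

/-- The map on normalized families induced by a map that kills degenerate families. -/
noncomputable def famLift {Z : Type*} [AddCommGroup Z] [Module k Z] (f : (∀ p q, X p q) →ₗ[k] Z)
    (hf : ∀ x : ∀ p q, X p q, (∀ p q, x p q ∈ C.degen p q) → f x = 0) :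
    (∀ p q, C.Norm p q) →ₗ[k] Z :=
  (LinearMap.ker (famMk C)).liftQ f (fun x hx => hf x (mem_ker_famMk.mp hx)) ∘ₗ
    ((famMk C).quotKerEquivOfSurjective famMk_surjective).symm.toLinearMap

theorem famLift_famMk {Z : Type*} [AddCommGroup Z] [Module k Z] (f : (∀ p q, X p q) →ₗ[k] Z)
    (hf : ∀ x : ∀ p q, X p q, (∀ p q, x p q ∈ C.degen p q) → f x = 0) (x : ∀ p q, X p q) :
    famLift f hf (famMk C x) = f x := by
  have : ((famMk C).quotKerEquivOfSurjective famMk_surjective).symm (famMk C x) =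
      Submodule.Quotient.mk x := by
    rw [LinearEquiv.symm_apply_eq]; rfl
  rw [famLift, LinearMap.comp_apply, LinearEquiv.coe_coe, this]
  rfl

theorem totb_famMk (H : C.IsCylindrical) (x : ∀ p q, X p q) :
    H.totb (famMk C x) = famMk C (C.famDiff x) := by
  funext p q
  rw [famMk_apply, famDiff_apply, add_comm]
  rfl

theorem totB_famMk (H : C.IsCylindrical) (x : ∀ p q, X p q) :
    H.totB (famMk C x) = famMk C (famB C x) := by
  funext p q
  rw [famMk_apply]
  have h1 : H.TB (famMk C x) p q = Submodule.Quotient.mk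
      ((-1 : k) ^ p • raise (fun q => (C.h p).B q) (x p) q) := by
    rcases q with _ | q <;> rfl
  have h2 : (H.T * H.TB') (famMk C x) p q = Submodule.Quotient.mk
      (raise (fun p => LinearMap.pi fun q =>
        ((C.h (p + 1)).t q ^ (q + 1)) ∘ₗ (C.v q).B p ∘ₗ LinearMap.proj q) x p q) := by
    have h : H.TB' (famMk C x) p q = Submodule.Quotient.mk
        (raise (fun p => LinearMap.pi fun q => (C.v q).B p ∘ₗ LinearMap.proj q) x p q) := by
      rcases p with _ | p <;> rfl
    rw [Module.End.mul_apply, H.T_apply _ p q _ h]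
    rcases p with _ | p
    · simp
    · rfl
  exact congrArg₂ (fun a b : C.Norm p q => a + b) h1 h2

/-- The shuffle map on normalized chains. -/
noncomputable def nablaNorm (H : C.IsCylindrical) (n : ℕ) : C.Tot n →ₗ[k] X n n ⧸ C.diag.degen n :=
  famLift ((C.diag.degen n).mkQ ∘ₗ nabla n C) (fun x hx => (Submodule.Quotient.mk_eq_zero _).mpr
    (nabla_mem_degen n H.isBisimplicial x hx)) ∘ₗ (C.Tot n).subtype

/-- The cyclic shuffle map on normalized chains. -/
noncomputable def cycNorm (H : C.IsCylindrical) (n : ℕ) :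
    C.Tot n →ₗ[k] X (n + 2) (n + 2) ⧸ C.diag.degen (n + 2) :=
  famLift ((C.diag.degen (n + 2)).mkQ ∘ₗ cycFam C n) (fun x hx =>
    (Submodule.Quotient.mk_eq_zero _).mpr
      (H.cycFam_mem_degen n x fun p q => degen_le_ext p q (hx p q))) ∘ₗ (C.Tot n).subtype

/-- The Alexander–Whitney map on normalized chains. -/
def awNorm (H : C.IsCylindrical) (n : ℕ) : X n n ⧸ C.diag.degen n →ₗ[k] C.Tot n :=
  (C.diag.degen n).liftQ
    (LinearMap.codRestrict (C.Tot n) (famMk C ∘ₗ aw n C) fun x p q h => by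
      rw [LinearMap.comp_apply, famMk_apply, aw_eq_zero n C x p q (by omega)]; rfl)
    fun x hx => by
      rw [LinearMap.mem_ker]
      exact Subtype.ext (LinearMap.mem_ker.mp
        (mem_ker_famMk.mpr (aw_mem_degen n H.isBisimplicial x hx)))

theorem nablaNorm_apply (H : C.IsCylindrical) (n : ℕ) (y : C.Tot n) (x : ∀ p q, X p q)
    (h : y.1 = famMk C x) : nablaNorm H n y = Submodule.Quotient.mk (nabla n C x) := by
  rw [nablaNorm, LinearMap.comp_apply, Submodule.subtype_apply, h]
  exact famLift_famMk _ _ x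

theorem cycNorm_apply (H : C.IsCylindrical) (n : ℕ) (y : C.Tot n) (x : ∀ p q, X p q)
    (h : y.1 = famMk C x) : cycNorm H n y = Submodule.Quotient.mk (cycFam C n x) := by
  rw [cycNorm, LinearMap.comp_apply, Submodule.subtype_apply, h]
  exact famLift_famMk _ _ x

theorem awNorm_mk (H : C.IsCylindrical) (n : ℕ) (x : X n n) :
    (awNorm H n (Submodule.Quotient.mk x)).1 = famMk C (aw n C x) := rfl

/-- The homotopy between `∇ ∘ AW` and the identity on normalized chains. -/
def htpyNorm (H : C.IsCylindrical) (n : ℕ) :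
    X n n ⧸ C.diag.degen n →ₗ[k] X (n + 1) (n + 1) ⧸ C.diag.degen (n + 1) :=
  Submodule.mapQ _ _ (htpy shuffleSub n C)
    (htpy_mem_degen shuffleSub_natural shuffleSub_preservesDegen n H.isBisimplicial)

theorem exists_lift (y : ∀ p q, C.Norm p q) : ∃ x, y = famMk C x :=
  (famMk_surjective y).imp fun _ h => h.symm

theorem awNorm_nablaNorm (H : C.IsCylindrical) (n : ℕ) (y : C.Tot n) :
    awNorm H n (nablaNorm H n y) = y := by
  obtain ⟨x, hx⟩ := exists_lift y.1
  refine Subtype.ext (funext fun p => funext fun q => ?_)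
  by_cases h : p + q = n
  · rw [nablaNorm_apply H n y x hx, awNorm_mk, hx]
    exact (Submodule.Quotient.eq _).mpr (aw_nabla_sub_mem n H.isBisimplicial x p q h)
  · rw [y.2 p q (by omega), (awNorm H n _).2 p q (by omega)]

/-- The shuffles and cyclic shuffles identify the cyclic homology of the total complex of a
cylindrical module with that of the normalized diagonal. -/
theorem nonempty_tot_equiv_normMixed (H : C.IsCylindrical) {W : Type*} [AddCommGroup W] [Module k W]
    [Module k[X] W] (𝒲 : ℤ → Submodule k W) (n : ℤ) :
    Nonempty (H.tot.HC 𝒲 n ≃ₗ[k] (C.diag.normMixed H.diag).HC 𝒲 n) := by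
  have hb : ∀ n (y : C.Tot (n + 1 : ℕ)) x, y.1 = famMk C x →
      (H.tot.b n y).1 = famMk C (C.famDiff x) := fun n y x h => by
    rw [← H.totb_famMk, ← h]; rfl
  have hB : ∀ n (y : C.Tot (n : ℕ)) x, y.1 = famMk C x →
      (H.tot.B n y).1 = famMk C (famB C x) := fun n y x h => by
    rw [← H.totB_famMk, ← h]; rfl
  refine MixedComplex.nonempty_HC_equiv _ _ (nablaNorm H) (cycNorm H)
    (MixedComplex.level_add_raise₂_total _ _ _ _ (fun n y => ?_) (fun y => ?_) (fun n y => ?_)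
      (fun n y => ?_))
    (awNorm H) (fun n y => ?_) (fun n => 0) (htpyNorm H)
    (fun y => ?_) (fun n y => ?_) (fun y => ?_) (fun n y => ?_) 𝒲 n
  · obtain ⟨x, hx⟩ := exists_lift y.1
    rw [nablaNorm_apply H _ _ _ (hb _ _ _ hx), nablaNorm_apply H _ _ _ hx,
      ← nabla_b n H.isBisimplicial]
    rfl
  · obtain ⟨x, hx⟩ := exists_lift y.1
    rw [nablaNorm_apply H _ _ _ (hB _ _ _ hx), nablaNorm_apply H _ _ _ hx,
      cycNorm_apply H _ _ _ hx]
    refine ((Submodule.Quotient.eq _).mpr ?_ : Submodule.Quotient.mk _ =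
      (Submodule.Quotient.mk (C.diag.B 0 (nabla 0 C x) + C.diag.b 1 (cycFam C 0 x)) :
        X 1 1 ⧸ C.diag.degen 1))
    convert neg_mem (H.b_cycFam 0 x) using 1
    simp [cycV, cycH]
    abel
  · obtain ⟨x, hx⟩ := exists_lift y.1
    rw [nablaNorm_apply H _ _ _ (hB _ _ _ hx), nablaNorm_apply H _ _ _ hx,
      cycNorm_apply H _ _ _ hx, cycNorm_apply H _ _ _ (hb _ _ _ hx)]
    refine ((Submodule.Quotient.eq _).mpr ?_ : Submodule.Quotient.mk
      (nabla (n + 2) C (famB C x) + cycFam C n (C.famDiff x)) =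
      (Submodule.Quotient.mk (C.diag.B (n + 1) (nabla (n + 1) C x) +
        C.diag.b (n + 2) (cycFam C (n + 1) x)) : X (n + 2) (n + 2) ⧸ C.diag.degen (n + 2)))
    convert neg_mem (H.b_cycFam (n + 1) x) using 1
    rw [sum_cycV_cycH]
    abel
  · obtain ⟨x, hx⟩ := exists_lift y.1
    rw [cycNorm_apply H _ _ _ (hB _ _ _ hx), cycNorm_apply H _ _ _ hx]
    rw [(Submodule.Quotient.mk_eq_zero _).mpr (H.cycFam_mem_degen _ _ (H.famB_mem_ext x))]
    exact ((Submodule.Quotient.mk_eq_zero _).mpr (H.B_cycFam n x)).symm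
  · obtain ⟨x, rfl⟩ := Submodule.Quotient.mk_surjective _ y
    refine Subtype.ext ?_
    rw [hb n _ _ (awNorm_mk H _ x)]
    refine (awNorm_mk H n (C.diag.b n x)).trans ?_
    exact congrArg (famMk C) (funext fun p => funext fun q => aw_b n H.isBisimplicial x p q)
  · rw [awNorm_nablaNorm, LinearMap.zero_apply, map_zero, add_zero]
  · rw [awNorm_nablaNorm, LinearMap.zero_apply, LinearMap.zero_apply, map_zero, add_zero, add_zero]
  · obtain ⟨x, rfl⟩ := Submodule.Quotient.mk_surjective _ y
    rw [nablaNorm_apply H _ _ _ (awNorm_mk H _ x)]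
    refine congrArg Submodule.Quotient.mk (?_ : _ = x + C.diag.b 0 (htpy shuffleSub 0 C x))
    rw [htpy_zero, map_zero, add_zero]
    exact sub_eq_zero.mp (shuffleSub_zero C x)
  · obtain ⟨x, rfl⟩ := Submodule.Quotient.mk_surjective _ y
    rw [nablaNorm_apply H _ _ _ (awNorm_mk H _ x)]
    refine congrArg Submodule.Quotient.mk (?_ : _ = x + (C.diag.b (n + 1)
      (htpy shuffleSub (n + 1) C x) + htpy shuffleSub n C (C.diag.b n x)))
    have := htpy_spec shuffleSub_natural shuffleSub_isChainMap shuffleSub_zero n H.isBisimplicial x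
    rw [shuffleSub_apply, sub_eq_iff_eq_add'] at this
    exact this

/-- The cyclic homology of the total complex of a cylindrical module agrees with that of its
diagonal. -/
theorem nonempty_tot_equiv_diag (H : C.IsCylindrical) {W : Type*} [AddCommGroup W] [Module k W]
    [Module k[X] W] (𝒲 : ℤ → Submodule k W) (n : ℤ) :
    Nonempty (H.tot.HC 𝒲 n ≃ₗ[k] (C.diag.mixed H.diag).HC 𝒲 n) :=
  (H.nonempty_tot_equiv_normMixed 𝒲 n).map2 (fun e f => e.trans f.symm)
    (H.nonempty_diag_equiv_normMixed 𝒲 n)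

end IsCylindrical

end CylindricalOps

/-! ### Ordered products -/

section OrdProd

variable {G : Type*} [Group G]

/-- The product `f 0 * f 1 * ⋯ * f (m - 1)`. -/
def ordProd (f : ℕ → G) : ℕ → G
  | 0 => 1
  | m + 1 => ordProd f m * f m

/-- The product `f (m - 1) * ⋯ * f 1 * f 0`. -/
def revProd (f : ℕ → G) : ℕ → G
  | 0 => 1
  | m + 1 => f m * revProd f m

theorem ordProd_succ (f : ℕ → G) (m : ℕ) : ordProd f (m + 1) = ordProd f m * f m := rfl

theorem revProd_succ (f : ℕ → G) (m : ℕ) : revProd f (m + 1) = f m * revProd f m := rfl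

theorem ordProd_succ' (f : ℕ → G) : ∀ m, ordProd f (m + 1) = f 0 * ordProd (fun i => f (i + 1)) m
  | 0 => by simp [ordProd]
  | m + 1 => by rw [ordProd, ordProd_succ' f m, mul_assoc]; rfl

theorem revProd_succ' (f : ℕ → G) : ∀ m, revProd f (m + 1) = revProd (fun i => f (i + 1)) m * f 0
  | 0 => by simp [revProd]
  | m + 1 => by rw [revProd, revProd_succ' f m, ← mul_assoc]; rfl

theorem inv_ordProd (f : ℕ → G) : ∀ m, (ordProd f m)⁻¹ = revProd (fun i => (f i)⁻¹) m
  | 0 => inv_one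
  | m + 1 => by rw [ordProd, mul_inv_rev, inv_ordProd f m, revProd]

theorem inv_revProd (f : ℕ → G) : ∀ m, (revProd f m)⁻¹ = ordProd (fun i => (f i)⁻¹) m
  | 0 => inv_one
  | m + 1 => by rw [revProd, mul_inv_rev, inv_revProd f m, ordProd]

theorem commute_ordProd (f : ℕ → G) (a : G) : ∀ m, (∀ i < m, Commute a (f i)) → Commute a (ordProd f m)
  | 0, _ => Commute.one_right a
  | m + 1, h => (commute_ordProd f a m fun i hi => h i (by omega)).mul_right (h m (by omega))

theorem commute_revProd (f : ℕ → G) (a : G) : ∀ m, (∀ i < m, Commute a (f i)) → Commute a (revProd f m)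
  | 0, _ => Commute.one_right a
  | m + 1, h => (h m (by omega)).mul_right (commute_revProd f a m fun i hi => h i (by omega))

theorem revProd_mul (f g : ℕ → G) : ∀ m, (∀ i < m, ∀ j < m, i ≠ j → Commute (f i) (g j)) →
    revProd f m * revProd g m = revProd (fun i => f i * g i) m
  | 0, _ => mul_one 1
  | m + 1, h => by
    have hc : Commute (g m) (revProd f m) :=
      commute_revProd f (g m) m fun i hi => (h i (by omega) m (by omega) (by omega)).symm
    rw [revProd, revProd, revProd, ← revProd_mul f g m fun i hi j hj => h i (by omega) j (by omega),
      mul_assoc, ← mul_assoc (revProd f m), ← hc.eq]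
    simp only [mul_assoc]

/-- The operators of a grid may be multiplied by rows or by columns. -/
theorem ordProd_revProd (e : ℕ → ℕ → G) (q : ℕ) : ∀ p,
    (∀ j < p, ∀ j' < p, ∀ i < q, ∀ i' < q, j ≠ j' → i ≠ i' → Commute (e j i) (e j' i')) →
    ordProd (fun j => revProd (e j) q) p = revProd (fun i => ordProd (fun j => e j i) p) q
  | 0, _ => by
    induction q with
    | zero => rfl
    | succ q ih => rw [revProd, ← ih (by simp)]; simp [ordProd]
  | p + 1, h => by
    rw [ordProd, ordProd_revProd e q p fun j hj j' hj' => h j (by omega) j' (by omega), revProd_mul]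
    · rfl
    · intro i hi i' hi' hne
      exact (commute_ordProd _ _ _ fun j hj =>
        (h j (by omega) p (by omega) i hi i' hi' (by omega) hne).symm).symm

variable {k : Type u} [CommRing k] {M N : Type*} [AddCommGroup M] [Module k M] [AddCommGroup N]
  [Module k N]

theorem map_ordProd (φ : M →ₗ[k] N) (f : ℕ → M ≃ₗ[k] M) (g : ℕ → N ≃ₗ[k] N) :
    ∀ m, (∀ i < m, ∀ x, φ (f i x) = g i (φ x)) → ∀ x, φ (ordProd f m x) = ordProd g m (φ x)
  | 0, _, x => rfl
  | m + 1, h, x => by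
    rw [ordProd, ordProd, LinearEquiv.mul_apply, LinearEquiv.mul_apply,
      map_ordProd φ f g m (fun i hi => h i (by omega)), h m (by omega)]

theorem map_revProd (φ : M →ₗ[k] N) (f : ℕ → M ≃ₗ[k] M) (g : ℕ → N ≃ₗ[k] N) :
    ∀ m, (∀ i < m, ∀ x, φ (f i x) = g i (φ x)) → ∀ x, φ (revProd f m x) = revProd g m (φ x)
  | 0, _, x => rfl
  | m + 1, h, x => by
    rw [revProd, revProd, LinearEquiv.mul_apply, LinearEquiv.mul_apply, h m (by omega),
      map_revProd φ f g m (fun i hi => h i (by omega))]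

theorem map_inv_apply {φ : M →ₗ[k] N} {f : M ≃ₗ[k] M} {g : N ≃ₗ[k] N} (h : ∀ x, φ (f x) = g (φ x))
    (x : M) : φ (f⁻¹ x) = g⁻¹ (φ x) := by
  change _ = g.symm _
  rw [LinearEquiv.eq_symm_apply, ← h]
  exact congrArg φ (f.apply_symm_apply x)

theorem inv_apply_self (f : M ≃ₗ[k] M) (x : M) : f⁻¹ (f x) = x := f.symm_apply_apply x

end OrdProd

/-! ### Twisted paracyclic modules -/

namespace ParacyclicOps

variable {k : Type u} [CommRing k] {X : ℕ → Type v}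
  [∀ n, AddCommGroup (X n)] [∀ n, Module k (X n)]

/-- Automorphisms `e n j` of `X n`, one for each of the `n + 1` slots, that are permuted by the
cyclic operator, multiplied by the faces and trivial on the slots filled by degeneracies. -/
structure IsTwisting (P : ParacyclicOps k X) (e : ∀ n, ℕ → (X n ≃ₗ[k] X n)) : Prop where
  t_e : ∀ n j, j < n → ∀ x, P.t n (e n j x) = e n (j + 1) (P.t n x)
  t_e_last : ∀ n x, P.t n (e n n x) = e n 0 (P.t n x)
  e_zero_d_zero : ∀ n x, e n 0 (P.d n 0 x) = P.d n 0 (e (n + 1) 0 (e (n + 1) 1 x))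
  e_zero_d_succ : ∀ n l, l < n → ∀ x, e n 0 (P.d n (l + 1) x) = P.d n (l + 1) (e (n + 1) 0 x)
  e_succ_d_zero : ∀ n j, j < n → ∀ x, e n (j + 1) (P.d n 0 x) = P.d n 0 (e (n + 1) (j + 2) x)
  e_zero_s : ∀ n l, l ≤ n → ∀ x, e (n + 1) 0 (P.s n l x) = P.s n l (e n 0 x)
  e_succ_s : ∀ n l, l ≤ n → ∀ x, e (n + 1) (l + 1) (P.s n l x) = P.s n l x
  e_succ_s_zero : ∀ n j, j < n → ∀ x, e (n + 1) (j + 2) (P.s n 0 x) = P.s n 0 (e n (j + 1) x)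

/-- `Q` arises from `P` by composing the cyclic operator with the automorphism of the first slot. -/
structure IsTwist (P : ParacyclicOps k X) (e : ∀ n, ℕ → (X n ≃ₗ[k] X n)) (Q : ParacyclicOps k X) :
    Prop where
  d : ∀ n i, i ≤ n → ∀ x, Q.d n i x = P.d n i x
  d_last : ∀ n x, Q.d n (n + 1) x = P.d n 0 (Q.t (n + 1) x)
  s : ∀ n i, i ≤ n → ∀ x, Q.s n i x = P.s n i x
  t : ∀ n x, Q.t n x = e n 0 (P.t n x)

variable {P Q : ParacyclicOps k X} {e e' : ∀ n, ℕ → (X n ≃ₗ[k] X n)}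

theorem IsTwisting.one (P : ParacyclicOps k X) : P.IsTwisting fun _ _ => 1 := by
  constructor <;> intros <;> rfl

theorem IsTwisting.mul (h : P.IsTwisting e) (h' : P.IsTwisting e')
    (hc : ∀ n, Commute (e (n + 1) 1) (e' (n + 1) 0)) : P.IsTwisting fun n j => e n j * e' n j where
  t_e n j hj x := by simp only [LinearEquiv.mul_apply, h.t_e n j hj, h'.t_e n j hj]
  t_e_last n x := by simp only [LinearEquiv.mul_apply, h.t_e_last, h'.t_e_last]
  e_zero_d_zero n x := by
    simp only [LinearEquiv.mul_apply, h'.e_zero_d_zero, h.e_zero_d_zero]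
    congr 2
    exact LinearEquiv.congr_fun (hc n).eq _
  e_zero_d_succ n l hl x := by
    simp only [LinearEquiv.mul_apply, h.e_zero_d_succ n l hl, h'.e_zero_d_succ n l hl]
  e_succ_d_zero n j hj x := by
    simp only [LinearEquiv.mul_apply, h.e_succ_d_zero n j hj, h'.e_succ_d_zero n j hj]
  e_zero_s n l hl x := by
    simp only [LinearEquiv.mul_apply, h.e_zero_s n l hl, h'.e_zero_s n l hl]
  e_succ_s n l hl x := by
    simp only [LinearEquiv.mul_apply, h.e_succ_s n l hl, h'.e_succ_s n l hl]
  e_succ_s_zero n j hj x := by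
    simp only [LinearEquiv.mul_apply, h.e_succ_s_zero n j hj, h'.e_succ_s_zero n j hj]

theorem IsTwisting.revProd {e : ℕ → ∀ n, ℕ → (X n ≃ₗ[k] X n)} : ∀ m : ℕ,
    (∀ i < m, P.IsTwisting (e i)) →
    (∀ i < m, ∀ i' < m, i ≠ i' → ∀ n, Commute (e i (n + 1) 1) (e i' (n + 1) 0)) →
    P.IsTwisting fun n j => HopfCyclic.revProd (fun i => e i n j) m
  | 0, _, _ => IsTwisting.one P
  | m + 1, h, hc => (h m (by omega)).mul
      (IsTwisting.revProd m (fun i hi => h i (by omega)) fun i hi i' hi' => hc i (by omega) i' (by omega))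
      fun n => commute_revProd _ _ _ fun i hi => hc m (by omega) i (by omega) (by omega) n

theorem IsTwisting.d_zero_ordProd (h : P.IsTwisting e) (n : ℕ) : ∀ m ≤ n, ∀ x,
    P.d n 0 (ordProd (e (n + 1)) (m + 2) x) = ordProd (e n) (m + 1) (P.d n 0 x)
  | 0, _, x => by
    simp only [ordProd, one_mul, LinearEquiv.mul_apply]
    rw [h.e_zero_d_zero]
  | m + 1, hm, x => by
    rw [ordProd_succ _ (m + 2), ordProd_succ (e n) (m + 1), LinearEquiv.mul_apply, LinearEquiv.mul_apply,
      h.d_zero_ordProd n m (by omega), h.e_succ_d_zero n m (by omega)]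

theorem IsTwisting.s_zero_ordProd (h : P.IsTwisting e) (n : ℕ) : ∀ m ≤ n, ∀ x,
    P.s n 0 (ordProd (e n) (m + 1) x) = ordProd (e (n + 1)) (m + 2) (P.s n 0 x)
  | 0, _, x => by
    simp only [ordProd, one_mul, LinearEquiv.mul_apply]
    rw [h.e_succ_s n 0 (by omega), h.e_zero_s n 0 (by omega)]
  | m + 1, hm, x => by
    rw [ordProd_succ (e n) (m + 1), ordProd_succ _ (m + 2), LinearEquiv.mul_apply, LinearEquiv.mul_apply,
      h.s_zero_ordProd n m (by omega), h.e_succ_s_zero n m (by omega)]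

namespace IsTwist

theorem d_t_succ (hQ : P.IsTwist e Q) (hP : P.IsParacyclic) (he : P.IsTwisting e) (n i : ℕ)
    (hi : i ≤ n) (x : X (n + 1)) : Q.d n (i + 1) (Q.t (n + 1) x) = Q.t n (Q.d n i x) := by
  rcases eq_or_lt_of_le hi with rfl | hi
  · rw [hQ.d_last, hQ.t, hQ.t, hQ.t, hQ.d _ _ le_rfl, he.t_e _ _ (by omega), ← he.e_zero_d_zero,
      hP.d_t_zero, hP.d_t_succ _ _ le_rfl]
  · rw [hQ.d _ _ (by omega), hQ.t, hQ.t, hQ.d _ _ hi.le, ← hP.d_t_succ _ _ hi.le,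
      he.e_zero_d_succ _ _ hi]

theorem t_s_last (hQ : P.IsTwist e Q) (he : P.IsTwisting e) (n : ℕ)
    (x : X n) : Q.t (n + 1) (Q.s n n x) = P.t (n + 1) (P.s n n x) := by
  rw [hQ.t, hQ.s _ _ le_rfl, ← he.t_e_last, he.e_succ_s _ _ le_rfl]

theorem t_bijective (hQ : P.IsTwist e Q) (hP : P.IsParacyclic) (n : ℕ) :
    Function.Bijective (Q.t n) := by
  have : (Q.t n : X n → X n) = e n 0 ∘ P.t n := funext (hQ.t n)
  rw [this]
  exact (e n 0).bijective.comp (hP.t_bijective n)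

/-- The faces of a twist satisfy the simplicial identities: conjugation by the cyclic operator
reduces these to the faces that the twist does not change. -/
theorem d_d (hQ : P.IsTwist e Q) (hP : P.IsParacyclic) (he : P.IsTwisting e) (n i : ℕ) :
    ∀ j, i ≤ j → j ≤ n + 1 → ∀ x, Q.d n i (Q.d (n + 1) (j + 1) x) = Q.d n j (Q.d (n + 1) i x) := by
  have h0 : ∀ j ≤ n, ∀ x, Q.d n 0 (Q.d (n + 1) (j + 1) x) = Q.d n j (Q.d (n + 1) 0 x) := by
    intro j hj x
    rw [hQ.d _ _ (by omega), hQ.d _ _ (by omega), hQ.d _ _ hj, hQ.d _ _ (by omega),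
      hP.d_d _ _ _ (by omega) (by omega)]
  induction i with
  | zero =>
    intro j _ hj x
    rcases eq_or_lt_of_le hj with rfl | hj
    · have h1 := fun y => (h0 0 (by omega) y)
      have h2 := hQ.d_last (n + 1) x
      rw [← hQ.d _ _ (by omega)] at h2
      have h3 := hQ.d_last n (Q.d (n + 1) 0 x)
      rw [← hQ.d _ _ (by omega)] at h3
      rw [h2, h3, ← hQ.d_t_succ hP he _ _ (by omega), h1]
    · exact h0 j (by omega) x
  | succ i ih =>
    intro j hij hj x
    obtain ⟨j, rfl⟩ : ∃ j', j = j' + 1 := ⟨j - 1, by omega⟩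
    obtain ⟨x, rfl⟩ := (hQ.t_bijective hP _).2 x
    rw [hQ.d_t_succ hP he _ _ (by omega), hQ.d_t_succ hP he _ _ (by omega),
      hQ.d_t_succ hP he _ _ (by omega), hQ.d_t_succ hP he _ _ (by omega),
      ih j (by omega) (by omega)]

theorem s_t_succ (hQ : P.IsTwist e Q) (hP : P.IsParacyclic) (he : P.IsTwisting e) (n i : ℕ)
    (hi : i + 1 ≤ n) (x : X n) : Q.s n (i + 1) (Q.t n x) = Q.t (n + 1) (Q.s n i x) := by
  rw [hQ.s _ _ hi, hQ.t, ← he.e_zero_s _ _ hi, hP.s_t_succ _ _ hi, hQ.t, hQ.s _ _ (by omega)]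

theorem isParacyclic (hQ : P.IsTwist e Q) (hP : P.IsParacyclic) (he : P.IsTwisting e) :
    Q.IsParacyclic where
  d_d n i j hij hj := hQ.d_d hP he n i j hij hj
  s_s n i j hij hj x := by
    rw [hQ.s _ _ (by omega), hQ.s _ _ (by omega), hQ.s _ _ (by omega), hQ.s _ _ (by omega),
      hP.s_s _ _ _ hij hj]
  d_s_lt n i j hij hj x := by
    rw [hQ.s _ _ (by omega), hQ.d _ _ (by omega), hQ.s _ _ (by omega), hQ.d _ _ (by omega),
      hP.d_s_lt _ _ _ hij hj]
  d_s_self n i hi x := by rw [hQ.s _ _ hi, hQ.d _ _ hi, hP.d_s_self _ _ hi]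
  d_s_succ n i hi x := by
    rcases eq_or_lt_of_le hi with rfl | hi
    · rw [hQ.d_last, hQ.t_s_last he]
      exact hP.d_extra_zero _ _
    · rw [hQ.s _ _ hi.le, hQ.d _ _ hi, hP.d_s_succ _ _ hi.le]
  d_s_gt n i j hij hi x := by
    rcases eq_or_lt_of_le hi with rfl | hi
    · rw [hQ.d_last, ← hQ.s_t_succ hP he _ _ (by omega), hQ.s _ _ (by omega),
        hP.d_s_lt _ _ _ (by omega) (by omega), hQ.d_last, hQ.s _ _ (by omega)]
    · rw [hQ.s _ _ (by omega), hQ.d _ _ (by omega), hQ.s _ _ (by omega), hQ.d _ _ (by omega),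
        hP.d_s_gt _ _ _ hij (by omega)]
  d_t_zero n x := by rw [hQ.d_last, hQ.d _ _ (by omega)]
  d_t_succ n i hi := hQ.d_t_succ hP he n i hi
  s_t_zero n x := by
    rw [hQ.t_s_last he, hQ.s _ _ (by omega), hQ.t, hQ.t, ← he.e_zero_s _ _ (by omega), hP.s_t_zero]
  s_t_succ n i hi := hQ.s_t_succ hP he n i hi
  t_bijective := hQ.t_bijective hP

theorem t_pow (hQ : P.IsTwist e Q) (he : P.IsTwisting e) (n : ℕ) : ∀ m ≤ n + 1, ∀ x,
    (Q.t n ^ m) x = ordProd (e n) m ((P.t n ^ m) x)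
  | 0, _, x => rfl
  | m + 1, hm, x => by
    rw [pow_succ', Module.End.mul_apply, hQ.t_pow he n m (by omega), hQ.t,
      map_ordProd _ _ (fun j => e n (j + 1)) m (fun j hj => he.t_e n j (by omega)), ordProd_succ',
      pow_succ', Module.End.mul_apply, LinearEquiv.mul_apply]

end IsTwist

/-- An operator commuting with `t` and `d_0` commutes with all faces. -/
theorem d_comm_of_zero {Y : ℕ → Type w} [∀ n, AddCommGroup (Y n)] [∀ n, Module k (Y n)]
    {Q : ParacyclicOps k Y} (hP : P.IsParacyclic) (hQ : Q.IsParacyclic) (f : ∀ n, X n →ₗ[k] Y n)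
    (ht : ∀ n x, f n (P.t n x) = Q.t n (f n x))
    (h0 : ∀ n x, f n (P.d n 0 x) = Q.d n 0 (f (n + 1) x)) (n i : ℕ) :
    i ≤ n + 1 → ∀ x, f n (P.d n i x) = Q.d n i (f (n + 1) x) := by
  induction i with
  | zero => exact fun _ x => h0 n x
  | succ i ih =>
    intro hi x
    obtain ⟨x, rfl⟩ := (hP.t_bijective _).2 x
    rw [hP.d_t_succ _ _ (by omega), ht, ht, hQ.d_t_succ _ _ (by omega), ih (by omega)]

/-- An operator commuting with `t` and `s_0` commutes with all degeneracies. -/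
theorem s_comm_of_zero {Y : ℕ → Type w} [∀ n, AddCommGroup (Y n)] [∀ n, Module k (Y n)]
    {Q : ParacyclicOps k Y} (hP : P.IsParacyclic) (hQ : Q.IsParacyclic) (f : ∀ n, X n →ₗ[k] Y n)
    (ht : ∀ n x, f n (P.t n x) = Q.t n (f n x))
    (h0 : ∀ n x, f (n + 1) (P.s n 0 x) = Q.s n 0 (f n x)) (n i : ℕ) :
    i ≤ n → ∀ x, f (n + 1) (P.s n i x) = Q.s n i (f n x) := by
  induction i with
  | zero => exact fun _ x => h0 n x
  | succ i ih =>
    intro hi x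
    obtain ⟨x, rfl⟩ := (hP.t_bijective _).2 x
    rw [hP.s_t_succ _ _ hi, ht, ht, hQ.s_t_succ _ _ hi, ih (by omega)]

end ParacyclicOps

/-! ### Grids of automorphisms -/

namespace CylindricalOps

open ParacyclicOps

variable {k : Type u} [CommRing k] {X : ℕ → ℕ → Type v}
  [∀ p q, AddCommGroup (X p q)] [∀ p q, Module k (X p q)]

/-- Two commuting cyclic structures `D` on `X p q` and automorphisms `e p q j i` of `X p q` for
`j ≤ p` and `i ≤ q`, such that every column is a twisting in the `p`-direction, the inverse of
every row is a twisting in the `q`-direction, and operators in distinct rows and distinct columns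
commute. -/
structure IsGrid (D : CylindricalOps k X) (e : ∀ p q, ℕ → ℕ → (X p q ≃ₗ[k] X p q)) : Prop where
  h_cyclic : ∀ p, (D.h p).IsCyclic
  v_cyclic : ∀ q, (D.v q).IsCyclic
  d_d : ∀ p q x, (D.h p).d q 0 ((D.v (q + 1)).d p 0 x) = (D.v q).d p 0 ((D.h (p + 1)).d q 0 x)
  d_s : ∀ p q x, (D.h (p + 1)).d q 0 ((D.v (q + 1)).s p 0 x) = (D.v q).s p 0 ((D.h p).d q 0 x)
  d_t : ∀ p q x, (D.h p).d q 0 ((D.v (q + 1)).t p x) = (D.v q).t p ((D.h p).d q 0 x)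
  s_d : ∀ p q x, (D.h p).s q 0 ((D.v q).d p 0 x) = (D.v (q + 1)).d p 0 ((D.h (p + 1)).s q 0 x)
  s_s : ∀ p q x, (D.h (p + 1)).s q 0 ((D.v q).s p 0 x) = (D.v (q + 1)).s p 0 ((D.h p).s q 0 x)
  s_t : ∀ p q x, (D.h p).s q 0 ((D.v q).t p x) = (D.v (q + 1)).t p ((D.h p).s q 0 x)
  t_d : ∀ p q x, (D.h p).t q ((D.v q).d p 0 x) = (D.v q).d p 0 ((D.h (p + 1)).t q x)
  t_s : ∀ p q x, (D.h (p + 1)).t q ((D.v q).s p 0 x) = (D.v q).s p 0 ((D.h p).t q x)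
  t_t : ∀ p q x, (D.h p).t q ((D.v q).t p x) = (D.v q).t p ((D.h p).t q x)
  v_twisting : ∀ q i, i ≤ q → (D.v q).IsTwisting fun p j => e p q j i
  h_twisting : ∀ p j, j ≤ p → (D.h p).IsTwisting fun q i => (e p q j i)⁻¹
  comm : ∀ p q j j' i i', j ≤ p → j' ≤ p → i ≤ q → i' ≤ q → j ≠ j' → i ≠ i' →
    Commute (e p q j i) (e p q j' i')

/-- The product of the operators in the `j`-th row, in decreasing order. -/
def row (e : ∀ p q, ℕ → ℕ → (X p q ≃ₗ[k] X p q)) (q p j : ℕ) : X p q ≃ₗ[k] X p q :=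
  revProd (e p q j) (q + 1)

/-- The product of the operators in the `i`-th column, in increasing order. -/
def col (e : ∀ p q, ℕ → ℕ → (X p q ≃ₗ[k] X p q)) (p q i : ℕ) : X p q ≃ₗ[k] X p q :=
  ordProd (fun j => e p q j i) (p + 1)

/-- `C` arises from `D` by twisting the cyclic operators of the `p`-direction by the rows and those
of the `q`-direction by the inverses of the columns. -/
structure IsGridTwist (D : CylindricalOps k X) (e : ∀ p q, ℕ → ℕ → (X p q ≃ₗ[k] X p q))
    (C : CylindricalOps k X) : Prop where
  h : ∀ p, (D.h p).IsTwist (fun q i => (col e p q i)⁻¹) (C.h p)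
  v : ∀ q, (D.v q).IsTwist (row e q) (C.v q)

variable {C D : CylindricalOps k X} {e : ∀ p q, ℕ → ℕ → (X p q ≃ₗ[k] X p q)}

namespace IsGrid

/-- The rows form a twisting since their operators lie in distinct columns. -/
theorem isTwisting_row (G : D.IsGrid e) (q : ℕ) : (D.v q).IsTwisting (row e q) :=
  IsTwisting.revProd (e := fun i p j => e p q j i) (q + 1) (fun i hi => G.v_twisting q i (by omega))
    fun i hi i' hi' hne n => G.comm _ _ _ _ _ _ (by omega) (by omega) (by omega) (by omega)
      (by omega) hne

theorem isTwisting_col (G : D.IsGrid e) (p : ℕ) :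
    (D.h p).IsTwisting fun q i => (col e p q i)⁻¹ := by
  simp only [col, inv_ordProd]
  exact IsTwisting.revProd (e := fun j q i => (e p q j i)⁻¹) (p + 1)
    (fun j hj => G.h_twisting p j (by omega))
    fun j hj j' hj' hne n => (G.comm _ _ _ _ _ _ (by omega) (by omega) (by omega) (by omega)
      hne (by omega)).inv_inv

theorem h_t_e (G : D.IsGrid e) (p q j i : ℕ) (hj : j ≤ p) (hi : i < q) (x : X p q) :
    (D.h p).t q (e p q j i x) = e p q j (i + 1) ((D.h p).t q x) := by
  have := map_inv_apply (fun x => (G.h_twisting p j hj).t_e q i hi x) x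
  simpa only [inv_inv] using this

theorem h_t_e_last (G : D.IsGrid e) (p q j : ℕ) (hj : j ≤ p) (x : X p q) :
    (D.h p).t q (e p q j q x) = e p q j 0 ((D.h p).t q x) := by
  have := map_inv_apply (fun x => (G.h_twisting p j hj).t_e_last q x) x
  simpa only [inv_inv] using this

theorem h_d_e (G : D.IsGrid e) (p q j i : ℕ) (hj : j ≤ p) (hi : i < q) (x : X p (q + 1)) :
    (D.h p).d q 0 (e p (q + 1) j (i + 2) x) = e p q j (i + 1) ((D.h p).d q 0 x) := by
  have := map_inv_apply (fun x => ((G.h_twisting p j hj).e_succ_d_zero q i hi x).symm) x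
  simpa only [inv_inv] using this

theorem h_s_e (G : D.IsGrid e) (p q j i : ℕ) (hj : j ≤ p) (hi : i < q) (x : X p q) :
    (D.h p).s q 0 (e p q j (i + 1) x) = e p (q + 1) j (i + 2) ((D.h p).s q 0 x) := by
  have := map_inv_apply (fun x => ((G.h_twisting p j hj).e_succ_s_zero q i hi x).symm) x
  simpa only [inv_inv] using this

theorem e_h_s (G : D.IsGrid e) (p q j : ℕ) (hj : j ≤ p) (x : X p q) :
    e p (q + 1) j 1 ((D.h p).s q 0 x) = (D.h p).s q 0 x := by
  have := (G.h_twisting p j hj).e_succ_s q 0 (by omega) x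
  exact ((e p (q + 1) j 1).symm_apply_eq.mp this).symm

/-- The cyclic operator of the `q`-direction permutes the columns cyclically. -/
theorem h_t_row (G : D.IsGrid e) (p q j : ℕ) (hj : j ≤ p) (x : X p q) : (D.h p).t q (row e q p j x) =
    e p q j 0 (revProd (fun i => e p q j (i + 1)) q ((D.h p).t q x)) := by
  rw [row, revProd_succ, LinearEquiv.mul_apply, G.h_t_e_last p q j hj,
    map_revProd _ _ (fun i => e p q j (i + 1)) q fun i hi => G.h_t_e p q j i hj hi]

theorem v_t_col (G : D.IsGrid e) (p q i : ℕ) (hi : i ≤ q) (x : X p q) : (D.v q).t p (col e p q i x) =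
    ordProd (fun j => e p q (j + 1) i) p (e p q 0 i ((D.v q).t p x)) := by
  rw [col, ordProd_succ, LinearEquiv.mul_apply,
    map_ordProd _ _ (fun j => e p q (j + 1) i) p fun j hj => (G.v_twisting q i hi).t_e p j hj,
    (G.v_twisting q i hi).t_e_last p]

end IsGrid

namespace IsGridTwist

theorem h_para (T : D.IsGridTwist e C) (G : D.IsGrid e) (p : ℕ) : (C.h p).IsParacyclic :=
  (T.h p).isParacyclic (G.h_cyclic p).toIsParacyclic (G.isTwisting_col p)

theorem v_para (T : D.IsGridTwist e C) (G : D.IsGrid e) (q : ℕ) : (C.v q).IsParacyclic :=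
  (T.v q).isParacyclic (G.v_cyclic q).toIsParacyclic (G.isTwisting_row q)

theorem t_t (T : D.IsGridTwist e C) (G : D.IsGrid e) (p q : ℕ) (x : X p q) :
    (C.h p).t q ((C.v q).t p x) = (C.v q).t p ((C.h p).t q x) := by
  set R := revProd (fun i => e p q 0 (i + 1)) q with hR
  set L := ordProd (fun j => e p q (j + 1) 0) p with hL
  set z := (D.v q).t p ((D.h p).t q x) with hz
  have hcol : ∀ y, (col e p q 0)⁻¹ (e p q 0 0 y) = L⁻¹ y := fun y => by
    rw [col, ordProd_succ', mul_inv_rev, LinearEquiv.mul_apply, inv_apply_self]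
  have h1 : (C.h p).t q ((C.v q).t p x) = L⁻¹ (R z) := by
    rw [(T.h p).t, (T.v q).t, G.h_t_row p q 0 (by omega), hcol, G.t_t]
  have h2 : (C.v q).t p ((C.h p).t q x) = R (L⁻¹ z) := by
    have h3 := map_inv_apply (φ := (D.v q).t p) (f := col e p q 0) (g := L * e p q 0 0)
      (fun x => G.v_t_col p q 0 (by omega) x) ((D.h p).t q x)
    rw [(T.v q).t, (T.h p).t, h3, row, revProd_succ', mul_inv_rev, LinearEquiv.mul_apply,
      LinearEquiv.mul_apply]
    exact congrArg R ((e p q 0 0).apply_symm_apply _)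
  rw [h1, h2]
  have hc : Commute L R := (commute_ordProd _ R p fun j hj => (commute_revProd _ _ q fun i hi =>
    G.comm _ _ _ _ _ _ (by omega) (by omega) (by omega) (by omega) (by omega) (by omega)).symm).symm
  exact LinearEquiv.congr_fun hc.inv_left.eq z

theorem h_t_d_zero (T : D.IsGridTwist e C) (G : D.IsGrid e) (p q : ℕ) (x : X (p + 1) q) :
    (C.h p).t q ((C.v q).d p 0 x) = (C.v q).d p 0 ((C.h (p + 1)).t q x) := by
  rw [(T.v q).d _ _ (by omega), (T.v q).d _ _ (by omega), (T.h p).t, (T.h _).t, G.t_d]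
  exact (map_inv_apply ((G.v_twisting q 0 (by omega)).d_zero_ordProd p p le_rfl) _).symm

theorem h_t_s_zero (T : D.IsGridTwist e C) (G : D.IsGrid e) (p q : ℕ) (x : X p q) :
    (C.h (p + 1)).t q ((C.v q).s p 0 x) = (C.v q).s p 0 ((C.h p).t q x) := by
  rw [(T.v q).s _ _ (by omega), (T.v q).s _ _ (by omega), (T.h p).t, (T.h _).t, G.t_s]
  exact (map_inv_apply ((G.v_twisting q 0 (by omega)).s_zero_ordProd p p le_rfl) _).symm

theorem d_zero_v_t (T : D.IsGridTwist e C) (G : D.IsGrid e) (p q : ℕ) (x : X p (q + 1)) :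
    (C.h p).d q 0 ((C.v (q + 1)).t p x) = (C.v q).t p ((C.h p).d q 0 x) := by
  rw [(T.h p).d _ _ (by omega), (T.h p).d _ _ (by omega), (T.v q).t, (T.v _).t, ← G.d_t]
  have := map_inv_apply (fun x => (G.h_twisting p 0 (by omega)).d_zero_ordProd q q le_rfl x)
    ((D.v (q + 1)).t p x)
  rw [inv_ordProd, inv_ordProd] at this
  simp only [inv_inv] at this
  exact this

theorem s_zero_v_t (T : D.IsGridTwist e C) (G : D.IsGrid e) (p q : ℕ) (x : X p q) :
    (C.h p).s q 0 ((C.v q).t p x) = (C.v (q + 1)).t p ((C.h p).s q 0 x) := by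
  rw [(T.h p).s _ _ (by omega), (T.h p).s _ _ (by omega), (T.v q).t, (T.v _).t, ← G.s_t]
  have := map_inv_apply (fun x => (G.h_twisting p 0 (by omega)).s_zero_ordProd q q le_rfl x)
    ((D.v q).t p x)
  rw [inv_ordProd, inv_ordProd] at this
  simp only [inv_inv] at this
  exact this

theorem h_d_t (T : D.IsGridTwist e C) (G : D.IsGrid e) (p q i : ℕ) (hi : i ≤ q + 1)
    (x : X p (q + 1)) : (C.h p).d q i ((C.v (q + 1)).t p x) = (C.v q).t p ((C.h p).d q i x) :=
  (d_comm_of_zero (T.h_para G p) (T.h_para G p) (fun q => (C.v q).t p)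
    (fun q x => (T.t_t G p q x).symm) (fun q x => (T.d_zero_v_t G p q x).symm) q i hi x).symm

theorem h_s_t (T : D.IsGridTwist e C) (G : D.IsGrid e) (p q i : ℕ) (hi : i ≤ q)
    (x : X p q) : (C.h p).s q i ((C.v q).t p x) = (C.v (q + 1)).t p ((C.h p).s q i x) :=
  (s_comm_of_zero (T.h_para G p) (T.h_para G p) (fun q => (C.v q).t p)
    (fun q x => (T.t_t G p q x).symm) (fun q x => (T.s_zero_v_t G p q x).symm) q i hi x).symm

theorem h_t_d (T : D.IsGridTwist e C) (G : D.IsGrid e) (p q j : ℕ) (hj : j ≤ p + 1)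
    (x : X (p + 1) q) : (C.h p).t q ((C.v q).d p j x) = (C.v q).d p j ((C.h (p + 1)).t q x) :=
  d_comm_of_zero (T.v_para G q) (T.v_para G q) (fun p => (C.h p).t q)
    (fun p x => T.t_t G p q x) (fun p x => T.h_t_d_zero G p q x) p j hj x

theorem h_t_s (T : D.IsGridTwist e C) (G : D.IsGrid e) (p q j : ℕ) (hj : j ≤ p)
    (x : X p q) : (C.h (p + 1)).t q ((C.v q).s p j x) = (C.v q).s p j ((C.h p).t q x) :=
  s_comm_of_zero (T.v_para G q) (T.v_para G q) (fun p => (C.h p).t q)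
    (fun p x => T.t_t G p q x) (fun p x => T.h_t_s_zero G p q x) p j hj x

theorem t_pow (T : D.IsGridTwist e C) (G : D.IsGrid e) (p q : ℕ) (x : X p q) :
    ((C.v q).t p ^ (p + 1)) (((C.h p).t q ^ (q + 1)) x) = x := by
  rw [(T.v q).t_pow (G.isTwisting_row q) p (p + 1) le_rfl, (G.v_cyclic q).t_pow,
    (T.h p).t_pow (G.isTwisting_col p) q (q + 1) le_rfl, (G.h_cyclic p).t_pow]
  have h := ordProd_revProd (e p q) (q + 1) (p + 1) fun j hj j' hj' i hi i' hi' hne hne' =>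
    G.comm p q j j' i i' (by omega) (by omega) (by omega) (by omega) hne hne'
  have h' := inv_revProd (col e p q) (q + 1)
  rw [← h']
  change (ordProd (fun j => revProd (e p q j) (q + 1)) (p + 1)) _ = _
  rw [h]
  exact (revProd (col e p q) (q + 1)).apply_symm_apply x

/-- The twist of a bicyclic module by a grid of automorphisms is a cylindrical module. -/
theorem isCylindrical (T : D.IsGridTwist e C) (G : D.IsGrid e) : C.IsCylindrical where
  h_para := T.h_para G
  v_para := T.v_para G
  d_d p q i j hi hj x := by
    refine (d_comm_of_zero (T.h_para G (p + 1)) (T.h_para G p) (fun q => (C.v q).d p j)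
      (fun q x => (T.h_t_d G p q j hj x).symm) (fun q x => ?_) q i hi x).symm
    refine (d_comm_of_zero (T.v_para G (q + 1)) (T.v_para G q) (fun p => (C.h p).d q 0)
      (fun p x => T.h_d_t G p q 0 (by omega) x) (fun p x => ?_) p j hj x).symm
    rw [(T.h p).d _ _ (by omega), (T.v _).d _ _ (by omega), G.d_d, (T.v _).d _ _ (by omega),
      (T.h _).d _ _ (by omega)]
  d_s p q i j hi hj x := by
    refine (d_comm_of_zero (T.h_para G p) (T.h_para G (p + 1)) (fun q => (C.v q).s p j)
      (fun q x => (T.h_t_s G p q j hj x).symm) (fun q x => ?_) q i hi x).symm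
    refine (s_comm_of_zero (T.v_para G (q + 1)) (T.v_para G q) (fun p => (C.h p).d q 0)
      (fun p x => T.h_d_t G p q 0 (by omega) x) (fun p x => ?_) p j hj x).symm
    rw [(T.h _).d _ _ (by omega), (T.v _).s _ _ (by omega), G.d_s, (T.v _).s _ _ (by omega),
      (T.h _).d _ _ (by omega)]
  d_t := T.h_d_t G
  s_d p q i j hi hj x := by
    refine (s_comm_of_zero (T.h_para G (p + 1)) (T.h_para G p) (fun q => (C.v q).d p j)
      (fun q x => (T.h_t_d G p q j hj x).symm) (fun q x => ?_) q i hi x).symm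
    refine (d_comm_of_zero (T.v_para G q) (T.v_para G (q + 1)) (fun p => (C.h p).s q 0)
      (fun p x => T.h_s_t G p q 0 (by omega) x) (fun p x => ?_) p j hj x).symm
    rw [(T.h _).s _ _ (by omega), (T.v _).d _ _ (by omega), G.s_d, (T.v _).d _ _ (by omega),
      (T.h _).s _ _ (by omega)]
  s_s p q i j hi hj x := by
    refine (s_comm_of_zero (T.h_para G p) (T.h_para G (p + 1)) (fun q => (C.v q).s p j)
      (fun q x => (T.h_t_s G p q j hj x).symm) (fun q x => ?_) q i hi x).symm
    refine (s_comm_of_zero (T.v_para G q) (T.v_para G (q + 1)) (fun p => (C.h p).s q 0)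
      (fun p x => T.h_s_t G p q 0 (by omega) x) (fun p x => ?_) p j hj x).symm
    rw [(T.h _).s _ _ (by omega), (T.v _).s _ _ (by omega), G.s_s, (T.v _).s _ _ (by omega),
      (T.h _).s _ _ (by omega)]
  s_t := T.h_s_t G
  t_d := T.h_t_d G
  t_s := T.h_t_s G
  t_t := T.t_t G
  t_pow := T.t_pow G

end IsGridTwist

/-- The automorphism of the diagonal by the operators `e j i` with `j < i`, which moves the first
direction past the second one. -/
def reorder (e : ∀ p q, ℕ → ℕ → (X p q ≃ₗ[k] X p q)) (n : ℕ) : X n n ≃ₗ[k] X n n :=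
  revProd (fun i => ordProd (fun j => e n n j (i + 1)) (i + 1)) n

namespace IsGridTwist

theorem diag_d_zero_reorder (T : D.IsGridTwist e C) (G : D.IsGrid e) (n : ℕ)
    (x : X (n + 1) (n + 1)) : C.diag.d n 0 (reorder e (n + 1) x) =
      reorder e n ((D.v n).d n 0 ((D.h (n + 1)).d n 0 (e (n + 1) (n + 1) 0 1 x))) := by
  have h : ∀ x, C.diag.d n 0 x = ((D.v n).d n 0 ∘ₗ (D.h (n + 1)).d n 0) x := fun x => by
    rw [diag_d_apply, (T.h _).d _ _ (by omega), (T.v _).d _ _ (by omega)]; rfl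
  rw [h, reorder, revProd_succ', LinearEquiv.mul_apply, map_revProd _ _
    (fun i => ordProd (fun j => e n n j (i + 1)) (i + 1)) n fun i hi x => ?_]
  · simp only [ordProd, zero_add, one_mul]; rfl
  · rw [LinearMap.comp_apply, map_ordProd _ _ (fun j => e (n + 1) n j (i + 1)) (i + 1 + 1)
      (fun j hj => G.h_d_e (n + 1) n j i (by omega) hi),
      (G.v_twisting n (i + 1) (by omega)).d_zero_ordProd n i hi.le]
    rfl

theorem diag_s_zero_reorder (T : D.IsGridTwist e C) (G : D.IsGrid e) (n : ℕ)
    (x : X n n) : C.diag.s n 0 (reorder e n x) =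
      reorder e (n + 1) ((D.v (n + 1)).s n 0 ((D.h n).s n 0 x)) := by
  have h : ∀ x, C.diag.s n 0 x = ((D.v (n + 1)).s n 0 ∘ₗ (D.h n).s n 0) x := fun x => by
    rw [diag_s_apply, (T.h _).s _ _ (by omega), (T.v _).s _ _ (by omega)]; rfl
  rw [h, reorder, reorder, revProd_succ', LinearEquiv.mul_apply, map_revProd _ _
    (fun i => ordProd (fun j => e (n + 1) (n + 1) j (i + 1 + 1)) (i + 1 + 1)) n fun i hi x => ?_]
  · congr 1
    simp only [ordProd, zero_add, one_mul]
    rw [← G.s_s, G.e_h_s _ _ _ (by omega), G.s_s]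
    rfl
  · rw [LinearMap.comp_apply, map_ordProd _ _ (fun j => e n (n + 1) j (i + 2)) (i + 1)
      (fun j hj => G.h_s_e n n j i (by omega) hi),
      (G.v_twisting (n + 1) (i + 2) (by omega)).s_zero_ordProd n i hi.le]
    rfl

/-- Rotation in the `q`-direction turns the operators `e j n` of `reorder` into `e j 0`, which the twist
of this rotation by the inverse of a column cancels up to the inverse of `e n 0`. Rotation in the
`p`-direction turns the latter into the inverse of `e 0 0`, which cancels in the row of the other
twist. The operators that are left make up `reorder` again. -/
theorem diag_t_reorder (T : D.IsGridTwist e C) (G : D.IsGrid e) (n : ℕ)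
    (x : X n n) : C.diag.t n (reorder e n x) =
      reorder e n ((D.v n).t n ((D.h n).t n x)) := by
  change (C.v n).t n ((C.h n).t n _) = _
  rcases n with _ | m
  · have h1 := T.t_pow G 0 0 x
    have h2 := (G.v_cyclic 0).t_pow 0 ((D.h 0).t 0 x)
    have h3 := (G.h_cyclic 0).t_pow 0 x
    simp only [zero_add, pow_one] at h1 h2 h3
    rw [h2, h3]
    exact h1
  · set G₁ := revProd (fun i => ordProd (fun j => e (m + 1) (m + 1) j (i + 2)) (i + 1)) m with hG₁
    set G₂ := revProd (fun i => ordProd (fun j => e (m + 1) (m + 1) (j + 1) (i + 2)) (i + 1)) m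
      with hG₂
    have h1 : (C.h (m + 1)).t (m + 1) (reorder e (m + 1) x) =
        (e (m + 1) (m + 1) (m + 1) 0)⁻¹ (G₁ ((D.h (m + 1)).t (m + 1) x)) := by
      rw [(T.h _).t, reorder, revProd_succ, LinearEquiv.mul_apply, map_ordProd _ _
        (fun j => e (m + 1) (m + 1) j 0) (m + 1) (fun j hj => G.h_t_e_last _ _ j (by omega)),
        map_revProd _ _ (fun i => ordProd (fun j => e (m + 1) (m + 1) j (i + 2)) (i + 1)) m
        fun i hi => map_ordProd _ _ (fun j => e (m + 1) (m + 1) j (i + 2)) (i + 1)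
          fun j hj => G.h_t_e _ _ j (i + 1) (by omega) (by omega), ← hG₁, col, ordProd_succ,
        mul_inv_rev, LinearEquiv.mul_apply, inv_apply_self]
    have h2 : ∀ y, (C.v (m + 1)).t (m + 1) ((e (m + 1) (m + 1) (m + 1) 0)⁻¹ (G₁ y)) =
        revProd (fun i => e (m + 1) (m + 1) 0 (i + 1)) (m + 1)
          (G₂ ((D.v (m + 1)).t (m + 1) y)) := fun y => by
      rw [(T.v _).t, map_inv_apply ((G.v_twisting (m + 1) 0 (by omega)).t_e_last (m + 1)),
        map_revProd _ _ (fun i => ordProd (fun j => e (m + 1) (m + 1) (j + 1) (i + 2)) (i + 1)) m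
        fun i hi => map_ordProd _ _ (fun j => e (m + 1) (m + 1) (j + 1) (i + 2)) (i + 1)
          fun j hj => (G.v_twisting (m + 1) (i + 2) (by omega)).t_e (m + 1) j (by omega), ← hG₂,
        row, revProd_succ', LinearEquiv.mul_apply]
      exact congrArg _ ((e (m + 1) (m + 1) 0 0).apply_symm_apply _)
    have h3 : G₂ = revProd (fun i => ordProd (fun j => e (m + 1) (m + 1) (j + 1) (i + 1)) i)
        (m + 1) := by
      rw [revProd_succ']
      exact (mul_one _).symm
    rw [h1, h2, h3, ← LinearEquiv.mul_apply, revProd_mul]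
    · congr 2
      exact funext fun i => (ordProd_succ' (fun j => e (m + 1) (m + 1) j (i + 1)) i).symm
    · exact fun i hi i' hi' hne => commute_ordProd _ _ _ fun j hj =>
        G.comm _ _ _ _ _ _ (by omega) (by omega) (by omega) (by omega) (by omega) (by omega)

end IsGridTwist

end CylindricalOps

/-! ### Coactions on the slots of a tensor power -/

section Slot

variable {k : Type u} [CommRing k] {H : Type v} [Ring H]

section Algebra

variable [Algebra k H] {N N' : Type*} [AddCommGroup N] [Module k N] [AddCommGroup N'] [Module k N']

/-- `(x_i ⊗ y_i)_i ↦ (x_0, …, x_{n-1}) ⊗ y_0 ⋯ y_{n-1}`. -/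
noncomputable def legsMul (k : Type u) [CommRing k] (H : Type v) [Ring H] [Algebra k H] (n : ℕ) :
    MultilinearMap k (fun _ : Fin n => H ⊗[k] H) (TPow k H n ⊗[k] H) :=
  (MultilinearMap.mkPiAlgebraFin k n (TPow k H n ⊗[k] H)).compLinearMap
    fun i => TensorProduct.map (single i).toLinearMap LinearMap.id

theorem legsMul_tmul {n : ℕ} (x y : Fin n → H) :
    legsMul k H n (fun i => x i ⊗ₜ y i) = PiTensorProduct.tprod k x ⊗ₜ (List.ofFn y).prod := by
  rw [legsMul, MultilinearMap.compLinearMap_apply, MultilinearMap.mkPiAlgebraFin_apply,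
    ← list_prod_single, ← list_prod_tmul]
  simp

theorem legs_tprod_eq {n : ℕ} (c : Fin n → H →ₗ[k] H ⊗[k] H) (g : Fin n → H) :
    legs c (PiTensorProduct.tprod k g) = legsMul k H n fun i => c i (g i) := by
  rw [legs, PiTensorProduct.lift.tprod]
  rfl

/-- For `c i (g i) = x i ⊗ y i` this is
`(g_0, …, g_{n-1} | v) ↦ (x_0, …, x_{n-1} | f (y_0 ⋯ y_{n-1}) v)`. -/
noncomputable def legsOp {n : ℕ} (c : Fin n → H →ₗ[k] H ⊗[k] H) (f : H →ₗ[k] N →ₗ[k] N') :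
    TPow k H n ⊗[k] N →ₗ[k] TPow k H n ⊗[k] N' :=
  LinearMap.lTensor _ (TensorProduct.lift f) ∘ₗ (TensorProduct.assoc k _ _ _).toLinearMap ∘ₗ
    LinearMap.rTensor N (legs c)

/-- `z ⊗ v ↦ (x | f y v)` for `z = x ⊗ y`. -/
noncomputable def apLeg {n : ℕ} (f : H →ₗ[k] N →ₗ[k] N') (v : N) :
    TPow k H n ⊗[k] H →ₗ[k] TPow k H n ⊗[k] N' :=
  LinearMap.lTensor _ (f.flip v)

theorem legsOp_pure {n : ℕ} (c : Fin n → H →ₗ[k] H ⊗[k] H) (f : H →ₗ[k] N →ₗ[k] N') (α : ℕ → H)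
    (v : N) : legsOp c f (pure n α ⊗ₜ v) = apLeg f v (legsMul k H n fun i => c i (α i)) := by
  rw [← legs_tprod_eq, legsOp, LinearMap.comp_apply, LinearMap.comp_apply, LinearMap.rTensor_tmul, pure]
  induction legs c (PiTensorProduct.tprod k fun i : Fin n => α i) with
  | zero => simp
  | add x y hx hy => simp only [TensorProduct.add_tmul, map_add, hx, hy]
  | tmul x y => simp [apLeg]

theorem legsOp_eq_of_rTensor {n : ℕ} (c : Fin n → H →ₗ[k] H ⊗[k] H) (f : H →ₗ[k] N →ₗ[k] N')
    (g : TPow k H n →ₗ[k] TPow k H n) (x) :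
    LinearMap.lTensor _ (TensorProduct.lift f) ((TensorProduct.assoc k _ _ _)
      (TensorProduct.map (legs c ∘ₗ g) LinearMap.id x)) = legsOp c f (LinearMap.rTensor N g x) := by
  induction x with
  | zero => simp
  | add x y hx hy => simp only [map_add, hx, hy]
  | tmul x y => simp [legsOp]

theorem legsOp_eq_of_lTensor {n : ℕ} (c : Fin n → H →ₗ[k] H ⊗[k] H) (f : H →ₗ[k] N →ₗ[k] N')
    (g : N →ₗ[k] N) (x) :
    LinearMap.lTensor _ (TensorProduct.lift f) ((TensorProduct.assoc k _ _ _)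
      (TensorProduct.map (legs c) g x)) = legsOp c f (LinearMap.lTensor _ g x) := by
  induction x with
  | zero => simp
  | add x y hx hy => simp only [map_add, hx, hy]
  | tmul x y => simp [legsOp]

theorem list_prod_update_one : ∀ (n : ℕ) (j : Fin n) (y : H),
    (List.ofFn (Function.update (fun _ : Fin n => (1 : H)) j y)).prod = y
  | n + 1, j, y => by
    rw [List.ofFn_succ, List.prod_cons]
    refine Fin.cases ?_ (fun l => ?_) j
    · rw [Function.update_self, List.prod_eq_one, mul_one]
      intro z hz
      obtain ⟨i, rfl⟩ := (List.mem_ofFn' _ _).mp hz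
      exact Function.update_of_ne (Fin.succ_ne_zero i) _ _
    · rw [Function.update_of_ne (Fin.succ_ne_zero l).symm, one_mul]
      refine Eq.trans ?_ (list_prod_update_one n l y)
      congr 2
      funext i
      simp [Function.update_apply, Fin.succ_inj]

theorem pure_tmul_ext {P : Type*} [AddCommGroup P] [Module k P] {n : ℕ}
    {f g : TPow k H n ⊗[k] N →ₗ[k] P}
    (h : ∀ α v, f (pure n α ⊗ₜ v) = g (pure n α ⊗ₜ v)) (x) : f x = g x := by
  refine LinearMap.congr_fun (TensorProduct.ext (tpow_ext fun α => LinearMap.ext fun v => ?_)) x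
  exact h α v

end Algebra

section Bialgebra

variable [Bialgebra k H] {N N' N'' : Type*} [AddCommGroup N] [Module k N] [AddCommGroup N'] [Module k N']
  [AddCommGroup N''] [Module k N'']

/-- `(g_0, …, g_{n-1} | v) ↦ (g_0, …, g_j⁰, …, g_{n-1} | f (g_j¹) v)`. -/
noncomputable def slotOp (f : H →ₗ[k] N →ₗ[k] N') (n j : ℕ) :
    TPow k H n ⊗[k] N →ₗ[k] TPow k H n ⊗[k] N' :=
  legsOp (fun i => if i.val = j then Coalgebra.comul else (TensorProduct.mk k H H).flip 1) f

theorem slotOp_pure (f : H →ₗ[k] N →ₗ[k] N') {n j : ℕ} (hj : j < n) (α : ℕ → H) {a : H}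
    (ha : α j = a) {ι : Type*} (r : Coalgebra.Repr k a ι) (v : N) :
    slotOp f n j (pure n α ⊗ₜ v) =
      ∑ l ∈ r.index, pure n (Function.update α j (r.left l)) ⊗ₜ f (r.right l) v := by
  classical
  subst ha
  rw [slotOp, legsOp_pure]
  have h1 : (fun i : Fin n => (if i.val = j then Coalgebra.comul else (TensorProduct.mk k H H).flip 1 :
      H →ₗ[k] H ⊗[k] H) (α i)) = Function.update (fun i : Fin n => α i ⊗ₜ[k] (1 : H)) ⟨j, hj⟩
        (∑ l ∈ r.index, r.left l ⊗ₜ r.right l) := by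
    funext i
    by_cases hi : i = ⟨j, hj⟩
    · subst hi
      simp [r.eq]
    · rw [Function.update_of_ne hi, if_neg fun h => hi (Fin.ext h)]
      rfl
  rw [h1, MultilinearMap.map_update_sum, map_sum]
  refine Finset.sum_congr rfl fun l _ => ?_
  have h2 : Function.update (fun i : Fin n => α i ⊗ₜ[k] (1 : H)) ⟨j, hj⟩ (r.left l ⊗ₜ r.right l) =
      fun i : Fin n => Function.update α j (r.left l) i ⊗ₜ
        Function.update (fun _ : Fin n => (1 : H)) ⟨j, hj⟩ (r.right l) i := by
    funext i
    by_cases hi : i = ⟨j, hj⟩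
    · subst hi
      simp
    · rw [Function.update_of_ne hi, Function.update_of_ne hi,
        Function.update_of_ne fun h => hi (Fin.ext h)]
  rw [h2, legsMul_tmul, list_prod_update_one]
  rfl

/-- The convolution `h ↦ f (h⁰) g (h¹)`. -/
noncomputable def conv (f g : H →ₗ[k] Module.End k N) : H →ₗ[k] Module.End k N :=
  LinearMap.mul' k _ ∘ₗ TensorProduct.map f g ∘ₗ Coalgebra.comul

theorem conv_repr (f g : H →ₗ[k] Module.End k N) {h : H} {ι : Type*} (r : Coalgebra.Repr k h ι) :
    conv f g h = ∑ l ∈ r.index, f (r.left l) * g (r.right l) := by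
  rw [conv, LinearMap.comp_apply, LinearMap.comp_apply, ← r.eq]
  simp

/-- By coassociativity, operators on the same slot compose by convolution. -/
theorem slotOp_slotOp (f g : H →ₗ[k] Module.End k N) {n j : ℕ} (hj : j < n) (x) :
    slotOp f n j (slotOp g n j x) = slotOp (conv f g) n j x := by
  refine pure_tmul_ext (f := slotOp f n j ∘ₗ slotOp g n j) (fun α v => ?_) x
  let r := Coalgebra.Repr.arbitrary k (α j)
  let r₁ := fun i => Coalgebra.Repr.arbitrary k (r.left i)
  let r₂ := fun i => Coalgebra.Repr.arbitrary k (r.right i)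
  let F : H ⊗[k] (H ⊗[k] H) →ₗ[k] TPow k H n ⊗[k] N :=
    TensorProduct.map ((PiTensorProduct.tprod k).toLinearMap (fun i : Fin n => α i) ⟨j, hj⟩)
      (TensorProduct.lift ((LinearMap.mul k (Module.End k N)).compl₁₂ f g) |>.flip v)
  have hF : ∀ x y z, F (x ⊗ₜ (y ⊗ₜ z)) = pure n (Function.update α j x) ⊗ₜ f y (g z v) := by
    intro x y z
    simp only [F, TensorProduct.map_tmul, MultilinearMap.toLinearMap_apply, LinearMap.flip_apply,
      TensorProduct.lift.tmul, LinearMap.compl₁₂_apply, LinearMap.mul_apply', Module.End.mul_apply]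
    congr 2
    funext i
    simp [Function.update_apply, Fin.ext_iff]
  have := congrArg F (Coalgebra.sum_tmul_tmul_eq r r₁ r₂)
  simp only [map_sum, hF] at this
  rw [LinearMap.comp_apply, slotOp_pure g hj α rfl r, slotOp_pure _ hj α rfl r, map_sum]
  have h1 : ∀ l, slotOp f n j (pure n (Function.update α j (r.left l)) ⊗ₜ g (r.right l) v) =
      ∑ m ∈ (r₁ l).index, pure n (Function.update α j ((r₁ l).left m)) ⊗ₜ
        f ((r₁ l).right m) (g (r.right l) v) := fun l => by
    rw [slotOp_pure f hj _ (Function.update_self ..) (r₁ l)]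
    simp only [Function.update_idem]
  simp only [h1, this, conv_repr f g (r₂ _), LinearMap.sum_apply, Module.End.mul_apply,
    TensorProduct.tmul_sum]

/-- A linear function of `h` that factors through the counit acts through the last variable. -/
theorem slotOp_counit (φ : N →ₗ[k] N') {n j : ℕ} (hj : j < n) (x) :
    slotOp (LinearMap.toSpanSingleton k _ φ ∘ₗ Coalgebra.counit (R := k) (A := H)) n j x =
      LinearMap.lTensor _ φ x := by
  refine pure_tmul_ext (fun α v => ?_) x
  let r := Coalgebra.Repr.arbitrary k (α j)
  rw [slotOp_pure _ hj α rfl r, LinearMap.lTensor_tmul]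
  have h1 : ∀ l, pure (k := k) n (Function.update α j (r.left l)) ⊗ₜ[k]
      ((LinearMap.toSpanSingleton k _ φ ∘ₗ Coalgebra.counit (R := k) (A := H)) (r.right l)) v =
      (PiTensorProduct.tprod k).toLinearMap (fun i : Fin n => α i) ⟨j, hj⟩
        (Coalgebra.counit (R := k) (r.right l) • r.left l) ⊗ₜ φ v := by
    intro l
    simp only [LinearMap.comp_apply, LinearMap.toSpanSingleton_apply, LinearMap.smul_apply, map_smul,
      TensorProduct.tmul_smul, TensorProduct.smul_tmul', MultilinearMap.toLinearMap_apply]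
    refine congrArg (fun z => Coalgebra.counit (R := k) (r.right l) • (z ⊗ₜ[k] φ v))
      (congrArg (PiTensorProduct.tprod k) (funext fun i => ?_))
    simp [Function.update_apply, Fin.ext_iff]
  have h2 : ∑ l ∈ r.index, Coalgebra.counit (R := k) (r.right l) • r.left l = α j := by
    have := congrArg (TensorProduct.rid k H) (Coalgebra.sum_tmul_counit_eq (R := k) r)
    simpa only [map_sum, TensorProduct.rid_tmul, one_smul] using this
  rw [Finset.sum_congr rfl fun l _ => h1 l, ← TensorProduct.sum_tmul, ← map_sum, h2,
    MultilinearMap.toLinearMap_apply]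
  congr 2
  funext i
  simp only [Function.update_apply, Fin.ext_iff]
  split_ifs with h
  · rw [h]
  · rfl

theorem lTensor_slotOp {P P' : Type*} [AddCommGroup P] [Module k P] [AddCommGroup P'] [Module k P']
    {f : H →ₗ[k] N →ₗ[k] N'} {f' : H →ₗ[k] P →ₗ[k] P'}
    {φ : N →ₗ[k] P} {ψ : N' →ₗ[k] P'} (h : ∀ a v, ψ (f a v) = f' a (φ v)) {n j : ℕ} (hj : j < n) (x) :
    LinearMap.lTensor _ ψ (slotOp f n j x) = slotOp f' n j (LinearMap.lTensor _ φ x) := by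
  refine pure_tmul_ext (f := LinearMap.lTensor _ ψ ∘ₗ slotOp f n j)
    (g := slotOp f' n j ∘ₗ LinearMap.lTensor _ φ) (fun α v => ?_) x
  let r := Coalgebra.Repr.arbitrary k (α j)
  simp only [LinearMap.comp_apply, LinearMap.lTensor_tmul, slotOp_pure _ hj α rfl r, map_sum, h]

theorem slotOp_comm {f g : H →ₗ[k] Module.End k N} (h : ∀ a b, Commute (f a) (g b)) {n j j' : ℕ}
    (hj : j < n) (hj' : j' < n) (hne : j ≠ j') (x) :
    slotOp f n j (slotOp g n j' x) = slotOp g n j' (slotOp f n j x) := by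
  refine pure_tmul_ext (f := slotOp f n j ∘ₗ slotOp g n j') (g := slotOp g n j' ∘ₗ slotOp f n j)
    (fun α v => ?_) x
  let r := Coalgebra.Repr.arbitrary k (α j)
  let r' := Coalgebra.Repr.arbitrary k (α j')
  rw [LinearMap.comp_apply, LinearMap.comp_apply, slotOp_pure f hj α rfl r, slotOp_pure g hj' α rfl r',
    map_sum, map_sum]
  have h1 : ∀ l, slotOp f n j (pure n (Function.update α j' (r'.left l)) ⊗ₜ g (r'.right l) v) = _ :=
    fun l => slotOp_pure f hj _ (Function.update_of_ne hne ..) r _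
  have h2 : ∀ l, slotOp g n j' (pure n (Function.update α j (r.left l)) ⊗ₜ f (r.right l) v) = _ :=
    fun l => slotOp_pure g hj' _ (Function.update_of_ne hne.symm ..) r' _
  simp only [h1, h2]
  rw [Finset.sum_comm]
  refine Finset.sum_congr rfl fun l _ => Finset.sum_congr rfl fun m _ => ?_
  rw [Function.update_comm hne]
  congr 1
  exact LinearMap.congr_fun (h _ _).eq v

end Bialgebra

section HopfAlgebra

variable [HopfAlgebra k H] {N : Type*} [AddCommGroup N] [Module k N]

theorem conv_antipode (f : H →ₐ[k] Module.End k N) :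
    conv f.toLinearMap (f.toLinearMap ∘ₗ HopfAlgebra.antipode k) =
      LinearMap.toSpanSingleton k _ LinearMap.id ∘ₗ Coalgebra.counit (R := k) (A := H) := by
  refine LinearMap.ext fun h => ?_
  let r := Coalgebra.Repr.arbitrary k h
  rw [conv_repr _ _ r]
  simp only [AlgHom.toLinearMap_apply, LinearMap.comp_apply, ← map_mul, ← map_sum]
  rw [HopfAlgebra.sum_mul_antipode_eq_algebraMap_counit r, AlgHom.commutes]
  rfl

theorem antipode_conv (f : H →ₐ[k] Module.End k N) :
    conv (f.toLinearMap ∘ₗ HopfAlgebra.antipode k) f.toLinearMap =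
      LinearMap.toSpanSingleton k _ LinearMap.id ∘ₗ Coalgebra.counit (R := k) (A := H) := by
  refine LinearMap.ext fun h => ?_
  let r := Coalgebra.Repr.arbitrary k h
  rw [conv_repr _ _ r]
  simp only [AlgHom.toLinearMap_apply, LinearMap.comp_apply, ← map_mul, ← map_sum]
  rw [HopfAlgebra.sum_antipode_mul_eq_algebraMap_counit r, AlgHom.commutes]
  rfl

/-- For an action `f` of a Hopf algebra on `N`, the operator
`(g_0, …, g_{n-1} | v) ↦ (g_0, …, g_j⁰, …, g_{n-1} | f (g_j¹) v)` is invertible. For `j ≥ n`, where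
there is no slot `j`, it is replaced by the identity. -/
noncomputable def slotEquiv (f : H →ₐ[k] Module.End k N) (n j : ℕ) :
    TPow k H n ⊗[k] N ≃ₗ[k] TPow k H n ⊗[k] N :=
  if hj : j < n then
    LinearEquiv.ofLinearMap (slotOp f.toLinearMap n j)
      (slotOp (f.toLinearMap ∘ₗ HopfAlgebra.antipode k) n j)
      (LinearMap.ext fun x => by
        rw [LinearMap.comp_apply, slotOp_slotOp _ _ hj, conv_antipode, slotOp_counit _ hj,
          LinearMap.lTensor_id])
      (LinearMap.ext fun x => by
        rw [LinearMap.comp_apply, slotOp_slotOp _ _ hj, antipode_conv, slotOp_counit _ hj,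
          LinearMap.lTensor_id])
  else 1

theorem slotEquiv_apply (f : H →ₐ[k] Module.End k N) {n j : ℕ} (hj : j < n) (x) :
    slotEquiv f n j x = slotOp f.toLinearMap n j x := by
  rw [slotEquiv, dif_pos hj]
  rfl

theorem slotEquiv_inv_apply (f : H →ₐ[k] Module.End k N) {n j : ℕ} (hj : j < n) (x) :
    (slotEquiv f n j)⁻¹ x = slotOp (f.toLinearMap ∘ₗ HopfAlgebra.antipode k) n j x := by
  rw [slotEquiv, dif_pos hj]
  rfl

end HopfAlgebra

end Slot

/-! ### The untwisted structure on `H^{⊗ (p+1)} ⊗ A^{⊗ (q+1)}` -/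

namespace ParacyclicOps

variable {k : Type u} [CommRing k] {X : ℕ → Type v} {Y : ℕ → Type w}
  [∀ n, AddCommGroup (X n)] [∀ n, Module k (X n)] [∀ n, AddCommGroup (Y n)] [∀ n, Module k (Y n)]

/-- The image of the operators of a paracyclic module under a functor `F`. -/
def mapOps (F : ∀ m n, (X m →ₗ[k] X n) → (Y m →ₗ[k] Y n)) (P : ParacyclicOps k X) :
    ParacyclicOps k Y where
  d n i := F _ _ (P.d n i)
  s n i := F _ _ (P.s n i)
  t n := F _ _ (P.t n)

theorem IsCyclic.mapOps {P : ParacyclicOps k X} (h : P.IsCyclic)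
    (F : ∀ m n, (X m →ₗ[k] X n) → (Y m →ₗ[k] Y n)) (hid : ∀ n, F n n LinearMap.id = LinearMap.id)
    (hF : ∀ l m n f g, F l n (f ∘ₗ g) = F m n f ∘ₗ F l m g) : (P.mapOps F).IsCyclic := by
  have key : ∀ {l m m' n} {f : X m →ₗ[k] X n} {g : X l →ₗ[k] X m} {f' : X m' →ₗ[k] X n}
      {g' : X l →ₗ[k] X m'}, (∀ x, f (g x) = f' (g' x)) → ∀ x, F _ _ f (F _ _ g x) = F _ _ f' (F _ _ g' x) := by
    intro l m m' n f g f' g' h x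
    have := congrArg (F l n) (LinearMap.ext h : f ∘ₗ g = f' ∘ₗ g')
    rw [hF, hF] at this
    exact LinearMap.congr_fun this x
  have key1 : ∀ {l m n} {f : X m →ₗ[k] X n} {g : X l →ₗ[k] X m} {f' : X l →ₗ[k] X n},
      (∀ x, f (g x) = f' x) → ∀ x, F _ _ f (F _ _ g x) = F _ _ f' x := by
    intro l m n f g f' h x
    have := congrArg (F l n) (LinearMap.ext h : f ∘ₗ g = f')
    rw [hF] at this
    exact LinearMap.congr_fun this x
  have key0 : ∀ {l m} {f : X m →ₗ[k] X l} {g : X l →ₗ[k] X m},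
      (∀ x, f (g x) = x) → ∀ x, F _ _ f (F _ _ g x) = x := by
    intro l m f g h x
    rw [key1 (f' := LinearMap.id) h, hid]
    rfl
  have hpow : ∀ n (f : X n →ₗ[k] X n) m, F n n (f ^ m) = F n n f ^ m := by
    intro n f m
    induction m with
    | zero => exact hid n
    | succ m ih => rw [pow_succ, pow_succ, Module.End.mul_eq_comp, hF, ih]; rfl
  have tp : ∀ n x, (F n n (P.t n) ^ (n + 1)) x = x := fun n x => by
    rw [← hpow, show P.t n ^ (n + 1) = LinearMap.id from LinearMap.ext (h.t_pow n), hid]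
    rfl
  exact {
    d_d := fun n i j hij hj => key (h.d_d n i j hij hj)
    s_s := fun n i j hij hj => key (h.s_s n i j hij hj)
    d_s_lt := fun n i j hij hj => key (h.d_s_lt n i j hij hj)
    d_s_self := fun n i hi => key0 (h.d_s_self n i hi)
    d_s_succ := fun n i hi => key0 (h.d_s_succ n i hi)
    d_s_gt := fun n i j hij hi => key (h.d_s_gt n i j hij hi)
    d_t_zero := fun n => key1 (h.d_t_zero n)
    d_t_succ := fun n i hi => key (h.d_t_succ n i hi)
    s_t_zero := fun n x => by
      have := key (f := P.s n 0) (g := P.t n) (f' := P.t (n + 1)) (g' := P.t (n + 1) ∘ₗ P.s n n)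
        (h.s_t_zero n) x
      rw [hF] at this
      exact this
    s_t_succ := fun n i hi => key (h.s_t_succ n i hi)
    t_bijective := fun n => by
      refine ⟨fun x y hxy => ?_, fun x => ⟨(F n n (P.t n) ^ n) x, ?_⟩⟩
      · rw [← tp n x, ← tp n y, pow_succ, Module.End.mul_apply, Module.End.mul_apply]
        exact congrArg _ hxy
      · change F n n (P.t n) _ = x
        rw [← Module.End.mul_apply, ← pow_succ', tp]
    t_pow := tp }

end ParacyclicOps

section Plain

variable {k : Type u} [CommRing k] {M : Type v} [AddCommGroup M] [Module k M] {M' : Type w}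
  [AddCommGroup M'] [Module k M']

/-- The isomorphism of tensor powers induced by a linear isomorphism. -/
noncomputable def tpowCongr (f : M ≃ₗ[k] M') (n : ℕ) : TPow k M n ≃ₗ[k] TPow k M' n :=
  PiTensorProduct.congr fun _ => f

theorem tpowCongr_pure (f : M ≃ₗ[k] M') (n : ℕ) (α : ℕ → M) :
    tpowCongr f n (pure n α) = pure n fun m => f (α m) :=
  PiTensorProduct.congr_tprod _ _

theorem tpowCongr_contract (f : M ≃ₗ[k] M') (μ : M →ₗ[k] M →ₗ[k] M) (μ' : M' →ₗ[k] M' →ₗ[k] M')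
    (h : ∀ x y, f (μ x y) = μ' (f x) (f y)) (n i : ℕ) (hi : i ≤ n) (x) :
    tpowCongr f (n + 1) (contract μ n i hi x) = contract μ' n i hi (tpowCongr f (n + 2) x) := by
  refine LinearMap.congr_fun (tpow_ext (f := (tpowCongr f (n + 1)).toLinearMap ∘ₗ contract μ n i hi)
    (g := contract μ' n i hi ∘ₗ (tpowCongr f (n + 2)).toLinearMap) fun α => ?_) x
  simp only [LinearMap.comp_apply, LinearEquiv.coe_coe, contract_pure, tpowCongr_pure]
  refine pure_congr fun m _ => ?_
  split_ifs <;> simp [h]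

theorem tpowCongr_insert (f : M ≃ₗ[k] M') (e : M) (n i : ℕ) (hi : i ≤ n) (x) :
    tpowCongr f (n + 2) (insert k e n i x) = insert k (f e) n i (tpowCongr f (n + 1) x) := by
  refine LinearMap.congr_fun (tpow_ext (f := (tpowCongr f (n + 2)).toLinearMap ∘ₗ insert k e n i)
    (g := insert k (f e) n i ∘ₗ (tpowCongr f (n + 1)).toLinearMap) fun α => ?_) x
  simp only [LinearMap.comp_apply, LinearEquiv.coe_coe, insert_pure _ _ _ hi, tpowCongr_pure]
  refine pure_congr fun m _ => ?_
  split_ifs <;> rfl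

theorem tpowCongr_rotate (f : M ≃ₗ[k] M') (n : ℕ) (x) :
    tpowCongr f (n + 1) (rotate k M n x) = rotate k M' n (tpowCongr f (n + 1) x) := by
  refine LinearMap.congr_fun (tpow_ext (f := (tpowCongr f (n + 1)).toLinearMap ∘ₗ rotate k M n)
    (g := rotate k M' n ∘ₗ (tpowCongr f (n + 1)).toLinearMap) fun α => ?_) x
  simp only [LinearMap.comp_apply, LinearEquiv.coe_coe, rotate_pure, tpowCongr_pure]
  refine pure_congr fun m _ => ?_
  split_ifs <;> rfl

end Plain

section Plain

variable (k : Type u) (H : Type v) (A : Type w) [CommRing k] [Ring H] [Ring A] [Algebra k A]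

/-- The linear isomorphism `A ≃ A^op`. -/
noncomputable def opEquiv : A ≃ₗ[k] Aᵐᵒᵖ := MulOpposite.opLinearEquiv k

/-- The tensor powers of `A` and `A^op` are the same modules. -/
noncomputable abbrev opTPow (n : ℕ) : TPow k A n ≃ₗ[k] TPow k Aᵐᵒᵖ n := tpowCongr (opEquiv k A) n

theorem opEquiv_mul (a b : A) : opEquiv k A ((LinearMap.mul k A).flip a b) =
    LinearMap.mul k Aᵐᵒᵖ (opEquiv k A a) (opEquiv k A b) := rfl

theorem opTPow_contract (q i : ℕ) (hi : i ≤ q) (x) :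
    opTPow k A _ (contract (LinearMap.mul k A).flip q i hi x) =
      contract (LinearMap.mul k Aᵐᵒᵖ) q i hi (opTPow k A _ x) :=
  tpowCongr_contract (opEquiv k A) (LinearMap.mul k A).flip (LinearMap.mul k Aᵐᵒᵖ)
    (opEquiv_mul k A) q i hi x

/-- The tensor product of the cyclic modules of `H` and `A^op`, on the modules underlying
`A ♮ H`. -/
noncomputable def plain [Algebra k H] :
    CylindricalOps k fun p q => TPow k H (p + 1) ⊗[k] TPow k A (q + 1) where
  h p := (algOps k Aᵐᵒᵖ).mapOps fun m n φ => LinearMap.lTensor _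
    ((opTPow k A (n + 1)).symm.toLinearMap ∘ₗ φ ∘ₗ (opTPow k A (m + 1)).toLinearMap)
  v _ := (algOps k H).mapOps fun _ _ φ => LinearMap.rTensor _ φ

variable {k H A}

section Algebra

variable [Algebra k H]

theorem plain_h_d (p q i : ℕ) (hi : i ≤ q) : ((plain k H A).h p).d q i =
    LinearMap.lTensor _ (contract (LinearMap.mul k A).flip q i hi) := by
  have h1 : (algOps k Aᵐᵒᵖ).d q i = contract (LinearMap.mul k Aᵐᵒᵖ) q i hi := dif_pos hi
  refine congrArg (LinearMap.lTensor _) (LinearMap.ext fun x => ?_)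
  rw [h1, LinearMap.comp_apply, LinearMap.comp_apply, LinearEquiv.coe_coe, LinearEquiv.symm_apply_eq]
  exact (opTPow_contract k A q i hi x).symm

theorem plain_h_s (p q i : ℕ) (hi : i ≤ q) : ((plain k H A).h p).s q i =
    LinearMap.lTensor _ (insert k 1 q i) := by
  refine congrArg (LinearMap.lTensor _) (LinearMap.ext fun x => ?_)
  rw [LinearMap.comp_apply, LinearMap.comp_apply, LinearEquiv.coe_coe, LinearEquiv.symm_apply_eq]
  exact (tpowCongr_insert (opEquiv k A) 1 q i hi x).symm

theorem plain_h_t (p q : ℕ) : ((plain k H A).h p).t q = LinearMap.lTensor _ (rotate k A q) := by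
  refine congrArg (LinearMap.lTensor _) (LinearMap.ext fun x => ?_)
  rw [LinearMap.comp_apply, LinearMap.comp_apply, LinearEquiv.coe_coe, LinearEquiv.symm_apply_eq]
  exact (tpowCongr_rotate (opEquiv k A) q x).symm

theorem plain_h_isCyclic (p : ℕ) : ((plain k H A).h p).IsCyclic := by
  refine (algOps_isCyclic k Aᵐᵒᵖ).mapOps (Y := fun q => TPow k H (p + 1) ⊗[k] TPow k A (q + 1))
    (fun m n φ => LinearMap.lTensor _
      ((opTPow k A (n + 1)).symm.toLinearMap ∘ₗ φ ∘ₗ (opTPow k A (m + 1)).toLinearMap))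
    (fun n => ?_) fun l m n f g => ?_
  · rw [LinearMap.id_comp, LinearEquiv.symm_comp, LinearMap.lTensor_id]
  · rw [← LinearMap.lTensor_comp]
    refine congrArg (LinearMap.lTensor _) (LinearMap.ext fun x => ?_)
    simp only [LinearMap.comp_apply, LinearEquiv.coe_coe, LinearEquiv.apply_symm_apply]

theorem plain_v_isCyclic (q : ℕ) : ((plain k H A).v q).IsCyclic :=
  (algOps_isCyclic k H).mapOps (Y := fun p => TPow k H (p + 1) ⊗[k] TPow k A (q + 1)) _
    (fun _ => LinearMap.rTensor_id ..)
    fun _ _ _ _ _ => LinearMap.rTensor_comp ..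

theorem plain_v_d_pure (p q i : ℕ) (hi : i ≤ p) (α : ℕ → H) (v) :
    ((plain k H A).v q).d p i (pure (p + 2) α ⊗ₜ v) = pure (p + 1) (fun m =>
      if m < i then α m else if m = i then α m * α (m + 1) else α (m + 1)) ⊗ₜ v := by
  refine (LinearMap.rTensor_tmul _ _ _ _).trans (congrArg (· ⊗ₜ[k] v) ?_)
  rw [alg_d_pure k H p i (by omega)]
  exact pure_congr fun m _ => by rw [if_neg (by omega)]

theorem plain_v_s_pure (p q i : ℕ) (hi : i ≤ p) (α : ℕ → H) (v) :
    ((plain k H A).v q).s p i (pure (p + 1) α ⊗ₜ v) = pure (p + 2) (fun m =>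
      if m ≤ i then α m else if m = i + 1 then 1 else α (m - 1)) ⊗ₜ v :=
  (LinearMap.rTensor_tmul _ _ _ _).trans (congrArg (· ⊗ₜ[k] v) (alg_s_pure k H p i hi α))

theorem plain_v_t_pure (p q : ℕ) (α : ℕ → H) (v) :
    ((plain k H A).v q).t p (pure (p + 1) α ⊗ₜ v) = pure (p + 1) (fun m =>
      if m = 0 then α p else α (m - 1)) ⊗ₜ v :=
  (LinearMap.rTensor_tmul _ _ _ _).trans (congrArg (· ⊗ₜ[k] v) (alg_t_pure k H p α))

end Algebra

section Action

variable [Module H A]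

section

variable [Algebra k H] [IsScalarTower k H A]

theorem map₂_single_pure (q : ℕ) (i : Fin (q + 1)) (h : H) (α : ℕ → A) :
    PiTensorProduct.map₂ (fun _ => (act k H A).toLinearMap) (single (k := k) i h) (pure (q + 1) α) =
      pure (q + 1) (Function.update α i (h • α i)) := by
  refine (PiTensorProduct.map₂_tprod_tprod _ _ _).trans
    (congrArg (PiTensorProduct.tprod k) (funext fun j => ?_))
  by_cases hj : j = i
  · subst hj
    simp
  · rw [Function.update_of_ne fun h => hj (Fin.ext h)]
    simp [Pi.mulSingle_eq_of_ne hj]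

variable (k H A) in
/-- The action `(a_0, …, a_q) ↦ (a_0, …, h a_i, …, a_q)` of `H` on slot `i`. (A slot `i > q` is
read modulo `q + 1`.) -/
noncomputable def slotAct (q i : ℕ) : H →ₐ[k] Module.End k (TPow k A (q + 1)) :=
  AlgHom.ofLinearMap (PiTensorProduct.map₂ (fun _ => (act k H A).toLinearMap) ∘ₗ
      (single (Fin.ofNat (q + 1) i)).toLinearMap)
    (tpow_ext fun α => by
      rw [LinearMap.comp_apply]
      refine (map₂_single_pure q _ 1 α).trans ?_
      rw [one_smul, Function.update_eq_self]
      rfl)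
    fun h h' => tpow_ext fun α => by
      rw [LinearMap.comp_apply, LinearMap.comp_apply, LinearMap.comp_apply, Module.End.mul_apply]
      refine (map₂_single_pure q _ _ α).trans (Eq.symm ?_)
      refine (congrArg _ (map₂_single_pure q _ h' α)).trans ((map₂_single_pure q _ h _).trans ?_)
      rw [Function.update_idem, Function.update_self, mul_smul]

theorem slotAct_pure {q i : ℕ} (hi : i ≤ q) (h : H) (α : ℕ → A) :
    slotAct k H A q i h (pure (q + 1) α) = pure (q + 1) (Function.update α i (h • α i)) := by
  refine (map₂_single_pure q _ h α).trans ?_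
  rw [show ((Fin.ofNat (q + 1) i : Fin (q + 1)) : ℕ) = i by
    simp [Nat.mod_eq_of_lt (Nat.lt_succ_of_le hi)]]

theorem slotAct_comm {q i i' : ℕ} (hi : i ≤ q) (hi' : i' ≤ q) (hne : i ≠ i') (h h' : H) :
    Commute (slotAct k H A q i h) (slotAct k H A q i' h') := by
  refine tpow_ext fun α => ?_
  rw [Module.End.mul_apply, Module.End.mul_apply, slotAct_pure hi, slotAct_pure hi', slotAct_pure hi,
    slotAct_pure hi', Function.update_of_ne hne, Function.update_of_ne hne.symm,
    Function.update_comm hne]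

theorem rotate_slotAct {q i : ℕ} (hi : i < q) (h : H) (x) :
    rotate k A q (slotAct k H A q i h x) = slotAct k H A q (i + 1) h (rotate k A q x) := by
  refine LinearMap.congr_fun (tpow_ext (f := rotate k A q ∘ₗ slotAct k H A q i h)
    (g := slotAct k H A q (i + 1) h ∘ₗ rotate k A q) fun α => ?_) x
  rw [LinearMap.comp_apply, LinearMap.comp_apply, slotAct_pure (by omega), rotate_pure, rotate_pure,
    slotAct_pure (by omega)]
  refine pure_congr fun m hm => ?_
  grind [Function.update_apply]

theorem rotate_slotAct_last (q : ℕ) (h : H) (x) :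
    rotate k A q (slotAct k H A q q h x) = slotAct k H A q 0 h (rotate k A q x) := by
  refine LinearMap.congr_fun (tpow_ext (f := rotate k A q ∘ₗ slotAct k H A q q h)
    (g := slotAct k H A q 0 h ∘ₗ rotate k A q) fun α => ?_) x
  rw [LinearMap.comp_apply, LinearMap.comp_apply, slotAct_pure (by omega), rotate_pure, rotate_pure,
    slotAct_pure (by omega)]
  refine pure_congr fun m hm => ?_
  grind [Function.update_apply]

theorem contract_slotAct {q l i i' : ℕ} (hl : l ≤ q) (hi : (i < l ∧ i' = i) ∨ (l < i ∧ i ≤ q ∧ i' = i + 1))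
    (h : H) (x) : slotAct k H A q i h (contract (LinearMap.mul k A).flip q l hl x) =
      contract (LinearMap.mul k A).flip q l hl (slotAct k H A (q + 1) i' h x) := by
  refine LinearMap.congr_fun (tpow_ext
    (f := slotAct k H A q i h ∘ₗ contract (LinearMap.mul k A).flip q l hl)
    (g := contract (LinearMap.mul k A).flip q l hl ∘ₗ slotAct k H A (q + 1) i' h) fun α => ?_) x
  rw [LinearMap.comp_apply, LinearMap.comp_apply, slotAct_pure (by omega), contract_pure, contract_pure,
    slotAct_pure (by omega)]
  refine pure_congr fun m hm => ?_
  simp only [Function.update_apply]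
  grind

theorem insert_slotAct {q l i i' : ℕ} (hl : l ≤ q) (hi : (i ≤ l ∧ i' = i) ∨ (l < i ∧ i ≤ q ∧ i' = i + 1))
    (h : H) (x) : slotAct k H A (q + 1) i' h (insert k 1 q l x) =
      insert k 1 q l (slotAct k H A q i h x) := by
  refine LinearMap.congr_fun (tpow_ext
    (f := slotAct k H A (q + 1) i' h ∘ₗ insert k 1 q l)
    (g := insert k 1 q l ∘ₗ slotAct k H A q i h) fun α => ?_) x
  rw [LinearMap.comp_apply, LinearMap.comp_apply, slotAct_pure (by omega), insert_pure _ _ _ hl,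
    insert_pure _ _ _ hl, slotAct_pure (by omega)]
  refine pure_congr fun m hm => ?_
  simp only [Function.update_apply]
  grind

end

variable [Bialgebra k H] [IsScalarTower k H A] [ModuleAlgebra k H A]

theorem contract_slotAct_self (q : ℕ) (h : H) (x) :
    slotAct k H A q 0 h (contract (LinearMap.mul k A).flip q 0 (Nat.zero_le q) x) =
      contract (LinearMap.mul k A).flip q 0 (Nat.zero_le q)
        (conv (slotAct k H A (q + 1) 1).toLinearMap (slotAct k H A (q + 1) 0).toLinearMap h x) := by
  refine LinearMap.congr_fun (tpow_ext
    (f := slotAct k H A q 0 h ∘ₗ contract (LinearMap.mul k A).flip q 0 (Nat.zero_le q))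
    (g := contract (LinearMap.mul k A).flip q 0 (Nat.zero_le q) ∘ₗ
      conv (slotAct k H A (q + 1) 1).toLinearMap (slotAct k H A (q + 1) 0).toLinearMap h) fun α => ?_) x
  let r := Coalgebra.Repr.arbitrary k h
  rw [LinearMap.comp_apply, LinearMap.comp_apply, conv_repr _ _ r, LinearMap.sum_apply, map_sum,
    contract_pure, slotAct_pure (by omega)]
  have h1 : ∀ l, contract (LinearMap.mul k A).flip q 0 (Nat.zero_le q)
      (((slotAct k H A (q + 1) 1).toLinearMap (r.left l) *
        (slotAct k H A (q + 1) 0).toLinearMap (r.right l)) (pure (q + 2) α)) =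
      pure (q + 1) (Function.update (fun m => α (m + 1)) 0 ((r.left l • α 1) * (r.right l • α 0))) := by
    intro l
    rw [Module.End.mul_apply, AlgHom.toLinearMap_apply, AlgHom.toLinearMap_apply,
      slotAct_pure (by omega), slotAct_pure (by omega), contract_pure]
    refine pure_congr fun m hm => ?_
    simp only [Function.update_apply]
    rcases m with _ | m <;> simp
  have h2 : ∀ y : A, pure (k := k) (q + 1) (Function.update (fun m => α (m + 1)) 0 y) =
      (PiTensorProduct.tprod k).toLinearMap (fun i : Fin (q + 1) => α (i + 1)) 0 y := by
    intro y
    rw [MultilinearMap.toLinearMap_apply]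
    refine congrArg (PiTensorProduct.tprod k) (funext fun i => ?_)
    by_cases hi : i = 0
    · subst hi
      rw [Function.update_self]
      exact Function.update_self ..
    · rw [Function.update_of_ne hi]
      exact Function.update_of_ne (fun h => hi (Fin.ext h)) _ _
  simp only [h1, h2]
  rw [← map_sum, ← ModuleAlgebra.smul_mul_repr (α 1) (α 0) r, ← h2]
  refine pure_congr fun m hm => ?_
  simp only [Function.update_apply]
  rcases m with _ | m <;> simp

theorem insert_slotAct_self {q l : ℕ} (hl : l ≤ q) (h : H) (x) :
    slotAct k H A (q + 1) (l + 1) h (insert k 1 q l x) =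
      Coalgebra.counit (R := k) h • insert k 1 q l x := by
  refine LinearMap.congr_fun (tpow_ext (f := slotAct k H A (q + 1) (l + 1) h ∘ₗ insert k 1 q l)
    (g := Coalgebra.counit (R := k) h • insert k 1 q l) fun α => ?_) x
  rw [LinearMap.comp_apply, LinearMap.smul_apply, insert_pure _ _ _ hl, slotAct_pure (by omega),
    if_neg (by omega), if_pos rfl, ModuleAlgebra.smul_one (k := k), Algebra.algebraMap_eq_smul_one]
  let β : Fin (q + 2) → A := fun m => if (m : ℕ) ≤ l then α m else if (m : ℕ) = l + 1 then 1 else α (m - 1)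
  have h2 : ∀ y : A, pure (k := k) (q + 2) (Function.update (fun m => if m ≤ l then α m else
      if m = l + 1 then 1 else α (m - 1)) (l + 1) y) =
      (PiTensorProduct.tprod k).toLinearMap β ⟨l + 1, by omega⟩ y := by
    intro y
    rw [MultilinearMap.toLinearMap_apply]
    refine congrArg (PiTensorProduct.tprod k) (funext fun i => ?_)
    by_cases hi : i = ⟨l + 1, by omega⟩
    · subst hi
      rw [Function.update_self, Function.update_self]
    · rw [Function.update_of_ne hi, Function.update_of_ne fun h => hi (Fin.ext h)]
  rw [h2, map_smul, ← h2]
  congr 1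
  refine pure_congr fun m hm => ?_
  simp only [Function.update_apply]
  grind

end Action

end Plain

/-! ### The grid of slot operators -/

section Grid

variable {k : Type u} {H : Type v} {A : Type w} [CommRing k] [Ring H] [Ring A] [Algebra k A]

/-- The coproduct of a product. -/
noncomputable def reprMul [Bialgebra k H] {a b : H} {ι ι' : Type*} (r : Coalgebra.Repr k a ι)
    (r' : Coalgebra.Repr k b ι') : Coalgebra.Repr k (a * b) (ι × ι') where
  index := r.index ×ˢ r'.index
  left l := r.left l.1 * r'.left l.2
  right l := r.right l.1 * r'.right l.2
  eq := by
    rw [Bialgebra.comul_mul, ← r.eq, ← r'.eq, Finset.sum_mul_sum, Finset.sum_product]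
    simp only [Algebra.TensorProduct.tmul_mul_tmul]

section Slot

variable [HopfAlgebra k H] {N : Type*} [AddCommGroup N] [Module k N]

theorem slotEquiv_pure (f : H →ₐ[k] Module.End k N) {n j : ℕ} (hj : j < n) (α : ℕ → H) {a : H}
    (ha : α j = a) {ι : Type*} (r : Coalgebra.Repr k a ι) (v : N) :
    slotEquiv f n j (pure n α ⊗ₜ v) =
      ∑ l ∈ r.index, pure n (Function.update α j (r.left l)) ⊗ₜ f (r.right l) v := by
  rw [slotEquiv_apply f hj, slotOp_pure _ hj α ha r]
  rfl

theorem slotEquiv_pure_one (f : H →ₐ[k] Module.End k N) {n j : ℕ} (hj : j < n) (α : ℕ → H)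
    (ha : α j = 1) (v : N) : slotEquiv f n j (pure n α ⊗ₜ v) = pure n α ⊗ₜ v := by
  let r : Coalgebra.Repr k (1 : H) Unit :=
    { index := {()}, left := fun _ => 1, right := fun _ => 1
      eq := by simp [Algebra.TensorProduct.one_def] }
  have h1 : Function.update α j 1 = α := by rw [← ha, Function.update_eq_self]
  rw [slotEquiv_pure f hj α ha r, Finset.sum_singleton, map_one]
  exact congrArg (fun β => pure n β ⊗ₜ[k] v) h1

theorem slotEquiv_comm {f g : H →ₐ[k] Module.End k N} (h : ∀ a b, Commute (f a) (g b)) {n j j' : ℕ}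
    (hj : j < n) (hj' : j' < n) (hne : j ≠ j') : Commute (slotEquiv f n j) (slotEquiv g n j') := by
  refine LinearEquiv.ext fun x => ?_
  rw [LinearEquiv.mul_apply, LinearEquiv.mul_apply, slotEquiv_apply f hj, slotEquiv_apply g hj',
    slotEquiv_apply g hj', slotEquiv_apply f hj]
  exact slotOp_comm h hj hj' hne x

theorem lTensor_slotEquiv {P : Type*} [AddCommGroup P] [Module k P]
    {f : H →ₐ[k] Module.End k N} {f' : H →ₐ[k] Module.End k P} {φ : N →ₗ[k] P}
    (h : ∀ a v, φ (f a v) = f' a (φ v)) {n j : ℕ} (hj : j < n) (x) :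
    LinearMap.lTensor _ φ (slotEquiv f n j x) = slotEquiv f' n j (LinearMap.lTensor _ φ x) := by
  rw [slotEquiv_apply f hj, slotEquiv_apply f' hj]
  exact lTensor_slotOp h hj x

/-- An action that is trivial on the image of `φ` gives the identity there. -/
theorem slotEquiv_lTensor_of_counit {P : Type*} [AddCommGroup P] [Module k P]
    {f : H →ₐ[k] Module.End k P} {φ : N →ₗ[k] P}
    (h : ∀ a v, f a (φ v) = Coalgebra.counit (R := k) a • φ v) {n j : ℕ} (hj : j < n) (x) :
    slotEquiv f n j (LinearMap.lTensor _ φ x) = LinearMap.lTensor _ φ x := by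
  have h1 := lTensor_slotOp (f' := f.toLinearMap) (φ := φ) (ψ := φ)
    (f := LinearMap.toSpanSingleton k _ LinearMap.id ∘ₗ Coalgebra.counit (R := k) (A := H))
    (fun a v => by rw [AlgHom.toLinearMap_apply, h]; exact map_smul φ _ v) hj x
  rw [slotOp_counit _ hj, LinearMap.lTensor_id] at h1
  rw [slotEquiv_apply f hj, ← h1]
  rfl

/-- The slot operators of an action are compatible with the cyclic module of `H`. -/
theorem plain_v_isTwisting (q : ℕ) (f : H →ₐ[k] Module.End k (TPow k A (q + 1))) :
    ((plain k H A).v q).IsTwisting fun p j => slotEquiv f (p + 1) j where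
  t_e n j hj := pure_tmul_ext (f := ((plain k H A).v q).t n ∘ₗ (slotEquiv f (n + 1) j).toLinearMap)
    (g := (slotEquiv f (n + 1) (j + 1)).toLinearMap ∘ₗ ((plain k H A).v q).t n) fun α v => by
      let r := Coalgebra.Repr.arbitrary k (α j)
      simp only [LinearMap.comp_apply, LinearEquiv.coe_coe]
      rw [plain_v_t_pure, slotEquiv_pure f (by omega) _ rfl r, slotEquiv_pure f (by omega) _ (by simp) r,
        map_sum]
      refine Finset.sum_congr rfl fun l _ => ?_
      rw [plain_v_t_pure]
      refine congrArg (· ⊗ₜ[k] _) (pure_congr fun m hm => ?_)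
      grind [Function.update_apply]
  t_e_last n := pure_tmul_ext (f := ((plain k H A).v q).t n ∘ₗ (slotEquiv f (n + 1) n).toLinearMap)
    (g := (slotEquiv f (n + 1) 0).toLinearMap ∘ₗ ((plain k H A).v q).t n) fun α v => by
      let r := Coalgebra.Repr.arbitrary k (α n)
      simp only [LinearMap.comp_apply, LinearEquiv.coe_coe]
      rw [plain_v_t_pure, slotEquiv_pure f (by omega) _ rfl r, slotEquiv_pure f (by omega) _ (by simp) r,
        map_sum]
      refine Finset.sum_congr rfl fun l _ => ?_
      rw [plain_v_t_pure]
      refine congrArg (· ⊗ₜ[k] _) (pure_congr fun m hm => ?_)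
      grind [Function.update_apply]
  e_zero_d_zero n := pure_tmul_ext
    (f := (slotEquiv f (n + 1) 0).toLinearMap ∘ₗ ((plain k H A).v q).d n 0)
    (g := ((plain k H A).v q).d n 0 ∘ₗ (slotEquiv f (n + 2) 0).toLinearMap ∘ₗ
      (slotEquiv f (n + 2) 1).toLinearMap) fun α v => by
      let r := Coalgebra.Repr.arbitrary k (α 0)
      let r' := Coalgebra.Repr.arbitrary k (α 1)
      simp only [LinearMap.comp_apply, LinearEquiv.coe_coe]
      rw [plain_v_d_pure n q 0 (by omega), slotEquiv_pure f (by omega) _ (by simp) (reprMul r r'),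
        slotEquiv_pure f (by omega) _ rfl r', map_sum, map_sum]
      refine (Finset.sum_product_right ..).trans (Finset.sum_congr rfl fun l' _ => ?_)
      rw [slotEquiv_pure f (by omega) _ (Function.update_of_ne (by omega) ..) r, map_sum]
      refine Finset.sum_congr rfl fun l _ => ?_
      rw [plain_v_d_pure n q 0 (by omega), reprMul]
      simp only [map_mul, Module.End.mul_apply]
      refine congrArg (· ⊗ₜ[k] _) (pure_congr fun m hm => ?_)
      grind [Function.update_apply]
  e_zero_d_succ n l hl := pure_tmul_ext
    (f := (slotEquiv f (n + 1) 0).toLinearMap ∘ₗ ((plain k H A).v q).d n (l + 1))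
    (g := ((plain k H A).v q).d n (l + 1) ∘ₗ (slotEquiv f (n + 2) 0).toLinearMap) fun α v => by
      let r := Coalgebra.Repr.arbitrary k (α 0)
      simp only [LinearMap.comp_apply, LinearEquiv.coe_coe]
      rw [plain_v_d_pure n q (l + 1) (by omega), slotEquiv_pure f (by omega) _ (by simp) r,
        slotEquiv_pure f (by omega) _ rfl r, map_sum]
      refine Finset.sum_congr rfl fun l _ => ?_
      rw [plain_v_d_pure n q _ (by omega)]
      refine congrArg (· ⊗ₜ[k] _) (pure_congr fun m hm => ?_)
      grind [Function.update_apply]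
  e_succ_d_zero n j hj := pure_tmul_ext
    (f := (slotEquiv f (n + 1) (j + 1)).toLinearMap ∘ₗ ((plain k H A).v q).d n 0)
    (g := ((plain k H A).v q).d n 0 ∘ₗ (slotEquiv f (n + 2) (j + 2)).toLinearMap) fun α v => by
      let r := Coalgebra.Repr.arbitrary k (α (j + 2))
      simp only [LinearMap.comp_apply, LinearEquiv.coe_coe]
      rw [plain_v_d_pure n q 0 (by omega), slotEquiv_pure f (by omega) _ (by simp) r,
        slotEquiv_pure f (by omega) _ rfl r, map_sum]
      refine Finset.sum_congr rfl fun l _ => ?_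
      rw [plain_v_d_pure n q _ (by omega)]
      refine congrArg (· ⊗ₜ[k] _) (pure_congr fun m hm => ?_)
      grind [Function.update_apply]
  e_zero_s n l hl := pure_tmul_ext
    (f := (slotEquiv f (n + 2) 0).toLinearMap ∘ₗ ((plain k H A).v q).s n l)
    (g := ((plain k H A).v q).s n l ∘ₗ (slotEquiv f (n + 1) 0).toLinearMap) fun α v => by
      let r := Coalgebra.Repr.arbitrary k (α 0)
      simp only [LinearMap.comp_apply, LinearEquiv.coe_coe]
      rw [plain_v_s_pure n q l hl, slotEquiv_pure f (by omega) _ (by simp) r,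
        slotEquiv_pure f (by omega) _ rfl r, map_sum]
      refine Finset.sum_congr rfl fun _ _ => ?_
      rw [plain_v_s_pure n q l hl]
      refine congrArg (· ⊗ₜ[k] _) (pure_congr fun m hm => ?_)
      grind [Function.update_apply]
  e_succ_s n l hl := pure_tmul_ext
    (f := (slotEquiv f (n + 2) (l + 1)).toLinearMap ∘ₗ ((plain k H A).v q).s n l)
    (g := ((plain k H A).v q).s n l) fun α v => by
      simp only [LinearMap.comp_apply, LinearEquiv.coe_coe]
      rw [plain_v_s_pure n q l hl, slotEquiv_pure_one f (by omega) _ (by simp)]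
  e_succ_s_zero n j hj := pure_tmul_ext
    (f := (slotEquiv f (n + 2) (j + 2)).toLinearMap ∘ₗ ((plain k H A).v q).s n 0)
    (g := ((plain k H A).v q).s n 0 ∘ₗ (slotEquiv f (n + 1) (j + 1)).toLinearMap) fun α v => by
      let r := Coalgebra.Repr.arbitrary k (α (j + 1))
      simp only [LinearMap.comp_apply, LinearEquiv.coe_coe]
      rw [plain_v_s_pure n q 0 (by omega), slotEquiv_pure f (by omega) _ (by simp) r,
        slotEquiv_pure f (by omega) _ rfl r, map_sum]
      refine Finset.sum_congr rfl fun _ _ => ?_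
      rw [plain_v_s_pure n q 0 (by omega)]
      refine congrArg (· ⊗ₜ[k] _) (pure_congr fun m hm => ?_)
      grind [Function.update_apply]

end Slot

variable [Module H A] [HopfAlgebra k H] [IsScalarTower k H A]

variable (k H A) in
/-- The operator `(g_0, …, g_p | a_q, …, a_0) ↦ (g_0, …, g_j⁰, …, g_p | a_q, …, g_j¹ a_i, …, a_0)`. -/
noncomputable def slotGrid (p q j i : ℕ) : TPow k H (p + 1) ⊗[k] TPow k A (q + 1) ≃ₗ[k]
    TPow k H (p + 1) ⊗[k] TPow k A (q + 1) :=
  slotEquiv (slotAct k H A q i) (p + 1) j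

theorem lTensor_slotGrid {p q q' j i i' : ℕ} (hj : j ≤ p)
    {φ : TPow k A (q + 1) →ₗ[k] TPow k A (q' + 1)}
    (h : ∀ a v, φ (slotAct k H A q i a v) = slotAct k H A q' i' a (φ v)) (x) :
    LinearMap.lTensor _ φ (slotGrid k H A p q j i x) =
      slotGrid k H A p q' j i' (LinearMap.lTensor _ φ x) :=
  lTensor_slotEquiv h (Nat.lt_succ_of_le hj) x

theorem lTensor_slotGrid_inv {p q q' j i i' : ℕ} (hj : j ≤ p)
    {φ : TPow k A (q + 1) →ₗ[k] TPow k A (q' + 1)}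
    (h : ∀ a v, φ (slotAct k H A q i a v) = slotAct k H A q' i' a (φ v)) (x) :
    LinearMap.lTensor _ φ ((slotGrid k H A p q j i)⁻¹ x) =
      (slotGrid k H A p q' j i')⁻¹ (LinearMap.lTensor _ φ x) :=
  map_inv_apply (lTensor_slotGrid hj h) x

theorem lTensor_rTensor_comm {p p' q q' : ℕ} (f : TPow k H (p + 1) →ₗ[k] TPow k H (p' + 1))
    (g : TPow k A (q + 1) →ₗ[k] TPow k A (q' + 1)) (x) :
    LinearMap.lTensor _ g (LinearMap.rTensor _ f x) = LinearMap.rTensor _ f (LinearMap.lTensor _ g x) := by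
  rw [← LinearMap.comp_apply, ← LinearMap.comp_apply, LinearMap.lTensor_comp_rTensor,
    LinearMap.rTensor_comp_lTensor]

theorem slotGrid_h_d_zero [ModuleAlgebra k H A] {p j : ℕ} (hj : j ≤ p) (q : ℕ) (x) :
    (slotGrid k H A p q j 0)⁻¹ (((plain k H A).h p).d q 0 x) = ((plain k H A).h p).d q 0
      ((slotGrid k H A p (q + 1) j 0)⁻¹ ((slotGrid k H A p (q + 1) j 1)⁻¹ x)) := by
  rw [plain_h_d p q 0 (by omega)]
  refine (map_inv_apply (φ := LinearMap.lTensor _ (contract (LinearMap.mul k A).flip q 0 (Nat.zero_le q)))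
    (f := slotGrid k H A p (q + 1) j 1 * slotGrid k H A p (q + 1) j 0) (g := slotGrid k H A p q j 0)
    (fun y => ?_) x).symm
  rw [LinearEquiv.mul_apply, slotGrid, slotGrid, slotGrid, slotEquiv_apply _ (by omega),
    slotEquiv_apply _ (by omega), slotEquiv_apply _ (by omega), slotOp_slotOp _ _ (by omega)]
  exact lTensor_slotOp (fun h x => (contract_slotAct_self q h x).symm) (by omega) y

theorem slotGrid_h_d {p j q l i i' : ℕ} (hj : j ≤ p) (hl : l ≤ q)
    (hi : (i < l ∧ i' = i) ∨ (l < i ∧ i ≤ q ∧ i' = i + 1)) (x) :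
    (slotGrid k H A p q j i)⁻¹ (((plain k H A).h p).d q l x) =
      ((plain k H A).h p).d q l ((slotGrid k H A p (q + 1) j i')⁻¹ x) := by
  rw [plain_h_d p q l hl]
  exact (lTensor_slotGrid_inv hj (fun h y => (contract_slotAct hl hi h y).symm) x).symm

theorem slotGrid_h_s {p j q l i i' : ℕ} (hj : j ≤ p) (hl : l ≤ q)
    (hi : (i ≤ l ∧ i' = i) ∨ (l < i ∧ i ≤ q ∧ i' = i + 1)) (x) :
    (slotGrid k H A p (q + 1) j i')⁻¹ (((plain k H A).h p).s q l x) =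
      ((plain k H A).h p).s q l ((slotGrid k H A p q j i)⁻¹ x) := by
  rw [plain_h_s p q l hl]
  exact (lTensor_slotGrid_inv hj (fun h y => (insert_slotAct hl hi h y).symm) x).symm

theorem slotGrid_h_s_self [ModuleAlgebra k H A] {p j q l : ℕ} (hj : j ≤ p) (hl : l ≤ q) (x) :
    (slotGrid k H A p (q + 1) j (l + 1))⁻¹ (((plain k H A).h p).s q l x) =
      ((plain k H A).h p).s q l x := by
  rw [plain_h_s p q l hl]
  exact (LinearEquiv.symm_apply_eq _).mpr
    (slotEquiv_lTensor_of_counit (insert_slotAct_self hl) (by omega) x).symm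

theorem plain_h_isTwisting [ModuleAlgebra k H A] (p j : ℕ) (hj : j ≤ p) :
    ((plain k H A).h p).IsTwisting fun q i => (slotGrid k H A p q j i)⁻¹ where
  t_e q i hi x := by
    rw [plain_h_t]
    exact lTensor_slotGrid_inv hj (rotate_slotAct hi) x
  t_e_last q x := by
    rw [plain_h_t]
    exact lTensor_slotGrid_inv hj (rotate_slotAct_last q) x
  e_zero_d_zero q x := slotGrid_h_d_zero hj q x
  e_zero_d_succ q l hl x := slotGrid_h_d hj (by omega) (Or.inl ⟨by omega, rfl⟩) x
  e_succ_d_zero q i hi x := slotGrid_h_d hj (by omega) (Or.inr ⟨by omega, by omega, rfl⟩) x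
  e_zero_s q l hl x := slotGrid_h_s hj hl (Or.inl ⟨by omega, rfl⟩) x
  e_succ_s q l hl x := slotGrid_h_s_self hj hl x
  e_succ_s_zero q i hi x := slotGrid_h_s hj (by omega) (Or.inr ⟨by omega, by omega, rfl⟩) x

theorem plain_v_d (p q i : ℕ) :
    ((plain k H A).v q).d p i = LinearMap.rTensor _ ((algOps k H).d p i) := rfl

theorem plain_v_s (p q i : ℕ) :
    ((plain k H A).v q).s p i = LinearMap.rTensor _ ((algOps k H).s p i) := rfl

theorem plain_v_t (p q : ℕ) :
    ((plain k H A).v q).t p = LinearMap.rTensor _ ((algOps k H).t p) := rfl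

theorem plain_d_d (p q : ℕ) (x) :
    ((plain k H A).h p).d q 0 (((plain k H A).v (q + 1)).d p 0 x) =
      ((plain k H A).v q).d p 0 (((plain k H A).h (p + 1)).d q 0 x) := by
  rw [plain_h_d _ _ 0 (Nat.zero_le _), plain_h_d _ _ 0 (Nat.zero_le _), plain_v_d, plain_v_d]
  exact lTensor_rTensor_comm _ _ x

theorem plain_d_s (p q : ℕ) (x) :
    ((plain k H A).h (p + 1)).d q 0 (((plain k H A).v (q + 1)).s p 0 x) =
      ((plain k H A).v q).s p 0 (((plain k H A).h p).d q 0 x) := by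
  rw [plain_h_d _ _ 0 (Nat.zero_le _), plain_h_d _ _ 0 (Nat.zero_le _), plain_v_s, plain_v_s]
  exact lTensor_rTensor_comm _ _ x

theorem plain_d_t (p q : ℕ) (x) :
    ((plain k H A).h p).d q 0 (((plain k H A).v (q + 1)).t p x) =
      ((plain k H A).v q).t p (((plain k H A).h p).d q 0 x) := by
  rw [plain_h_d _ _ 0 (Nat.zero_le _), plain_v_t, plain_v_t]
  exact lTensor_rTensor_comm _ _ x

theorem plain_s_d (p q : ℕ) (x) :
    ((plain k H A).h p).s q 0 (((plain k H A).v q).d p 0 x) =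
      ((plain k H A).v (q + 1)).d p 0 (((plain k H A).h (p + 1)).s q 0 x) := by
  rw [plain_h_s _ _ 0 (Nat.zero_le _), plain_h_s _ _ 0 (Nat.zero_le _), plain_v_d, plain_v_d]
  exact lTensor_rTensor_comm _ _ x

theorem plain_s_s (p q : ℕ) (x) :
    ((plain k H A).h (p + 1)).s q 0 (((plain k H A).v q).s p 0 x) =
      ((plain k H A).v (q + 1)).s p 0 (((plain k H A).h p).s q 0 x) := by
  rw [plain_h_s _ _ 0 (Nat.zero_le _), plain_h_s _ _ 0 (Nat.zero_le _), plain_v_s, plain_v_s]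
  exact lTensor_rTensor_comm _ _ x

theorem plain_s_t (p q : ℕ) (x) :
    ((plain k H A).h p).s q 0 (((plain k H A).v q).t p x) =
      ((plain k H A).v (q + 1)).t p (((plain k H A).h p).s q 0 x) := by
  rw [plain_h_s _ _ 0 (Nat.zero_le _), plain_v_t, plain_v_t]
  exact lTensor_rTensor_comm _ _ x

theorem plain_t_d (p q : ℕ) (x) :
    ((plain k H A).h p).t q (((plain k H A).v q).d p 0 x) =
      ((plain k H A).v q).d p 0 (((plain k H A).h (p + 1)).t q x) := by
  rw [plain_h_t, plain_h_t, plain_v_d]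
  exact lTensor_rTensor_comm _ _ x

theorem plain_t_s (p q : ℕ) (x) :
    ((plain k H A).h (p + 1)).t q (((plain k H A).v q).s p 0 x) =
      ((plain k H A).v q).s p 0 (((plain k H A).h p).t q x) := by
  rw [plain_h_t, plain_h_t, plain_v_s]
  exact lTensor_rTensor_comm _ _ x

theorem plain_t_t (p q : ℕ) (x) :
    ((plain k H A).h p).t q (((plain k H A).v q).t p x) =
      ((plain k H A).v q).t p (((plain k H A).h p).t q x) := by
  rw [plain_h_t, plain_v_t]
  exact lTensor_rTensor_comm _ _ x

theorem slotGrid_comm (p q j j' i i' : ℕ) (hj : j ≤ p) (hj' : j' ≤ p) (hi : i ≤ q) (hi' : i' ≤ q)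
    (hne : j ≠ j') (hne' : i ≠ i') : Commute (slotGrid k H A p q j i) (slotGrid k H A p q j' i') := by
  have := slotEquiv_comm (f := slotAct k H A q i) (g := slotAct k H A q i') (n := p + 1)
    (slotAct_comm hi hi' hne') (Nat.lt_succ_of_le hj) (Nat.lt_succ_of_le hj') hne
  unfold slotGrid
  exact this

theorem slotGrid_isGrid [ModuleAlgebra k H A] : (plain k H A).IsGrid (slotGrid k H A) where
  h_cyclic := plain_h_isCyclic
  v_cyclic := plain_v_isCyclic
  d_d := plain_d_d
  d_s := plain_d_s
  d_t := plain_d_t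
  s_d := plain_s_d
  s_s := plain_s_s
  s_t := plain_s_t
  t_d := plain_t_d
  t_s := plain_t_s
  t_t := plain_t_t
  v_twisting q i _ := plain_v_isTwisting q _
  h_twisting := plain_h_isTwisting
  comm := slotGrid_comm

end Grid

/-! ### `A ♮ H` as a twist by the grid of slot operators -/

section Conv

variable {k : Type u} [CommRing k] {H : Type v} [Ring H] [Bialgebra k H] {N : Type*}
  [AddCommGroup N] [Module k N]

theorem conv_assoc (f g h : H →ₗ[k] Module.End k N) : conv (conv f g) h = conv f (conv g h) := by
  refine LinearMap.ext fun a => ?_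
  let r := Coalgebra.Repr.arbitrary k a
  let r₁ := fun i => Coalgebra.Repr.arbitrary k (r.left i)
  let r₂ := fun i => Coalgebra.Repr.arbitrary k (r.right i)
  let F : H ⊗[k] (H ⊗[k] H) →ₗ[k] Module.End k N :=
    LinearMap.mul' k _ ∘ₗ TensorProduct.map f (LinearMap.mul' k _ ∘ₗ TensorProduct.map g h)
  have hF : ∀ x y z, F (x ⊗ₜ (y ⊗ₜ z)) = f x * (g y * h z) := fun x y z => rfl
  have := congrArg F (Coalgebra.sum_tmul_tmul_eq r r₁ r₂)
  simp only [map_sum, hF] at this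
  simp only [conv_repr _ _ r, conv_repr f g (r₁ _), conv_repr g h (r₂ _), Finset.sum_mul,
    Finset.mul_sum, mul_assoc, this]

/-- The convolution product `F_m * ⋯ * F_0`. -/
noncomputable def revConv (F : ℕ → (H →ₗ[k] Module.End k N)) : ℕ → (H →ₗ[k] Module.End k N)
  | 0 => F 0
  | m + 1 => conv (F (m + 1)) (revConv F m)

theorem revConv_succ' (F : ℕ → (H →ₗ[k] Module.End k N)) : ∀ m,
    revConv F (m + 1) = conv (revConv (fun i => F (i + 1)) m) (F 0)
  | 0 => rfl
  | m + 1 => by rw [revConv, revConv_succ' F m, ← conv_assoc]; rfl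

theorem map_revConv {P : Type*} [AddCommGroup P] [Module k P] {F : ℕ → (H →ₗ[k] Module.End k N)}
    {G : ℕ → (H →ₗ[k] Module.End k P)} {φ : N →ₗ[k] P} (m : ℕ)
    (h : ∀ i ≤ m, ∀ a v, φ (F i a v) = G i a (φ v)) (a v) :
    φ (revConv F m a v) = revConv G m a (φ v) := by
  induction m generalizing a v with
  | zero => exact h 0 le_rfl a v
  | succ m ih =>
    let r := Coalgebra.Repr.arbitrary k a
    simp only [revConv, conv_repr _ _ r, LinearMap.sum_apply, map_sum, Module.End.mul_apply,
      h (m + 1) le_rfl, ih fun i hi => h i (by omega)]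

end Conv

section ActAll

variable {k : Type u} {H : Type v} {A : Type w} [CommRing k] [Ring H] [Ring A] [Algebra k A]
  [Module H A] [Bialgebra k H] [IsScalarTower k H A]

theorem tcons_tprod {M : Type v} [AddCommGroup M] [Module k M] (n : ℕ) (m : M) (x : Fin n → M) :
    Natural.tcons n (m ⊗ₜ[k] PiTensorProduct.tprod k x) = PiTensorProduct.tprod k (Fin.cons m x : Fin (n + 1) → M) := by
  simp [Natural.tcons]

theorem pure_eq_tcons {M : Type v} [AddCommGroup M] [Module k M] (n : ℕ) (α : ℕ → M) :
    pure (n + 1) α = Natural.tcons n (α 0 ⊗ₜ[k] pure n fun m => α (m + 1)) := by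
  rw [pure, pure, tcons_tprod]
  congr 1
  funext i
  refine Fin.cases ?_ (fun j => ?_) i <;> simp

theorem map₂_tcons (n : ℕ) (a : H) (b : A) (z : TPow k H n) (y : TPow k A n) :
    PiTensorProduct.map₂ (fun _ => (act k H A).toLinearMap) (Natural.tcons n (a ⊗ₜ z))
      (Natural.tcons n (b ⊗ₜ y)) =
    Natural.tcons n ((a • b) ⊗ₜ PiTensorProduct.map₂ (fun _ => (act k H A).toLinearMap) z y) := by
  induction z using PiTensorProduct.induction_on with
  | add z z' hz hz' => simp only [TensorProduct.tmul_add, map_add, LinearMap.add_apply, hz, hz']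
  | smul_tprod c x =>
    induction y using PiTensorProduct.induction_on with
    | add y y' hy hy' => simp only [TensorProduct.tmul_add, map_add, hy, hy']
    | smul_tprod c' x' =>
      simp only [TensorProduct.tmul_smul, map_smul, LinearMap.smul_apply, tcons_tprod,
        PiTensorProduct.map₂_tprod_tprod]
      congr 3
      funext i
      refine Fin.cases ?_ (fun j => ?_) i <;> simp

theorem tcons_slotAct {q i : ℕ} (hi : i ≤ q) (b : A) (a : H) (y) :
    Natural.tcons (q + 1) (b ⊗ₜ[k] slotAct k H A q i a y) =
      slotAct k H A (q + 1) (i + 1) a (Natural.tcons (q + 1) (b ⊗ₜ[k] y)) := by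
  refine LinearMap.congr_fun (tpow_ext
    (f := Natural.tcons (q + 1) ∘ₗ TensorProduct.mk k A _ b ∘ₗ slotAct k H A q i a)
    (g := slotAct k H A (q + 1) (i + 1) a ∘ₗ Natural.tcons (q + 1) ∘ₗ TensorProduct.mk k A _ b)
    fun α => ?_) y
  let β : ℕ → A := fun m => Nat.casesOn m b α
  have h1 : Natural.tcons (q + 1) (b ⊗ₜ[k] pure (q + 1) α) = pure (q + 2) β :=
    (pure_eq_tcons (q + 1) β).symm
  have h2 : Natural.tcons (q + 1) (b ⊗ₜ[k] pure (q + 1) (Function.update α i (a • α i))) =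
      pure (q + 2) (Function.update β (i + 1) (a • α i)) := by
    rw [pure_eq_tcons (q + 1)]
    rw [Function.update_of_ne (by omega)]
    refine congrArg (fun z => Natural.tcons (q + 1) (b ⊗ₜ[k] z)) (pure_congr fun m _ => ?_)
    by_cases hm : m = i <;> simp [hm, β]
  simp only [LinearMap.comp_apply, TensorProduct.mk_apply]
  rw [slotAct_pure hi, h1, h2, slotAct_pure (by omega)]

/-- The action of `H` on all slots is the convolution of the actions on the single slots. -/
theorem actAll_eq_revConv (q : ℕ) : Natural.actAll k H A q =
    revConv (fun i => (slotAct k H A q i).toLinearMap) q := by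
  induction q with
  | zero => rfl
  | succ q ih =>
    refine LinearMap.ext fun h => tpow_ext fun α => ?_
    let r := Coalgebra.Repr.arbitrary k h
    have h1 : Natural.revComul k H (q + 1) h =
        ∑ l ∈ r.index, Natural.tcons (q + 1) (r.right l ⊗ₜ Natural.revComul k H q (r.left l)) := by
      simp only [Natural.revComul, LinearMap.comp_apply]
      rw [← r.eq]
      simp
    rw [revConv_succ', conv_repr _ _ r, LinearMap.sum_apply]
    simp only [Natural.actAll, LinearMap.comp_apply]
    rw [h1, map_sum, LinearMap.sum_apply]
    refine Finset.sum_congr rfl fun l _ => ?_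
    have h2 : slotAct k H A (q + 1) 0 (r.right l) (pure (q + 2) α) =
        Natural.tcons (q + 1) ((r.right l • α 0) ⊗ₜ pure (q + 1) fun m => α (m + 1)) := by
      rw [slotAct_pure (by omega), pure_eq_tcons (q + 1), Function.update_self]
      refine congrArg (fun z => Natural.tcons (q + 1) ((r.right l • α 0) ⊗ₜ[k] z))
        (pure_congr fun m _ => ?_)
      simp
    have h3 := map_revConv (φ := Natural.tcons (q + 1) ∘ₗ TensorProduct.mk k A _ (r.right l • α 0))
      (F := fun i => (slotAct k H A q i).toLinearMap)
      (G := fun i => (slotAct k H A (q + 1) (i + 1)).toLinearMap) q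
      (fun i hi a y => tcons_slotAct hi _ a y) (r.left l) (pure (q + 1) fun m => α (m + 1))
    rw [pure_eq_tcons (q + 1) α, map₂_tcons, Module.End.mul_apply, ← pure_eq_tcons (q + 1) α,
      AlgHom.toLinearMap_apply, h2]
    refine Eq.trans ?_ h3
    rw [← ih]
    rfl

end ActAll

section AllLegs

variable {k : Type u} [CommRing k] {H : Type v} [Ring H]

theorem list_prod_update : ∀ (n : ℕ) (y : Fin n → H) (m : Fin n) (b : H), (∀ i, m ≤ i → y i = 1) →
    (List.ofFn (Function.update y m b)).prod = (List.ofFn y).prod * b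
  | n + 1, y, m, b, h => by
    revert h
    refine Fin.cases (fun h => ?_) (fun m h => ?_) m
    · have : y = fun _ => 1 := funext fun i => h i (Fin.zero_le i)
      rw [this, list_prod_update_one, List.ofFn_const, List.prod_replicate, one_pow, one_mul]
    · have h1 : (fun i => Function.update y m.succ b (Fin.succ i)) =
          Function.update (fun i : Fin n => y i.succ) m b := by
        funext i
        simp [Function.update_apply, Fin.succ_inj]
      rw [List.ofFn_succ, List.prod_cons, List.ofFn_succ, List.prod_cons, h1,
        list_prod_update n _ m b fun i hi => h i.succ (Fin.succ_le_succ_iff.mpr hi),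
        Function.update_of_ne (Fin.succ_ne_zero m).symm, mul_assoc]

variable [Bialgebra k H] {N : Type*} [AddCommGroup N] [Module k N]

theorem slotOp_tprod (f : H →ₗ[k] N →ₗ[k] N) {n : ℕ} (j : Fin n) (x : Fin n → H) {a : H}
    (ha : x j = a) {ι : Type*} (r : Coalgebra.Repr k a ι) (v : N) :
    slotOp f n j (PiTensorProduct.tprod k x ⊗ₜ v) =
      ∑ l ∈ r.index, PiTensorProduct.tprod k (Function.update x j (r.left l)) ⊗ₜ f (r.right l) v := by
  let α : ℕ → H := fun m => if h : m < n then x ⟨m, h⟩ else 0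
  have h1 : PiTensorProduct.tprod k x = pure n α :=
    congrArg (PiTensorProduct.tprod k) (funext fun i => by simp [α])
  rw [h1, slotOp_pure f j.2 α (by simp [α, ha]) r]
  refine Finset.sum_congr rfl fun l _ => congrArg (· ⊗ₜ[k] _)
    (congrArg (PiTensorProduct.tprod k) (funext fun i => ?_))
  by_cases hi : i = j
  · subst hi
    simp
  · rw [Function.update_of_ne hi, Function.update_of_ne fun h => hi (Fin.ext h)]
    simp [α]

/-- The legs of the first `m` slots, as arguments of `legsOp`. -/
noncomputable def firstLegs (k : Type u) [CommRing k] (H : Type v) [Ring H] [Bialgebra k H]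
    (n m : ℕ) (i : Fin n) : H →ₗ[k] H ⊗[k] H :=
  if i.val < m then Coalgebra.comul else (TensorProduct.mk k H H).flip 1

/-- The product of the legs of all slots can be acted with one slot at a time. -/
theorem slotOp_legsOp (F : H →ₗ[k] Module.End k N) (hF : ∀ a b, F (a * b) = F b * F a) {n : ℕ}
    (m : Fin n) (x) :
    slotOp F n m (legsOp (firstLegs k H n m) F x) = legsOp (firstLegs k H n (m + 1)) F x := by
  classical
  refine pure_tmul_ext (f := slotOp F n m ∘ₗ legsOp (firstLegs k H n m) F) (fun α v => ?_) x
  rw [LinearMap.comp_apply, legsOp_pure, legsOp_pure]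
  let r := Coalgebra.Repr.arbitrary k (α m)
  -- The slots from `m` on carry the trivial leg `1`, so that splitting the slot `m` does not interact
  -- with the legs already chosen.
  have hS : ∀ i : Fin n, ∃ S : Finset (H × H), firstLegs k H n m i (α i) = ∑ l ∈ S, l.1 ⊗ₜ[k] l.2 ∧
      (m ≤ i → S = {(α i, 1)}) := by
    intro i
    by_cases hi : m ≤ i
    · refine ⟨{(α i, 1)}, ?_, fun _ => rfl⟩
      rw [firstLegs, if_neg (by simpa using hi), Finset.sum_singleton]
      rfl
    · obtain ⟨S, hS⟩ := TensorProduct.exists_finset (firstLegs k H n m i (α i))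
      exact ⟨S, hS, fun h => absurd h hi⟩
  choose S hS hS1 using hS
  have h1 : (fun i : Fin n => firstLegs k H n (m + 1) i (α i)) =
      Function.update (fun i : Fin n => firstLegs k H n m i (α i)) m
        (∑ l ∈ r.index, r.left l ⊗ₜ r.right l) := by
    funext i
    by_cases hi : i = m
    · subst hi
      rw [Function.update_self, r.eq, firstLegs, if_pos (by omega)]
    · rw [Function.update_of_ne hi, firstLegs, firstLegs]
      have : i.val ≠ m.val := fun h => hi (Fin.ext h)
      congr 2
      exact propext (by omega)
  have h2 : ∀ j, Function.update (fun i : Fin n => firstLegs k H n m i (α i)) m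
      (r.left j ⊗ₜ r.right j) = fun i => ∑ l ∈ S i,
        Function.update (fun i => l.1) m (r.left j) i ⊗ₜ Function.update (fun i => l.2) m (r.right j) i := by
    intro j
    funext i
    by_cases hi : i = m
    · subst hi
      simp [hS1 i le_rfl]
    · simp [Function.update_of_ne hi, hS]
  rw [h1, MultilinearMap.map_update_sum, map_sum]
  simp only [h2]
  simp only [hS]
  rw [MultilinearMap.map_sum_finset, map_sum, map_sum]
  have h3 : ∀ l ∈ Fintype.piFinset S, slotOp F n m (apLeg F v (legsMul k H n fun i => (l i).1 ⊗ₜ (l i).2)) =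
      ∑ j ∈ r.index, PiTensorProduct.tprod k (Function.update (fun i => (l i).1) m (r.left j)) ⊗ₜ
        F (r.right j) (F (List.ofFn fun i => (l i).2).prod v) := by
    intro l hl
    have hm : (l m).1 = α m := by
      have := Fintype.mem_piFinset.mp hl m
      rw [hS1 m le_rfl, Finset.mem_singleton] at this
      rw [this]
    rw [legsMul_tmul, apLeg, LinearMap.lTensor_tmul, slotOp_tprod F m _ hm r]
    rfl
  rw [Finset.sum_congr rfl h3, Finset.sum_comm]
  refine Finset.sum_congr rfl fun j _ => ?_
  rw [MultilinearMap.map_sum_finset, map_sum]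
  refine Finset.sum_congr rfl fun l hl => ?_
  have hl1 : ∀ i, m ≤ i → (l i).2 = 1 := by
    intro i hi
    have := Fintype.mem_piFinset.mp hl i
    rw [hS1 i hi, Finset.mem_singleton] at this
    rw [this]
  have h4 : (fun i => Function.update (fun _ : Fin n => (l i).1) m (r.left j) i ⊗ₜ[k]
      Function.update (fun _ : Fin n => (l i).2) m (r.right j) i) =
      fun i => Function.update (fun i => (l i).1) m (r.left j) i ⊗ₜ[k]
        Function.update (fun i => (l i).2) m (r.right j) i := by
    funext i
    simp only [Function.update_apply]
  rw [h4, legsMul_tmul, list_prod_update n _ m _ hl1, apLeg, LinearMap.lTensor_tmul,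
    LinearMap.flip_apply, hF]
  rfl

end AllLegs

section Twist

variable {k : Type u} {H : Type v} {A : Type w} [CommRing k] [Ring H] [Ring A] [Algebra k A]
  [Module H A] [HopfAlgebra k H] [IsScalarTower k H A]

/-- The diagonal action of a leg of the first slot is the product of the first row. -/
theorem slotOp_actAll (p q : ℕ) (x : TPow k H (p + 1) ⊗[k] TPow k A (q + 1)) :
    slotOp (Natural.actAll k H A q) (p + 1) 0 x = CylindricalOps.row (slotGrid k H A) q p 0 x := by
  have h : ∀ m, slotOp (revConv (fun i => (slotAct k H A q i).toLinearMap) m) (p + 1) 0 x =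
      revProd (slotGrid k H A p q 0) (m + 1) x := by
    intro m
    induction m with
    | zero => exact (slotEquiv_apply (slotAct k H A q 0) (Nat.succ_pos p) x).symm
    | succ m ih =>
      rw [revConv, ← slotOp_slotOp _ _ (Nat.succ_pos p), ih, revProd, LinearEquiv.mul_apply]
      exact (slotEquiv_apply (slotAct k H A q (m + 1)) (Nat.succ_pos p) _).symm
  rw [actAll_eq_revConv, h]
  rfl

/-- `τ̄` is the rotation of `H^{⊗ (p+1)}` followed by the first row. -/
theorem tauBar_eq (p q : ℕ) (x : TPow k H (p + 1) ⊗[k] TPow k A (q + 1)) :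
    Natural.tauBar k H A p q x =
      CylindricalOps.row (slotGrid k H A) q p 0 (((plain k H A).v q).t p x) := by
  have h : (fun i : Fin (p + 1) => if i.val = 0 then Coalgebra.comul else
      (TensorProduct.mk k H H).flip 1) = fun i => if i = 0 then Coalgebra.comul else
        (TensorProduct.mk k H H).flip 1 := by
    funext i
    by_cases hi : i = 0
    · rw [if_pos hi, if_pos (by simp [hi])]
    · rw [if_neg hi, if_neg (c := i.val = 0) fun h => hi (Fin.ext h)]
  rw [← slotOp_actAll, slotOp, h]
  exact legsOp_eq_of_rTensor _ (Natural.actAll k H A q) (rotate k H p) x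

/-- The legs of the first `m` slots acting through the antipode of their product invert the first `m`
operators of the first column. -/
theorem slotOp_antipode (p q m : ℕ) (hm : m ≤ p + 1) (x : TPow k H (p + 1) ⊗[k] TPow k A (q + 1)) :
    legsOp (firstLegs k H (p + 1) m)
        ((slotAct k H A q 0).toLinearMap ∘ₗ HopfAlgebra.antipode k) x =
      revProd (fun j => (slotGrid k H A p q j 0)⁻¹) m x := by
  induction m with
  | zero =>
    refine pure_tmul_ext (g := LinearMap.id) (fun α v => ?_) x
    have h1 : (fun i : Fin (p + 1) => firstLegs k H (p + 1) 0 i (α i)) =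
        fun i : Fin (p + 1) => α i ⊗ₜ[k] (1 : H) := rfl
    rw [legsOp_pure, h1, legsMul_tmul, apLeg, LinearMap.lTensor_tmul, LinearMap.flip_apply,
      List.ofFn_const, List.prod_replicate, one_pow, LinearMap.comp_apply, HopfAlgebra.antipode_one,
      AlgHom.toLinearMap_apply, map_one]
    rfl
  | succ m ih =>
    rw [revProd, LinearEquiv.mul_apply, ← ih (by omega), slotGrid,
      slotEquiv_inv_apply _ (by omega)]
    exact (slotOp_legsOp _ (fun a b => by
      rw [LinearMap.comp_apply, HopfAlgebra.antipode_mul_antidistrib, AlgHom.toLinearMap_apply, map_mul]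
      rfl) (⟨m, by omega⟩ : Fin (p + 1)) x).symm

/-- `τ` is the rotation of `A^{⊗ (q+1)}` followed by the inverse of the first column, since the antipode
reverses products. -/
theorem tau_eq (p q : ℕ) (x : TPow k H (p + 1) ⊗[k] TPow k A (q + 1)) :
    Natural.tau k H A p q x =
      (CylindricalOps.col (slotGrid k H A) p q 0)⁻¹ (((plain k H A).h p).t q x) := by
  rw [CylindricalOps.col, inv_ordProd, ← slotOp_antipode p q (p + 1) le_rfl, plain_h_t]
  refine Eq.trans ?_ ((legsOp_eq_of_lTensor (fun _ => Coalgebra.comul)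
    (Natural.actZero k H A q ∘ₗ HopfAlgebra.antipode k) (rotate k A q) x).trans ?_)
  · rfl
  · have : firstLegs k H (p + 1) (p + 1) = fun _ => Coalgebra.comul := funext fun i => if_pos i.2
    rw [this]
    rfl

/-- `A ♮ H` is the twist of the tensor product of the cyclic modules of `H` and `A^op`. -/
theorem natural_isGridTwist :
    (plain k H A).IsGridTwist (slotGrid k H A) (natural k H A) where
  h p := {
    d := fun q i hi x => by
      rw [plain_h_d p q i hi]
      exact LinearMap.congr_fun (dif_pos hi) x
    d_last := fun q x => by
      rw [plain_h_d p q 0 (Nat.zero_le q)]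
      exact LinearMap.congr_fun (dif_neg (by omega)) x
    s := fun q i hi x => by
      rw [plain_h_s p q i hi]
      rfl
    t := fun q x => tau_eq p q x }
  v q := {
    d := fun p i hi x => by
      have h : (algOps k H).d p i = contract (LinearMap.mul k H) p i hi := dif_pos hi
      rw [plain_v_d, h]
      exact LinearMap.congr_fun (dif_pos hi) x
    d_last := fun p x => by
      have h : (algOps k H).d p 0 = contract (LinearMap.mul k H) p 0 (Nat.zero_le p) := rfl
      rw [plain_v_d, h]
      exact LinearMap.congr_fun (dif_neg (by omega)) x
    s := fun p i hi x => rfl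
    t := fun p x => tauBar_eq p q x }

/-- `A ♮ H` is a cylindrical module. -/
theorem natural_isCylindrical [ModuleAlgebra k H A] : (natural k H A).IsCylindrical :=
  natural_isGridTwist.isCylindrical slotGrid_isGrid

end Twist

/-! ### The crossed product -/

section Zip

variable {k : Type u} {H : Type v} {A : Type w} {R : Type (max w v)} [CommRing k] [Ring H] [Algebra k H]
  [Ring A] [Algebra k A] [Ring R] [Algebra k R]

/-- `(g_0, …, g_{n-1}) ⊗ (a_0, …, a_{n-1}) ↦ (c (a_0 ⊗ g_0), …, c (a_{n-1} ⊗ g_{n-1}))`. -/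
noncomputable def zip (c : A ⊗[k] H ≃ₗ[k] R) (n : ℕ) :
    TPow k H n ⊗[k] TPow k A n →ₗ[k] TPow k R n :=
  TensorProduct.lift (PiTensorProduct.map₂ fun _ =>
    ((TensorProduct.mk k A H).compr₂ c.toLinearMap).flip)

/-- The inverse of `zip`. -/
noncomputable def unzip (c : A ⊗[k] H ≃ₗ[k] R) (n : ℕ) :
    TPow k R n →ₗ[k] TPow k H n ⊗[k] TPow k A n :=
  PiTensorProduct.lift ((MultilinearMap.mkPiAlgebraFin k n (TPow k H n ⊗[k] TPow k A n)).compLinearMap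
    fun i => TensorProduct.map (single i).toLinearMap (single i).toLinearMap ∘ₗ
      (TensorProduct.comm k A H).toLinearMap ∘ₗ c.symm.toLinearMap)

variable (c : A ⊗[k] H ≃ₗ[k] R)

theorem zip_tprod (n : ℕ) (g : Fin n → H) (a : Fin n → A) :
    zip c n (PiTensorProduct.tprod k g ⊗ₜ PiTensorProduct.tprod k a) =
      PiTensorProduct.tprod k fun i => c (a i ⊗ₜ g i) := by
  rw [zip, TensorProduct.lift.tmul, PiTensorProduct.map₂_tprod_tprod]
  rfl

theorem zip_pure (n : ℕ) (g : ℕ → H) (a : ℕ → A) :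
    zip c n (pure n g ⊗ₜ pure n a) = pure n fun i => c (a i ⊗ₜ g i) := zip_tprod c n _ _

theorem unzip_tprod (n : ℕ) (g : Fin n → H) (a : Fin n → A) :
    unzip c n (PiTensorProduct.tprod k fun i => c (a i ⊗ₜ g i)) =
      PiTensorProduct.tprod k g ⊗ₜ PiTensorProduct.tprod k a := by
  rw [unzip, PiTensorProduct.lift.tprod, MultilinearMap.compLinearMap_apply,
    MultilinearMap.mkPiAlgebraFin_apply, ← list_prod_single, ← list_prod_single, ← list_prod_tmul]
  simp

theorem pure_tmul_pure_ext {P : Type*} [AddCommGroup P] [Module k P] {m n : ℕ}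
    {f g : TPow k H m ⊗[k] TPow k A n →ₗ[k] P}
    (h : ∀ α β, f (pure m α ⊗ₜ pure n β) = g (pure m α ⊗ₜ pure n β)) (x) : f x = g x := by
  refine pure_tmul_ext (fun α v => ?_) x
  exact LinearMap.congr_fun (tpow_ext (f := f ∘ₗ TensorProduct.mk k _ _ (pure m α))
    (g := g ∘ₗ TensorProduct.mk k _ _ (pure m α)) fun β => h α β) v

/-- The tensor powers of an algebra isomorphic to `A ⊗ H` as a module. -/
noncomputable def zipEquiv (n : ℕ) : TPow k H n ⊗[k] TPow k A n ≃ₗ[k] TPow k R n :=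
  LinearEquiv.ofLinearMap (zip c n) (unzip c n)
    (PiTensorProduct.ext (MultilinearMap.ext fun z => by
      classical
      choose S hS using fun i => TensorProduct.exists_finset (c.symm (z i))
      have h : z = fun i => ∑ l ∈ S i, c (l.1 ⊗ₜ l.2) := by
        funext i
        rw [← map_sum, ← hS, LinearEquiv.apply_symm_apply]
      simp only [LinearMap.compMultilinearMap_apply, LinearMap.comp_apply, LinearMap.id_apply]
      rw [h, MultilinearMap.map_sum_finset, map_sum, map_sum]
      exact Finset.sum_congr rfl fun l _ => by rw [unzip_tprod, zip_tprod]))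
    (LinearMap.ext fun x => pure_tmul_pure_ext (f := unzip c n ∘ₗ zip c n) (g := LinearMap.id)
      (fun α β => by
        rw [LinearMap.comp_apply, zip_pure]
        exact unzip_tprod c n _ _) x)

end Zip

section Crossed

variable {k : Type u} {H : Type v} {A : Type w} {R : Type (max w v)} [CommRing k] [Ring H]
  [Ring A] [Algebra k A] [Ring R] [Algebra k R] [Module H A] [HopfAlgebra k H] [IsScalarTower k H A]

variable (c : A ⊗[k] H ≃ₗ[k] R)

theorem zip_t (n : ℕ) (x) : zip c (n + 1) (((plain k H A).v n).t n (((plain k H A).h n).t n x)) =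
    (algOps k R).t n (zip c (n + 1) x) := by
  refine pure_tmul_pure_ext (f := zip c (n + 1) ∘ₗ ((plain k H A).v n).t n ∘ₗ ((plain k H A).h n).t n)
    (g := (algOps k R).t n ∘ₗ zip c (n + 1)) (fun α β => ?_) x
  simp only [LinearMap.comp_apply]
  rw [plain_h_t, LinearMap.lTensor_tmul, rotate_pure, plain_v_t_pure, zip_pure, zip_pure, alg_t_pure]
  refine pure_congr fun m _ => ?_
  split_ifs <;> rfl

theorem zip_s (hc : c (1 ⊗ₜ 1) = 1) (n : ℕ) (x) :
    zip c (n + 2) (((plain k H A).v (n + 1)).s n 0 (((plain k H A).h n).s n 0 x)) =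
      (algOps k R).s n 0 (zip c (n + 1) x) := by
  refine pure_tmul_pure_ext
    (f := zip c (n + 2) ∘ₗ ((plain k H A).v (n + 1)).s n 0 ∘ₗ ((plain k H A).h n).s n 0)
    (g := (algOps k R).s n 0 ∘ₗ zip c (n + 1)) (fun α β => ?_) x
  simp only [LinearMap.comp_apply]
  rw [plain_h_s _ _ _ (Nat.zero_le n), LinearMap.lTensor_tmul, insert_pure _ _ _ (Nat.zero_le n),
    plain_v_s_pure _ _ _ (Nat.zero_le n), zip_pure, zip_pure, alg_s_pure _ _ _ _ (Nat.zero_le n)]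
  refine pure_congr fun m _ => ?_
  split_ifs
  · rfl
  · exact hc
  · rfl

/-- The product of two adjacent entries is the product of the entries in `A` and in `H`, after
the second entry of `A` has been acted upon by the first entry of `H`. -/
theorem zip_d (hc : ∀ a b g h, c (a ⊗ₜ g) * c (b ⊗ₜ h) =
      ∑ l ∈ (Coalgebra.Repr.arbitrary k g).index, c
        (((Coalgebra.Repr.arbitrary k g).right l • b * a) ⊗ₜ ((Coalgebra.Repr.arbitrary k g).left l * h)))
    (n : ℕ) (x) :
    zip c (n + 1) (((plain k H A).v n).d n 0 (((plain k H A).h (n + 1)).d n 0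
        (slotGrid k H A (n + 1) (n + 1) 0 1 x))) = (algOps k R).d n 0 (zip c (n + 2) x) := by
  refine pure_tmul_pure_ext
    (f := zip c (n + 1) ∘ₗ ((plain k H A).v n).d n 0 ∘ₗ ((plain k H A).h (n + 1)).d n 0 ∘ₗ
      (slotGrid k H A (n + 1) (n + 1) 0 1).toLinearMap)
    (g := (algOps k R).d n 0 ∘ₗ zip c (n + 2)) (fun α β => ?_) x
  let r := Coalgebra.Repr.arbitrary k (α 0)
  let γ : Fin (n + 1) → R := fun m => c (β (m + 1) ⊗ₜ α (m + 1))
  have h1 : ∀ y : R, pure (k := k) (n + 1) (Function.update (fun m => c (β (m + 1) ⊗ₜ α (m + 1))) 0 y) =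
      (PiTensorProduct.tprod k).toLinearMap γ 0 y := by
    intro y
    rw [MultilinearMap.toLinearMap_apply]
    refine congrArg (PiTensorProduct.tprod k) (funext fun i => ?_)
    by_cases hi : i = 0
    · subst hi
      rw [Function.update_self]
      exact Function.update_self ..
    · rw [Function.update_of_ne hi]
      exact Function.update_of_ne (fun h => hi (Fin.ext h)) _ _
  have h2 : (algOps k R).d n 0 (zip c (n + 2) (pure (n + 2) α ⊗ₜ pure (n + 2) β)) =
      (PiTensorProduct.tprod k).toLinearMap γ 0 (c (β 0 ⊗ₜ α 0) * c (β 1 ⊗ₜ α 1)) := by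
    rw [← h1, zip_pure, alg_d_pure k R n 0 (by omega)]
    refine pure_congr fun m _ => ?_
    rcases m with _ | m <;> simp
  simp only [LinearMap.comp_apply, LinearEquiv.coe_coe]
  rw [h2, hc, map_sum, slotGrid, slotEquiv_pure _ (by omega) _ rfl r, map_sum, map_sum, map_sum]
  refine Finset.sum_congr rfl fun l _ => ?_
  rw [slotAct_pure (by omega), plain_h_d _ _ _ (Nat.zero_le n), LinearMap.lTensor_tmul, contract_pure,
    plain_v_d_pure _ _ _ (Nat.zero_le n), zip_pure, ← h1]
  refine pure_congr fun m _ => ?_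
  rcases m with _ | m
  · simp [r]
  · simp

end Crossed

/-! ### Cyclic homology of the crossed product -/

namespace ParacyclicOps

variable {k : Type u} [CommRing k] {X : ℕ → Type v} {Y : ℕ → Type w}
  [∀ n, AddCommGroup (X n)] [∀ n, Module k (X n)] [∀ n, AddCommGroup (Y n)] [∀ n, Module k (Y n)]

/-- Isomorphic cyclic modules have isomorphic cyclic homology. -/
theorem nonempty_HC_equiv {P : ParacyclicOps k X} {Q : ParacyclicOps k Y} (hP : P.IsCyclic)
    (hQ : Q.IsCyclic) (f : ∀ n, X n ≃ₗ[k] Y n) (ht : ∀ n x, f n (P.t n x) = Q.t n (f n x))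
    (hd : ∀ n x, f n (P.d n 0 x) = Q.d n 0 (f (n + 1) x))
    (hs : ∀ n x, f (n + 1) (P.s n 0 x) = Q.s n 0 (f n x)) {W : Type*} [AddCommGroup W] [Module k W]
    [Module k[X] W] (𝒲 : ℤ → Submodule k W) (n : ℤ) :
    Nonempty ((P.mixed hP).HC 𝒲 n ≃ₗ[k] (Q.mixed hQ).HC 𝒲 n) := by
  have hd' := d_comm_of_zero hP.toIsParacyclic hQ.toIsParacyclic (fun n => (f n).toLinearMap) ht hd
  have hs' := s_comm_of_zero hP.toIsParacyclic hQ.toIsParacyclic (fun n => (f n).toLinearMap) ht hs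
  have hb : ∀ n x, f n (P.b n x) = Q.b n (f (n + 1) x) := fun n x => by
    simp only [b, LinearMap.sum_apply, LinearMap.smul_apply, map_sum, map_smul]
    exact Finset.sum_congr rfl fun i hi => congrArg _
      (hd' n i (Nat.lt_succ_iff.mp (Finset.mem_range.mp hi)) x)
  have hpow : ∀ n j x, f n ((P.t n ^ j) x) = (Q.t n ^ j) (f n x) := by
    intro n j
    induction j with
    | zero => exact fun x => rfl
    | succ j ih =>
      intro x
      rw [pow_succ, pow_succ, Module.End.mul_apply, Module.End.mul_apply, ih, ht]
  have hN : ∀ n x, f n (P.norm n x) = Q.norm n (f n x) := fun n x => by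
    simp only [norm, LinearMap.sum_apply, LinearMap.smul_apply, map_sum, map_smul, hpow]
  have hB : ∀ n x, f (n + 1) (P.B n x) = Q.B n (f n x) := fun n x => by
    have h1 : ∀ y, f (n + 1) (P.s n n y) = Q.s n n (f n y) := hs' n n le_rfl
    rw [B_apply, B_apply, ← hN]
    simp only [extra, LinearMap.comp_apply, st, LinearMap.smul_apply, map_sub, map_smul, h1, ht]
  have hD : ∀ x, MixedComplex.level (fun n => (f n).toLinearMap) ((P.mixed hP).total x) =
      (Q.mixed hQ).total (MixedComplex.level (fun n => (f n).toLinearMap) x) := by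
    intro x
    funext n
    rcases n with _ | n
    · simp [MixedComplex.total, ParacyclicOps.mixed, hb]
    · simp [MixedComplex.total, ParacyclicOps.mixed, hb, hB]
  have hi : ∀ x : ∀ n, X n, MixedComplex.level (fun n => (f n).symm.toLinearMap)
      (MixedComplex.level (fun n => (f n).toLinearMap) x) = x := fun x => funext fun n => by simp
  have hi' : ∀ x : ∀ n, Y n, MixedComplex.level (fun n => (f n).toLinearMap)
      (MixedComplex.level (fun n => (f n).symm.toLinearMap) x) = x := fun x => funext fun n => by simp
  refine MixedComplex.nonempty_HC_equiv_of_homotopy _ _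
    (MixedComplex.level fun n => (f n).toLinearMap)
    (MixedComplex.level fun n => (f n).symm.toLinearMap) 0 0 (MixedComplex.isHomog_level _)
    (MixedComplex.isHomog_level _) (fun _ _ _ _ _ => rfl) (fun _ _ _ _ _ => rfl) hD (fun x => ?_)
    (fun x => ?_) (fun x => ?_) 𝒲 n
  · rw [← hi (MixedComplex.total _ _), hD, hi']
  · simp [hi]
  · simp [hi']

end ParacyclicOps

section Crossed

variable {k : Type u} {H : Type v} {A : Type w} [CommRing k] [Ring H]
  [Ring A] [Algebra k A] [Module H A] [HopfAlgebra k H] [IsScalarTower k H A] [ModuleAlgebra k H A]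

/-- The diagonal of `A ♮ H` is isomorphic to the cyclic module of any algebra that is `A ⊗ H` with
the product `(a ⊗ g) (b ⊗ h) = (g¹ b) a ⊗ g⁰ h`. -/
theorem nonempty_HC_diag_equiv {R : Type (max w v)} [Ring R] [Algebra k R] (c : A ⊗[k] H ≃ₗ[k] R)
    (hone : c (1 ⊗ₜ 1) = 1)
    (hmul : ∀ a b g h, c (a ⊗ₜ g) * c (b ⊗ₜ h) = ∑ l ∈ (Coalgebra.Repr.arbitrary k g).index, c
        (((Coalgebra.Repr.arbitrary k g).right l • b * a) ⊗ₜ ((Coalgebra.Repr.arbitrary k g).left l * h)))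
    (hcyl : (natural k H A).IsCylindrical)
    {W : Type*} [AddCommGroup W] [Module k W] [Module k[X] W] (𝒲 : ℤ → Submodule k W) (n : ℤ) :
    Nonempty (((natural k H A).diag.mixed hcyl.diag).HC 𝒲 n ≃ₗ[k]
      ((algOps k R).mixed (algOps_isCyclic k R)).HC 𝒲 n) := by
  have T := natural_isGridTwist (k := k) (H := H) (A := A)
  have G := slotGrid_isGrid (k := k) (H := H) (A := A)
  let e : ∀ n, TPow k H (n + 1) ⊗[k] TPow k A (n + 1) ≃ₗ[k] TPow k R (n + 1) := fun n => zipEquiv c (n + 1)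
  obtain ⟨f⟩ := ParacyclicOps.nonempty_HC_equiv (algOps_isCyclic k R) hcyl.diag
    (fun n => (e n).symm.trans (CylindricalOps.reorder (slotGrid k H A) n))
    (fun n x => by
      obtain ⟨x, rfl⟩ := (e n).surjective x
      have h1 : (algOps k R).t n (e n x) = e n _ := (zip_t c n x).symm
      rw [h1, LinearEquiv.trans_apply, LinearEquiv.trans_apply, LinearEquiv.symm_apply_apply,
        LinearEquiv.symm_apply_apply, T.diag_t_reorder G])
    (fun n x => by
      obtain ⟨x, rfl⟩ := (e (n + 1)).surjective x
      have h1 : (algOps k R).d n 0 (e (n + 1) x) = e n _ := (zip_d c hmul n x).symm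
      rw [h1, LinearEquiv.trans_apply, LinearEquiv.trans_apply, LinearEquiv.symm_apply_apply,
        LinearEquiv.symm_apply_apply, T.diag_d_zero_reorder G])
    (fun n x => by
      obtain ⟨x, rfl⟩ := (e n).surjective x
      have h1 : (algOps k R).s n 0 (e n x) = e (n + 1) _ := (zip_s c hone n x).symm
      rw [h1, LinearEquiv.trans_apply, LinearEquiv.trans_apply, LinearEquiv.symm_apply_apply,
        LinearEquiv.symm_apply_apply, T.diag_s_zero_reorder G]) 𝒲 n
  exact ⟨f.symm⟩

/-- The multiplication of `A^op ⋊ H^cop` is `(a ⊗ g) (b ⊗ h) = (g¹ b) a ⊗ g⁰ h` in terms of `A` and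
`H`. -/
theorem nonempty_HC_diag_equiv_crossed_cop (hcyl : (natural k H A).IsCylindrical)
    {W : Type*} [AddCommGroup W] [Module k W] [Module k[X] W] (𝒲 : ℤ → Submodule k W) (n : ℤ) :
    Nonempty (((natural k H A).diag.mixed hcyl.diag).HC 𝒲 n ≃ₗ[k]
      ((algOps k (Crossed k (Cop H) Aᵐᵒᵖ)).mixed (algOps_isCyclic k _)).HC 𝒲 n) := by
  let c : A ⊗[k] H ≃ₗ[k] Crossed k (Cop H) Aᵐᵒᵖ :=
    TensorProduct.congr (opEquiv k A) (Cop.of k (H := H)).toLinearEquiv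
  refine nonempty_HC_diag_equiv c rfl (fun a b g h => ?_) hcyl 𝒲 n
  let r := Coalgebra.Repr.arbitrary k g
  let r' : Coalgebra.Repr k (Cop.of k g) (H × H) :=
    { index := r.index, left := fun l => Cop.of k (r.right l), right := fun l => Cop.of k (r.left l)
      eq := (Cop.comul_repr r).symm }
  exact Crossed.mulHom_tmul_tmul (opEquiv k A a) (opEquiv k A b) (Cop.of k g) (Cop.of k h) r'

end Crossed

section Cop

variable {k : Type u} {H : Type v} {A : Type w} [CommRing k] [Ring H]
  [Ring A] [Algebra k A] [Module H A] [HopfAlgebra k H] [IsScalarTower k H A] [ModuleAlgebra k H A]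

/-- If `H^cop` is a Hopf algebra then `A ⋊ H` is the crossed product attached to the
`H^cop`-module algebra `A^op`. -/
theorem nonempty_HC_diag_equiv_crossed (hS : Function.Bijective (HopfAlgebra.antipode k : H → H)) :
    letI : HopfAlgebra k (Cop H) := Cop.hopfAlgebra hS
    ∀ (hcyl : (natural k (Cop H) Aᵐᵒᵖ).IsCylindrical)
    {W : Type x} [AddCommGroup W] [Module k W] [Module k[X] W] (𝒲 : ℤ → Submodule k W) (n : ℤ),
    Nonempty (((natural k (Cop H) Aᵐᵒᵖ).diag.mixed hcyl.diag).HC 𝒲 n ≃ₗ[k]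
      ((algOps k (Crossed k H A)).mixed (algOps_isCyclic k _)).HC 𝒲 n) := by
  let : HopfAlgebra k (Cop H) := Cop.hopfAlgebra hS
  intro hcyl W _ _ _ 𝒲 n
  let c : Aᵐᵒᵖ ⊗[k] Cop H ≃ₗ[k] Crossed k H A :=
    TensorProduct.congr (opEquiv k A).symm (Cop.of k (H := H)).symm.toLinearEquiv
  refine nonempty_HC_diag_equiv c rfl (fun a b g h => ?_) hcyl 𝒲 n
  let r := Coalgebra.Repr.arbitrary k g
  let r' : Coalgebra.Repr k ((Cop.of k (H := H)).symm g) (Cop H × Cop H) :=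
    { index := r.index
      left := fun l => (Cop.of k (H := H)).symm (r.right l)
      right := fun l => (Cop.of k (H := H)).symm (r.left l)
      eq := by
        have h1 := congrArg (TensorProduct.map (Cop.of k (H := H)).symm.toLinearMap
          (Cop.of k (H := H)).symm.toLinearMap ∘ₗ (TensorProduct.comm k (Cop H) (Cop H)).toLinearMap) r.eq
        obtain ⟨g, rfl⟩ := (Cop.of k (H := H)).surjective g
        rw [Cop.comul_repr (Coalgebra.Repr.arbitrary k g)] at h1
        simp only [map_sum, LinearMap.comp_apply, LinearEquiv.coe_coe, TensorProduct.comm_tmul,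
          TensorProduct.map_tmul, AlgEquiv.toLinearMap_apply, AlgEquiv.symm_apply_apply] at h1
        rw [AlgEquiv.symm_apply_apply, ← (Coalgebra.Repr.arbitrary k g).eq]
        exact h1 }
  exact Crossed.mulHom_tmul_tmul ((opEquiv k A).symm a) ((opEquiv k A).symm b)
    ((Cop.of k (H := H)).symm g) ((Cop.of k (H := H)).symm h) r'

end Cop

end HopfCyclic

theorem mainTheorem2 {k : Type u} [CommRing k] {H : Type v} [Ring H] [HopfAlgebra k H]
    {A : Type w} [Ring A] [Algebra k A] [Module H A] [IsScalarTower k H A]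
    [HopfCyclic.ModuleAlgebra k H A]
    (W : Type (max u x)) [AddCommGroup W] [Module k W] [Module k[X] W] [IsScalarTower k k[X] W]
    (𝒲 : ℤ → Submodule k W) (hW : DirectSum.IsInternal 𝒲)
    (hu : ∀ j, ∀ w ∈ 𝒲 j, (Polynomial.X : k[X]) • w ∈ 𝒲 (j - 2))
    (hd : ∃ d : ℕ, CategoryTheory.HasProjectiveDimensionLE (ModuleCat.of k[X] W) d) :
    (∃ hcyl : (HopfCyclic.natural k H A).IsCylindrical, ∀ n : ℤ,
      Nonempty (hcyl.tot.HC 𝒲 n ≃ₗ[k]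
        ((HopfCyclic.natural k H A).diag.mixed hcyl.diag).HC 𝒲 n) ∧
      Nonempty (((HopfCyclic.natural k H A).diag.mixed hcyl.diag).HC 𝒲 n ≃ₗ[k]
        ((HopfCyclic.algOps k (HopfCyclic.Crossed k (HopfCyclic.Cop H) Aᵐᵒᵖ)).mixed
          (HopfCyclic.algOps_isCyclic k _)).HC 𝒲 n)) ∧
    (∀ hS : Function.Bijective (HopfAlgebra.antipode k : H → H),
      letI : HopfAlgebra k (HopfCyclic.Cop H) := HopfCyclic.Cop.hopfAlgebra hS
      ∃ hcyl : (HopfCyclic.natural k (HopfCyclic.Cop H) Aᵐᵒᵖ).IsCylindrical, ∀ n : ℤ,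
        Nonempty (hcyl.tot.HC 𝒲 n ≃ₗ[k]
          ((HopfCyclic.natural k (HopfCyclic.Cop H) Aᵐᵒᵖ).diag.mixed hcyl.diag).HC 𝒲 n) ∧
        Nonempty (((HopfCyclic.natural k (HopfCyclic.Cop H) Aᵐᵒᵖ).diag.mixed hcyl.diag).HC 𝒲 n ≃ₗ[k]
          ((HopfCyclic.algOps k (HopfCyclic.Crossed k H A)).mixed
            (HopfCyclic.algOps_isCyclic k _)).HC 𝒲 n)) := by
  refine ⟨⟨HopfCyclic.natural_isCylindrical, fun n =>
    ⟨HopfCyclic.natural_isCylindrical.nonempty_tot_equiv_diag 𝒲 n,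
      HopfCyclic.nonempty_HC_diag_equiv_crossed_cop HopfCyclic.natural_isCylindrical 𝒲 n⟩⟩,
    fun hS => ?_⟩
  let _ : HopfAlgebra k (HopfCyclic.Cop H) := HopfCyclic.Cop.hopfAlgebra hS
  have hcyl : (HopfCyclic.natural k (HopfCyclic.Cop H) Aᵐᵒᵖ).IsCylindrical :=
    HopfCyclic.natural_isCylindrical
  exact ⟨hcyl, fun n => ⟨hcyl.nonempty_tot_equiv_diag 𝒲 n,
    HopfCyclic.nonempty_HC_diag_equiv_crossed hS hcyl 𝒲 n⟩⟩
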